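/- Setting. Let $X$ be a compact smooth (for instance real analytic) $n$-manifold with a smooth Riemannian metric $g$, let $\pi:T^*X\to X$ be its cotangent bundle and $\omega=d\theta$ its canonical symplectic form. The Levi-Civita connection gives a splitting $T(T^*X)=T_b\oplus T_f$ into horizontal and vertical parts; let $j_0:T_b\to T_f$ be the isomorphism given by $g$. For a continuous function $w:T^*X\to\mathbb R_{>0}$ with $w=1$ on the zero section, equip $T^*X$ with the almost complex structure $J_w=\begin{pmatrix}0&w^{-1}j_0^{-1}\\-w j_0&0\end{pmatrix}$ and the metric $\omega(\cdot,J_w\cdot)$ ($w=1$ is the Sasaki structure; $w=|\xi|$ outside a compact set is the conical one). Let $\kappa=(\wedge^n_{\mathbb C}T(T^*X))^{-1}$ be the canonical bundle of $(T^*X,J_w)$. For a trivialization $\eta^2$ of $\kappa^{\otimes2}$ the squared phase of an $n$-dimensional Lagrangian subspace $V$ is $\alpha(V)=\eta(\wedge^nV)^2/|\eta(\wedge^nV)|^2\in U(1)$. A grading of a Lagrangian submanifold $L$ is a continuous $\tilde\alpha:L\to\mathbb R$ with $e^{i\tilde\alpha(p)}=\alpha(T_pL)$; the Maslov class is $\mu(L)=\alpha^*[dt]\in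 H^1(L;\mathbb R)$. $Pin^+(n)$ is the double cover of $O(n)$ in which unit vectors have square $+1$; $w_2$ of a Riemannian manifold is the class in (Čech) $H^2(\,\cdot\,;\mathbb Z/2)$ of the coboundary of $Pin^+(n)$-valued lifts of the transition functions of its tangent bundle between local orthonormal frames. For a Čech cocycle $b$ on $T^*X$ with values in $\mathbb Z/2$, a pin structure on $L\subset T^*X$ relative to $b$ is a $Pin^+(n)$-valued Čech $1$-cochain on $L$ which lifts transition functions of $TL$ and has coboundary $b|_L$. A brane structure on $L$ is a pair of a grading and a relative pin structure. Let $Y\subset X$ be a $d$-dimensional (not necessarily closed) submanifold of class $C^2$, and $m:X\to\mathbb R_{\ge0}$ a function with zero set $\partial Y=\overline Y\setminus Y$ which is $C^2$ on $X\setminus\partial Y$. Put $f=\log m$ and, for $0\le t\le1$, $L_{Y,tf}=T^*_YX+\Gamma_{d(tf)}|_Y\subset T^*X$ (fibrewise sum of the conormal bundle and the graph); so $L_{Y,0}=T_Y^*X$, and $L_{Y,f}$ is the standard Lagrangian. Theorem. (1) $\kappa^{\otimes2}$ is canonically trivial: there is a continuous trivialization $\eta^2$ of $\kappa^{\otimes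 2}$ over $T^*X$ with $\eta^2((e_1\wedge\dots\wedge e_n)^{\otimes2})=1$ at $(x,0)$ for all $x\in X$ and all orthonormal bases $(e_i)$ of $T_xX$ (seen as horizontal vectors), and any two such trivializations are homotopic through such trivializations. Fix one of them, $\eta^2$, below. (2) For every standard Lagrangian $L_{Y,f}$ the squared phase is a continuous map $\alpha:L_{Y,f}\to U(1)$ and $\mu(L_{Y,f})=0$. There is a canonical grading of $L_{Y,f}$: exactly one grading $\tilde\alpha$ of $L_{Y,f}$ is the end $\tilde\alpha=\tilde\alpha_1$ of a family of gradings $\tilde\alpha_t$ of $L_{Y,tf}$, jointly continuous in $t\in[0,1]$ and the point, with $\tilde\alpha_0=-(n-d)\pi$ on $Y\subset T^*_YX$. (3) $w_2(X)\in H^2(X;\mathbb Z/2)$ and $w_2(L_{Y,f})\in H^2(L_{Y,f};\mathbb Z/2)$ exist and are well defined, and $w_2(L_{Y,f})=\pi^*w_2(X)|_{L_{Y,f}}$. Let $P_X$ be any system of $Pin^+(n)$-valued lifts of transition functions of $TX$, with coboundary a cocycle $b$ (which represents $w_2(X)$). Then $L_{Y,f}$ has a canonical pin structure relative to $\pi^*b$: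 up to isomorphism exactly one relative pin structure on $L_{Y,f}$ is the end at $t=1$ of a continuous family of pin structures on $L_{Y,tf}$, $0\le t\le 1$, relative to $\pi^*b$, which along $Y\subset T_Y^*X$ corresponds to $P_X|_Y$ under the isometry $T(T_Y^*X)|_Y=TY\oplus T_Y^*X\cong TX|_Y$ given by $g$. Consequently $L_{Y,f}$ carries, with respect to $\eta^2$ and $\pi^*b$, a canonical brane structure (canonical grading and canonical relative pin structure), with unique grading and with pin structure unique up to isomorphism. -/

import Mathlib

open Bundle Manifold Set Filter Topology
open scoped ContDiff TensorProduct

namespace CotBrane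

noncomputable section

/-! ## Čech cohomology with constant coefficients

Open covers are indexed by the points of the space (every open cover is refined by such a cover, and
any two of them have a common refinement of the same kind), so that refinements need no choice of an
index map.  Čech cohomology is the direct limit over these covers. -/

/-- An open cover indexed by the points of the space, with each point in its own member. -/
structure PointedCover (B : Type*) [TopologicalSpace B] where
  set : B → Set B
  isOpen : ∀ x, IsOpen (set x)
  mem : ∀ x, x ∈ set x

namespace PointedCover

variable {B B' : Type*} [TopologicalSpace B] [TopologicalSpace B']

/-- `V ≤ U`: the cover `V` refines `U`. -/
instance : LE (PointedCover B) := ⟨fun V U => ∀ x, V.set x ⊆ U.set x⟩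

/-- The intersection of the members of the cover indexed by `s`. -/
def inter {k : ℕ} (U : PointedCover B) (s : Fin k → B) : Set B := ⋂ i, U.set (s i)

/-- Memberwise intersection of two covers. -/
def inf (U V : PointedCover B) : PointedCover B where
  set x := U.set x ∩ V.set x
  isOpen x := (U.isOpen x).inter (V.isOpen x)
  mem x := ⟨U.mem x, V.mem x⟩

/-- The inverse image of a cover. -/
def pullback (f : C(B', B)) (U : PointedCover B) : PointedCover B' where
  set x := f ⁻¹' U.set (f x)
  isOpen x := (U.isOpen (f x)).preimage f.continuous
  mem x := U.mem (f x)

theorem inter_mono {k : ℕ} {U V : PointedCover B} (h : V ≤ U) (s : Fin k → B) :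
    V.inter s ⊆ U.inter s :=
  iInter_mono fun i => h (s i)

theorem inf_le_left (U V : PointedCover B) : U.inf V ≤ U := fun _ _ h => h.1

theorem inf_le_right (U V : PointedCover B) : U.inf V ≤ V := fun _ _ h => h.2

theorem le_trans {U V W : PointedCover B} (h : U ≤ V) (h' : V ≤ W) : U ≤ W :=
  fun x => (h x).trans (h' x)

end PointedCover

/-- `c` is locally constant on the open set `S`. -/
def LocConstOn {B A : Type*} [TopologicalSpace B] (c : B → A) (S : Set B) : Prop :=
  ∀ b ∈ S, ∀ᶠ b' in 𝓝 b, c b' = c b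

/-- The Čech differential, `(δc)(x₀, …, x_k) = ∑ i, (-1)^i c(x₀, …, x̂_i, …, x_k)`. -/
def cechD {B A : Type*} [AddCommGroup A] {k : ℕ} (c : (Fin k → B) → B → A)
    (s : Fin (k + 1) → B) (b : B) : A :=
  ∑ i : Fin (k + 1), (-1 : ℤ) ^ (i : ℕ) • c (s ∘ i.succAbove) b

/-- A Čech `k`-cocycle with values in the discrete abelian group `A`: for all points `x₀, …, x_k` a
locally constant function `val ![x₀, …, x_k]` on `U_{x₀} ∩ … ∩ U_{x_k}` (its values elsewhere are
irrelevant), with vanishing Čech differential. -/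
structure CechCocycle (B : Type*) [TopologicalSpace B] (A : Type*) [AddCommGroup A] (k : ℕ) where
  cover : PointedCover B
  val : (Fin (k + 1) → B) → B → A
  locConst : ∀ s, LocConstOn (val s) (cover.inter s)
  closed : ∀ (s : Fin (k + 2) → B), ∀ b ∈ cover.inter s, cechD val s b = 0

section Cech

variable {B B' B'' : Type*} [TopologicalSpace B] [TopologicalSpace B'] [TopologicalSpace B'']
  {A : Type*} [AddCommGroup A] {k : ℕ}

/-- Two cocycles of degree `k + 1` are cohomologous if on a common refinement they differ by the
differential of a locally constant cochain of degree `k`. -/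
def Cohomologous (c c' : CechCocycle B A (k + 1)) : Prop :=
  ∃ V : PointedCover B, V ≤ c.cover ∧ V ≤ c'.cover ∧
    ∃ h : (Fin (k + 1) → B) → B → A, (∀ s, LocConstOn (h s) (V.inter s)) ∧
      ∀ (s : Fin (k + 2) → B), ∀ b ∈ V.inter s, c.val s b - c'.val s b = cechD h s b

theorem Cohomologous.refl (c : CechCocycle B A (k + 1)) : Cohomologous c c :=
  ⟨c.cover, fun _ => Subset.rfl, fun _ => Subset.rfl, fun _ _ => 0,
    fun _ _ _ => Eventually.of_forall fun _ => rfl, fun s b _ => by simp [cechD]⟩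

theorem Cohomologous.symm {c c' : CechCocycle B A (k + 1)} (H : Cohomologous c c') :
    Cohomologous c' c := by
  obtain ⟨V, h1, h2, h, hl, hd⟩ := H
  refine ⟨V, h2, h1, fun s b => - h s b, fun s b hb => ?_, fun s b hb => ?_⟩
  · filter_upwards [hl s b hb] with b' hb'
    rw [hb']
  · rw [← neg_sub, hd s b hb]
    simp [cechD, Finset.sum_neg_distrib]

theorem Cohomologous.trans {c c' c'' : CechCocycle B A (k + 1)} (H : Cohomologous c c')
    (H' : Cohomologous c' c'') : Cohomologous c c'' := by
  obtain ⟨V, h1, h2, h, hl, hd⟩ := H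
  obtain ⟨V', h1', h2', h', hl', hd'⟩ := H'
  refine ⟨V.inf V', PointedCover.le_trans (PointedCover.inf_le_left V V') h1,
    PointedCover.le_trans (PointedCover.inf_le_right V V') h2',
    fun s b => h s b + h' s b, fun s b hb => ?_, fun s b hb => ?_⟩
  · filter_upwards [hl s b (PointedCover.inter_mono (PointedCover.inf_le_left V V') s hb),
      hl' s b (PointedCover.inter_mono (PointedCover.inf_le_right V V') s hb)] with b' e e'
    rw [e, e']
  · have e := hd s b (PointedCover.inter_mono (PointedCover.inf_le_left V V') s hb)
    have e' := hd' s b (PointedCover.inter_mono (PointedCover.inf_le_right V V') s hb)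
    have : c.val s b - c''.val s b = (c.val s b - c'.val s b) + (c'.val s b - c''.val s b) := by
      abel
    rw [this, e, e']
    simp [cechD, Finset.sum_add_distrib]

/-- The equivalence relation of being cohomologous. -/
instance cechSetoid (B : Type*) [TopologicalSpace B] (A : Type*) [AddCommGroup A] (k : ℕ) :
    Setoid (CechCocycle B A (k + 1)) :=
  ⟨Cohomologous, Cohomologous.refl, Cohomologous.symm, Cohomologous.trans⟩

/-- Čech cohomology in the positive degree `k + 1`. -/
def CechH (B : Type*) [TopologicalSpace B] (A : Type*) [AddCommGroup A] (k : ℕ) : Type _ :=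
  Quotient (cechSetoid B A k)

/-- `H¹(B; A)`. -/
abbrev CechH1 (B : Type*) [TopologicalSpace B] (A : Type*) [AddCommGroup A] : Type _ := CechH B A 0

/-- `H²(B; A)`. -/
abbrev CechH2 (B : Type*) [TopologicalSpace B] (A : Type*) [AddCommGroup A] : Type _ := CechH B A 1

/-- The cohomology class of a cocycle. -/
def CechCocycle.toClass (c : CechCocycle B A (k + 1)) : CechH B A k :=
  Quotient.mk (cechSetoid B A k) c

/-- The zero cocycle, on the trivial cover. -/
def CechCocycle.zero (B : Type*) [TopologicalSpace B] (A : Type*) [AddCommGroup A] (k : ℕ) :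
    CechCocycle B A k where
  cover := ⟨fun _ => univ, fun _ => isOpen_univ, fun _ => mem_univ _⟩
  val _ _ := 0
  locConst _ _ _ := Eventually.of_forall fun _ => rfl
  closed s b _ := by simp [cechD]

instance : Zero (CechH B A k) := ⟨(CechCocycle.zero B A (k + 1)).toClass⟩

theorem PointedCover.mem_inter_pullback {j : ℕ} (f : C(B', B)) (U : PointedCover B)
    {s : Fin j → B'} {b : B'} (hb : b ∈ (U.pullback f).inter s) : f b ∈ U.inter (f ∘ s) := by
  simp only [PointedCover.inter, mem_iInter] at hb ⊢
  exact hb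

/-- The pullback of a cocycle along a continuous map. -/
def CechCocycle.pullback (f : C(B', B)) (c : CechCocycle B A k) : CechCocycle B' A k where
  cover := c.cover.pullback f
  val s b := c.val (f ∘ s) (f b)
  locConst s b hb :=
    f.continuous.continuousAt.eventually
      (c.locConst (f ∘ s) (f b) (PointedCover.mem_inter_pullback f c.cover hb))
  closed s b hb := c.closed (f ∘ s) (f b) (PointedCover.mem_inter_pullback f c.cover hb)

/-- The pullback map `f^* : H^{k+1}(B; A) → H^{k+1}(B'; A)`. -/
def CechH.pullback (f : C(B', B)) : CechH B A k → CechH B' A k :=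
  Quotient.map (CechCocycle.pullback f) (by
    rintro c c' ⟨V, h1, h2, h, hl, hd⟩
    refine ⟨V.pullback f, fun x => preimage_mono (h1 (f x)), fun x => preimage_mono (h2 (f x)),
      fun s b => h (f ∘ s) (f b), fun s b hb => ?_, fun s b hb => ?_⟩
    · exact f.continuous.continuousAt.eventually
        (hl (f ∘ s) (f b) (PointedCover.mem_inter_pullback f V hb))
    · exact hd (f ∘ s) (f b) (PointedCover.mem_inter_pullback f V hb))

end Cech

/-! ## The class of the standard one-form on the circle -/

/-- The branch `t_z` of the angle on the open half circle centred at `z`. -/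
def angleBranch (z u : Circle) : ℝ := Complex.arg (z : ℂ) + Complex.arg ((u / z : Circle) : ℂ)

/-- The cover of the circle by the open half circles centred at its points. -/
def halfCircles : PointedCover Circle where
  set z := {u | 0 < ((u / z : Circle) : ℂ).re}
  isOpen z := isOpen_lt continuous_const
    (Complex.continuous_re.comp (continuous_subtype_val.comp (continuous_id.div_const z)))
  mem z := by simp

theorem exp_angleBranch (z u : Circle) :
    Complex.exp ((angleBranch z u : ℝ) * Complex.I) = (u : ℂ) := by
  have h : ∀ v : Circle, Complex.exp ((Complex.arg (v : ℂ) : ℂ) * Complex.I) = (v : ℂ) := by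
    intro v
    have := Complex.norm_mul_exp_arg_mul_I (v : ℂ)
    rwa [Circle.norm_coe, Complex.ofReal_one, one_mul] at this
  unfold angleBranch
  push_cast
  have h2 : (z : ℂ) * ((u / z : Circle) : ℂ) = (u : ℂ) := by
    rw [← Circle.coe_mul, mul_div_cancel]
  rw [add_mul, Complex.exp_add]
  exact (congrArg₂ (· * ·) (h z) (h (u / z))).trans h2

theorem continuousAt_angleBranch {z u : Circle} (h : u ∈ halfCircles.set z) :
    ContinuousAt (angleBranch z) u := by
  refine continuousAt_const.add ?_
  have h1 : ContinuousAt (fun v : Circle => ((v / z : Circle) : ℂ)) u :=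
    (continuous_subtype_val.comp (continuous_id.div_const z)).continuousAt
  exact ContinuousAt.comp (f := fun v : Circle => ((v / z : Circle) : ℂ))
    (Complex.continuousAt_arg (Or.inl h)) h1

theorem angleBranch_sub_locConst {z z' u : Circle} (h : u ∈ halfCircles.set z)
    (h' : u ∈ halfCircles.set z') :
    ∀ᶠ v in 𝓝 u, angleBranch z' v - angleBranch z v = angleBranch z' u - angleBranch z u := by
  have key : ∀ v, ∃ k : ℤ, angleBranch z' v - angleBranch z v = k * (2 * Real.pi) := by
    intro v
    obtain ⟨k, hk⟩ := Complex.exp_eq_exp_iff_exists_int.1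
      ((exp_angleBranch z' v).trans (exp_angleBranch z v).symm)
    refine ⟨k, ?_⟩
    have h2 : ((angleBranch z' v - angleBranch z v : ℝ) : ℂ) * Complex.I
        = ((k * (2 * Real.pi) : ℝ) : ℂ) * Complex.I := by
      push_cast
      linear_combination hk
    exact_mod_cast mul_right_cancel₀ Complex.I_ne_zero h2
  have hc : ContinuousAt (fun v => angleBranch z' v - angleBranch z v) u :=
    (continuousAt_angleBranch h').sub (continuousAt_angleBranch h)
  have hpi : 0 < 2 * Real.pi := by positivity
  filter_upwards [Metric.continuousAt_iff'.1 hc _ hpi] with v hv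
  obtain ⟨a, ha⟩ := key v
  obtain ⟨b, hb⟩ := key u
  rw [Real.dist_eq] at hv
  rw [ha, hb] at hv ⊢
  rw [← sub_mul, abs_mul, abs_of_pos hpi] at hv
  have h3 : |((a - b : ℤ) : ℝ)| < 1 := by
    push_cast
    by_contra hcon
    push Not at hcon
    nlinarith
  have h4 : a - b = 0 := Int.abs_lt_one_iff.1 (by exact_mod_cast h3)
  rw [sub_eq_zero.1 h4]

/-- The class `[dt] ∈ H¹(U(1); ℝ)` of the standard one-form, as a Čech class: the differences
`t_{z₁} - t_{z₀}` of local primitives of `dt`. -/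
def dtCocycle : CechCocycle Circle ℝ 1 where
  cover := halfCircles
  val s u := angleBranch (s 1) u - angleBranch (s 0) u
  locConst s u hu := by
    have h := mem_iInter.1 hu
    exact angleBranch_sub_locConst (h 0) (h 1)
  closed s u _ := by
    simp [cechD, Fin.sum_univ_three, Fin.succAbove]

/-- The Maslov class `α^*[dt]` of a squared phase map `α : L → U(1)`. -/
def maslovClass {L : Type*} [TopologicalSpace L] (α : C(L, Circle)) : CechH1 L ℝ :=
  CechH.pullback α dtCocycle.toClass

/-! ## Pin⁺(n) -/

/-- The quadratic form `v ↦ |v|²` on `ℝⁿ`; in its Clifford algebra unit vectors have square `+1`. -/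
abbrev stdForm (n : ℕ) : QuadraticForm ℝ (Fin n → ℝ) :=
  QuadraticMap.weightedSumSquares ℝ (fun _ : Fin n => (1 : ℝ))

/-- The Clifford algebra of `(ℝⁿ, |·|²)`. -/
abbrev Cl (n : ℕ) : Type := CliffordAlgebra (stdForm n)

/-- `Pin⁺(n)`: the group generated by the unit vectors in the Clifford algebra in which they have
square `+1`.  The generator `-1` is a product of unit vectors as soon as `n ≥ 1`. -/
def pinPlus (n : ℕ) : Subgroup (Cl n)ˣ :=
  Subgroup.closure
    ({x | ∃ v : Fin n → ℝ, stdForm n v = 1 ∧ (x : Cl n) = CliffordAlgebra.ι (stdForm n) v} ∪ {-1})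

/-- `x` is an element of `Pin⁺(n)` over the orthogonal matrix `r`, under the covering
`Pin⁺(n) → O(n)` by the twisted adjoint action; a unit vector lies over the reflection in its
orthogonal hyperplane. -/
def IsPinLift {n : ℕ} (x : Cl n) (r : Matrix (Fin n) (Fin n) ℝ) : Prop :=
  (∃ y ∈ pinPlus n, (y : Cl n) = x) ∧
    ∀ v : Fin n → ℝ, CliffordAlgebra.involute x * CliffordAlgebra.ι (stdForm n) v
      = CliffordAlgebra.ι (stdForm n) (r.mulVec v) * x

/-- Continuity on `S` of a map into the Clifford algebra, a finite-dimensional real vector space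
with its usual topology. -/
def ClContinuousOn {B : Type*} [TopologicalSpace B] {n : ℕ} (c : B → Cl n) (S : Set B) : Prop :=
  ∀ l : Cl n →ₗ[ℝ] ℝ, ContinuousOn (fun b => l (c b)) S

/-! ## Families of Euclidean subspaces of a tangent bundle, and pin structures on them -/

section Pin

variable {E H M : Type*} [NormedAddCommGroup E] [NormedSpace ℝ E] [TopologicalSpace H]
  {I : ModelWithCorners ℝ E H} [TopologicalSpace M] [ChartedSpace H M]
  {E' H' M' : Type*} [NormedAddCommGroup E'] [NormedSpace ℝ E'] [TopologicalSpace H']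
  {I' : ModelWithCorners ℝ E' H'} [TopologicalSpace M'] [ChartedSpace H' M']
  {B B' : Type*} [TopologicalSpace B] [TopologicalSpace B'] {n : ℕ}

/-- A family over `B` of subspaces `fib b` of tangent spaces of a manifold `M`, with bilinear forms,
for example the tangent bundle of a Riemannian submanifold `B` of `M`. -/
structure EuclFamily (I : ModelWithCorners ℝ E H) (M : Type*) [TopologicalSpace M]
    [ChartedSpace H M] (B : Type*) where
  map : B → M
  fib : ∀ b, Submodule ℝ (TangentSpace I (map b))
  form : ∀ b, TangentSpace I (map b) → TangentSpace I (map b) → ℝ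

/-- The pullback of a family. -/
def EuclFamily.pullback (F : EuclFamily I M B) (f : B' → B) : EuclFamily I M B' where
  map b := F.map (f b)
  fib b := F.fib (f b)
  form b := F.form (f b)

/-- `e` is a continuous orthonormal frame of the family `F` on `S`. -/
def EuclFamily.IsFrameOn [IsManifold I 1 M] (F : EuclFamily I M B) (S : Set B)
    (e : Fin n → ∀ b, TangentSpace I (F.map b)) : Prop :=
  (∀ i, ContinuousOn (fun b => (⟨F.map b, e i b⟩ : TangentBundle I M)) S) ∧
    ∀ b ∈ S, Submodule.span ℝ (range fun i => e i b) = F.fib b ∧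
      ∀ i j, F.form b (e i b) (e j b) = if i = j then 1 else 0

/-- A `Pin⁺(n)`-valued Čech `1`-cochain lifting transition functions of the family `F`: a cover `U`
with orthonormal frames `frame x` on `U_x`, and continuous maps `lift x y : U_x ∩ U_y → Pin⁺(n)`
over the transition functions `U_x ∩ U_y → O(n)` from the frame of `U_x` to that of `U_y`. -/
structure PinCochain [IsManifold I 1 M] (n : ℕ) (F : EuclFamily I M B) where
  cover : PointedCover B
  frame : B → Fin n → ∀ b, TangentSpace I (F.map b)
  isFrame : ∀ x, F.IsFrameOn (cover.set x) (frame x)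
  lift : B → B → B → Cl n
  isLift : ∀ x y, ∀ b ∈ cover.set x ∩ cover.set y,
    IsPinLift (lift x y b) (Matrix.of fun i j => F.form b (frame x i b) (frame y j b))
  continuous : ∀ x y, ClContinuousOn (lift x y) (cover.set x ∩ cover.set y)

/-- The coboundary of the cochain is `(-1)^w`; that is, the cochain is a pin structure on `F`
relative to the Čech cocycle `w` (a `w`-twisted pin structure). -/
def PinCochain.IsRelativeTo [IsManifold I 1 M] {F : EuclFamily I M B} (P : PinCochain n F)
    (w : CechCocycle B (ZMod 2) 2) : Prop :=
  P.cover ≤ w.cover ∧ ∀ x y z, ∀ b ∈ P.cover.set x ∩ P.cover.set y ∩ P.cover.set z,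
    P.lift x y b * P.lift y z b = (-1 : Cl n) ^ (w.val ![x, y, z] b).val * P.lift x z b

/-- `c` is the second Stiefel-Whitney class of `F`: the obstruction to lifting the structure group
to `Pin⁺(n)`, represented by the coboundary of lifts of transition functions. -/
def IsSW2 [IsManifold I 1 M] (n : ℕ) (F : EuclFamily I M B) (c : CechH2 B (ZMod 2)) : Prop :=
  ∃ (P : PinCochain n F) (w : CechCocycle B (ZMod 2) 2), P.IsRelativeTo w ∧ w.toClass = c

/-- The pullback of a cochain. -/
def PinCochain.pullback [IsManifold I 1 M] {F : EuclFamily I M B} (P : PinCochain n F)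
    (f : C(B', B)) : PinCochain n (F.pullback f) where
  cover := P.cover.pullback f
  frame x i b := P.frame (f x) i (f b)
  isFrame x := by
    obtain ⟨h1, h2⟩ := P.isFrame (f x)
    exact ⟨fun i => (h1 i).comp f.continuous.continuousOn fun _ hb => hb, fun b hb => h2 (f b) hb⟩
  lift x y b := P.lift (f x) (f y) (f b)
  isLift x y b hb := P.isLift (f x) (f y) (f b) hb
  continuous x y l := (P.continuous (f x) (f y) l).comp f.continuous.continuousOn fun _ hb => hb

/-- Isomorphism of (relative) pin structures over the fibrewise map `Ψ`: after refining the covers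
there are continuous lifts `h x` to `Pin⁺(n)` of the change of frame from `Ψ (P.frame x)` to
`P'.frame x` which intertwine the two cochains. -/
def PinIso [IsManifold I 1 M] [IsManifold I' 1 M'] {F : EuclFamily I M B}
    {F' : EuclFamily I' M' B}
    (Ψ : ∀ b, TangentSpace I (F.map b) → TangentSpace I' (F'.map b))
    (P : PinCochain n F) (P' : PinCochain n F') : Prop :=
  ∃ V : PointedCover B, V ≤ P.cover ∧ V ≤ P'.cover ∧ ∃ h : B → B → Cl n,
    (∀ x, ClContinuousOn (h x) (V.set x)) ∧
    (∀ x, ∀ b ∈ V.set x, IsPinLift (h x b)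
      (Matrix.of fun i j => F'.form b (Ψ b (P.frame x i b)) (P'.frame x j b))) ∧
    ∀ x y, ∀ b ∈ V.set x ∩ V.set y, P.lift x y b * h y b = h x b * P'.lift x y b

/-- The tangent space at `p` of a submanifold `S` of `M`: the velocities at `p` of curves in `S`. -/
def tangentOf (I : ModelWithCorners ℝ E H) (S : Set M) (p : M) : Submodule ℝ (TangentSpace I p) :=
  Submodule.span ℝ {v | ∃ c : ℝ → M, c 0 = p ∧ (∀ᶠ t in 𝓝 (0 : ℝ), c t ∈ S) ∧
    HasMFDerivAt 𝓘(ℝ, ℝ) I c 0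
      (ContinuousLinearMap.toSpanSingleton (M₁ := TangentSpace I (c 0)) ℝ v)}

end Pin

/-! ## The cotangent bundle -/

/-- The model space `ℝⁿ`. -/
abbrev Eu (n : ℕ) : Type := EuclideanSpace ℝ (Fin n)

/-- The model space `ℝⁿ × (ℝⁿ)^*` of the cotangent bundle. -/
abbrev EuCot (n : ℕ) : Type := Eu n × (Eu n →L[ℝ] ℝ)

/-- The model with corners of the cotangent bundle of an `n`-manifold. -/
abbrev IC (n : ℕ) : ModelWithCorners ℝ (EuCot n) (ModelProd (Eu n) (Eu n →L[ℝ] ℝ)) :=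
  (𝓘(ℝ, Eu n)).prod 𝓘(ℝ, Eu n →L[ℝ] ℝ)

section Cotangent

variable (n : ℕ) (X : Type*) [TopologicalSpace X] [ChartedSpace (Eu n) X]
  [IsManifold 𝓘(ℝ, Eu n) ∞ X]

/-- The cotangent space at `x`. -/
abbrev CotSpace (x : X) : Type := TangentSpace 𝓘(ℝ, Eu n) x →L[ℝ] Bundle.Trivial X ℝ x

/-- The cotangent bundle `T^*X`. -/
abbrev Cot : Type _ := TotalSpace (Eu n →L[ℝ] ℝ) (CotSpace n X)

/-- Smooth Riemannian metrics on `X`. -/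
abbrev Metric : Type _ :=
  ContMDiffRiemannianMetric 𝓘(ℝ, Eu n) ∞ (Eu n) (fun x : X => TangentSpace 𝓘(ℝ, Eu n) x)

end Cotangent

section Geometry

variable {n : ℕ} {X : Type*} [TopologicalSpace X] [ChartedSpace (Eu n) X]
  [IsManifold 𝓘(ℝ, Eu n) ∞ X]

theorem flat_injective (g : Metric n X) (x : X) : Function.Injective (g.inner x) := by
  rw [injective_iff_map_eq_zero]
  intro v hv
  by_contra h
  have := g.pos x v h
  rw [hv] at this
  simp at this

/-- The musical isomorphism `♭ : T_x X ≃ T_x^* X`, `v ↦ g_x(v, ·)`, in the model coordinates given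
by the preferred chart at `x`. -/
def flat (g : Metric n X) (x : X) : Eu n ≃ₗ[ℝ] (Eu n →L[ℝ] ℝ) :=
  LinearMap.linearEquivOfInjective
    ((g.inner x).toLinearMap : Eu n →ₗ[ℝ] (Eu n →L[ℝ] ℝ)) (flat_injective g x) (by
      rw [← LinearEquiv.finrank_eq
        (LinearMap.toContinuousLinearMap : (Eu n →ₗ[ℝ] ℝ) ≃ₗ[ℝ] (Eu n →L[ℝ] ℝ))]
      exact (Subspace.dual_finrank_eq).symm)

/-- The matrix of the metric in the preferred chart `φ` at `x`: the bilinear form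
`g(Dφ⁻¹ ·, Dφ⁻¹ ·)` as a function on the chart domain in `ℝⁿ`. -/
def chartMetric (g : Metric n X) (x : X) (u : Eu n) : Eu n →L[ℝ] Eu n →L[ℝ] ℝ :=
  let y : X := (extChartAt 𝓘(ℝ, Eu n) x).symm u
  let D : Eu n →L[ℝ] Eu n := mfderiv 𝓘(ℝ, Eu n) 𝓘(ℝ, Eu n) (extChartAt 𝓘(ℝ, Eu n) x).symm u
  ContinuousLinearMap.bilinearComp (E := Eu n) (F := Eu n) (G := ℝ) (g.inner y) D D

/-- At `p = (x, ξ)` the covector `ξ(Γ(a, ·)) = ∑ ξ_k Γ^k_{ij} a^i`, where `Γ` are the Christoffel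
symbols at `x` of the Levi-Civita connection in the preferred chart at `x`:
`ξ(Γ(a, b)) = (∂_a G(b, s) + ∂_b G(a, s) - ∂_s G(a, b)) / 2` for the vector `s` dual to `ξ`. -/
def christoffel (g : Metric n X) (p : Cot n X) (a : Eu n) : Eu n →L[ℝ] ℝ :=
  let D := fderiv ℝ (chartMetric g p.1) (extChartAt 𝓘(ℝ, Eu n) p.1 p.1)
  let s := (flat g p.1).symm p.2
  (1 / 2 : ℝ) • ((D a).flip s + (D.flip a).flip s - D s a)

/-! A tangent vector of `T^*X` at `p = (x, ξ)` is a pair `(a, β)` in the cotangent coordinates of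
the preferred chart at `x`.  Its horizontal part for the Levi-Civita connection is
`(a, ξ(Γ(a, ·)))` and its vertical part is `β - ξ(Γ(a, ·))`. -/

/-- The pair `(a, β)` of a tangent vector of `T^*X`. -/
def toModel {p : Cot n X} (V : TangentSpace (IC n) p) : EuCot n := V

/-- The tangent vector of `T^*X` at `p` given by a pair `(a, β)`. -/
def ofModel (p : Cot n X) (V : EuCot n) : TangentSpace (IC n) p := V

/-- The almost complex structure `J_w`.  In the splitting into horizontal vectors (`≅ T_x X`) and
vertical vectors (`≅ T_x^* X`) it is `(a, η) ↦ (w⁻¹ ♯η, -w ♭a)`.  For `w = 1` it is the Sasaki almost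
complex structure. -/
def acs (g : Metric n X) (w : Cot n X → ℝ) (p : Cot n X) (V : TangentSpace (IC n) p) :
    TangentSpace (IC n) p :=
  let a : Eu n := (toModel V).1
  let η : Eu n →L[ℝ] ℝ := (toModel V).2 - christoffel g p a
  let a' : Eu n := (w p)⁻¹ • (flat g p.1).symm η
  ofModel p (a', -(w p • flat g p.1 a) + christoffel g p a')

/-- The canonical symplectic form `ω = dθ = ∑ dξ_i ∧ dx^i`. -/
def symplectic (p : Cot n X) (V W : TangentSpace (IC n) p) : ℝ :=
  (toModel V).2 (toModel W).1 - (toModel W).2 (toModel V).1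

/-- The Riemannian metric `ω(·, J_w ·)` on `T^*X`. -/
def compatMetric (g : Metric n X) (w : Cot n X → ℝ) (p : Cot n X)
    (V W : TangentSpace (IC n) p) : ℝ :=
  symplectic p V (acs g w p W)

/-! ## The bicanonical bundle -/

/-- The fibre `κ_p` of the canonical bundle: `J`-complex linear alternating `n`-forms on
`T_p(T^*X)`. -/
def canonicalFiber (g : Metric n X) (w : Cot n X → ℝ) (p : Cot n X) :
    Submodule ℂ ((TangentSpace (IC n) p) [⋀^Fin n]→ₗ[ℝ] ℂ) where
  carrier := {η | ∀ (v : Fin n → TangentSpace (IC n) p) (i : Fin n),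
    η (Function.update v i (acs g w p (v i))) = Complex.I * η v}
  add_mem' := by
    intro η η' h h' v i
    simp only [AlternatingMap.add_apply, h v i, h' v i, mul_add]
  zero_mem' := by
    intro v i
    simp
  smul_mem' := by
    intro c η h v i
    simp only [AlternatingMap.smul_apply, h v i, smul_eq_mul]
    ring

/-- The fibre of the bicanonical bundle `κ ⊗ κ`. -/
abbrev BicanFiber (g : Metric n X) (w : Cot n X → ℝ) (p : Cot n X) : Type :=
  canonicalFiber g w p ⊗[ℂ] canonicalFiber g w p

/-- Evaluation of `n`-forms on an `n`-tuple. -/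
def evalForm (g : Metric n X) (w : Cot n X → ℝ) (p : Cot n X)
    (u : Fin n → TangentSpace (IC n) p) : canonicalFiber g w p →ₗ[ℂ] ℂ where
  toFun η := η.1 u
  map_add' _ _ := rfl
  map_smul' _ _ := rfl

/-- The pairing of the bicanonical fibre with two `n`-tuples, `(η ⊗ η')(u, v) = η(u) η'(v)`. -/
def evalBican (g : Metric n X) (w : Cot n X → ℝ) (p : Cot n X)
    (u v : Fin n → TangentSpace (IC n) p) : BicanFiber g w p →ₗ[ℂ] ℂ :=
  LinearMap.mul' ℂ ℂ ∘ₗ TensorProduct.map (evalForm g w p u) (evalForm g w p v)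

/-- Continuity of a section of the pullback of the bicanonical bundle along `φ : B → T^*X`: its
coefficients in local trivializations of the tangent bundle of `T^*X` are continuous. -/
def IsContinuousSection (g : Metric n X) (w : Cot n X → ℝ) {B : Type*} [TopologicalSpace B]
    (φ : B → Cot n X) (s : ∀ b, BicanFiber g w (φ b)) : Prop :=
  ∀ (p₀ : Cot n X) (u v : Fin n → EuCot n),
    let T := trivializationAt (EuCot n) (TangentSpace (IC n) : Cot n X → Type) p₀
    ContinuousOn (fun b => evalBican g w (φ b) (fun i => T.symm (φ b) (u i))
      (fun i => T.symm (φ b) (v i)) (s b)) (φ ⁻¹' T.baseSet)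

/-- The section `s` takes the value `1` at the points of the zero section on the pair `(e, e)`, for
every orthonormal basis `e` of `T_x X` (considered as horizontal vectors).  This says that over the
zero section it is the trivialization coming from `κ|_X ≅ or_X ⊗ ℂ`. -/
def IsNormalized (g : Metric n X) (w : Cot n X → ℝ) (s : ∀ p, BicanFiber g w p) : Prop :=
  ∀ (x : X) (e : Fin n → Eu n), (∀ i j, flat g x (e i) (e j) = if i = j then 1 else 0) →
    evalBican g w ⟨x, 0⟩ (fun i => ofModel ⟨x, 0⟩ (e i, 0)) (fun i => ofModel ⟨x, 0⟩ (e i, 0))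
      (s ⟨x, 0⟩) = 1

/-- A trivialization of the bicanonical bundle (a continuous nowhere vanishing section) which is the
canonical one over the zero section. -/
structure CanonicalTrivialization (g : Metric n X) (w : Cot n X → ℝ) where
  toFun : ∀ p, BicanFiber g w p
  continuous : IsContinuousSection g w id toFun
  ne_zero : ∀ p, toFun p ≠ 0
  normalized : IsNormalized g w toFun

/-- Homotopy of trivializations which are canonical over the zero section. -/
def CanonicalTrivialization.Homotopic {g : Metric n X} {w : Cot n X → ℝ}
    (s s' : CanonicalTrivialization g w) : Prop :=
  ∃ h : ∀ q : unitInterval × Cot n X, BicanFiber g w q.2,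
    IsContinuousSection g w Prod.snd h ∧ (∀ q, h q ≠ 0) ∧
    (∀ t, IsNormalized g w fun p => h (t, p)) ∧
    (∀ p, h (0, p) = s.toFun p) ∧ ∀ p, h (1, p) = s'.toFun p

open Classical in
/-- The squared phase `η(∧ⁿ V)² / |η(∧ⁿ V)|²` of an `n`-dimensional subspace `V` of `T_p(T^*X)`,
computed in a basis of `V` (it does not depend on the basis). -/
def squaredPhase {g : Metric n X} {w : Cot n X → ℝ} (s : CanonicalTrivialization g w)
    (p : Cot n X) (V : Submodule ℝ (TangentSpace (IC n) p)) : ℂ :=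
  if h : Nonempty (Module.Basis (Fin n) ℝ V) then
    let u : Fin n → TangentSpace (IC n) p := fun i => (h.some i : TangentSpace (IC n) p)
    let z := evalBican g w p u u (s.toFun p)
    z / (‖z‖ : ℂ)
  else 0

/-! ## Standard Lagrangians -/

/-- `Y` is a (not necessarily closed) `d`-dimensional submanifold of `X` of class `C^k`: around each
of its points it is a piece of a `d`-dimensional linear subspace in some `C^k` chart. -/
def IsSubmanifold (n : ℕ) {X : Type*} [TopologicalSpace X] [ChartedSpace (Eu n) X] (k : ℕ∞ω) (d : ℕ)
    (Y : Set X) : Prop :=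
  ∀ y ∈ Y, ∃ φ ∈ IsManifold.maximalAtlas 𝓘(ℝ, Eu n) k X, y ∈ φ.source ∧
    ∃ W : Submodule ℝ (Eu n), Module.finrank ℝ W = d ∧ ∀ x ∈ φ.source, x ∈ Y ↔ φ x ∈ W

/-- The fibre at `x` of the conormal bundle `T_Y^* X`. -/
def conormal (Y : Set X) (x : X) : Set (CotSpace n X x) :=
  {ν | ∀ v ∈ tangentOf 𝓘(ℝ, Eu n) Y x, ν v = 0}

/-- The differential of a function, as a covector. -/
def differential (f : X → ℝ) (x : X) : CotSpace n X x := mfderiv 𝓘(ℝ, Eu n) 𝓘(ℝ, ℝ) f x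

theorem differential_zero_mul (f : X → ℝ) (x : X) :
    differential (n := n) (fun x => ((0 : unitInterval) : ℝ) * f x) x = 0 := by
  have h : (fun x => ((0 : unitInterval) : ℝ) * f x) = fun _ : X => (0 : ℝ) := by
    funext x
    simp
  rw [h]
  exact mfderiv_const

/-- The function `log m`. -/
def logFn (m : X → ℝ) : X → ℝ := fun x => Real.log (m x)

/-- The Lagrangian `L_{Y,f} = T_Y^* X + Γ_{df}|_Y`. -/
def stdLag (n : ℕ) {X : Type*} [TopologicalSpace X] [ChartedSpace (Eu n) X]
    [IsManifold 𝓘(ℝ, Eu n) ∞ X] (Y : Set X) (f : X → ℝ) : Set (Cot n X) :=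
  {p | p.1 ∈ Y ∧ ∃ ν ∈ conormal Y p.1, p.2 = ν + differential f p.1}

/-- The family of the dilations `L_{Y,tf}`, `0 ≤ t ≤ 1`, from `T_Y^* X` to `L_{Y,f}`. -/
def stdLagFamily (n : ℕ) {X : Type*} [TopologicalSpace X] [ChartedSpace (Eu n) X]
    [IsManifold 𝓘(ℝ, Eu n) ∞ X] (Y : Set X) (f : X → ℝ) : Set (unitInterval × Cot n X) :=
  {q | q.2 ∈ stdLag n Y (fun x => (q.1 : ℝ) * f x)}

/-- The inclusion of `L_{Y,f}` into the family at `t = 1`. -/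
def inclOne (Y : Set X) (f : X → ℝ) : C(stdLag n Y f, stdLagFamily n Y f) where
  toFun p := ⟨(1, p.1), by
    have h := p.2
    simp [stdLagFamily, h]⟩
  continuous_toFun := by fun_prop

theorem continuous_zeroSection : Continuous fun x : X => (⟨x, 0⟩ : Cot n X) :=
  (contMDiff_zeroSection ℝ (CotSpace n X) (IB := 𝓘(ℝ, Eu n)) (n := 0)).continuous

/-- The inclusion of `Y` into the family as the zero section at `t = 0`. -/
def inclZero (Y : Set X) (f : X → ℝ) : C(Y, stdLagFamily n Y f) where
  toFun y := ⟨(0, ⟨y.1, 0⟩), by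
    refine ⟨y.2, 0, fun v _ => rfl, ?_⟩
    change (0 : CotSpace n X y.1)
      = 0 + differential (n := n) (fun x => ((0 : unitInterval) : ℝ) * f x) y.1
    rw [differential_zero_mul, zero_add]⟩
  continuous_toFun := by
    have h : Continuous fun y : Y => (⟨y.1, 0⟩ : Cot n X) :=
      continuous_zeroSection.comp continuous_subtype_val
    fun_prop

/-- The projection `π : T^*X → X`. -/
def cotProj (n : ℕ) (X : Type*) [TopologicalSpace X] [ChartedSpace (Eu n) X]
    [IsManifold 𝓘(ℝ, Eu n) ∞ X] : C(Cot n X, X) :=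
  ⟨fun p => p.1, FiberBundle.continuous_proj (Eu n →L[ℝ] ℝ) (CotSpace n X)⟩

/-- The inclusion of a subspace. -/
def incl {T : Type*} [TopologicalSpace T] (S : Set T) : C(S, T) := ⟨Subtype.val, continuous_subtype_val⟩

/-- The projection of the family to `T^*X`. -/
def famToCot (Y : Set X) (f : X → ℝ) : C(stdLagFamily n Y f, Cot n X) :=
  ⟨fun q => q.1.2, by fun_prop⟩

/-- The tangent bundle of the Riemannian manifold `X`. -/
def tangentX (g : Metric n X) : EuclFamily 𝓘(ℝ, Eu n) X X where
  map x := x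
  fib _ := ⊤
  form x u v := g.inner x u v

/-- The tangent bundle of a submanifold `L` of `T^*X`, with the metric induced from `T^*X`. -/
def tangentL (g : Metric n X) (w : Cot n X → ℝ) (L : Set (Cot n X)) :
    EuclFamily (IC n) (Cot n X) L where
  map p := p.1
  fib p := tangentOf (IC n) L p.1
  form p := compatMetric g w p.1

/-- The bundle over the family of the dilations `L_{Y,tf}`, with fibre the tangent space of
`L_{Y,tf}` at the points of `L_{Y,tf}`. -/
def tangentFam (g : Metric n X) (w : Cot n X → ℝ) (Y : Set X) (f : X → ℝ) :
    EuclFamily (IC n) (Cot n X) (stdLagFamily n Y f) where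
  map q := q.1.2
  fib q := tangentOf (IC n) (stdLag n Y (fun x => (q.1.1 : ℝ) * f x)) q.1.2
  form q := compatMetric g w q.1.2

/-! ## Brane structures -/

/-- A brane structure on `L ⊂ T^*X` (with respect to the trivialization `s` of the bicanonical
bundle and the background cocycle `b`): a grading, which is a continuous lift to `ℝ` of the squared
phase, and a pin structure relative to the restriction of `b`. -/
structure BraneStructure {g : Metric n X} {w : Cot n X → ℝ} (s : CanonicalTrivialization g w)
    (b : CechCocycle (Cot n X) (ZMod 2) 2) (L : Set (Cot n X)) where
  grading : C(L, ℝ)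
  isGrading : ∀ p : L, Complex.exp (grading p * Complex.I)
    = squaredPhase s p.1 (tangentOf (IC n) L p.1)
  pin : PinCochain n (tangentL g w L)
  isRelative : pin.IsRelativeTo (b.pullback (incl L))

/-- `a` is the canonical grading of `L_{Y,f}` (for `d`-dimensional `Y`): the end at `t = 1` of a
continuous family of gradings of `L_{Y,tf}`, `0 ≤ t ≤ 1`, which on `Y ⊂ T_Y^* X = L_{Y,0}` is the
constant `-(codim Y) π`. -/
def IsCanonicalGrading {g : Metric n X} {w : Cot n X → ℝ} (s : CanonicalTrivialization g w)
    (d : ℕ) (Y : Set X) (f : X → ℝ) (a : C(stdLag n Y f, ℝ)) : Prop :=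
  ∃ A : C(stdLagFamily n Y f, ℝ),
    (∀ q, Complex.exp (A q * Complex.I)
      = squaredPhase s q.1.2 ((tangentFam g w Y f).fib q)) ∧
    (∀ y : Y, A (inclZero Y f y) = -((n : ℝ) - d) * Real.pi) ∧
    ∀ p, a p = A (inclOne Y f p)

/-- `Ψ` is the identification of `TX|_Y` with the tangent spaces of `T_Y^* X` along `Y` given by the
metric: a vector `u` tangent to `Y` goes to the horizontal vector `u`, and a vector `v` normal to `Y`
goes to the vertical vector `♭v`. -/
def IsConormalIdentification (g : Metric n X) (Y : Set X) (Ψ : Y → (Eu n →ₗ[ℝ] EuCot n)) : Prop :=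
  ∀ y : Y, (∀ u ∈ tangentOf 𝓘(ℝ, Eu n) Y y.1, Ψ y u = (u, 0)) ∧
    ∀ v : Eu n, (∀ u ∈ tangentOf 𝓘(ℝ, Eu n) Y y.1, flat g y.1 v u = 0) → Ψ y v = (0, flat g y.1 v)

/-- Let `PX` be lifts to `Pin⁺(n)` of transition functions of `TX`, with coboundary the cocycle `b`
(so that `b` represents `w₂(X)` and `PX` is the tautological pin structure on `TX` relative to `b`).
`P` is the canonical pin structure on `L_{Y,f}` relative to `π^* b`: the end at `t = 1` of a
continuous family of relative pin structures on `L_{Y,tf}`, `0 ≤ t ≤ 1`, which along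
`Y ⊂ T_Y^* X = L_{Y,0}` corresponds to `PX|_Y` under the identification of `TX|_Y` with
`T(T_Y^* X)|_Y` given by the metric. -/
def IsCanonicalPin (g : Metric n X) (w : Cot n X → ℝ) (PX : PinCochain n (tangentX g))
    (b : CechCocycle X (ZMod 2) 2) (Y : Set X) (f : X → ℝ)
    (P : PinCochain n (tangentL g w (stdLag n Y f))) : Prop :=
  ∃ Q : PinCochain n (tangentFam g w Y f),
    Q.IsRelativeTo ((b.pullback (cotProj n X)).pullback (famToCot Y f)) ∧
    (∃ Ψ, IsConormalIdentification g Y Ψ ∧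
      PinIso (fun y v => Ψ y v) (PX.pullback (incl Y)) (Q.pullback (inclZero Y f))) ∧
    PinIso (F := (tangentFam g w Y f).pullback (inclOne Y f))
      (F' := tangentL g w (stdLag n Y f)) (fun _ v => v) (Q.pullback (inclOne Y f)) P

end Geometry

end

end CotBrane

open CotBrane

namespace CotBrane
noncomputable section

/-! ## Clifford algebras of Euclidean spaces -/

section Clifford

variable {n : ℕ}

local notation "γ" => CliffordAlgebra.ι (stdForm n)

/-! The total space of the family, the set of pairs (t, p) with p in L_{Y,tf}, contracts onto Y,
embedded as the zero section at t = 0. The fibre of L_{Y,tf} over x is the coset of the conormal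
space through t df, so multiplying covectors by τ carries L_{Y,tf} into L_{Y,τtf}; the resulting
homotopy is `dilation`. Gradings and isomorphisms of relative pin structures are sections of
covering spaces, so over the whole family they exist and are unique once they are prescribed along
Y, by homotopy lifting (`existsUnique_circle_lift`, `exists_trivialization_of_contraction`). What
remains is linear algebra along Y and enough continuity.

Bicanonical bundle. An orthonormal basis e of T_xX identifies T_p(T^*X) with ℂⁿ, complex linearly
for J_w, and the determinant of the coordinates spans κ_p. Another choice of e changes this form by
a sign. The value of its square on two tuples is the determinant of a matrix of the basis-free
complex bilinear form `cform` (`evalBican_std`), so the squares form one continuous section. Every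
canonical trivialization is a multiple of it by a function to ℂ^× which is 1 on the zero section,
and shrinking the fibres deforms the quotient of two such functions to 1.

Grading. A C² chart adapted to Y, lifted to covectors after subtraction of d(tf), straightens
L_{Y,tf} to the conormal bundle of a linear subspace. This yields local frames of the tangent spaces
which are continuous also in t, and shows that these spaces are Lagrangian, hence totally real, so
η² does not vanish on them (`det_cplxMat_ne_zero`). Thus the phase is continuous on the family.
Along Y it is the determinant of the orthogonal reflection in TY, that is (-1)^(n-d)
(`det_conormalId`), and -(n-d)π is one of its arguments. A global argument is a primitive of the
pulled back angle cocycle, so the Maslov class vanishes.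

Pin structures. The elements of Pin⁺(n) over a given matrix are x and -x (`twisted_centre`), and
continuous orthogonal matrices lift locally, as products of reflections. Two cochains with the same
coboundary therefore differ by a ℤ/2-valued 1-cocycle, to which the contraction applies; this is
uniqueness. For existence, the pairing `conormalPairing` of T_pL_{Y,tf} with T_xX is nondegenerate
and gives an isomorphism of the pullback of TX with the tangent bundle of the family
(`famTransport`); along Y this is the isometry in the statement. Polar decomposition makes it an
isometry everywhere. Because polar decomposition is equivariant under O(n), transported frames have
the same transition matrices as those of P_X, so the same elements of Pin⁺(n) serve as lifts and
their coboundary is π^*b (`famPin`). Restriction to t = 1 also computes w₂.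

Continuity of families of vectors tangent to T^*X is always tested on horizontal and vertical parts
(`tot_iff`); that this is legitimate is the transformation law of the Christoffel symbols. -/

theorem stdForm_apply (v : Fin n → ℝ) : stdForm n v = v ⬝ᵥ v := by
  simp [stdForm, QuadraticMap.weightedSumSquares_apply, dotProduct]

theorem polar_stdForm (u v : Fin n → ℝ) : QuadraticMap.polar (stdForm n) u v = 2 * (u ⬝ᵥ v) := by
  simp only [QuadraticMap.polar, stdForm_apply, dotProduct_add, add_dotProduct]
  rw [dotProduct_comm v u]
  ring

/-- Linearly the Clifford algebra is the exterior algebra. Finite dimension is what makes continuity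
tested against linear functionals compatible with products. -/
instance : Module.Finite ℝ (Cl n) := by
  have : Module.Finite ℝ (ExteriorAlgebra ℝ (Fin n → ℝ)) :=
    Module.Finite.of_basis (Pi.basisFun ℝ (Fin n)).ExteriorAlgebra
  exact Module.Finite.equiv (CliffordAlgebra.equivExterior (stdForm n)).symm

/-- The scalar part of an element of the Clifford algebra. -/
def scalarPart (n : ℕ) : Cl n →ₗ[ℝ] ℝ :=
  ExteriorAlgebra.algebraMapInv.toLinearMap ∘ₗ (CliffordAlgebra.equivExterior (stdForm n)).toLinearMap

theorem scalarPart_algebraMap (r : ℝ) : scalarPart n (algebraMap ℝ (Cl n) r) = r := by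
  simp [scalarPart, CliffordAlgebra.changeForm_algebraMap, ExteriorAlgebra.algebraMap_leftInverse _ r]

theorem algebraMap_Cl_injective : Function.Injective (algebraMap ℝ (Cl n)) :=
  Function.LeftInverse.injective scalarPart_algebraMap

/-- Elements supported on the coordinate directions in `s`. -/
def coordSubalgebra (s : Finset (Fin n)) : Subalgebra ℝ (Cl n) :=
  Algebra.adjoin ℝ ((fun i => γ (Pi.single i 1)) '' s)

theorem single_mul_single_of_ne {i j : Fin n} (h : i ≠ j) :
    γ (Pi.single i 1) * γ (Pi.single j 1) = -(γ (Pi.single j 1) * γ (Pi.single i 1)) := by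
  rw [eq_neg_iff_add_eq_zero, CliffordAlgebra.ι_mul_ι_add_swap, polar_stdForm]
  simp [h]

theorem single_mul_self (i : Fin n) : γ (Pi.single i 1) * γ (Pi.single i 1) = 1 := by
  rw [CliffordAlgebra.ι_sq_scalar, stdForm_apply]
  simp

theorem involute_mem_coordSubalgebra {s : Finset (Fin n)} {a : Cl n} (ha : a ∈ coordSubalgebra s) :
    CliffordAlgebra.involute a ∈ coordSubalgebra s := by
  induction ha using Algebra.adjoin_induction with
  | mem x hx =>
    obtain ⟨i, hi, rfl⟩ := hx
    simp only [CliffordAlgebra.involute_ι]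
    exact neg_mem (Algebra.subset_adjoin ⟨i, hi, rfl⟩)
  | algebraMap r => simp
  | add x y _ _ hx hy => simpa using add_mem hx hy
  | mul x y _ _ hx hy => simpa using mul_mem hx hy

/-- The vector e_i anticommutes with every generator e_j, j ∈ s, so moving it through a product
produces the grading involution. -/
theorem single_mul_of_mem_coordSubalgebra {s : Finset (Fin n)} {i : Fin n} (hi : i ∉ s) {a : Cl n}
    (ha : a ∈ coordSubalgebra s) :
    γ (Pi.single i 1) * a = CliffordAlgebra.involute a * γ (Pi.single i 1) := by
  induction ha using Algebra.adjoin_induction with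
  | mem x hx =>
    obtain ⟨j, hj, rfl⟩ := hx
    have : i ≠ j := fun h => hi (h ▸ hj)
    simp only [CliffordAlgebra.involute_ι, neg_mul]
    exact single_mul_single_of_ne this
  | algebraMap r => simp [Algebra.commutes]
  | add x y _ _ hx hy => simp [mul_add, add_mul, hx, hy]
  | mul x y _ _ hx hy => rw [← mul_assoc, hx, mul_assoc, hy, map_mul, mul_assoc]

/-- Normal form: each e_i can be moved to the left at the cost of an involution, and e_i² = 1
absorbs repetitions. -/
theorem mem_coordSubalgebra_insert {s : Finset (Fin n)} {i : Fin n} (hi : i ∉ s) {y : Cl n}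
    (hy : y ∈ coordSubalgebra (insert i s)) :
    ∃ a ∈ coordSubalgebra s, ∃ b ∈ coordSubalgebra s, y = a + γ (Pi.single i 1) * b := by
  induction hy using Algebra.adjoin_induction with
  | mem x hx =>
    obtain ⟨j, hj, rfl⟩ := hx
    rcases Finset.mem_insert.1 hj with rfl | hj
    · exact ⟨0, zero_mem _, 1, one_mem _, by simp⟩
    · exact ⟨_, Algebra.subset_adjoin ⟨j, hj, rfl⟩, 0, zero_mem _, by simp⟩
  | algebraMap r => exact ⟨_, algebraMap_mem _ r, 0, zero_mem _, by simp⟩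
  | add x y _ _ hx hy =>
    obtain ⟨a, ha, b, hb, rfl⟩ := hx
    obtain ⟨a', ha', b', hb', rfl⟩ := hy
    exact ⟨_, add_mem ha ha', _, add_mem hb hb', by rw [mul_add]; abel⟩
  | mul x y _ _ hx hy =>
    obtain ⟨a, ha, b, hb, rfl⟩ := hx
    obtain ⟨a', ha', b', hb', rfl⟩ := hy
    set e := γ (Pi.single i 1)
    have h1 : ∀ c ∈ coordSubalgebra s, c * e = e * CliffordAlgebra.involute c := by
      intro c hc
      rw [single_mul_of_mem_coordSubalgebra hi (involute_mem_coordSubalgebra hc),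
        CliffordAlgebra.involute_involute]
    have h2 : e * e = 1 := single_mul_self i
    refine ⟨a * a' + CliffordAlgebra.involute b * b',
      add_mem (mul_mem ha ha') (mul_mem (involute_mem_coordSubalgebra hb) hb'),
      b * a' + CliffordAlgebra.involute a * b',
      add_mem (mul_mem hb ha') (mul_mem (involute_mem_coordSubalgebra ha) hb'), ?_⟩
    have h3 : e * b * (e * b') = CliffordAlgebra.involute b * b' := by
      calc e * b * (e * b') = e * (b * e) * b' := by simp only [mul_assoc]
        _ = (e * e) * CliffordAlgebra.involute b * b' := by rw [h1 b hb]; simp only [mul_assoc]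
        _ = _ := by rw [h2, one_mul]
    have h4 : a * (e * b') = e * (CliffordAlgebra.involute a * b') := by
      rw [← mul_assoc, h1 a ha, mul_assoc]
    rw [add_mul, mul_add, mul_add, h3, h4]
    noncomm_ring

theorem coordSubalgebra_univ : coordSubalgebra (Finset.univ : Finset (Fin n)) = ⊤ := by
  rw [← CliffordAlgebra.adjoin_range_ι (Q := stdForm n)]
  refine le_antisymm (Algebra.adjoin_mono ?_) (Algebra.adjoin_le ?_)
  · rintro _ ⟨i, -, rfl⟩
    exact mem_range_self _
  · rintro _ ⟨v, rfl⟩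
    have hv : v = ∑ i, v i • (Pi.single i 1 : Fin n → ℝ) := by
      ext j
      simp [Finset.sum_apply, Pi.single_apply]
    rw [hv, map_sum]
    refine sum_mem fun i _ => ?_
    rw [map_smul]
    exact Subalgebra.smul_mem _ (Algebra.subset_adjoin (mem_image_of_mem (fun i => γ (Pi.single i 1)) (by simp))) _

/-- The twisted centre of the Clifford algebra consists of the scalars. -/
theorem twisted_centre {y : Cl n}
    (hy : ∀ v, CliffordAlgebra.involute y * γ v = γ v * y) : ∃ r : ℝ, y = algebraMap ℝ (Cl n) r := by
  have key : ∀ s : Finset (Fin n), y ∈ coordSubalgebra s → y ∈ coordSubalgebra (∅ : Finset (Fin n)) := by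
    intro s
    induction s using Finset.induction_on with
    | empty => exact id
    | insert i s hi ih =>
      intro hys
      refine ih ?_
      obtain ⟨a, ha, b, hb, hab⟩ := mem_coordSubalgebra_insert hi hys
      have h1 := hy (Pi.single i 1)
      have h2 := single_mul_of_mem_coordSubalgebra hi ha
      have h3 := single_mul_of_mem_coordSubalgebra hi hb
      set e := γ (Pi.single i 1)
      have hee : e * e = 1 := single_mul_self i
      -- For y = a + e b, twisted commutation with e reads e a - b = e a + b. So e_i does not occur
      -- in y, and the directions can be removed one at a time.
      have h4 : b = 0 := by
        rw [hab, map_add, map_mul, CliffordAlgebra.involute_ι, add_mul, ← h2, mul_add, neg_mul, neg_mul,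
          mul_assoc, ← h3, ← mul_assoc, hee, one_mul] at h1
        have h5 : -b = b := add_left_cancel h1
        have h6 : (2 : ℝ) • b = 0 := by
          rw [two_smul]
          nth_rewrite 1 [← h5]
          simp
        simpa using h6
      rw [hab, h4, mul_zero, add_zero]
      exact ha
  have h := key Finset.univ (by rw [coordSubalgebra_univ]; trivial)
  rw [coordSubalgebra, Finset.coe_empty, image_empty, Algebra.adjoin_empty] at h
  obtain ⟨r, hr⟩ := Algebra.mem_bot.1 h
  exact ⟨r, hr.symm⟩

/-! ## Elements of `Pin⁺(n)` over orthogonal matrices -/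

/-- Reversal is an antiautomorphism which fixes vectors, and unit vectors square to 1. Hence x times
its reversal is 1 on generators, and this is inherited by products and inverses. -/
theorem pinPlus_mul_reverse {y : (Cl n)ˣ} (hy : y ∈ pinPlus n) :
    (y : Cl n) * CliffordAlgebra.reverse (y : Cl n) = 1 ∧
      ((y⁻¹ : (Cl n)ˣ) : Cl n) = CliffordAlgebra.reverse (y : Cl n) := by
  have key : (y : Cl n) * CliffordAlgebra.reverse (y : Cl n) = 1 ∧
      CliffordAlgebra.reverse (y : Cl n) * (y : Cl n) = 1 := by
    induction hy using Subgroup.closure_induction with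
    | mem x hx =>
      rcases hx with ⟨v, hv, hx⟩ | hx
      · rw [hx, CliffordAlgebra.reverse_ι, CliffordAlgebra.ι_sq_scalar, hv]
        simp
      · rw [mem_singleton_iff.1 hx]
        simp
    | one => simp
    | mul x y _ _ hx hy =>
      simp only [Units.val_mul, CliffordAlgebra.reverse.map_mul]
      constructor
      · rw [mul_assoc, ← mul_assoc (y : Cl n), hy.1, one_mul, hx.1]
      · rw [mul_assoc, ← mul_assoc _ (x : Cl n), hx.2, one_mul, hy.2]
    | inv x _ hx =>
      have h : ((x⁻¹ : (Cl n)ˣ) : Cl n) = CliffordAlgebra.reverse (x : Cl n) :=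
        Units.inv_eq_of_mul_eq_one_right hx.1
      rw [h, CliffordAlgebra.reverse_reverse]
      exact ⟨hx.2, hx.1⟩
  exact ⟨key.1, Units.inv_eq_of_mul_eq_one_right key.1⟩

namespace IsPinLift

variable {x y : Cl n} {r s : Matrix (Fin n) (Fin n) ℝ}

theorem mul_reverse (h : IsPinLift x r) : x * CliffordAlgebra.reverse x = 1 := by
  obtain ⟨⟨y, hy, rfl⟩, -⟩ := h
  exact (pinPlus_mul_reverse hy).1

theorem reverse_mul (h : IsPinLift x r) : CliffordAlgebra.reverse x * x = 1 := by
  obtain ⟨⟨y, hy, rfl⟩, -⟩ := h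
  rw [← (pinPlus_mul_reverse hy).2]
  simp

theorem one : IsPinLift (1 : Cl n) 1 := ⟨⟨1, one_mem _, rfl⟩, fun v => by simp⟩

theorem mul (h : IsPinLift x r) (h' : IsPinLift y s) : IsPinLift (x * y) (r * s) := by
  obtain ⟨⟨a, ha, rfl⟩, h1⟩ := h
  obtain ⟨⟨b, hb, rfl⟩, h2⟩ := h'
  refine ⟨⟨a * b, mul_mem ha hb, rfl⟩, fun v => ?_⟩
  rw [map_mul, mul_assoc, h2, ← mul_assoc, h1, mul_assoc, Matrix.mulVec_mulVec]

theorem neg (h : IsPinLift x r) : IsPinLift (-x) r := by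
  obtain ⟨⟨a, ha, rfl⟩, h1⟩ := h
  refine ⟨⟨-1 * a, mul_mem (Subgroup.subset_closure (Or.inr rfl)) ha, by simp⟩, fun v => ?_⟩
  simp [h1]

/-- `IsPinLift` does not ask for orthogonality. The relation gives γ(rv) = α(x) γ(v) xᵗ, where α is
the grading involution and xᵗ the reversal of x; applying α yields the same formula with α moved to
the other factor. The product of the two is γ(v)², so r preserves lengths, and by polarization inner
products. -/
theorem transpose_mul_self (h : IsPinLift x r) : r.transpose * r = 1 := by
  have hx := h.mul_reverse
  have hx' := h.reverse_mul
  have hi : CliffordAlgebra.involute x * CliffordAlgebra.involute (CliffordAlgebra.reverse x) = 1 := by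
    rw [← map_mul, hx, map_one]
  have h1 : ∀ v, γ (r.mulVec v) = CliffordAlgebra.involute x * γ v * CliffordAlgebra.reverse x := by
    intro v
    rw [h.2 v, mul_assoc, hx, mul_one]
  have h2 : ∀ v, γ (r.mulVec v)
      = x * γ v * CliffordAlgebra.involute (CliffordAlgebra.reverse x) := by
    intro v
    have := congrArg CliffordAlgebra.involute (h1 v)
    simp only [map_mul, CliffordAlgebra.involute_ι, CliffordAlgebra.involute_involute] at this
    simpa using this
  have h3 : ∀ v, stdForm n (r.mulVec v) = stdForm n v := by
    intro v
    apply algebraMap_Cl_injective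
    rw [← CliffordAlgebra.ι_sq_scalar]
    nth_rewrite 1 [h1]
    rw [h2]
    calc _ = CliffordAlgebra.involute x * γ v * (CliffordAlgebra.reverse x * x) * γ v
          * CliffordAlgebra.involute (CliffordAlgebra.reverse x) := by simp only [mul_assoc]
      _ = CliffordAlgebra.involute x * (γ v * γ v)
          * CliffordAlgebra.involute (CliffordAlgebra.reverse x) := by
        rw [hx', mul_one]; simp only [mul_assoc]
      _ = _ := by
        rw [CliffordAlgebra.ι_sq_scalar, ← Algebra.commutes, mul_assoc, hi, mul_one]
  have h4 : ∀ u v, r.mulVec u ⬝ᵥ r.mulVec v = u ⬝ᵥ v := by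
    intro u v
    have := polar_stdForm (r.mulVec u) (r.mulVec v)
    rw [QuadraticMap.polar, ← Matrix.mulVec_add, h3, h3, h3] at this
    have h5 := polar_stdForm u v
    rw [QuadraticMap.polar, this] at h5
    linarith
  ext i j
  have := h4 (Pi.single i 1) (Pi.single j 1)
  rw [Matrix.mulVec_single_one, Matrix.mulVec_single_one] at this
  simpa [Matrix.mul_apply, dotProduct, Matrix.one_apply, Matrix.col, Pi.single_apply, eq_comm] using this

theorem mul_transpose_self (h : IsPinLift x r) : r * r.transpose = 1 :=
  mul_eq_one_comm.1 h.transpose_mul_self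

theorem reverse (h : IsPinLift x r) : IsPinLift (CliffordAlgebra.reverse x) r.transpose := by
  have hx := h.mul_reverse
  have hx' := h.reverse_mul
  have hr := h.mul_transpose_self
  obtain ⟨⟨a, ha, rfl⟩, h1⟩ := h
  refine ⟨⟨a⁻¹, inv_mem ha, (pinPlus_mul_reverse ha).2⟩, fun v => ?_⟩
  have h2 := h1 (r.transpose.mulVec v)
  rw [Matrix.mulVec_mulVec, hr, Matrix.one_mulVec] at h2
  have h3 : CliffordAlgebra.involute (CliffordAlgebra.reverse (a : Cl n))
      * CliffordAlgebra.involute (a : Cl n) = 1 := by rw [← map_mul, hx', map_one]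
  calc _ = CliffordAlgebra.involute (CliffordAlgebra.reverse (a : Cl n)) * (γ v * a)
        * CliffordAlgebra.reverse (a : Cl n) := by rw [mul_assoc, mul_assoc, hx, mul_one]
    _ = _ := by rw [← h2, ← mul_assoc, h3, one_mul]

/-- An element over the identity lies in the twisted centre, so it is a scalar c. Reversal fixes
scalars, so c² = 1. -/
theorem eq_or_eq_neg_one (h : IsPinLift x 1) : x = 1 ∨ x = -1 := by
  obtain ⟨c, rfl⟩ := twisted_centre (y := x) fun v => by rw [h.2 v, Matrix.one_mulVec]
  have hx := h.mul_reverse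
  rw [CliffordAlgebra.reverse.commutes, ← map_mul, ← map_one (algebraMap ℝ (Cl n))] at hx
  rcases mul_self_eq_one_iff.1 (algebraMap_Cl_injective hx) with rfl | rfl
  · exact Or.inl (map_one _)
  · right
    rw [map_neg, map_one]

theorem eq_or_eq_neg (h : IsPinLift x r) (h' : IsPinLift y r) : y = x ∨ y = -x := by
  have h1 := h.reverse.mul h'
  rw [h.transpose_mul_self] at h1
  have h2 : y = x * (CliffordAlgebra.reverse x * y) := by rw [← mul_assoc, h.mul_reverse, one_mul]
  rcases h1.eq_or_eq_neg_one with h3 | h3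
  · left
    rw [h2, h3, mul_one]
  · right
    rw [h2, h3, mul_neg, mul_one]

theorem ne_neg (h : IsPinLift x r) : x ≠ -x := by
  intro h1
  have h2 : (2 : ℝ) • x = 0 := by
    rw [two_smul]
    nth_rewrite 1 [h1]
    simp
  have h3 : x = 0 := by simpa using h2
  have h4 := h.mul_reverse
  rw [h3, zero_mul, ← map_zero (algebraMap ℝ (Cl n)), ← map_one (algebraMap ℝ (Cl n))] at h4
  exact zero_ne_one (algebraMap_Cl_injective h4)

end IsPinLift

/-! ## Continuous maps into the Clifford algebra -/

namespace ClContinuousOn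

variable {B : Type*} [TopologicalSpace B] {c c' : B → Cl n} {S T : Set B}

theorem mono (h : ClContinuousOn c S) (hT : T ⊆ S) : ClContinuousOn c T := fun l => (h l).mono hT

theorem const (a : Cl n) : ClContinuousOn (fun _ : B => a) S := fun _ => continuousOn_const

theorem linear (h : ClContinuousOn c S) (f : Cl n →ₗ[ℝ] Cl n) : ClContinuousOn (fun b => f (c b)) S :=
  fun l => h (l ∘ₗ f)

/-- Expanding both factors in a finite basis makes any functional of the product a polynomial in
continuous coordinates. -/
theorem mul (h : ClContinuousOn c S) (h' : ClContinuousOn c' S) :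
    ClContinuousOn (fun b => c b * c' b) S := by
  intro l
  let bs := Module.finBasis ℝ (Cl n)
  have key : ∀ x y : Cl n, l (x * y) = ∑ i, ∑ j, bs.coord i x * bs.coord j y * l (bs i * bs j) := by
    intro x y
    conv_lhs => rw [← bs.sum_repr x, ← bs.sum_repr y]
    simp only [Finset.sum_mul, Finset.mul_sum, map_sum, smul_mul_smul_comm, map_smul, smul_eq_mul,
      Module.Basis.coord_apply]
    exact Finset.sum_comm
  rw [show (fun b => l (c b * c' b)) = _ from funext fun b => key (c b) (c' b)]
  exact continuousOn_finsetSum _ fun i _ => continuousOn_finsetSum _ fun j _ =>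
    ((h _).mul (h' _)).mul continuousOn_const

theorem reverse (h : ClContinuousOn c S) :
    ClContinuousOn (fun b => CliffordAlgebra.reverse (c b)) S := h.linear _

theorem smul {φ : B → ℝ} (hφ : ContinuousOn φ S) (h : ClContinuousOn c S) :
    ClContinuousOn (fun b => φ b • c b) S := by
  intro l
  simp only [map_smul, smul_eq_mul]
  exact hφ.mul (h l)

theorem vector {u : B → Fin n → ℝ} (hu : ContinuousOn u S) : ClContinuousOn (fun b => γ (u b)) S :=
  fun l => (LinearMap.continuous_of_finiteDimensional (l ∘ₗ γ)).comp_continuousOn hu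

theorem comp {B' : Type*} [TopologicalSpace B'] {f : B' → B} {T : Set B'} (h : ClContinuousOn c S)
    (hf : ContinuousOn f T) (hT : MapsTo f T S) : ClContinuousOn (fun b => c (f b)) T :=
  fun l => (h l).comp hf hT

/-- Two continuous lifts which agree at a point agree near that point. -/
theorem eventually_eq {r : B → Matrix (Fin n) (Fin n) ℝ} (hS : IsOpen S) (h : ClContinuousOn c S)
    (h' : ClContinuousOn c' S) (hc : ∀ b ∈ S, IsPinLift (c b) (r b))
    (hc' : ∀ b ∈ S, IsPinLift (c' b) (r b)) {b : B} (hb : b ∈ S) :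
    ∀ᶠ b' in 𝓝 b, (c' b' = c b' ↔ c' b = c b) := by
  -- The product of c⁻¹ and c' is 1 or -1 at every point, so its scalar part is a continuous
  -- function with values ±1 that records whether the lifts agree.
  have h1 : ContinuousOn (fun b => scalarPart n (CliffordAlgebra.reverse (c b) * c' b)) S :=
    h.reverse.mul h' (scalarPart n)
  have hone : scalarPart n 1 = 1 := by rw [← map_one (algebraMap ℝ (Cl n)), scalarPart_algebraMap]
  have hval : ∀ a ∈ S, (c' a = c a ∧ scalarPart n (CliffordAlgebra.reverse (c a) * c' a) = 1) ∨
      (c' a ≠ c a ∧ scalarPart n (CliffordAlgebra.reverse (c a) * c' a) = -1) := by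
    intro a ha
    rcases (hc a ha).eq_or_eq_neg (hc' a ha) with e | e
    · left
      rw [e, (hc a ha).reverse_mul]
      exact ⟨rfl, hone⟩
    · right
      refine ⟨fun e' => (hc a ha).ne_neg (e'.symm.trans e), ?_⟩
      rw [e, mul_neg, (hc a ha).reverse_mul, map_neg, hone]
  have h2 := (h1 b hb).continuousAt (hS.mem_nhds hb)
  filter_upwards [hS.mem_nhds hb, Metric.continuousAt_iff'.1 h2 1 one_pos] with a ha hd
  rw [Real.dist_eq] at hd
  rcases hval a ha with ⟨e, e'⟩ | ⟨e, e'⟩ <;> rcases hval b hb with ⟨f, f'⟩ | ⟨f, f'⟩ <;>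
    simp only [e, f] <;> rw [e', f'] at hd <;> norm_num at hd

end ClContinuousOn

end Clifford

/-! ### Reflections and local lifts of orthogonal matrices -/

section LocalLifts

variable {n : ℕ}

local notation "γ" => CliffordAlgebra.ι (stdForm n)

theorem dotProduct_self_nonneg' (u : Fin n → ℝ) : 0 ≤ u ⬝ᵥ u :=
  Finset.sum_nonneg fun i _ => mul_self_nonneg (u i)

/-- The matrix of the reflection in the hyperplane orthogonal to `u`. -/
def householder (u : Fin n → ℝ) : Matrix (Fin n) (Fin n) ℝ :=
  1 - (2 / (u ⬝ᵥ u)) • Matrix.vecMulVec u u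

theorem householder_mulVec (u v : Fin n → ℝ) :
    (householder u).mulVec v = v - (2 / (u ⬝ᵥ u) * (u ⬝ᵥ v)) • u := by
  simp only [householder, Matrix.sub_mulVec, Matrix.one_mulVec, Matrix.smul_mulVec,
    Matrix.vecMulVec_mulVec]
  simp [smul_smul]

/-- This is the Clifford relation uv + vu = 2⟨u, v⟩ for the normalized vector u. The twist by the
involution supplies the sign which makes the action the reflection and not its negative. -/
theorem isPinLift_householder {u : Fin n → ℝ} (hu : u ⬝ᵥ u ≠ 0) :
    IsPinLift ((Real.sqrt (u ⬝ᵥ u))⁻¹ • γ u) (householder u) := by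
  have hpos : 0 < u ⬝ᵥ u := lt_of_le_of_ne (dotProduct_self_nonneg' u) hu.symm
  have hs : Real.sqrt (u ⬝ᵥ u) * Real.sqrt (u ⬝ᵥ u) = u ⬝ᵥ u := Real.mul_self_sqrt hpos.le
  have hs0 : Real.sqrt (u ⬝ᵥ u) ≠ 0 := (Real.sqrt_pos.2 hpos).ne'
  set c := Real.sqrt (u ⬝ᵥ u)
  have h1 : stdForm n (c⁻¹ • u) = 1 := by
    rw [stdForm_apply, smul_dotProduct, dotProduct_smul, smul_eq_mul, smul_eq_mul, ← hs]
    field_simp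
  have h2 : γ (c⁻¹ • u) * γ (c⁻¹ • u) = 1 := by
    rw [CliffordAlgebra.ι_sq_scalar, h1, map_one]
  rw [← map_smul]
  refine ⟨⟨⟨_, _, h2, h2⟩, Subgroup.subset_closure (Or.inl ⟨_, h1, rfl⟩), rfl⟩, fun v => ?_⟩
  have h3 := CliffordAlgebra.ι_mul_ι_add_swap (Q := stdForm n) u v
  rw [polar_stdForm] at h3
  rw [CliffordAlgebra.involute_ι, householder_mulVec, map_sub, map_smul, map_smul, sub_mul]
  have h4 : γ u * γ u = algebraMap ℝ (Cl n) (u ⬝ᵥ u) := by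
    rw [CliffordAlgebra.ι_sq_scalar, stdForm_apply]
  simp only [smul_mul_assoc, mul_smul_comm, neg_mul, h4]
  rw [← eq_sub_iff_add_eq] at h3
  rw [h3, Algebra.algebraMap_eq_smul_one, Algebra.algebraMap_eq_smul_one]
  simp only [smul_sub, smul_smul, neg_sub]
  congr 2
  field_simp

/-- The hyperplane orthogonal to w - u bisects two vectors of equal length, so the reflection in it
exchanges them. -/
theorem householder_sub {u w : Fin n → ℝ} (hu : u ⬝ᵥ u = 1) (hw : w ⬝ᵥ w = 1)
    (h : (w - u) ⬝ᵥ (w - u) ≠ 0) : (householder (w - u)).mulVec w = u := by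
  rw [householder_mulVec]
  have h1 : (w - u) ⬝ᵥ (w - u) = 2 * ((w - u) ⬝ᵥ w) := by
    simp only [dotProduct_sub, sub_dotProduct, hu, hw, dotProduct_comm u w]
    ring
  have h2 : (w - u) ⬝ᵥ w ≠ 0 := fun h3 => h (by rw [h1, h3, mul_zero])
  rw [h1, div_mul_eq_mul_div, div_self (mul_ne_zero two_ne_zero h2), one_smul, sub_sub_cancel]

theorem householder_of_orthogonal {u v : Fin n → ℝ} (h : u ⬝ᵥ v = 0) :
    (householder u).mulVec v = v := by
  rw [householder_mulVec, h, mul_zero, zero_smul, sub_zero]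

theorem householder_orthogonal (u : Fin n → ℝ) (hu : u ⬝ᵥ u ≠ 0) :
    (householder u).transpose * householder u = 1 :=
  (isPinLift_householder hu).transpose_mul_self

theorem dotProduct_mulVec_of_orthogonal {r : Matrix (Fin n) (Fin n) ℝ} (h : r.transpose * r = 1)
    (u v : Fin n → ℝ) : r.mulVec u ⬝ᵥ r.mulVec v = u ⬝ᵥ v := by
  rw [Matrix.dotProduct_mulVec, Matrix.vecMul_mulVec, h, Matrix.vecMul_one]

theorem continuousOn_householder {B : Type*} [TopologicalSpace B] {S : Set B} {u : B → Fin n → ℝ}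
    (hu : ContinuousOn u S) (h0 : ∀ b ∈ S, u b ⬝ᵥ u b ≠ 0) :
    ContinuousOn (fun b => householder (u b)) S := by
  have h1 : ContinuousOn (fun b => u b ⬝ᵥ u b) S := by
    simp only [dotProduct]
    fun_prop
  have h2 : ContinuousOn (fun b => Matrix.vecMulVec (u b) (u b)) S := by
    refine continuousOn_pi.2 fun i => continuousOn_pi.2 fun j => ?_
    simp only [Matrix.vecMulVec_apply]
    fun_prop
  exact continuousOn_const.sub ((continuousOn_const.div h1 h0).smul h2)

theorem clContinuousOn_unit {B : Type*} [TopologicalSpace B] {S : Set B} {u : B → Fin n → ℝ}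
    (hu : ContinuousOn u S) (h0 : ∀ b ∈ S, u b ⬝ᵥ u b ≠ 0) :
    ClContinuousOn (fun b => (Real.sqrt (u b ⬝ᵥ u b))⁻¹ • γ (u b)) S := by
  have h1 : ContinuousOn (fun b => u b ⬝ᵥ u b) S := by
    simp only [dotProduct]
    fun_prop
  refine ClContinuousOn.smul ((Real.continuous_sqrt.comp_continuousOn h1).inv₀ fun b hb => ?_)
    (ClContinuousOn.vector hu)
  exact (Real.sqrt_pos.2 (lt_of_le_of_ne (dotProduct_self_nonneg' _) (h0 b hb).symm)).ne'

/-- If `r'` has continuous lifts locally then so has `r = H(u) r'`. -/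
theorem exists_local_lift_of_householder_mul {B : Type*} [TopologicalSpace B] {S : Set B}
    {r : B → Matrix (Fin n) (Fin n) ℝ} {u : B → Fin n → ℝ} (hu : ContinuousOn u S)
    (h0 : ∀ b ∈ S, u b ⬝ᵥ u b ≠ 0) {b₀ : B}
    (h : ∃ U, IsOpen U ∧ b₀ ∈ U ∧ ∃ c : B → Cl n, ClContinuousOn c (U ∩ S) ∧
      ∀ b ∈ U ∩ S, IsPinLift (c b) (householder (u b) * r b)) :
    ∃ U, IsOpen U ∧ b₀ ∈ U ∧ ∃ c : B → Cl n, ClContinuousOn c (U ∩ S) ∧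
      ∀ b ∈ U ∩ S, IsPinLift (c b) (r b) := by
  obtain ⟨U, hU, hbU, c, hc, hl⟩ := h
  have hc1 := (clContinuousOn_unit hu h0).mono (inter_subset_right : U ∩ S ⊆ S)
  refine ⟨U, hU, hbU, _, hc1.reverse.mul hc, fun b hb => ?_⟩
  have h1 := isPinLift_householder (h0 b hb.2)
  have h2 := h1.reverse.mul (hl b hb)
  rwa [← mul_assoc, h1.transpose_mul_self, one_mul] at h2

/-- Cartan–Dieudonné with parameters, by induction on the number k of final basis vectors that may
move. Let w(b) be the image of the first vector e that may move. A reflection, or two, depending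
continuously on b brings w(b) back to e and leaves the fixed vectors alone, since w(b) and e are
both orthogonal to them. The remaining matrix is covered by the induction hypothesis, and
reflections have explicit continuous lifts. -/
theorem exists_local_pinLift_aux {B : Type*} [TopologicalSpace B] (k : ℕ) :
    ∀ (S : Set B) (r : B → Matrix (Fin n) (Fin n) ℝ), ContinuousOn r S →
    (∀ b ∈ S, (r b).transpose * r b = 1) →
    (∀ b ∈ S, ∀ i : Fin n, (i : ℕ) + k < n → (r b).mulVec (Pi.single i 1) = Pi.single i 1) →
    ∀ b₀ ∈ S, ∃ U, IsOpen U ∧ b₀ ∈ U ∧ ∃ c : B → Cl n, ClContinuousOn c (U ∩ S) ∧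
      ∀ b ∈ U ∩ S, IsPinLift (c b) (r b) := by
  induction k with
  | zero =>
    intro S r hr horth hfix b₀ hb₀
    refine ⟨univ, isOpen_univ, mem_univ _, fun _ => 1, ClContinuousOn.const 1, fun b hb => ?_⟩
    have : r b = 1 := by
      refine Matrix.ext_of_mulVec_single fun i => ?_
      rw [hfix b hb.2 i (by simp), Matrix.one_mulVec]
    rw [this]
    exact IsPinLift.one
  | succ k ih =>
    intro S r hr horth hfix b₀ hb₀
    by_cases hk : n ≤ k
    · exact ih S r hr horth (fun b hb i hi => by omega) b₀ hb₀
    push Not at hk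
    -- The hypothesis fixes exactly the basis vectors with index below n - 1 - k, so this is the
    -- first one that may move.
    let i : Fin n := ⟨n - 1 - k, by omega⟩
    let e : Fin n → ℝ := Pi.single i 1
    let w : B → Fin n → ℝ := fun b => (r b).mulVec e
    have hee : e ⬝ᵥ e = 1 := by simp [e]
    have hww : ∀ b ∈ S, w b ⬝ᵥ w b = 1 := fun b hb => by
      simp only [w]
      rw [dotProduct_mulVec_of_orthogonal (horth b hb), hee]
    have hwc : ContinuousOn w S := by
      refine continuousOn_pi.2 fun j => ?_
      have : ContinuousOn (fun b => r b j) S :=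
        (continuous_apply j).comp_continuousOn hr
      simp only [w, Matrix.mulVec, dotProduct]
      fun_prop
    have hwj : ∀ b ∈ S, ∀ j : Fin n, (j : ℕ) < n - 1 - k →
        w b ⬝ᵥ (Pi.single j 1 : Fin n → ℝ) = 0 ∧ e ⬝ᵥ (Pi.single j 1 : Fin n → ℝ) = 0 := by
      intro b hb j hj
      have h1 : e ⬝ᵥ (Pi.single j 1 : Fin n → ℝ) = 0 := by
        have : j ≠ i := fun h => by simp [h, i] at hj
        simp [e, this]
      refine ⟨?_, h1⟩
      have h2 := hfix b hb j (by omega)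
      rw [← h2]
      simp only [w]
      rw [dotProduct_mulVec_of_orthogonal (horth b hb), h1]
    have step : ∀ (T : Set B), T ⊆ S → b₀ ∈ T → ∀ (r' : B → Matrix (Fin n) (Fin n) ℝ),
        ContinuousOn r' T → (∀ b ∈ T, (r' b).transpose * r' b = 1) →
        (∀ b ∈ T, ∀ j : Fin n, (j : ℕ) < n - 1 - k →
          (r' b).mulVec (Pi.single j 1) = Pi.single j 1) →
        (∀ b ∈ T, (r' b).mulVec e = e) →
        ∃ U, IsOpen U ∧ b₀ ∈ U ∧ ∃ c : B → Cl n, ClContinuousOn c (U ∩ T) ∧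
          ∀ b ∈ U ∩ T, IsPinLift (c b) (r' b) := by
      intro T hT hbT r' hr' ho hf hi
      refine ih T r' hr' ho (fun b hb j hj => ?_) b₀ hbT
      rcases lt_or_eq_of_le (show (j : ℕ) ≤ n - 1 - k by omega) with h | h
      · exact hf b hb j h
      · have : j = i := Fin.ext h
        rw [this]
        exact hi b hb
    have orth_mul : ∀ {r r' : Matrix (Fin n) (Fin n) ℝ}, r.transpose * r = 1 →
        r'.transpose * r' = 1 → (r * r').transpose * (r * r') = 1 := by
      intro r r' h h'
      rw [Matrix.transpose_mul, mul_assoc, ← mul_assoc r.transpose, h, one_mul, h']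
    have descend : ∀ (V : Set B), IsOpen V → b₀ ∈ V →
        (∃ U, IsOpen U ∧ b₀ ∈ U ∧ ∃ c : B → Cl n, ClContinuousOn c (U ∩ (V ∩ S)) ∧
          ∀ b ∈ U ∩ (V ∩ S), IsPinLift (c b) (r b)) →
        ∃ U, IsOpen U ∧ b₀ ∈ U ∧ ∃ c : B → Cl n, ClContinuousOn c (U ∩ S) ∧
          ∀ b ∈ U ∩ S, IsPinLift (c b) (r b) := by
      rintro V hV hbV ⟨U, hU, hbU, c, hc, hl⟩
      refine ⟨U ∩ V, hU.inter hV, ⟨hbU, hbV⟩, c, ?_, ?_⟩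
      · rw [inter_assoc]; exact hc
      · rw [inter_assoc]; exact hl
    have nhd : ∀ u : B → Fin n → ℝ, ContinuousOn u S → u b₀ ⬝ᵥ u b₀ ≠ 0 →
        ∃ V, IsOpen V ∧ b₀ ∈ V ∧ ∀ b ∈ V ∩ S, u b ⬝ᵥ u b ≠ 0 := by
      intro u hu hub
      have h1 : ContinuousOn (fun b => u b ⬝ᵥ u b) S := by
        simp only [dotProduct]
        fun_prop
      obtain ⟨V, hV, hbV, hVS⟩ := mem_nhdsWithin.1 ((h1 b₀ hb₀).eventually_ne hub)
      exact ⟨V, hV, hbV, fun b hb => hVS hb⟩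
    -- The vector defining the reflection must stay nonzero near b₀. If w(b₀) = e then w - e fails,
    -- but -w - e equals -2e there; its reflection sends w to -e, and a second reflection, in e
    -- itself, sends -e to e.
    by_cases hw : w b₀ = e
    · let u : B → Fin n → ℝ := fun b => -w b - e
      have hu : ContinuousOn u S := hwc.neg.sub continuousOn_const
      have hub : u b₀ ⬝ᵥ u b₀ ≠ 0 := by
        have : u b₀ = (-2 : ℝ) • e := by
          simp only [u, hw]
          ext j
          simp
          ring
        rw [this, smul_dotProduct, dotProduct_smul, hee]
        norm_num
      obtain ⟨V, hV, hbV, hVS⟩ := nhd u hu hub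
      have hee0 : e ⬝ᵥ e ≠ 0 := by rw [hee]; exact one_ne_zero
      have hHc := continuousOn_householder (hu.mono inter_subset_right) hVS
      refine descend V hV hbV (exists_local_lift_of_householder_mul (hu.mono inter_subset_right) hVS
        (exists_local_lift_of_householder_mul (u := fun _ => e) continuousOn_const
          (fun _ _ => hee0) (step (V ∩ S) inter_subset_right ⟨hbV, hb₀⟩ _
          (continuousOn_const.mul (hHc.mul (hr.mono inter_subset_right))) ?_ ?_ ?_)))
      · intro b hb
        exact orth_mul (householder_orthogonal _ hee0)
          (orth_mul (householder_orthogonal _ (hVS b hb)) (horth b hb.2))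
      · intro b hb j hj
        obtain ⟨h1, h2⟩ := hwj b hb.2 j hj
        have h3 : u b ⬝ᵥ (Pi.single j 1 : Fin n → ℝ) = 0 := by
          simp only [u, sub_dotProduct, neg_dotProduct, h1, h2]
          simp
        rw [← Matrix.mulVec_mulVec, ← Matrix.mulVec_mulVec, hfix b hb.2 j (by omega),
          householder_of_orthogonal h3, householder_of_orthogonal h2]
      · intro b hb
        have h1 : (householder (u b)).mulVec (-w b) = e :=
          householder_sub hee (by simp [hww b hb.2]) (hVS b hb)
        have h2 : (householder e).mulVec e = -e := by
          rw [householder_mulVec, hee]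
          ext j
          simp
          ring
        rw [← Matrix.mulVec_mulVec, ← Matrix.mulVec_mulVec]
        change (householder e).mulVec ((householder (u b)).mulVec (w b)) = e
        rw [← neg_neg (w b), Matrix.mulVec_neg, h1, Matrix.mulVec_neg, h2, neg_neg]
    · let u : B → Fin n → ℝ := fun b => w b - e
      have hu : ContinuousOn u S := hwc.sub continuousOn_const
      have hub : u b₀ ⬝ᵥ u b₀ ≠ 0 := by
        intro h
        exact hw (sub_eq_zero.1 (dotProduct_self_eq_zero.1 h))
      obtain ⟨V, hV, hbV, hVS⟩ := nhd u hu hub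
      have hHc := continuousOn_householder (hu.mono inter_subset_right) hVS
      refine descend V hV hbV (exists_local_lift_of_householder_mul (hu.mono inter_subset_right) hVS
        (step (V ∩ S) inter_subset_right ⟨hbV, hb₀⟩ _
          (hHc.mul (hr.mono inter_subset_right)) ?_ ?_ ?_))
      · intro b hb
        exact orth_mul (householder_orthogonal _ (hVS b hb)) (horth b hb.2)
      · intro b hb j hj
        obtain ⟨h1, h2⟩ := hwj b hb.2 j hj
        rw [← Matrix.mulVec_mulVec, hfix b hb.2 j (by omega),
          householder_of_orthogonal (by simp only [u, sub_dotProduct, h1, h2]; simp)]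
      · intro b hb
        rw [← Matrix.mulVec_mulVec]
        exact householder_sub hee (hww b hb.2) (hVS b hb)

/-- Continuous families of orthogonal matrices lift locally to `Pin⁺(n)`. -/
theorem exists_local_pinLift {B : Type*} [TopologicalSpace B] {S : Set B}
    {r : B → Matrix (Fin n) (Fin n) ℝ} (hr : ContinuousOn r S)
    (horth : ∀ b ∈ S, (r b).transpose * r b = 1) {b₀ : B} (hb₀ : b₀ ∈ S) :
    ∃ U, IsOpen U ∧ b₀ ∈ U ∧ ∃ c : B → Cl n, ClContinuousOn c (U ∩ S) ∧
      ∀ b ∈ U ∩ S, IsPinLift (c b) (r b) :=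
  exists_local_pinLift_aux n S r hr horth (fun _ _ i hi => by omega) b₀ hb₀

end LocalLifts

/-! ### Inverse square roots of positive definite matrices -/

section InvSqrt

open scoped MatrixOrder

variable {n : ℕ} {A : Matrix (Fin n) (Fin n) ℝ}

/-- The inverse square root of a positive definite matrix. -/
def invSqrt (A : Matrix (Fin n) (Fin n) ℝ) : Matrix (Fin n) (Fin n) ℝ := (CFC.sqrt A)⁻¹

theorem isUnit_det_sqrt (hA : A.PosDef) : IsUnit (CFC.sqrt A).det := by
  have h : CFC.sqrt A * CFC.sqrt A = A := CFC.sqrt_mul_sqrt_self A hA.posSemidef.nonneg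
  have h1 : IsUnit A.det := hA.det_pos.ne'.isUnit
  rw [← h, Matrix.det_mul] at h1
  exact isUnit_of_mul_isUnit_left h1

theorem transpose_invSqrt : (invSqrt A).transpose = invSqrt A := by
  have h : (CFC.sqrt A).PosSemidef := (Matrix.nonneg_iff_posSemidef.1 (CFC.sqrt_nonneg A))
  have h1 : (CFC.sqrt A).transpose = CFC.sqrt A := by
    have := h.1
    rwa [Matrix.IsHermitian, Matrix.conjTranspose_eq_transpose_of_trivial] at this
  rw [invSqrt, Matrix.transpose_nonsing_inv, h1]

theorem invSqrt_mul_mul_invSqrt (hA : A.PosDef) : invSqrt A * A * invSqrt A = 1 := by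
  have h : CFC.sqrt A * CFC.sqrt A = A := CFC.sqrt_mul_sqrt_self A hA.posSemidef.nonneg
  have hu := isUnit_det_sqrt hA
  rw [invSqrt]
  nth_rewrite 2 [← h]
  rw [← mul_assoc, Matrix.nonsing_inv_mul _ hu, one_mul, Matrix.mul_nonsing_inv _ hu]

theorem invSqrt_one : invSqrt (1 : Matrix (Fin n) (Fin n) ℝ) = 1 := by
  have : CFC.sqrt (1 : Matrix (Fin n) (Fin n) ℝ) = 1 :=
    CFC.sqrt_unique (mul_one 1) Matrix.PosSemidef.one.nonneg
  rw [invSqrt, this, inv_one]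

/-- The conjugate of the positive root is positive and has the right square, so uniqueness of
positive roots applies. Orthonormalization by Gram–Schmidt would not have this equivariance. -/
theorem invSqrt_conj (hA : A.PosDef) {r : Matrix (Fin n) (Fin n) ℝ} (hr : r.transpose * r = 1) :
    invSqrt (r.transpose * A * r) = r.transpose * invSqrt A * r := by
  have h : CFC.sqrt A * CFC.sqrt A = A := CFC.sqrt_mul_sqrt_self A hA.posSemidef.nonneg
  have hu := isUnit_det_sqrt hA
  have hr' : r * r.transpose = 1 := mul_eq_one_comm.1 hr
  have h1 : CFC.sqrt (r.transpose * A * r) = r.transpose * CFC.sqrt A * r := by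
    refine CFC.sqrt_unique ?_ ?_
    · calc _ = r.transpose * CFC.sqrt A * (r * r.transpose) * CFC.sqrt A * r := by
            simp only [mul_assoc]
        _ = r.transpose * (CFC.sqrt A * CFC.sqrt A) * r := by
            rw [hr', mul_one]; simp only [mul_assoc]
        _ = _ := by rw [h]
    · have := (Matrix.nonneg_iff_posSemidef.1 (CFC.sqrt_nonneg A)).conjTranspose_mul_mul_same r
      rw [Matrix.conjTranspose_eq_transpose_of_trivial] at this
      exact this.nonneg
  rw [invSqrt, h1]
  refine Matrix.inv_eq_left_inv ?_
  calc _ = r.transpose * invSqrt A * (r * r.transpose) * CFC.sqrt A * r := by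
        simp only [mul_assoc]
    _ = r.transpose * (invSqrt A * CFC.sqrt A) * r := by
        rw [hr', mul_one]; simp only [mul_assoc]
    _ = _ := by rw [invSqrt, Matrix.nonsing_inv_mul _ hu, mul_one, hr]

open scoped Matrix.Norms.L2Operator in
theorem continuousOn_sqrt_aux {B : Type*} [TopologicalSpace B] {S : Set B}
    {A : B → Matrix (Fin n) (Fin n) ℝ} (hA : ContinuousOn A S) (hp : ∀ b ∈ S, (A b).PosDef) :
    ContinuousOn (fun b => CFC.sqrt (A b)) S := by
  -- Continuity of the functional calculus asks for a compact set containing the spectra of all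
  -- nearby matrices; a ball of radius slightly above the norm at b serves.
  have h := ContinuousOn.cfc (A := Matrix (Fin n) (Fin n) ℝ) (p := IsSelfAdjoint)
    (s := fun b => Metric.closedBall 0 ((‖A b‖ + 1) * ‖(1 : Matrix (Fin n) (Fin n) ℝ)‖)) Real.sqrt
    (fun x _ => isCompact_closedBall 0 _) hA ?_ (fun b hb => (hp b hb).1)
    (fun x _ => Real.continuous_sqrt.continuousOn)
  · refine h.congr fun b hb => ?_
    simp only
    rw [CFC.sqrt_eq_real_sqrt _ (hp b hb).posSemidef.nonneg, cfcₙ_eq_cfc (hf0 := Real.sqrt_zero)]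
  · intro b hb
    have h1 : ∀ᶠ x in 𝓝[S] b, ‖A x‖ < ‖A b‖ + 1 :=
      ((hA b hb).norm).eventually_lt_const (by linarith)
    filter_upwards [h1] with x hx r hr
    rw [mem_closedBall_zero_iff]
    refine (spectrum.norm_le_norm_mul_of_mem hr).trans ?_
    gcongr

theorem continuousOn_invSqrt {B : Type*} [TopologicalSpace B] {S : Set B}
    {A : B → Matrix (Fin n) (Fin n) ℝ} (hA : ContinuousOn A S) (hp : ∀ b ∈ S, (A b).PosDef) :
    ContinuousOn (fun b => invSqrt (A b)) S := by
  have h : ContinuousOn (fun b => CFC.sqrt (A b)) S := continuousOn_sqrt_aux hA hp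
  have hdet : ContinuousOn (fun b => (CFC.sqrt (A b)).det) S :=
    (Continuous.matrix_det continuous_id).comp_continuousOn h
  have hadj : ContinuousOn (fun b => (CFC.sqrt (A b)).adjugate) S :=
    (Continuous.matrix_adjugate continuous_id).comp_continuousOn h
  simp only [invSqrt, Matrix.inv_def, Ring.inverse_eq_inv']
  exact (hdet.inv₀ fun b hb => (isUnit_det_sqrt (hp b hb)).ne_zero).smul hadj

end InvSqrt

/-! ## Pin structures on families of Euclidean spaces -/

section Signs

variable {n : ℕ}

theorem neg_one_pow_val_add (a b : ZMod 2) :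
    (-1 : Cl n) ^ (a + b).val = (-1) ^ a.val * (-1) ^ b.val := by
  rw [← pow_add, ZMod.val_add, ← neg_one_pow_eq_pow_mod_two]

theorem neg_one_pow_mul_comm (k : ℕ) (x : Cl n) : (-1 : Cl n) ^ k * x = x * (-1) ^ k :=
  ((Commute.neg_one_left x).pow_left k).eq

theorem neg_one_pow_val_self (a : ZMod 2) : (-1 : Cl n) ^ a.val * (-1) ^ a.val = 1 := by
  rw [← neg_one_pow_val_add, CharTwo.add_self_eq_zero]
  simp

theorem zmod_two_cases (a : ZMod 2) : a = 0 ∨ a = 1 := by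
  revert a
  decide

theorem IsPinLift.neg_one_pow_mul {x : Cl n} {r : Matrix (Fin n) (Fin n) ℝ} (h : IsPinLift x r)
    (k : ℕ) : IsPinLift ((-1) ^ k * x) r := by
  rcases neg_one_pow_eq_or (Cl n) k with e | e
  · rw [e, one_mul]
    exact h
  · rw [e, neg_one_mul]
    exact h.neg

theorem IsPinLift.sign_cancel {x : Cl n} {r : Matrix (Fin n) (Fin n) ℝ} (h : IsPinLift x r)
    {a b : ZMod 2} (hab : (-1) ^ a.val * x = (-1) ^ b.val * x) : a = b := by
  have h1 : (ZMod.val (1 : ZMod 2)) = 1 := rfl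
  rcases zmod_two_cases a with rfl | rfl <;> rcases zmod_two_cases b with rfl | rfl
  · rfl
  · rw [h1] at hab
    simp only [ZMod.val_zero, pow_zero, one_mul, pow_one, neg_mul] at hab
    exact absurd hab h.ne_neg
  · rw [h1] at hab
    simp only [ZMod.val_zero, pow_zero, one_mul, pow_one, neg_mul] at hab
    exact absurd hab.symm h.ne_neg
  · rfl

open Classical in
/-- The sign by which two elements of the Clifford algebra differ. -/
def signOf (x y : Cl n) : ZMod 2 := if x = y then 0 else 1

theorem IsPinLift.eq_signOf {x y : Cl n} {r : Matrix (Fin n) (Fin n) ℝ} (h : IsPinLift x r)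
    (h' : IsPinLift y r) : x = (-1) ^ (signOf x y).val * y := by
  unfold signOf
  split_ifs with e
  · simpa using e
  · have h1 : (ZMod.val (1 : ZMod 2)) = 1 := rfl
    rw [h1, pow_one, neg_one_mul]
    exact (h'.eq_or_eq_neg h).resolve_left e

theorem signOf_eq_of_iff {x y x' y' : Cl n} (h : x = y ↔ x' = y') : signOf x y = signOf x' y' := by
  by_cases e : x = y
  · rw [signOf, signOf, if_pos e, if_pos (h.1 e)]
  · rw [signOf, signOf, if_neg e, if_neg fun e' => e (h.2 e')]

theorem ClContinuousOn.signOf_locConst {B : Type*} [TopologicalSpace B] {c c' : B → Cl n} {S : Set B}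
    {r : B → Matrix (Fin n) (Fin n) ℝ} (hS : IsOpen S) (h : ClContinuousOn c S)
    (h' : ClContinuousOn c' S) (hc : ∀ b ∈ S, IsPinLift (c b) (r b))
    (hc' : ∀ b ∈ S, IsPinLift (c' b) (r b)) : LocConstOn (fun b => signOf (c b) (c' b)) S := by
  intro b hb
  filter_upwards [ClContinuousOn.eventually_eq hS h' h hc' hc hb] with b' hb'
  exact signOf_eq_of_iff hb'

theorem ClContinuousOn.sign_mul {B : Type*} [TopologicalSpace B] {c : B → Cl n} {S : Set B}
    {a : B → ZMod 2} (ha : LocConstOn a S) (h : ClContinuousOn c S) :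
    ClContinuousOn (fun b => (-1) ^ (a b).val * c b) S := by
  intro l b hb
  have h1 : ClContinuousOn (fun b' => (-1) ^ (a b).val * c b') S := (ClContinuousOn.const _).mul h
  refine (h1 l b hb).congr_of_eventuallyEq ?_ rfl
  filter_upwards [(ha b hb).filter_mono nhdsWithin_le_nhds] with b' hb'
  rw [hb']

end Signs

/-! ### The Čech differential in low degrees -/

section CechDifferential

variable {B A : Type*} [AddCommGroup A]

theorem cechD_two (c : (Fin 2 → B) → B → A) (s : Fin 3 → B) (b : B) :
    cechD c s b = c ![s 1, s 2] b - c ![s 0, s 2] b + c ![s 0, s 1] b := by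
  have h0 : s ∘ (0 : Fin 3).succAbove = ![s 1, s 2] := by funext i; fin_cases i <;> rfl
  have h1 : s ∘ (1 : Fin 3).succAbove = ![s 0, s 2] := by funext i; fin_cases i <;> rfl
  have h2 : s ∘ (2 : Fin 3).succAbove = ![s 0, s 1] := by funext i; fin_cases i <;> rfl
  refine (Fin.sum_univ_three _).trans ?_
  rw [h0, h1, h2]
  simp [sub_eq_add_neg]

theorem cechD_three (c : (Fin 3 → B) → B → A) (s : Fin 4 → B) (b : B) :
    cechD c s b = c ![s 1, s 2, s 3] b - c ![s 0, s 2, s 3] b + c ![s 0, s 1, s 3] b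
      - c ![s 0, s 1, s 2] b := by
  have h0 : s ∘ (0 : Fin 4).succAbove = ![s 1, s 2, s 3] := by funext i; fin_cases i <;> rfl
  have h1 : s ∘ (1 : Fin 4).succAbove = ![s 0, s 2, s 3] := by funext i; fin_cases i <;> rfl
  have h2 : s ∘ (2 : Fin 4).succAbove = ![s 0, s 1, s 3] := by funext i; fin_cases i <;> rfl
  have h3 : s ∘ (3 : Fin 4).succAbove = ![s 0, s 1, s 2] := by funext i; fin_cases i <;> rfl
  have h4 : (-1 : ℤ) ^ 3 = -1 := by norm_num
  refine (Fin.sum_univ_four _).trans ?_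
  rw [h0, h1, h2, h3]
  simp [sub_eq_add_neg, h4]

end CechDifferential

/-! ### Comparison of cochains of lifts and the well-definedness of w₂ -/

section Abstract

variable {E H M : Type*} [NormedAddCommGroup E] [NormedSpace ℝ E] [TopologicalSpace H]
  {I : ModelWithCorners ℝ E H} [TopologicalSpace M] [ChartedSpace H M]
  {E' H' M' : Type*} [NormedAddCommGroup E'] [NormedSpace ℝ E'] [TopologicalSpace H']
  {I' : ModelWithCorners ℝ E' H'} [TopologicalSpace M'] [ChartedSpace H' M']
  {B B' : Type*} [TopologicalSpace B] [TopologicalSpace B'] {n : ℕ}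
  [IsManifold I 1 M] [IsManifold I' 1 M']

theorem PointedCover.isOpen_inter {k : ℕ} (U : PointedCover B) (s : Fin k → B) :
    IsOpen (U.inter s) := isOpen_iInter_of_finite fun i => U.isOpen (s i)

/-- The forms of a family are symmetric, bilinear and continuous. -/
structure EuclFamily.IsRiemannian (F : EuclFamily I M B) : Prop where
  symm : ∀ b u v, F.form b u v = F.form b v u
  add : ∀ b u v v', F.form b u (v + v') = F.form b u v + F.form b u v'
  smul : ∀ b u (c : ℝ) v, F.form b u (c • v) = c * F.form b u v
  cont : ∀ (S : Set B) (u v : ∀ b, TangentSpace I (F.map b)),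
    ContinuousOn (fun b => (⟨F.map b, u b⟩ : TangentBundle I M)) S →
    ContinuousOn (fun b => (⟨F.map b, v b⟩ : TangentBundle I M)) S →
    ContinuousOn (fun b => F.form b (u b) (v b)) S

/-- `e` is an orthonormal basis of the fibre at `b`. -/
def EuclFamily.IsBasisAt (F : EuclFamily I M B) (b : B) (e : Fin n → TangentSpace I (F.map b)) :
    Prop :=
  Submodule.span ℝ (range e) = F.fib b ∧ ∀ i j, F.form b (e i) (e j) = if i = j then 1 else 0

/-- The matrix of the change from the orthonormal basis `e` to `e'`. -/
def EuclFamily.change (F : EuclFamily I M B) (b : B) (e e' : Fin n → TangentSpace I (F.map b)) :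
    Matrix (Fin n) (Fin n) ℝ := Matrix.of fun i j => F.form b (e i) (e' j)

namespace EuclFamily

variable {F : EuclFamily I M B} {b : B} {e e' e'' : Fin n → TangentSpace I (F.map b)}

theorem IsFrameOn.isBasisAt {S : Set B} {e : Fin n → ∀ b, TangentSpace I (F.map b)}
    (h : F.IsFrameOn S e) {b : B} (hb : b ∈ S) : F.IsBasisAt b (fun i => e i b) := h.2 b hb

namespace IsRiemannian

variable (hF : F.IsRiemannian)
include hF

theorem sum_right {ι : Type*} (s : Finset ι) (u : TangentSpace I (F.map b)) (c : ι → ℝ)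
    (v : ι → TangentSpace I (F.map b)) :
    F.form b u (∑ i ∈ s, c i • v i) = ∑ i ∈ s, c i * F.form b u (v i) := by
  classical
  induction s using Finset.induction_on with
  | empty =>
    have := hF.smul b u 0 0
    simpa using this
  | insert i s hi ih => rw [Finset.sum_insert hi, Finset.sum_insert hi, hF.add, hF.smul, ih]

theorem expand (he : F.IsBasisAt b e) {v : TangentSpace I (F.map b)} (hv : v ∈ F.fib b) :
    v = ∑ i, F.form b (e i) v • e i := by
  rw [← he.1] at hv
  obtain ⟨c, rfl⟩ := (Submodule.mem_span_range_iff_exists_fun ℝ).1 hv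
  refine Finset.sum_congr rfl fun i _ => ?_
  rw [hF.sum_right]
  simp [he.2]

theorem form_expand (he : F.IsBasisAt b e) (u : TangentSpace I (F.map b))
    {v : TangentSpace I (F.map b)} (hv : v ∈ F.fib b) :
    F.form b u v = ∑ i, F.form b u (e i) * F.form b (e i) v := by
  conv_lhs => rw [hF.expand he hv]
  rw [hF.sum_right]
  exact Finset.sum_congr rfl fun i _ => mul_comm _ _

theorem change_mul (he' : F.IsBasisAt b e') (he'' : ∀ i, e'' i ∈ F.fib b) :
    F.change b e e' * F.change b e' e'' = F.change b e e'' := by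
  ext i j
  simp only [change, Matrix.mul_apply, Matrix.of_apply]
  exact (hF.form_expand he' _ (he'' j)).symm

omit hF in
theorem _root_.CotBrane.EuclFamily.IsBasisAt.mem (he : F.IsBasisAt b e) (i : Fin n) :
    e i ∈ F.fib b := by
  rw [← he.1]
  exact Submodule.subset_span ⟨i, rfl⟩

omit hF in
theorem _root_.CotBrane.EuclFamily.IsBasisAt.change_self (he : F.IsBasisAt b e) :
    F.change b e e = 1 := by
  ext i j
  simp only [change, Matrix.of_apply, he.2, Matrix.one_apply]

theorem change_transpose : (F.change b e e').transpose = F.change b e' e := by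
  ext i j
  exact hF.symm _ _ _

theorem change_orthogonal (he : F.IsBasisAt b e) (he' : F.IsBasisAt b e') :
    (F.change b e e').transpose * F.change b e e' = 1 := by
  rw [hF.change_transpose, hF.change_mul he he'.mem, he'.change_self]

theorem continuousOn_change {S T : Set B} {e e' : Fin n → ∀ b, TangentSpace I (F.map b)}
    (he : F.IsFrameOn S e) (he' : F.IsFrameOn T e') :
    ContinuousOn (fun b => F.change b (fun i => e i b) (fun i => e' i b)) (S ∩ T) :=
  continuousOn_pi.2 fun i => continuousOn_pi.2 fun j => hF.cont _ _ _
    ((he.1 i).mono inter_subset_left) ((he'.1 j).mono inter_subset_right)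

end IsRiemannian

end EuclFamily

namespace PinCochain

variable {F : EuclFamily I M B}

theorem isLift_change (P : PinCochain n F) {x y b : B} (hx : b ∈ P.cover.set x)
    (hy : b ∈ P.cover.set y) : IsPinLift (P.lift x y b)
      (F.change b (fun i => P.frame x i b) fun i => P.frame y i b) := P.isLift x y b ⟨hx, hy⟩

theorem isBasisAt (P : PinCochain n F) {x b : B} (hx : b ∈ P.cover.set x) :
    F.IsBasisAt b (fun i => P.frame x i b) := (P.isFrame x).isBasisAt hx

variable (hF : F.IsRiemannian)
include hF

theorem isLift_mul (P : PinCochain n F) {x y z b : B} (hx : b ∈ P.cover.set x)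
    (hy : b ∈ P.cover.set y) (hz : b ∈ P.cover.set z) : IsPinLift (P.lift x y b * P.lift y z b)
      (F.change b (fun i => P.frame x i b) fun i => P.frame z i b) := by
  rw [← hF.change_mul (P.isBasisAt hy) (P.isBasisAt hz).mem]
  exact (P.isLift_change hx hy).mul (P.isLift_change hy hz)

/-- The coboundary of a cochain of lifts is a cocycle. -/
theorem exists_isRelativeTo (P : PinCochain n F) :
    ∃ w : CechCocycle B (ZMod 2) 2, P.IsRelativeTo w := by
  let ε : B → B → B → B → ZMod 2 := fun x y z b =>
    signOf (P.lift x y b * P.lift y z b) (P.lift x z b)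
  have hε : ∀ x y z b, b ∈ P.cover.set x → b ∈ P.cover.set y → b ∈ P.cover.set z →
      P.lift x y b * P.lift y z b = (-1) ^ (ε x y z b).val * P.lift x z b :=
    fun x y z b hx hy hz => (P.isLift_mul hF hx hy hz).eq_signOf (P.isLift_change hx hz)
  refine ⟨⟨P.cover, fun s b => ε (s 0) (s 1) (s 2) b, fun s => ?_, fun s b hb => ?_⟩,
    fun _ => Subset.rfl, fun x y z b hb => hε x y z b hb.1.1 hb.1.2 hb.2⟩
  · have hm : ∀ b ∈ P.cover.inter s, ∀ i, b ∈ P.cover.set (s i) := fun b hb => mem_iInter.1 hb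
    refine ClContinuousOn.signOf_locConst (P.cover.isOpen_inter s)
      (((P.continuous _ _).mono fun b hb => ?_).mul ((P.continuous _ _).mono fun b hb => ?_))
      ((P.continuous _ _).mono fun b hb => ?_)
      (fun b hb => P.isLift_mul hF (hm b hb _) (hm b hb _) (hm b hb _))
      (fun b hb => P.isLift_change (hm b hb _) (hm b hb _))
    all_goals exact ⟨hm b hb _, hm b hb _⟩
  · have hm : ∀ i, b ∈ P.cover.set (s i) := mem_iInter.1 hb
    have h1 := hε _ _ _ b (hm 0) (hm 1) (hm 2)
    have h2 := hε _ _ _ b (hm 0) (hm 2) (hm 3)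
    have h3 := hε _ _ _ b (hm 1) (hm 2) (hm 3)
    have h4 := hε _ _ _ b (hm 0) (hm 1) (hm 3)
    -- Associativity: the two bracketings of the product of the lifts 01, 12 and 23 are both signs
    -- times the lift 03.
    have key : ε (s 0) (s 1) (s 2) b + ε (s 0) (s 2) (s 3) b
        = ε (s 1) (s 2) (s 3) b + ε (s 0) (s 1) (s 3) b := by
      refine (P.isLift_change (hm 0) (hm 3)).sign_cancel ?_
      rw [neg_one_pow_val_add, neg_one_pow_val_add, mul_assoc, ← h2, mul_assoc, ← h4, ← mul_assoc,
        ← h1, mul_assoc, h3, ← mul_assoc, ← mul_assoc, neg_one_pow_mul_comm]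
    rw [cechD_three]
    simp only [Matrix.cons_val]
    linear_combination -key

/-- Two cochains of lifts for the same family can be compared locally. -/
theorem exists_comparison (P P' : PinCochain n F) : ∃ V : PointedCover B, V ≤ P.cover ∧
    V ≤ P'.cover ∧ ∃ h : B → B → Cl n, (∀ x, ClContinuousOn (h x) (V.set x)) ∧
      ∀ x, ∀ b ∈ V.set x, IsPinLift (h x b)
        (F.change b (fun i => P.frame x i b) fun i => P'.frame x i b) := by
  have key : ∀ x, ∃ U, IsOpen U ∧ x ∈ U ∧ ∃ c : B → Cl n,
      ClContinuousOn c (U ∩ (P.cover.set x ∩ P'.cover.set x)) ∧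
      ∀ b ∈ U ∩ (P.cover.set x ∩ P'.cover.set x), IsPinLift (c b)
        (F.change b (fun i => P.frame x i b) fun i => P'.frame x i b) := fun x =>
    exists_local_pinLift (hF.continuousOn_change (P.isFrame x) (P'.isFrame x))
      (fun b hb => hF.change_orthogonal (P.isBasisAt hb.1) (P'.isBasisAt hb.2))
      ⟨P.cover.mem x, P'.cover.mem x⟩
  choose U hU hxU c hc hl using key
  exact ⟨⟨fun x => U x ∩ (P.cover.set x ∩ P'.cover.set x),
    fun x => (hU x).inter ((P.cover.isOpen x).inter (P'.cover.isOpen x)),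
    fun x => ⟨hxU x, P.cover.mem x, P'.cover.mem x⟩⟩, fun _ _ h => h.2.1, fun _ _ h => h.2.2,
    c, hc, hl⟩

/-- The difference of two cochains of lifts, as a `ℤ/2`-valued cochain. -/
theorem exists_difference {P P' : PinCochain n F} {w w' : CechCocycle B (ZMod 2) 2}
    (hP : P.IsRelativeTo w) (hP' : P'.IsRelativeTo w') : ∃ V : PointedCover B, V ≤ P.cover ∧
    V ≤ P'.cover ∧ ∃ h : B → B → Cl n, (∀ x, ClContinuousOn (h x) (V.set x)) ∧
      (∀ x, ∀ b ∈ V.set x, IsPinLift (h x b)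
        (F.change b (fun i => P.frame x i b) fun i => P'.frame x i b)) ∧
      ∃ ε : B → B → B → ZMod 2, (∀ x y, LocConstOn (ε x y) (V.set x ∩ V.set y)) ∧
        (∀ x y, ∀ b ∈ V.set x ∩ V.set y,
          P.lift x y b * h y b = (-1) ^ (ε x y b).val * (h x b * P'.lift x y b)) ∧
        ∀ x y z, ∀ b ∈ V.set x ∩ V.set y ∩ V.set z,
          w.val ![x, y, z] b + ε x z b = ε x y b + ε y z b + w'.val ![x, y, z] b := by
  obtain ⟨V, hV, hV', h, hc, hl⟩ := exists_comparison hF P P'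
  have l1 : ∀ x y b, b ∈ V.set x → b ∈ V.set y → IsPinLift (P.lift x y b * h y b)
      (F.change b (fun i => P.frame x i b) fun i => P'.frame y i b) := by
    intro x y b hx hy
    rw [← hF.change_mul (P.isBasisAt (hV y hy)) (P'.isBasisAt (hV' y hy)).mem]
    exact (P.isLift_change (hV x hx) (hV y hy)).mul (hl y b hy)
  have l2 : ∀ x y b, b ∈ V.set x → b ∈ V.set y → IsPinLift (h x b * P'.lift x y b)
      (F.change b (fun i => P.frame x i b) fun i => P'.frame y i b) := by
    intro x y b hx hy
    rw [← hF.change_mul (P'.isBasisAt (hV' x hx)) (P'.isBasisAt (hV' y hy)).mem]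
    exact (hl x b hx).mul (P'.isLift_change (hV' x hx) (hV' y hy))
  have hε : ∀ x y b, b ∈ V.set x → b ∈ V.set y → P.lift x y b * h y b
      = (-1) ^ (signOf (P.lift x y b * h y b) (h x b * P'.lift x y b)).val
        * (h x b * P'.lift x y b) := fun x y b hx hy => (l1 x y b hx hy).eq_signOf (l2 x y b hx hy)
  refine ⟨V, hV, hV', h, hc, hl, fun x y b => signOf (P.lift x y b * h y b) (h x b * P'.lift x y b),
    fun x y => ?_, fun x y b hb => hε x y b hb.1 hb.2, fun x y z b hb => ?_⟩
  · exact ClContinuousOn.signOf_locConst ((V.isOpen x).inter (V.isOpen y))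
      (((P.continuous x y).mono (inter_subset_inter (hV x) (hV y))).mul
        ((hc y).mono inter_subset_right))
      (((hc x).mono inter_subset_left).mul
        ((P'.continuous x y).mono (inter_subset_inter (hV' x) (hV' y))))
      (fun b hb => l1 x y b hb.1 hb.2) (fun b hb => l2 x y b hb.1 hb.2)
  · obtain ⟨⟨hx, hy⟩, hz⟩ := hb
    have r1 := hP.2 x y z b ⟨⟨hV x hx, hV y hy⟩, hV z hz⟩
    have r2 := hP'.2 x y z b ⟨⟨hV' x hx, hV' y hy⟩, hV' z hz⟩
    have e1 := hε x y b hx hy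
    have e2 := hε y z b hy hz
    have e3 := hε x z b hx hz
    -- Both signs come from the product of `P.lift x y`, `P.lift y z` and `h z`. Contracting the two
    -- lifts first produces w and the sign of xz; moving h to the left through them produces the
    -- signs of yz and xy, and then w'.
    refine (l2 x z b hx hz).sign_cancel ?_
    rw [neg_one_pow_val_add, neg_one_pow_val_add, neg_one_pow_val_add, mul_assoc, ← e3, ← mul_assoc,
      ← r1, mul_assoc, e2, ← mul_assoc, ← neg_one_pow_mul_comm, mul_assoc, ← mul_assoc (P.lift x y b),
      e1, mul_assoc, mul_assoc, r2]
    simp only [← mul_assoc]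
    rw [mul_assoc _ (h x b), ← neg_one_pow_mul_comm _ (h x b)]
    simp only [← mul_assoc]
    rw [neg_one_pow_mul_comm _ ((-1 : Cl n) ^ _)]

end PinCochain

theorem matrix_vec_three {α : Type*} (s : Fin 3 → α) : ![s 0, s 1, s 2] = s := by
  funext i
  fin_cases i <;> rfl

/-- The second Stiefel-Whitney class is well defined. -/
theorem IsSW2.unique {F : EuclFamily I M B} (hF : F.IsRiemannian) {c c' : CechH2 B (ZMod 2)}
    (hc : IsSW2 n F c) (hc' : IsSW2 n F c') : c = c' := by
  obtain ⟨P, w, hP, rfl⟩ := hc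
  obtain ⟨P', w', hP', rfl⟩ := hc'
  obtain ⟨V, hV, hV', h, -, -, ε, hε, -, hd⟩ := PinCochain.exists_difference hF hP hP'
  refine Quotient.sound ⟨V, PointedCover.le_trans hV hP.1, PointedCover.le_trans hV' hP'.1,
    fun s b => ε (s 0) (s 1) b, fun s b hb => ?_, fun s b hb => ?_⟩
  · have hm := mem_iInter.1 hb
    exact hε _ _ b ⟨hm 0, hm 1⟩
  · have hm := mem_iInter.1 hb
    have := hd (s 0) (s 1) (s 2) b ⟨⟨hm 0, hm 1⟩, hm 2⟩
    rw [matrix_vec_three] at this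
    rw [cechD_two]
    simp only [Matrix.cons_val]
    linear_combination this

end Abstract

/-! ### Trivializing ℤ/2-cocycles along a contraction -/

section Homotopy

variable {B Y : Type*} [TopologicalSpace B] [TopologicalSpace Y]

/-- The double cover defined by a `ℤ/2`-valued `1`-cocycle. -/
def doubleCover (V : PointedCover B) (ε : B → B → B → ZMod 2)
    (hε : ∀ x y, LocConstOn (ε x y) (V.set x ∩ V.set y))
    (hc : ∀ x y z, ∀ b ∈ V.set x ∩ V.set y ∩ V.set z, ε x z b = ε x y b + ε y z b) :
    FiberBundleCore B B (ZMod 2) where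
  baseSet := V.set
  isOpen_baseSet := V.isOpen
  indexAt b := b
  mem_baseSet_at := V.mem
  coordChange x y b v := v + ε x y b
  coordChange_self x b hb v := by
    have h := hc x x x b ⟨⟨hb, hb⟩, hb⟩
    rw [left_eq_add.1 h, add_zero]
  continuousOn_coordChange x y := by
    have : ContinuousOn (ε x y) (V.set x ∩ V.set y) := fun b hb =>
      (continuousAt_const.congr (f := fun _ => ε x y b)
        ((hε x y b hb).mono fun _ h => h.symm)).continuousWithinAt
    have h2 : Continuous fun p : ZMod 2 × ZMod 2 => p.1 + p.2 := continuous_of_discreteTopology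
    exact h2.comp_continuousOn (continuous_snd.continuousOn.prodMk
      (this.comp continuous_fst.continuousOn fun p hp => hp.1))
  coordChange_comp x y z b hb v := by rw [hc x y z b hb, add_assoc]

/-- Over a space which contracts onto `Y`, a trivialization over `Y` of a `ℤ/2`-valued `1`-cocycle
extends to the whole space. -/
theorem exists_trivialization_of_contraction {V : PointedCover B} {ε : B → B → B → ZMod 2}
    (hε : ∀ x y, LocConstOn (ε x y) (V.set x ∩ V.set y))
    (hc : ∀ x y z, ∀ b ∈ V.set x ∩ V.set y ∩ V.set z, ε x z b = ε x y b + ε y z b)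
    (j : C(Y, B)) (ρ : C(B, Y)) (K : C(unitInterval × B, B)) (hK0 : ∀ b, K (0, b) = j (ρ b))
    (hK1 : ∀ b, K (1, b) = b) {V' : PointedCover Y} (hV' : ∀ y, V'.set y ⊆ j ⁻¹' V.set (j y))
    {σ : Y → Y → ZMod 2} (hσ : ∀ y, LocConstOn (σ y) (V'.set y))
    (hσε : ∀ y z, ∀ b ∈ V'.set y ∩ V'.set z, σ y b = σ z b + ε (j y) (j z) (j b)) :
    ∃ τ : B → B → ZMod 2, (∀ x, LocConstOn (τ x) (V.set x)) ∧
      ∀ x y, ∀ b ∈ V.set x ∩ V.set y, τ y b = τ x b + ε x y b := by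
  let Z := doubleCover V ε hε hc
  have cov : IsCoveringMap (π (ZMod 2) Z.Fiber) := FiberBundle.isCoveringMap
  -- The data over Y are a section along j of the double cover: at y take the value σ y y in the
  -- chart centred at j y.
  let s : Y → TotalSpace (ZMod 2) Z.Fiber := fun y => ⟨j y, σ y y⟩
  have hs : Continuous s := by
    refine continuous_iff_continuousAt.2 fun y₀ => ?_
    rw [FiberBundle.continuousAt_totalSpace]
    refine ⟨j.continuous.continuousAt, ?_⟩
    change ContinuousAt (fun y => σ y y + ε (j y) (j y₀) (j y)) y₀
    -- Read in the fixed chart centred at j y₀, the section is locally the constant σ y₀ y₀: the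
    -- relation between σ and ε cancels the change of chart.
    have h1 : ∀ᶠ y in 𝓝 y₀, σ y y + ε (j y) (j y₀) (j y) = σ y₀ y₀ := by
      filter_upwards [(V'.isOpen y₀).mem_nhds (V'.mem y₀), hσ y₀ y₀ (V'.mem y₀)] with y hy hy'
      rw [hσε y y₀ y ⟨V'.mem y, hy⟩, add_assoc, CharTwo.add_self_eq_zero, add_zero, hy']
    exact (continuousAt_const (y := σ y₀ y₀)).congr (h1.mono fun _ h => h.symm)
  -- Homotopy lifting along K, with the section over Y as initial value at ρ b. At time 1 the lift
  -- lies over b itself, so its end is a global section.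
  let f : C(B, TotalSpace (ZMod 2) Z.Fiber) := ⟨fun b => s (ρ b), hs.comp ρ.continuous⟩
  have h0 : ∀ b, K (0, b) = π (ZMod 2) Z.Fiber (f b) := fun b => hK0 b
  let T : B → TotalSpace (ZMod 2) Z.Fiber := fun b => cov.liftHomotopy K f h0 (1, b)
  have hT : Continuous T := (cov.liftHomotopy K f h0).continuous.comp (by fun_prop)
  have hTp : ∀ b, (T b).proj = b := fun b =>
    (congrFun (cov.liftHomotopy_lifts K f h0) (1, b)).trans (hK1 b)
  let v : B → ZMod 2 := fun b => (T b).2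
  -- The fibre coordinate v b refers to the chart indexed by b; in the chart of x the section reads
  -- v b + ε b x b, which is the cochain τ sought.
  have hTv : ∀ x b, (Z.localTriv x (T b)).2 = v b + ε b x b := by
    intro x b
    rw [FiberBundleCore.localTriv_apply]
    change v b + ε (T b).proj x (T b).proj = _
    rw [hTp]
  refine ⟨fun x b => v b + ε b x b, fun x b hb => ?_, fun x y b hb => ?_⟩
  · have h1 : ContinuousAt (fun b' => (Z.localTriv x (T b')).2) b := by
      refine continuousAt_snd.comp (ContinuousAt.comp ?_ hT.continuousAt)
      refine (Z.localTriv x).toOpenPartialHomeomorph.continuousAt ?_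
      change (T b).proj ∈ V.set x
      rw [hTp]
      exact hb
    simp only [hTv] at h1
    exact h1.eventually (isOpen_discrete {v b + ε b x b} |>.mem_nhds rfl)
  · simp only
    rw [hc b x y b ⟨⟨V.mem b, hb.1⟩, hb.2⟩, add_assoc]

end Homotopy

/-! ### Isomorphisms of pin structures -/

section PinIso

variable {E H M : Type*} [NormedAddCommGroup E] [NormedSpace ℝ E] [TopologicalSpace H]
  {I : ModelWithCorners ℝ E H} [TopologicalSpace M] [ChartedSpace H M]
  {E' H' M' : Type*} [NormedAddCommGroup E'] [NormedSpace ℝ E'] [TopologicalSpace H']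
  {I' : ModelWithCorners ℝ E' H'} [TopologicalSpace M'] [ChartedSpace H' M']
  {B Y : Type*} [TopologicalSpace B] [TopologicalSpace Y] {n : ℕ}
  [IsManifold I 1 M] [IsManifold I' 1 M']

/-- Two cochains of lifts which are isomorphic to a third one are isomorphic. -/
theorem PinIso.of_common_source {F₀ : EuclFamily I M B} {F : EuclFamily I' M' B}
    (hF : F.IsRiemannian) {Ψ : ∀ b, TangentSpace I (F₀.map b) → TangentSpace I' (F.map b)}
    {P : PinCochain n F₀} {Q Q' : PinCochain n F} (h : PinIso Ψ P Q) (h' : PinIso Ψ P Q') :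
    PinIso (fun _ v => v) Q Q' := by
  obtain ⟨V, hVP, hVQ, h, hc, hl, hi⟩ := h
  obtain ⟨V', hVP', hVQ', h', hc', hl', hi'⟩ := h'
  refine ⟨V.inf V', PointedCover.le_trans (PointedCover.inf_le_left _ _) hVQ,
    PointedCover.le_trans (PointedCover.inf_le_right _ _) hVQ',
    fun x b => CliffordAlgebra.reverse (h x b) * h' x b,
    fun x => ((hc x).mono inter_subset_left).reverse.mul ((hc' x).mono inter_subset_right),
    fun x b hb => ?_, fun x y b hb => ?_⟩
  · have h1 := hl x b hb.1
    have h2 := h1.reverse.mul (hl' x b hb.2)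
    have h3 : (Matrix.of fun i j => F.form b (Ψ b (P.frame x i b)) (Q'.frame x j b))
        = (Matrix.of fun i j => F.form b (Ψ b (P.frame x i b)) (Q.frame x j b))
          * F.change b (fun i => Q.frame x i b) (fun i => Q'.frame x i b) := by
      ext i j
      simp only [EuclFamily.change, Matrix.mul_apply, Matrix.of_apply]
      exact hF.form_expand (Q.isBasisAt (hVQ x hb.1)) _ ((Q'.isBasisAt (hVQ' x hb.2)).mem j)
    rw [h3, ← mul_assoc, h1.transpose_mul_self, one_mul] at h2
    exact h2
  · have e1 := hi x y b ⟨hb.1.1, hb.2.1⟩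
    have e2 := hi' x y b ⟨hb.1.2, hb.2.2⟩
    have u1 := hl x b hb.1.1
    have u2 := hl y b hb.2.1
    calc Q.lift x y b * (CliffordAlgebra.reverse (h y b) * h' y b)
        = CliffordAlgebra.reverse (h x b) * (h x b * Q.lift x y b)
          * CliffordAlgebra.reverse (h y b) * h' y b := by
          rw [← mul_assoc (CliffordAlgebra.reverse (h x b)), u1.reverse_mul, one_mul, mul_assoc]
      _ = CliffordAlgebra.reverse (h x b) * P.lift x y b * (h y b
          * CliffordAlgebra.reverse (h y b)) * h' y b := by rw [← e1]; simp only [mul_assoc]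
      _ = _ := by rw [u2.mul_reverse, mul_one, mul_assoc, e2, mul_assoc]

/-- Matrices of frame change multiply: expand the frame of P in that of Q and apply Ψ, which has to
be linear for this. -/
theorem PinIso.trans {F : EuclFamily I M B} {F' : EuclFamily I' M' B} (hF : F.IsRiemannian)
    (hF' : F'.IsRiemannian) {Ψ : ∀ b, TangentSpace I (F.map b) →ₗ[ℝ] TangentSpace I' (F'.map b)}
    {P Q : PinCochain n F} {Q' : PinCochain n F'} (h : PinIso (fun _ v => v) P Q)
    (h' : PinIso (fun b v => Ψ b v) Q Q') : PinIso (fun b v => Ψ b v) P Q' := by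
  obtain ⟨V, hVP, hVQ, h, hc, hl, hi⟩ := h
  obtain ⟨V', hVP', hVQ', h', hc', hl', hi'⟩ := h'
  refine ⟨V.inf V', PointedCover.le_trans (PointedCover.inf_le_left _ _) hVP,
    PointedCover.le_trans (PointedCover.inf_le_right _ _) hVQ',
    fun x b => h x b * h' x b,
    fun x => ((hc x).mono inter_subset_left).mul ((hc' x).mono inter_subset_right),
    fun x b hb => ?_, fun x y b hb => ?_⟩
  · have h2 := (hl x b hb.1).mul (hl' x b hb.2)
    have h3 : (Matrix.of fun i j => F'.form b (Ψ b (P.frame x i b)) (Q'.frame x j b))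
        = (Matrix.of fun i j => F.form b (P.frame x i b) (Q.frame x j b))
          * Matrix.of fun i j => F'.form b (Ψ b (Q.frame x i b)) (Q'.frame x j b) := by
      ext i j
      simp only [Matrix.mul_apply, Matrix.of_apply]
      have h4 := hF.expand (Q.isBasisAt (hVQ x hb.1)) ((P.isBasisAt (hVP x hb.1)).mem i)
      conv_lhs => rw [h4]
      rw [map_sum, hF'.symm]
      simp only [map_smul]
      rw [hF'.sum_right]
      refine Finset.sum_congr rfl fun k _ => ?_
      rw [hF.symm, hF'.symm]
    rw [h3]
    exact h2
  · have e1 := hi x y b ⟨hb.1.1, hb.2.1⟩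
    have e2 := hi' x y b ⟨hb.1.2, hb.2.2⟩
    rw [← mul_assoc, e1, mul_assoc, e2, mul_assoc]

theorem PinIso.pullback {F : EuclFamily I M B} {F' : EuclFamily I' M' B}
    {Ψ : ∀ b, TangentSpace I (F.map b) → TangentSpace I' (F'.map b)}
    {P : PinCochain n F} {Q : PinCochain n F'} (h : PinIso Ψ P Q) (j : C(Y, B)) :
    PinIso (fun y => Ψ (j y)) (P.pullback j) (Q.pullback j) := by
  obtain ⟨V, hVP, hVQ, h, hc, hl, hi⟩ := h
  exact ⟨V.pullback j, fun y => preimage_mono (hVP (j y)), fun y => preimage_mono (hVQ (j y)),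
    fun x b => h (j x) (j b), fun x => (hc (j x)).comp j.continuous.continuousOn fun _ hb => hb,
    fun x b hb => hl (j x) (j b) hb, fun x y b hb => hi (j x) (j y) (j b) hb⟩

/-- Over a space which contracts onto `Y`, relative pin structures which are isomorphic over `Y` are
isomorphic. -/
theorem PinIso.of_contraction {F : EuclFamily I M B} (hF : F.IsRiemannian) {Q Q' : PinCochain n F}
    {w : CechCocycle B (ZMod 2) 2} (hQ : Q.IsRelativeTo w) (hQ' : Q'.IsRelativeTo w)
    (j : C(Y, B)) (ρ : C(B, Y)) (K : C(unitInterval × B, B)) (hK0 : ∀ b, K (0, b) = j (ρ b))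
    (hK1 : ∀ b, K (1, b) = b)
    (h : PinIso (F := F.pullback j) (F' := F.pullback j) (fun _ v => v) (Q.pullback j)
      (Q'.pullback j)) : PinIso (fun _ v => v) Q Q' := by
  obtain ⟨V, hV, hV', h₁, hc, hl, ε, hε, hd, hw⟩ := PinCochain.exists_difference hF hQ hQ'
  obtain ⟨V', hVQ, hVQ', k, hkc, hkl, hki⟩ := h
  let W : PointedCover Y := V'.inf (V.pullback j)
  have hkl' : ∀ y, ∀ b ∈ W.set y, IsPinLift (k y b) (F.change (j b)
      (fun i => Q.frame (j y) i (j b)) fun i => Q'.frame (j y) i (j b)) := fun y b hb => hkl y b hb.1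
  -- Over Y there are two lifts of the same change of frame: the isomorphism k, and the arbitrary
  -- comparison h₁, which intertwines only up to the sign ε. Their quotient σ trivializes ε over Y.
  have hσ : ∀ y, ∀ b ∈ W.set y,
      k y b = (-1) ^ (signOf (k y b) (h₁ (j y) (j b))).val * h₁ (j y) (j b) :=
    fun y b hb => (hkl' y b hb).eq_signOf (hl (j y) (j b) hb.2)
  -- Both cochains have coboundary w, so w cancels and the discrepancy ε is a cocycle.
  have hcoc : ∀ x y z, ∀ b ∈ V.set x ∩ V.set y ∩ V.set z, ε x z b = ε x y b + ε y z b := by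
    intro x y z b hb
    have := hw x y z b hb
    linear_combination this
  obtain ⟨τ, hτ, hτε⟩ := exists_trivialization_of_contraction hε hcoc j ρ K hK0 hK1 (V' := W)
    (fun y b hb => hb.2) (σ := fun y b => signOf (k y b) (h₁ (j y) (j b)))
    (fun y => ClContinuousOn.signOf_locConst (W.isOpen y) ((hkc y).mono inter_subset_left)
      ((hc (j y)).comp j.continuous.continuousOn fun b hb => hb.2) (hkl' y)
      fun b hb => hl (j y) (j b) hb.2) (fun y z b hb => by
        have e1 := hki y z b ⟨hb.1.1, hb.2.1⟩
        have e2 := hd (j y) (j z) (j b) ⟨hb.1.2, hb.2.2⟩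
        have e3 := hσ y b hb.1
        have e4 := hσ z b hb.2
        have e5 : IsPinLift (h₁ (j y) (j b) * Q'.lift (j y) (j z) (j b)) _ :=
          (hl (j y) (j b) hb.1.2).mul (Q'.isLift_change (hV' _ hb.1.2) (hV' _ hb.2.2))
        refine e5.sign_cancel ?_
        rw [neg_one_pow_val_add, ← mul_assoc, ← e3]
        rw [mul_assoc, ← e2, ← mul_assoc, neg_one_pow_mul_comm, mul_assoc, ← e4]
        exact e1.symm)
  -- The signs τ, which extend σ over the whole space, correct the comparison h₁ so that it
  -- intertwines exactly.
  refine ⟨V, hV, hV', fun x b => (-1) ^ (τ x b).val * h₁ x b, fun x => (hc x).sign_mul (hτ x),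
    fun x b hb => (hl x b hb).neg_one_pow_mul _, fun x y b hb => ?_⟩
  calc Q.lift x y b * ((-1) ^ (τ y b).val * h₁ y b)
      = (-1) ^ (τ y b).val * (Q.lift x y b * h₁ y b) := by
        rw [← mul_assoc, ← neg_one_pow_mul_comm, mul_assoc]
    _ = (-1) ^ (τ x b).val * ((-1) ^ (ε x y b).val * (-1) ^ (ε x y b).val)
        * (h₁ x b * Q'.lift x y b) := by
        rw [hd x y b hb, hτε x y b hb, neg_one_pow_val_add]
        simp only [mul_assoc]
    _ = (-1) ^ (τ x b).val * h₁ x b * Q'.lift x y b := by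
        rw [neg_one_pow_val_self, mul_one, mul_assoc]

end PinIso

/-! ### Existence of cochains of lifts on compact spaces -/

section Existence

variable {E H M : Type*} [NormedAddCommGroup E] [NormedSpace ℝ E] [TopologicalSpace H]
  {I : ModelWithCorners ℝ E H} [TopologicalSpace M] [ChartedSpace H M]
  {B : Type*} [TopologicalSpace B] {n : ℕ} [IsManifold I 1 M]

theorem EuclFamily.IsFrameOn.mono {F : EuclFamily I M B} {S T : Set B}
    {e : Fin n → ∀ b, TangentSpace I (F.map b)} (h : F.IsFrameOn S e) (hT : T ⊆ S) :
    F.IsFrameOn T e := ⟨fun i => (h.1 i).mono hT, fun b hb => h.2 b (hT hb)⟩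

/-- On a compact Hausdorff space transition functions of a Riemannian family have lifts to
`Pin⁺(n)` with respect to a sufficiently fine cover. -/
theorem EuclFamily.IsRiemannian.exists_pinCochain [CompactSpace B] [T2Space B]
    {F : EuclFamily I M B} (hF : F.IsRiemannian)
    (hloc : ∀ x : B, ∃ U, IsOpen U ∧ x ∈ U ∧ ∃ e : Fin n → ∀ b, TangentSpace I (F.map b),
      F.IsFrameOn U e) : Nonempty (PinCochain n F) := by
  -- Local lifts are not enough: a cochain needs one lift on each whole overlap. So only finitely
  -- many frames are used, and around each point the cover is shrunk to fit lifts chosen for the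
  -- finitely many pairs of frames.
  choose U hU hxU e he using hloc
  have hW : ∀ x, ∃ W, IsOpen W ∧ x ∈ W ∧ closure W ⊆ U x := fun x => by
    obtain ⟨W, hW, hx, hWU⟩ := normal_exists_closure_subset isClosed_singleton (hU x)
      (singleton_subset_iff.2 (hxU x))
    exact ⟨W, hW, singleton_subset_iff.1 hx, hWU⟩
  choose W hWo hxW hWU using hW
  obtain ⟨t, ht⟩ := isCompact_univ.elim_finite_subcover W hWo
    (fun x _ => mem_iUnion.2 ⟨x, hxW x⟩)
  have hr : ∀ x, ∃ i ∈ t, x ∈ W i := fun x => by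
    simpa using ht (mem_univ x)
  choose r hrt hrW using hr
  -- Near x a lift of the transition between the frames i and j is fixed. Where x is outside the
  -- common domain the data are dummies.
  have hlift : ∀ i j x, ∃ O, IsOpen O ∧ x ∈ O ∧ ∃ c : B → Cl n, x ∈ U i ∩ U j →
      O ⊆ U i ∩ U j ∧ ClContinuousOn c O ∧ ∀ b ∈ O, IsPinLift (c b)
        (F.change b (fun k => e i k b) fun k => e j k b) := by
    intro i j x
    by_cases hx : x ∈ U i ∩ U j
    · obtain ⟨O, hO, hxO, c, hc, hl⟩ := exists_local_pinLift (hF.continuousOn_change (he i) (he j))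
        (fun b hb => hF.change_orthogonal ((he i).isBasisAt hb.1) ((he j).isBasisAt hb.2)) hx
      exact ⟨O ∩ (U i ∩ U j), hO.inter ((hU i).inter (hU j)), ⟨hxO, hx⟩, c,
        fun _ => ⟨inter_subset_right, hc, hl⟩⟩
    · exact ⟨univ, isOpen_univ, mem_univ _, fun _ => 1, fun h => absurd h hx⟩
  choose O hO hxO c hc using hlift
  -- Because the closure of W i lies in U i, a small enough neighbourhood of x can meet W i only if
  -- x is in U i. Hence, whenever V_x and V_y meet, the point y lies in the domains of both frames,
  -- and the lift fixed near y is defined on all of the overlap.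
  have hA : ∀ i x, ∃ A, IsOpen A ∧ x ∈ A ∧ ((A ∩ W i).Nonempty → x ∈ U i) := by
    intro i x
    by_cases hx : x ∈ closure (W i)
    · exact ⟨univ, isOpen_univ, mem_univ _, fun _ => hWU i hx⟩
    · refine ⟨(closure (W i))ᶜ, isClosed_closure.isOpen_compl, hx, ?_⟩
      rintro ⟨y, hy, hy'⟩
      exact absurd (subset_closure hy') hy
  choose A hAo hxA hA using hA
  let V : PointedCover B := ⟨fun x => W (r x) ∩ ((⋂ i ∈ t, A i x) ∩ ⋂ i ∈ t, ⋂ j ∈ t, O i j x),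
    fun x => (hWo _).inter ((isOpen_biInter_finset fun i _ => hAo i x).inter
      (isOpen_biInter_finset fun i _ => isOpen_biInter_finset fun j _ => hO i j x)),
    fun x => ⟨hrW x, mem_iInter₂.2 fun i _ => hxA i x,
      mem_iInter₂.2 fun i _ => mem_iInter₂.2 fun j _ => hxO i j x⟩⟩
  have hVU : ∀ x, V.set x ⊆ U (r x) := fun x b hb => hWU _ (subset_closure hb.1)
  have hVO : ∀ x y, (V.set x ∩ V.set y).Nonempty → y ∈ U (r x) ∩ U (r y) := by
    rintro x y ⟨b, hb, hb'⟩
    exact ⟨hA (r x) y ⟨b, mem_iInter₂.1 hb'.2.1 (r x) (hrt x), hb.1⟩, hVU y (V.mem y)⟩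
  have hsub : ∀ x y, V.set x ∩ V.set y ⊆ O (r x) (r y) y := fun x y b hb =>
    mem_iInter₂.1 (mem_iInter₂.1 hb.2.2.2 (r x) (hrt x)) (r y) (hrt y)
  exact ⟨{
    cover := V
    frame := fun x => e (r x)
    isFrame := fun x => (he (r x)).mono (hVU x)
    lift := fun x y => c (r x) (r y) y
    isLift := fun x y b hb =>
      (hc _ _ y (hVO x y ⟨b, hb⟩)).2.2 b (hsub x y hb)
    continuous := fun x y => by
      rcases (V.set x ∩ V.set y).eq_empty_or_nonempty with h | h
      · rw [h]
        exact fun l => continuousOn_empty _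
      · exact (hc _ _ y (hVO x y h)).2.1.mono (hsub x y) }⟩

end Existence

end
end CotBrane

namespace CotBrane
noncomputable section
-- Instance shortcuts for the cotangent bundle and its tangent bundle
namespace Shortcuts
variable {n : ℕ} {X : Type*} [TopologicalSpace X] [ChartedSpace (Eu n) X]
  [IsManifold 𝓘(ℝ, Eu n) ∞ X]
scoped instance : TopologicalSpace (Cot n X) := inferInstance
scoped instance : ChartedSpace (ModelProd (Eu n) (Eu n →L[ℝ] ℝ)) (Cot n X) := inferInstance
scoped instance : IsManifold (IC n) 1 (Cot n X) := inferInstance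
scoped instance : NormedAddCommGroup (Eu n) := inferInstance
scoped instance : NormedSpace ℝ (Eu n) := inferInstance
scoped instance : NormedAddCommGroup (EuCot n) := inferInstance
scoped instance : NormedSpace ℝ (EuCot n) := inferInstance
scoped instance : NormedAddCommGroup (Eu n →L[ℝ] ℝ) := inferInstance
scoped instance : NormedSpace ℝ (Eu n →L[ℝ] ℝ) := inferInstance
scoped instance : NormedAddCommGroup (Eu n →L[ℝ] Eu n →L[ℝ] ℝ) := inferInstance
scoped instance : NormedSpace ℝ (Eu n →L[ℝ] Eu n →L[ℝ] ℝ) := inferInstance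
scoped instance (p : Cot n X) : TopologicalSpace (TangentSpace (IC n) p) := inferInstance
scoped instance (p : Cot n X) : AddCommGroup (TangentSpace (IC n) p) := inferInstance
scoped instance (p : Cot n X) : Module ℝ (TangentSpace (IC n) p) := inferInstance
scoped instance : TopologicalSpace (TangentBundle (IC n) (Cot n X)) := inferInstance
scoped instance : FiberBundle (EuCot n) (TangentSpace (IC n) : Cot n X → Type) := inferInstance
scoped instance : VectorBundle ℝ (EuCot n) (TangentSpace (IC n) : Cot n X → Type) := inferInstance
end Shortcuts

open Shortcuts
-- Charts of X and of T^*X and their coordinate changes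
section Coordinates

variable {n : ℕ} {X : Type*} [TopologicalSpace X] [ChartedSpace (Eu n) X]
  [IsManifold 𝓘(ℝ, Eu n) ∞ X]

/-- The preferred chart at `x`, with values in `ℝⁿ`. -/
def ech (n : ℕ) {X : Type*} [TopologicalSpace X] [ChartedSpace (Eu n) X] (x : X) : PartialEquiv X (Eu n) := extChartAt 𝓘(ℝ, Eu n) x

/-- The coordinate change from the preferred chart at `x` to the one at `y`. -/
def chg (n : ℕ) {X : Type*} [TopologicalSpace X] [ChartedSpace (Eu n) X] (x y : X) : Eu n → Eu n := ech n y ∘ (ech n x).symm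

/-- The derivative at `z` of the coordinate change from the preferred chart at `x` to the one at
`y`. -/
def tcc (n : ℕ) {X : Type*} [TopologicalSpace X] [ChartedSpace (Eu n) X]
    [IsManifold 𝓘(ℝ, Eu n) ∞ X] (x y z : X) : Eu n →L[ℝ] Eu n := tangentCoordChange 𝓘(ℝ, Eu n) x y z

theorem tcc_eq_fderiv (x y z : X) : tcc n x y z = fderiv ℝ (chg n x y) (ech n x z) := by
  have hr : range 𝓘(ℝ, Eu n) = univ := by simp
  rw [tcc, tangentCoordChange_def, hr, fderivWithin_univ]
  rfl

theorem tcc_self {x z : X} (h : z ∈ (ech n x).source) : tcc n x x z = .id ℝ _ := by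
  ext1 v
  exact tangentCoordChange_self h

theorem tcc_comp {w x y z : X} (hw : z ∈ (ech n w).source) (hx : z ∈ (ech n x).source)
    (hy : z ∈ (ech n y).source) (v : Eu n) : tcc n x y z (tcc n w x z v) = tcc n w y z v :=
  tangentCoordChange_comp ⟨⟨hw, hx⟩, hy⟩

theorem tcc_tcc {x y z : X} (hx : z ∈ (ech n x).source) (hy : z ∈ (ech n y).source) (v : Eu n) :
    tcc n y x z (tcc n x y z v) = v := by
  rw [tcc_comp hx hy hx, tcc_self hx]
  rfl

theorem continuousOn_tcc (x y : X) :
    ContinuousOn (tcc n x y) ((ech n x).source ∩ (ech n y).source) :=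
  continuousOn_tangentCoordChange x y

theorem contDiffAt_chg {x y z : X} (hx : z ∈ (ech n x).source) (hy : z ∈ (ech n y).source) :
    ContDiffAt ℝ ∞ (chg n x y) (ech n x z) := by
  have h' : ech n x z ∈ ((ech n x).symm ≫ (ech n y)).source := by
    rw [PartialEquiv.trans_source'', PartialEquiv.symm_symm, PartialEquiv.symm_target]
    exact mem_image_of_mem _ ⟨hx, hy⟩
  have := contDiffWithinAt_ext_coord_change (I := 𝓘(ℝ, Eu n)) (n := ∞) y x h'
  have hr : range 𝓘(ℝ, Eu n) = univ := by simp
  rw [hr, contDiffWithinAt_univ] at this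
  exact this

theorem chg_apply {x y z : X} (hx : z ∈ (ech n x).source) : chg n x y (ech n x z) = ech n y z := by
  simp only [chg, Function.comp_apply]
  rw [(ech n x).left_inv hx]

theorem eventually_ech_source {x y z : X} (hx : z ∈ (ech n x).source) (hy : z ∈ (ech n y).source) :
    ∀ᶠ u in 𝓝 (ech n x z), u ∈ (ech n x).target ∧ (ech n x).symm u ∈ (ech n y).source := by
  refine Filter.Eventually.and ((isOpen_extChartAt_target (I := 𝓘(ℝ, Eu n)) x).mem_nhds ((ech n x).map_source hx)) ?_
  have h1 : ContinuousAt (ech n x).symm (ech n x z) := continuousAt_extChartAt_symm' hx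
  refine h1.eventually ?_
  rw [(ech n x).left_inv hx]
  exact (isOpen_extChartAt_source (I := 𝓘(ℝ, Eu n)) y).mem_nhds hy

theorem mem_ech_source (x : X) : x ∈ (ech n x).source := mem_extChartAt_source x

theorem mem_ech_source_iff {x y : X} :
    y ∈ (ech n x).source ↔ y ∈ (chartAt (Eu n) x).source := by
  simp [ech]

theorem tau_eq {x y : X} (h : y ∈ (ech n x).source) :
    (trivializationAt (Eu n) (TangentSpace 𝓘(ℝ, Eu n) : X → Type) x).continuousLinearMapAt ℝ y
      = tcc n y x y :=
  TangentBundle.continuousLinearMapAt_trivializationAt_eq_core (mem_ech_source_iff.1 h)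

theorem tauInv_eq {x y : X} (h : y ∈ (ech n x).source) :
    (trivializationAt (Eu n) (TangentSpace 𝓘(ℝ, Eu n) : X → Type) x).symmL ℝ y = tcc n x y y :=
  TangentBundle.symmL_trivializationAt_eq_core (mem_ech_source_iff.1 h)

theorem mfderiv_ech_symm {x y : X} (h : y ∈ (ech n x).source) :
    mfderiv 𝓘(ℝ, Eu n) 𝓘(ℝ, Eu n) (ech n x).symm (ech n x y) = tcc n x y y := by
  have := TangentBundle.symmL_trivializationAt (I := 𝓘(ℝ, Eu n)) (x₀ := x) (x := y)
    (mem_ech_source_iff.1 h)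
  rw [tauInv_eq h] at this
  have hr : range 𝓘(ℝ, Eu n) = univ := by simp
  rw [this, hr, mfderivWithin_univ]
  rfl

theorem mfderiv_ech {x y : X} (h : y ∈ (ech n x).source) :
    mfderiv 𝓘(ℝ, Eu n) 𝓘(ℝ, Eu n) (ech n x) y = tcc n y x y := by
  have := TangentBundle.continuousLinearMapAt_trivializationAt (I := 𝓘(ℝ, Eu n)) (x₀ := x) (x := y)
    (mem_ech_source_iff.1 h)
  rw [tau_eq h] at this
  rw [this]
  rfl

/-- The vector `ξ` of `(T_xX)^*` as a functional on `ℝⁿ`, by the preferred chart at `x`. -/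
def toCov {x : X} (ξ : CotSpace n X x) : Eu n →L[ℝ] ℝ := ξ

theorem hom_inCoordinates {x y : X} (h : y ∈ (ech n x).source) (ξ : CotSpace n X y) :
    ContinuousLinearMap.inCoordinates (Eu n) (TangentSpace 𝓘(ℝ, Eu n) : X → Type) ℝ
      (Bundle.Trivial X ℝ) x y x y ξ = (toCov ξ).comp (tcc n x y y) := by
  ext v
  rw [ContinuousLinearMap.inCoordinates]
  simp only [ContinuousLinearMap.comp_apply]
  rw [tauInv_eq h]
  erw [Bundle.Trivial.continuousLinearMapAt_trivialization]
  rfl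

theorem cotChart_apply {p₀ p : Cot n X} (h : p.1 ∈ (ech n p₀.1).source) :
    extChartAt (IC n) p₀ p = (ech n p₀.1 p.1, (toCov p.2).comp (tcc n p₀.1 p.1 p.1)) := by
  rw [extChartAt_coe]
  simp only [Function.comp_apply]
  rw [hom_chart, hom_inCoordinates h]
  rfl

theorem cotChart_source (p₀ : Cot n X) :
    (extChartAt (IC n) p₀).source = {p | p.1 ∈ (ech n p₀.1).source} := by
  rw [extChartAt_source, FiberBundle.chartedSpace_chartAt]
  ext p
  simp only [OpenPartialHomeomorph.trans_source, OpenPartialHomeomorph.prod_source, mem_preimage,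
    mem_inter_iff, mem_prod, OpenPartialHomeomorph.refl_source, mem_univ, and_true]
  have : (p.1 ∈ (chartAt (Eu n) p₀.1).source) ↔ p.1 ∈ (ech n p₀.1).source :=
    mem_ech_source_iff.symm
  constructor
  · intro h
    exact this.1 (by simpa using h.1)
  · intro h
    have h' := this.2 h
    exact ⟨by simpa using h', h'⟩

theorem cotChart_self (p : Cot n X) : extChartAt (IC n) p p = (ech n p.1 p.1, toCov p.2) := by
  rw [cotChart_apply (mem_ech_source (n := n) _), tcc_self (mem_ech_source (n := n) _)]
  rfl

/-- The covector at `x` given by a functional on `ℝⁿ`, by the preferred chart at `x`. -/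
def ofCov (x : X) (β : Eu n →L[ℝ] ℝ) : CotSpace n X x := β

@[simp]
theorem toCov_ofCov (x : X) (β : Eu n →L[ℝ] ℝ) : toCov (ofCov x β) = β := rfl

/-- The point of `T^*X` with given coordinates in the preferred chart at `x`. -/
def cotPoint (x : X) (v : EuCot n) : Cot n X :=
  ⟨(ech n x).symm v.1, ofCov _ (v.2.comp (tcc n ((ech n x).symm v.1) x ((ech n x).symm v.1)))⟩

theorem cotChart_cotPoint (p₀ : Cot n X) {v : EuCot n} (h : v.1 ∈ (ech n p₀.1).target) :
    extChartAt (IC n) p₀ (cotPoint p₀.1 v) = v := by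
  have hs := (ech n p₀.1).map_target h
  rw [cotChart_apply (by exact hs)]
  refine Prod.ext ((ech n p₀.1).right_inv h) ?_
  ext a
  simp only [cotPoint, toCov_ofCov, ContinuousLinearMap.comp_apply]
  rw [tcc_tcc hs (mem_ech_source (n := n) _)]

theorem cotChart_symm_apply (p₀ : Cot n X) {v : EuCot n} (h : v.1 ∈ (ech n p₀.1).target) :
    (extChartAt (IC n) p₀).symm v = cotPoint p₀.1 v := by
  rw [← (extChartAt (IC n) p₀).left_inv (x := cotPoint p₀.1 v), cotChart_cotPoint p₀ h]
  rw [cotChart_source]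
  exact (ech n p₀.1).map_target h

theorem cot_transition {p₀ p : Cot n X} (h : p.1 ∈ (ech n p₀.1).source) :
    (extChartAt (IC n) p₀ ∘ (extChartAt (IC n) p).symm) =ᶠ[𝓝 (extChartAt (IC n) p p)]
      fun v => (chg n p.1 p₀.1 v.1,
        v.2.comp (fderiv ℝ (chg n p₀.1 p.1) (chg n p.1 p₀.1 v.1))) := by
  have h1 : Tendsto (fun v : EuCot n => v.1) (𝓝 (extChartAt (IC n) p p)) (𝓝 (ech n p.1 p.1)) := by
    have := (continuous_fst (X := Eu n) (Y := Eu n →L[ℝ] ℝ)).tendsto (extChartAt (IC n) p p)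
    rwa [cotChart_self] at this ⊢
  filter_upwards [h1.eventually (eventually_ech_source (mem_ech_source (n := n) p.1) h)] with v hv
  rw [Function.comp_apply, cotChart_symm_apply p hv.1, cotChart_apply (by exact hv.2)]
  refine Prod.ext rfl ?_
  have hs := (ech n p.1).map_target hv.1
  have e : chg n p.1 p₀.1 v.1 = ech n p₀.1 ((ech n p.1).symm v.1) := rfl
  ext a
  simp only [cotPoint, toCov_ofCov, ContinuousLinearMap.comp_apply]
  rw [tcc_comp hv.2 (mem_ech_source (n := n) _) hs, e, tcc_eq_fderiv]

/-- Covectors transform by the derivative of the inverse coordinate change taken at the moving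
point. The product rule therefore adds a second derivative contracted with ξ; the Christoffel form
has the same inhomogeneous term, which makes the splitting independent of the chart. -/
theorem tcc_cot_apply {p₀ p : Cot n X} (h : p.1 ∈ (ech n p₀.1).source) (V : EuCot n) :
    tangentCoordChange (IC n) p p₀ p V = (tcc n p.1 p₀.1 p.1 V.1,
      V.2.comp (tcc n p₀.1 p.1 p.1) + (toCov p.2).comp
        (fderiv ℝ (fderiv ℝ (chg n p₀.1 p.1)) (ech n p₀.1 p.1) (tcc n p.1 p₀.1 p.1 V.1))) := by
  have hs := mem_ech_source (n := n) p.1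
  have e0 : chg n p.1 p₀.1 (ech n p.1 p.1) = ech n p₀.1 p.1 := chg_apply hs
  have h1 : HasFDerivAt (fun v : EuCot n => chg n p.1 p₀.1 v.1)
      ((tcc n p.1 p₀.1 p.1).comp (.fst ℝ _ _)) (ech n p.1 p.1, toCov p.2) := by
    rw [tcc_eq_fderiv]
    exact HasFDerivAt.comp (f := Prod.fst) (x := (ech n p.1 p.1, toCov p.2))
      (((contDiffAt_chg hs h).differentiableAt (by simp)).hasFDerivAt) hasFDerivAt_fst
  have h2 : HasFDerivAt (fderiv ℝ (chg n p₀.1 p.1))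
      (fderiv ℝ (fderiv ℝ (chg n p₀.1 p.1)) (ech n p₀.1 p.1)) (chg n p.1 p₀.1 (ech n p.1 p.1)) := by
    rw [e0]
    exact (((contDiffAt_chg h hs).fderiv_right (m := 1) (by norm_cast)).differentiableAt
      (by simp)).hasFDerivAt
  have h3 := (hasFDerivAt_snd (𝕜 := ℝ) (E := Eu n) (F := Eu n →L[ℝ] ℝ)
    (p := (ech n p.1 p.1, toCov p.2))).clm_comp
      (HasFDerivAt.comp (f := fun v : EuCot n => chg n p.1 p₀.1 v.1) (x := (ech n p.1 p.1, toCov p.2)) h2 h1)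
  rw [tangentCoordChange_def]
  have : range (IC n) = univ := by simp [ModelWithCorners.range_eq_univ]
  rw [this, fderivWithin_univ, (cot_transition h).fderiv_eq, cotChart_self]
  refine (DFunLike.congr_fun (h1.prodMk h3).fderiv V).trans (Prod.ext rfl ?_)
  ext a
  simp [e0, ← tcc_eq_fderiv]
  rw [add_comm]

end Coordinates

/-! ### The Levi-Civita splitting of the tangent bundle of T^*X -/

section Connection

set_option synthInstance.maxHeartbeats 200000

variable {n : ℕ} {X : Type*} [TopologicalSpace X] [ChartedSpace (Eu n) X]
  [IsManifold 𝓘(ℝ, Eu n) ∞ X] (g : Metric n X)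

theorem flat_comm (x : X) (a b : Eu n) : flat g x a b = flat g x b a := g.symm x a b

theorem flat_pos (x : X) {a : Eu n} (h : a ≠ 0) : 0 < flat g x a a := g.pos x a h

theorem flat_sharp (x : X) (β : Eu n →L[ℝ] ℝ) : flat g x ((flat g x).symm β) = β :=
  (flat g x).apply_symm_apply β

theorem chartMetric_apply {x y : X} (h : y ∈ (ech n x).source) (a b : Eu n) :
    chartMetric g x (ech n x y) a b = flat g y (tcc n x y y a) (tcc n x y y b) := by
  have e := (ech n x).left_inv h
  set D : Eu n →L[ℝ] Eu n := mfderiv 𝓘(ℝ, Eu n) 𝓘(ℝ, Eu n) (ech n x).symm (ech n x y) with hD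
  have e2 : D = tcc n x y y := mfderiv_ech_symm h
  change flat g ((ech n x).symm (ech n x y)) (D a) (D b) = _
  rw [e2, e]

theorem chartMetric_self (x : X) (a b : Eu n) :
    chartMetric g x (ech n x x) a b = flat g x a b := by
  rw [chartMetric_apply g (mem_ech_source _), tcc_self (mem_ech_source _)]
  rfl

/-- Smoothness of g is given in the trivialization of the bundle of bilinear forms induced by the
chart; near the point, the chart matrix is that trivialized metric composed with the inverse chart.
-/
theorem contDiffAt_chartMetric {x y : X} (h : y ∈ (ech n x).source) :
    ContDiffAt ℝ ∞ (chartMetric g x) (ech n x y) := by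
  have hb : y ∈ (trivializationAt (Eu n) (TangentSpace 𝓘(ℝ, Eu n) : X → Type) x).baseSet :=
    mem_ech_source_iff.1 h
  have h1 := (Bundle.Trivialization.contMDiffAt_iff (n := ∞) (IM := 𝓘(ℝ, Eu n)) (IB := 𝓘(ℝ, Eu n)) (e := trivializationAt (Eu n →L[ℝ] Eu n →L[ℝ] ℝ)
      (fun z : X => TangentSpace 𝓘(ℝ, Eu n) z →L[ℝ] TangentSpace 𝓘(ℝ, Eu n) z →L[ℝ] ℝ) x)
    (f := fun b ↦ TotalSpace.mk' (Eu n →L[ℝ] Eu n →L[ℝ] ℝ) b (g.inner b)) (x₀ := y)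
    (by
      rw [hom_trivializationAt_source]
      exact ⟨hb, hb, mem_univ _⟩)).1 (g.contMDiff y)
  have h2 : ContMDiffAt 𝓘(ℝ, Eu n) 𝓘(ℝ, Eu n) ∞ (ech n x).symm (ech n x y) :=
    (contMDiffOn_extChartAt_symm (I := 𝓘(ℝ, Eu n)) (n := ∞) x).contMDiffAt
      ((isOpen_extChartAt_target (I := 𝓘(ℝ, Eu n)) x).mem_nhds ((ech n x).map_source h))
  have e := (ech n x).left_inv h
  have h3 := ContMDiffAt.comp_of_eq h1.2 h2 e
  refine (contMDiffAt_iff_contDiffAt.1 h3).congr_of_eventuallyEq ?_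
  filter_upwards [eventually_ech_source h h] with v hv
  have hb' : (ech n x).symm v ∈
      (trivializationAt (Eu n) (TangentSpace 𝓘(ℝ, Eu n) : X → Type) x).baseSet :=
    mem_ech_source_iff.1 hv.2
  ext a b
  rw [← (ech n x).right_inv hv.1, chartMetric_apply g hv.2, (ech n x).right_inv hv.1]
  rw [Function.comp_apply]
  erw [hom_trivializationAt_apply]
  erw [inCoordinates_apply_eq₂ hb' hb' (mem_univ _)]
  have e3 : ∀ a, tcc n x ((ech n x).symm v) ((ech n x).symm v) a = (trivializationAt (Eu n)
      (TangentSpace 𝓘(ℝ, Eu n) : X → Type) x).symm ((ech n x).symm v) a := by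
    intro a
    rw [← tauInv_eq hv.2]
    exact Trivialization.symmL_apply _ hb' _
  rw [e3, e3]
  erw [Bundle.Trivial.linearMapAt_trivialization]
  rfl

/-- The Christoffel form of the preferred chart at `x`, contracted with the vector `s`. -/
def christoffelAt (x : X) (u s a : Eu n) : Eu n →L[ℝ] ℝ :=
  (1 / 2 : ℝ) • ((fderiv ℝ (chartMetric g x) u a).flip s
    + ((fderiv ℝ (chartMetric g x) u).flip a).flip s - fderiv ℝ (chartMetric g x) u s a)

theorem christoffelAt_apply (x : X) (u s a b : Eu n) : christoffelAt g x u s a b =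
    (1 / 2 : ℝ) * (fderiv ℝ (chartMetric g x) u a b s + fderiv ℝ (chartMetric g x) u b a s
      - fderiv ℝ (chartMetric g x) u s a b) := by
  simp [christoffelAt]

theorem christoffel_eq (p : Cot n X) (a : Eu n) : christoffel g p a
    = christoffelAt g p.1 (ech n p.1 p.1) ((flat g p.1).symm (toCov p.2)) a := rfl

theorem chartMetric_transform {x y z : X} (hx : z ∈ (ech n x).source) (hy : z ∈ (ech n y).source)
    (a b : Eu n) : (fun v => chartMetric g x v a b) =ᶠ[𝓝 (ech n x z)]
      fun v => chartMetric g y (chg n x y v) (fderiv ℝ (chg n x y) v a) (fderiv ℝ (chg n x y) v b) := by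
  filter_upwards [eventually_ech_source hx hy] with v hv
  obtain ⟨y', hy', rfl⟩ : ∃ y' ∈ (ech n x).source, ech n x y' = v :=
    ⟨_, (ech n x).map_target hv.1, (ech n x).right_inv hv.1⟩
  have h2 := hv.2
  rw [(ech n x).left_inv hy'] at h2
  rw [chg_apply hy', ← tcc_eq_fderiv, chartMetric_apply g hy', chartMetric_apply g h2,
    tcc_comp hy' h2 (mem_ech_source _), tcc_comp hy' h2 (mem_ech_source _)]

/-- Differentiate `chartMetric_transform`: the chain rule for the metric in the second chart, and
one second derivative of the coordinate change for each of the two arguments. -/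
theorem fderiv_chartMetric_transform {x y z : X} (hx : z ∈ (ech n x).source)
    (hy : z ∈ (ech n y).source) (a b c : Eu n) :
    fderiv ℝ (chartMetric g x) (ech n x z) c a b
      = fderiv ℝ (chartMetric g y) (ech n y z) (tcc n x y z c) (tcc n x y z a) (tcc n x y z b)
        + chartMetric g y (ech n y z) (fderiv ℝ (fderiv ℝ (chg n x y)) (ech n x z) c a)
          (tcc n x y z b)
        + chartMetric g y (ech n y z) (tcc n x y z a)
          (fderiv ℝ (fderiv ℝ (chg n x y)) (ech n x z) c b) := by
  have hθ := contDiffAt_chg hx hy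
  have h1 : HasFDerivAt (chg n x y) (tcc n x y z) (ech n x z) := by
    rw [tcc_eq_fderiv]
    exact (hθ.differentiableAt (by simp)).hasFDerivAt
  have h2 : HasFDerivAt (fderiv ℝ (chg n x y)) (fderiv ℝ (fderiv ℝ (chg n x y)) (ech n x z))
      (ech n x z) :=
    ((hθ.fderiv_right (m := 1) (by norm_cast)).differentiableAt (by simp)).hasFDerivAt
  have h4 : HasFDerivAt (fun v => chartMetric g y (chg n x y v))
      ((fderiv ℝ (chartMetric g y) (ech n y z)).comp (tcc n x y z)) (ech n x z) := by
    have h3 := ((contDiffAt_chartMetric g hy).differentiableAt (by simp)).hasFDerivAt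
    rw [← chg_apply hx (y := y)] at h3 ⊢
    exact HasFDerivAt.comp (ech n x z) h3 h1
  have ha := h2.clm_apply (hasFDerivAt_const a (ech n x z))
  have hb := h2.clm_apply (hasFDerivAt_const b (ech n x z))
  have h5 := (h4.clm_apply ha).clm_apply hb
  have h0 : HasFDerivAt (chartMetric g x) (fderiv ℝ (chartMetric g x) (ech n x z)) (ech n x z) :=
    ((contDiffAt_chartMetric g hx).differentiableAt (by simp)).hasFDerivAt
  have h6 := (h0.clm_apply (hasFDerivAt_const a (ech n x z))).clm_apply
    (hasFDerivAt_const b (ech n x z))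
  have h7 := DFunLike.congr_fun (h6.unique
    (h5.congr_of_eventuallyEq (chartMetric_transform g hx hy a b))) c
  simp [chg_apply hx, ← tcc_eq_fderiv] at h7
  linarith

theorem fderiv_chg_symm {x y z : X} (hx : z ∈ (ech n x).source) (hy : z ∈ (ech n y).source)
    (a b : Eu n) : fderiv ℝ (fderiv ℝ (chg n x y)) (ech n x z) a b
      = fderiv ℝ (fderiv ℝ (chg n x y)) (ech n x z) b a :=
  ((contDiffAt_chg hx hy).isSymmSndFDerivAt (by
    simp only [minSmoothness_of_isRCLikeNormedField]
    exact WithTop.coe_le_coe.2 (le_top : (2 : ℕ∞) ≤ ⊤))) a b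

/-- The transformation law of the Christoffel symbols. -/
theorem christoffelAt_transform {x y z : X} (hx : z ∈ (ech n x).source)
    (hy : z ∈ (ech n y).source) (s a b : Eu n) :
    christoffelAt g x (ech n x z) s a b
      = christoffelAt g y (ech n y z) (tcc n x y z s) (tcc n x y z a) (tcc n x y z b)
        + chartMetric g y (ech n y z) (tcc n x y z s)
          (fderiv ℝ (fderiv ℝ (chg n x y)) (ech n x z) a b) := by
  have hs : ∀ v v', chartMetric g y (ech n y z) v v' = chartMetric g y (ech n y z) v' v := by
    intro v v'
    rw [chartMetric_apply g hy, chartMetric_apply g hy, flat_comm]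
  simp only [christoffelAt_apply, fderiv_chartMetric_transform g hx hy]
  -- Of the six terms with second derivatives, four cancel once second derivatives and the metric
  -- are known to be symmetric. The other two coincide and use up the factor 1/2.
  rw [fderiv_chg_symm hx hy b a, fderiv_chg_symm hx hy s a, fderiv_chg_symm hx hy s b,
    hs (fderiv ℝ (fderiv ℝ (chg n x y)) (ech n x z) a b) (tcc n x y z s),
    hs (fderiv ℝ (fderiv ℝ (chg n x y)) (ech n x z) a s) (tcc n x y z b)]
  ring

theorem christoffelAt_symm {x z : X} (hx : z ∈ (ech n x).source) (s a b : Eu n) :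
    christoffelAt g x (ech n x z) s a b = christoffelAt g x (ech n x z) s b a := by
  have h0 : HasFDerivAt (chartMetric g x) (fderiv ℝ (chartMetric g x) (ech n x z)) (ech n x z) :=
    ((contDiffAt_chartMetric g hx).differentiableAt (by simp)).hasFDerivAt
  have h6 := (h0.clm_apply (hasFDerivAt_const a (ech n x z))).clm_apply
    (hasFDerivAt_const b (ech n x z))
  have h6' := (h0.clm_apply (hasFDerivAt_const b (ech n x z))).clm_apply
    (hasFDerivAt_const a (ech n x z))
  have e : (fun v => chartMetric g x v a b) =ᶠ[𝓝 (ech n x z)] fun v => chartMetric g x v b a := by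
    filter_upwards [eventually_ech_source hx hx] with v hv
    rw [← (ech n x).right_inv hv.1, chartMetric_apply g hv.2, chartMetric_apply g hv.2, flat_comm]
  have h7 := DFunLike.congr_fun (h6.unique (h6'.congr_of_eventuallyEq e)) s
  simp at h7
  rw [christoffelAt_apply, christoffelAt_apply, h7]
  ring

theorem christoffel_symm (p : Cot n X) (a b : Eu n) :
    christoffel g p a b = christoffel g p b a := by
  rw [christoffel_eq, christoffel_eq]
  exact christoffelAt_symm g (mem_ech_source _) _ _ _

/-- The case where the second chart is centred at the base point and s is the vector dual to ξ:
pairing s by the metric returns ξ, and the inhomogeneous term is the one of `tcc_cot_apply`. -/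
theorem christoffel_transform {x : X} (p : Cot n X) (h : p.1 ∈ (ech n x).source) (a b : Eu n) :
    christoffelAt g x (ech n x p.1) (tcc n p.1 x p.1 ((flat g p.1).symm (toCov p.2)))
        (tcc n p.1 x p.1 a) b
      = christoffel g p a (tcc n x p.1 p.1 b) + toCov p.2
        (fderiv ℝ (fderiv ℝ (chg n x p.1)) (ech n x p.1) (tcc n p.1 x p.1 a) b) := by
  rw [christoffelAt_transform g h (mem_ech_source p.1), tcc_tcc (mem_ech_source _) h,
    tcc_tcc (mem_ech_source _) h, chartMetric_self, flat_sharp, christoffel_eq]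

/-! ### Horizontal and vertical parts -/

/-- The horizontal part of a tangent vector of `T^*X`. -/
def hor {p : Cot n X} (V : TangentSpace (IC n) p) : Eu n := (toModel V).1

/-- The vertical part of a tangent vector of `T^*X`. -/
def ver {p : Cot n X} (V : TangentSpace (IC n) p) : Eu n →L[ℝ] ℝ :=
  (toModel V).2 - christoffel g p (hor V)

/-- The tangent vector with given horizontal and vertical parts. -/
def ofHV (p : Cot n X) (a : Eu n) (η : Eu n →L[ℝ] ℝ) : TangentSpace (IC n) p :=
  ofModel p (a, η + christoffel g p a)

theorem hor_ofHV (p : Cot n X) (a : Eu n) (η : Eu n →L[ℝ] ℝ) : hor (ofHV g p a η) = a := rfl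

theorem ver_ofHV (p : Cot n X) (a : Eu n) (η : Eu n →L[ℝ] ℝ) : ver g (ofHV g p a η) = η :=
  add_sub_cancel_right _ _

theorem ofHV_hor_ver {p : Cot n X} (V : TangentSpace (IC n) p) : ofHV g p (hor V) (ver g V) = V := by
  refine Prod.ext rfl ?_
  exact sub_add_cancel _ _

theorem ext_hor_ver {p : Cot n X} {V V' : TangentSpace (IC n) p} (h : hor V = hor V')
    (h' : ver g V = ver g V') : V = V' := by
  rw [← ofHV_hor_ver g V, ← ofHV_hor_ver g V', h, h']

theorem hor_add {p : Cot n X} (V V' : TangentSpace (IC n) p) : hor (V + V') = hor V + hor V' := rfl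

theorem hor_smul {p : Cot n X} (c : ℝ) (V : TangentSpace (IC n) p) : hor (c • V) = c • hor V := rfl

theorem christoffelAt_add (x : X) (u s a a' : Eu n) :
    christoffelAt g x u s (a + a') = christoffelAt g x u s a + christoffelAt g x u s a' := by
  ext b
  simp [christoffelAt_apply]
  ring

theorem christoffelAt_smul (x : X) (u s : Eu n) (c : ℝ) (a : Eu n) :
    christoffelAt g x u s (c • a) = c • christoffelAt g x u s a := by
  ext b
  simp [christoffelAt_apply]
  ring

theorem ver_add {p : Cot n X} (V V' : TangentSpace (IC n) p) :
    ver g (V + V') = ver g V + ver g V' := by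
  have : (toModel (V + V')).2 = (toModel V).2 + (toModel V').2 := rfl
  rw [ver, hor_add, christoffel_eq, christoffelAt_add, this, ver, ver, christoffel_eq,
    christoffel_eq]
  abel

theorem ver_smul {p : Cot n X} (c : ℝ) (V : TangentSpace (IC n) p) :
    ver g (c • V) = c • ver g V := by
  have : (toModel (c • V)).2 = c • (toModel V).2 := rfl
  rw [ver, hor_smul, christoffel_eq, christoffelAt_smul, this, ver, christoffel_eq, smul_sub]

/-- The horizontal and the vertical part as a linear map. -/
def horL (p : Cot n X) : TangentSpace (IC n) p →ₗ[ℝ] Eu n where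
  toFun := hor
  map_add' := hor_add
  map_smul' := hor_smul

def verL (p : Cot n X) : TangentSpace (IC n) p →ₗ[ℝ] (Eu n →L[ℝ] ℝ) where
  toFun := ver g
  map_add' := ver_add g
  map_smul' := ver_smul g

/-- The connection is torsion free, so the Christoffel contributions cancel; in particular the
horizontal space is Lagrangian. -/
theorem symplectic_eq {p : Cot n X} (V W : TangentSpace (IC n) p) :
    symplectic p V W = ver g V (hor W) - ver g W (hor V) := by
  simp only [symplectic, ver, sub_apply]
  rw [christoffel_symm g p (hor V) (hor W)]
  simp only [hor]
  ring

variable (w : Cot n X → ℝ)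

theorem acs_eq {p : Cot n X} (V : TangentSpace (IC n) p) :
    acs g w p V = ofHV g p ((w p)⁻¹ • (flat g p.1).symm (ver g V)) (-(w p • flat g p.1 (hor V))) :=
  rfl

theorem hor_acs {p : Cot n X} (V : TangentSpace (IC n) p) :
    hor (acs g w p V) = (w p)⁻¹ • (flat g p.1).symm (ver g V) := rfl

theorem ver_acs {p : Cot n X} (V : TangentSpace (IC n) p) :
    ver g (acs g w p V) = -(w p • flat g p.1 (hor V)) := by
  rw [acs_eq, ver_ofHV]

theorem compatMetric_eq {p : Cot n X} (V W : TangentSpace (IC n) p) :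
    compatMetric g w p V W = (w p)⁻¹ * ver g V ((flat g p.1).symm (ver g W))
      + w p * flat g p.1 (hor V) (hor W) := by
  rw [compatMetric, symplectic_eq g, hor_acs, ver_acs, flat_comm]
  simp

/-- The coordinates of a tangent vector in the trivialization of the preferred chart at `p₀`. -/
theorem tangent_coords {p₀ p : Cot n X} (h : p.1 ∈ (ech n p₀.1).source)
    (V : TangentSpace (IC n) p) :
    tangentCoordChange (IC n) p p₀ p V = (tcc n p.1 p₀.1 p.1 (hor V),
      (ver g V).comp (tcc n p₀.1 p.1 p.1) + christoffelAt g p₀.1 (ech n p₀.1 p.1)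
        (tcc n p.1 p₀.1 p.1 ((flat g p.1).symm (toCov p.2))) (tcc n p.1 p₀.1 p.1 (hor V))) := by
  refine (tcc_cot_apply h V).trans (Prod.ext rfl ?_)
  ext b
  simp only [add_apply, ContinuousLinearMap.comp_apply]
  rw [christoffel_transform g p h]
  simp only [ver, sub_apply, hor, toModel]
  ring

end Connection

/-! ### Continuity of families of vectors and covectors -/

section Sections

set_option synthInstance.maxHeartbeats 200000

variable {n : ℕ} {X : Type*} [TopologicalSpace X] [ChartedSpace (Eu n) X]
  [IsManifold 𝓘(ℝ, Eu n) ∞ X] (g : Metric n X) {B : Type*} [TopologicalSpace B]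

/-- Continuity at `b₀` of a family of tangent vectors of `X`, in the chart at `x b₀`. -/
def VecAt (x : B → X) (v : B → Eu n) (S : Set B) (b₀ : B) : Prop :=
  ContinuousWithinAt (fun b => tcc n (x b) (x b₀) (x b) (v b)) S b₀

/-- Continuity at `b₀` of a family of covectors of `X`, in the chart at `x b₀`. -/
def CovAt (x : B → X) (η : B → Eu n →L[ℝ] ℝ) (S : Set B) (b₀ : B) : Prop :=
  ContinuousWithinAt (fun b => (η b).comp (tcc n (x b₀) (x b) (x b))) S b₀

variable {x : B → X} {v v' : B → Eu n} {η η' : B → Eu n →L[ℝ] ℝ} {S : Set B} {b₀ : B}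

theorem eventually_mem_source (hx : ContinuousWithinAt x S b₀) :
    ∀ᶠ b in 𝓝[S] b₀, x b ∈ (ech n (x b₀)).source :=
  hx.eventually ((isOpen_extChartAt_source (I := 𝓘(ℝ, Eu n)) (x b₀)).mem_nhds (mem_ech_source _))

theorem vec_iff : ContinuousWithinAt (fun b => (⟨x b, v b⟩ : TangentBundle 𝓘(ℝ, Eu n) X)) S b₀
    ↔ ContinuousWithinAt x S b₀ ∧ VecAt x v S b₀ :=
  FiberBundle.continuousWithinAt_totalSpace ..

theorem cov_iff {η : ∀ b, CotSpace n X (x b)} :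
    ContinuousWithinAt (fun b => (⟨x b, η b⟩ : Cot n X)) S b₀
      ↔ ContinuousWithinAt x S b₀ ∧ CovAt x (fun b => toCov (η b)) S b₀ := by
  rw [continuousWithinAt_hom_bundle]
  refine and_congr_right fun hx => ?_
  refine Filter.EventuallyEq.congr_continuousWithinAt ?_ ?_
  · filter_upwards [eventually_mem_source (n := n) hx] with b hb
    exact hom_inCoordinates hb _
  · exact hom_inCoordinates (mem_ech_source _) _

theorem cov_of_cot {φ : B → Cot n X} (h : ContinuousWithinAt φ S b₀) :
    ContinuousWithinAt (fun b => (φ b).1) S b₀ ∧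
      CovAt (fun b => (φ b).1) (fun b => toCov (φ b).2) S b₀ :=
  cov_iff.1 h

theorem CovAt.pair (hx : ContinuousWithinAt x S b₀) (hη : CovAt x η S b₀) (hv : VecAt x v S b₀) :
    ContinuousWithinAt (fun b => η b (v b)) S b₀ := by
  have key : ∀ b, x b ∈ (ech n (x b₀)).source → η b (v b)
      = ((η b).comp (tcc n (x b₀) (x b) (x b))) (tcc n (x b) (x b₀) (x b) (v b)) := by
    intro b hb
    rw [ContinuousLinearMap.comp_apply, tcc_tcc (mem_ech_source _) hb]
  refine (ContinuousWithinAt.clm_apply hη hv).congr_of_eventuallyEq ?_ ?_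
  · filter_upwards [eventually_mem_source (n := n) hx] with b hb using key b hb
  · exact key b₀ (mem_ech_source _)

theorem VecAt.smul {c : B → ℝ} (hc : ContinuousWithinAt c S b₀) (h : VecAt x v S b₀) :
    VecAt x (fun b => c b • v b) S b₀ := by
  simp only [VecAt, map_smul]
  exact ContinuousWithinAt.smul hc h

theorem CovAt.smul {c : B → ℝ} (hc : ContinuousWithinAt c S b₀) (h : CovAt x η S b₀) :
    CovAt x (fun b => c b • η b) S b₀ := by
  simp only [CovAt, ContinuousLinearMap.smul_comp]
  exact ContinuousWithinAt.smul hc h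

theorem continuousAt_ech {x₀ y : X} (h : y ∈ (ech n x₀).source) : ContinuousAt (ech n x₀) y :=
  continuousAt_extChartAt' (I := 𝓘(ℝ, Eu n)) h

theorem continuousWithinAt_ech (hx : ContinuousWithinAt x S b₀) :
    ContinuousWithinAt (fun b => ech n (x b₀) (x b)) S b₀ :=
  ContinuousAt.comp_continuousWithinAt (f := x)
    (continuousAt_ech (mem_ech_source (n := n) (x b₀))) hx

theorem continuousWithinAt_chartMetric (hx : ContinuousWithinAt x S b₀) :
    ContinuousWithinAt (fun b => chartMetric g (x b₀) (ech n (x b₀) (x b))) S b₀ :=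
  ContinuousAt.comp_continuousWithinAt (f := fun b => ech n (x b₀) (x b))
    (contDiffAt_chartMetric g (mem_ech_source (n := n) (x b₀))).continuousAt
    (continuousWithinAt_ech hx)

theorem flat_comp_tcc {x₀ y : X} (h : y ∈ (ech n x₀).source) (v : Eu n) :
    (flat g y v).comp (tcc n x₀ y y) = chartMetric g x₀ (ech n x₀ y) (tcc n y x₀ y v) := by
  ext a
  rw [chartMetric_apply g h, tcc_tcc (mem_ech_source _) h]
  rfl

theorem VecAt.flat (hx : ContinuousWithinAt x S b₀) (hv : VecAt x v S b₀) :
    CovAt x (fun b => CotBrane.flat g (x b) (v b)) S b₀ := by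
  refine (ContinuousWithinAt.clm_apply (continuousWithinAt_chartMetric g hx)
    hv).congr_of_eventuallyEq ?_ ?_
  · filter_upwards [eventually_mem_source (n := n) hx] with b hb using flat_comp_tcc g hb _
  · exact flat_comp_tcc g (mem_ech_source _) _

/-- The metric at `y` in the chart at `x₀` as an isomorphism. -/
def chartFlat {x₀ y : X} (h : y ∈ (ech n x₀).source) : Eu n ≃L[ℝ] (Eu n →L[ℝ] ℝ) :=
  LinearEquiv.toContinuousLinearEquiv
    (LinearEquiv.ofBijective (chartMetric g x₀ (ech n x₀ y)).toLinearMap (by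
      have hinj : Function.Injective (chartMetric g x₀ (ech n x₀ y)).toLinearMap := by
        rw [injective_iff_map_eq_zero]
        intro a ha
        have h1 : (flat g y (tcc n x₀ y y a)).comp (tcc n x₀ y y) = 0 := by
          rw [flat_comp_tcc g h, tcc_tcc h (mem_ech_source _)]
          exact ha
        by_contra hne
        have h2 : tcc n x₀ y y a ≠ 0 := by
          intro h0
          apply hne
          rw [← tcc_tcc h (mem_ech_source y) a, h0, map_zero]
        exact (flat_pos g y h2).ne' (DFunLike.congr_fun h1 a)
      refine ⟨hinj, (LinearMap.injective_iff_surjective_of_finrank_eq_finrank ?_).1 hinj⟩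
      rw [← LinearEquiv.finrank_eq
        (LinearMap.toContinuousLinearMap : (Eu n →ₗ[ℝ] ℝ) ≃ₗ[ℝ] (Eu n →L[ℝ] ℝ))]
      exact (Subspace.dual_finrank_eq).symm))

theorem coe_chartFlat {x₀ y : X} (h : y ∈ (ech n x₀).source) :
    (chartFlat g h : Eu n →L[ℝ] (Eu n →L[ℝ] ℝ)) = chartMetric g x₀ (ech n x₀ y) := by
  ext a
  rfl

theorem tcc_sharp {x₀ y : X} (h : y ∈ (ech n x₀).source) (η : Eu n →L[ℝ] ℝ) :
    tcc n y x₀ y ((flat g y).symm η) = (chartMetric g x₀ (ech n x₀ y)).inverse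
      (η.comp (tcc n x₀ y y)) := by
  rw [← coe_chartFlat g h, ContinuousLinearMap.inverse_equiv]
  refine ((chartFlat g h).symm_apply_eq.2 ?_).symm
  have : chartFlat g h (tcc n y x₀ y ((flat g y).symm η))
    = chartMetric g x₀ (ech n x₀ y) (tcc n y x₀ y ((flat g y).symm η)) := rfl
  rw [this, ← flat_comp_tcc g h, flat_sharp]

/-- In the chart at x b₀, raising the index is the inverse of the matrix of the metric, and
inversion is continuous at invertible operators. -/
theorem CovAt.sharp (hx : ContinuousWithinAt x S b₀) (hη : CovAt x η S b₀) :
    VecAt x (fun b => (CotBrane.flat g (x b)).symm (η b)) S b₀ := by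
  have h1 : ContinuousAt ContinuousLinearMap.inverse
      (chartMetric g (x b₀) (ech n (x b₀) (x b₀))) := by
    rw [← coe_chartFlat g (mem_ech_source (n := n) (x b₀))]
    exact (contDiffAt_map_inverse (𝕜 := ℝ) (n := 0) _).continuousAt
  have h2 : ContinuousWithinAt
      (fun b => (chartMetric g (x b₀) (ech n (x b₀) (x b))).inverse) S b₀ :=
    ContinuousAt.comp_continuousWithinAt
      (f := fun b => chartMetric g (x b₀) (ech n (x b₀) (x b))) h1
      (continuousWithinAt_chartMetric g hx)
  refine (ContinuousWithinAt.clm_apply h2 hη).congr_of_eventuallyEq ?_ ?_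
  · filter_upwards [eventually_mem_source (n := n) hx] with b hb using tcc_sharp g hb _
  · exact tcc_sharp g (mem_ech_source _) _

theorem continuousWithinAt_christoffelAt (hx : ContinuousWithinAt x S b₀) {s a : B → Eu n}
    (hs : ContinuousWithinAt s S b₀) (ha : ContinuousWithinAt a S b₀) :
    ContinuousWithinAt (fun b => christoffelAt g (x b₀) (ech n (x b₀) (x b)) (s b) (a b)) S b₀ := by
  have h1 := ContinuousAt.comp_continuousWithinAt (f := fun b => ech n (x b₀) (x b))
      ((contDiffAt_chartMetric g (mem_ech_source (n := n) (x b₀))).fderiv_right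
        (m := 0) (by norm_cast)).continuousAt (continuousWithinAt_ech hx)
  rw [continuousWithinAt_clm_apply]
  intro c
  simp only [christoffelAt_apply]
  have hc : ContinuousWithinAt (fun _ : B => c) S b₀ := continuousWithinAt_const
  exact continuousWithinAt_const.mul (((((h1.clm_apply ha).clm_apply hc).clm_apply hs).add
    (((h1.clm_apply hc).clm_apply ha).clm_apply hs)).sub
      (((h1.clm_apply hs).clm_apply ha).clm_apply hc))

/-- A family of tangent vectors of `T^*X` is continuous if and only if its horizontal and its
vertical part are. -/
theorem tot_iff {φ : B → Cot n X} {V : ∀ b, TangentSpace (IC n) (φ b)} :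
    ContinuousWithinAt (fun b => (⟨φ b, V b⟩ : TangentBundle (IC n) (Cot n X))) S b₀
      ↔ ContinuousWithinAt φ S b₀ ∧ VecAt (fun b => (φ b).1) (fun b => hor (V b)) S b₀ ∧
        CovAt (fun b => (φ b).1) (fun b => ver g (V b)) S b₀ := by
  have e : ContinuousWithinAt (fun b => (⟨φ b, V b⟩ : TangentBundle (IC n) (Cot n X))) S b₀
      ↔ ContinuousWithinAt φ S b₀ ∧ ContinuousWithinAt (fun b =>
        (tangentCoordChange (IC n) (φ b) (φ b₀) (φ b) (V b) : EuCot n)) S b₀ :=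
    FiberBundle.continuousWithinAt_totalSpace ..
  rw [e]
  refine and_congr_right fun hφ => ?_
  obtain ⟨hx, hξ⟩ := cov_of_cot hφ
  have hs := hξ.sharp g hx
  rw [Filter.EventuallyEq.congr_continuousWithinAt (g := fun b =>
    ((tcc n (φ b).1 (φ b₀).1 (φ b).1 (hor (V b)),
      (ver g (V b)).comp (tcc n (φ b₀).1 (φ b).1 (φ b).1) + christoffelAt g (φ b₀).1
        (ech n (φ b₀).1 (φ b).1)
        (tcc n (φ b).1 (φ b₀).1 (φ b).1 ((flat g (φ b).1).symm (toCov (φ b).2)))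
        (tcc n (φ b).1 (φ b₀).1 (φ b).1 (hor (V b)))) : EuCot n))]
  -- The change between coordinates and parts is triangular: the second coordinate is the vertical
  -- part plus a Christoffel term, which depends continuously on the base point, the covector and
  -- the horizontal part.
  · constructor
    · intro h
      have h1 := h.fst
      refine ⟨h1, ?_⟩
      have h2 := h.snd.sub (continuousWithinAt_christoffelAt g hx hs h1)
      refine h2.congr (fun b _ => ?_) ?_ <;> exact (add_sub_cancel_right _ _).symm
    · rintro ⟨h1, h2⟩
      exact h1.prodMk (ContinuousWithinAt.add h2 (continuousWithinAt_christoffelAt g hx hs h1))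
  · filter_upwards [eventually_mem_source (n := n) hx] with b hb
    exact tangent_coords g hb _
  · exact tangent_coords g (mem_ech_source _) _

theorem continuousWithinAt_compatMetric {w : Cot n X → ℝ} (hw : Continuous w) (hw0 : ∀ p, w p ≠ 0)
    {φ : B → Cot n X} {U V : ∀ b, TangentSpace (IC n) (φ b)}
    (hU : ContinuousWithinAt (fun b => (⟨φ b, U b⟩ : TangentBundle (IC n) (Cot n X))) S b₀)
    (hV : ContinuousWithinAt (fun b => (⟨φ b, V b⟩ : TangentBundle (IC n) (Cot n X))) S b₀) :
    ContinuousWithinAt (fun b => compatMetric g w (φ b) (U b) (V b)) S b₀ := by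
  obtain ⟨hφ, h1, h2⟩ := (tot_iff g).1 hU
  obtain ⟨-, h3, h4⟩ := (tot_iff g).1 hV
  have hx := (cov_of_cot hφ).1
  have hw' : ContinuousWithinAt (fun b => w (φ b)) S b₀ :=
    hw.continuousAt.comp_continuousWithinAt hφ
  simp only [compatMetric_eq]
  exact ((hw'.inv₀ (hw0 _)).mul (h2.pair hx (h4.sharp g hx))).add
    (hw'.mul ((h1.flat g hx).pair hx h3))

theorem compatMetric_comm (w : Cot n X → ℝ) {p : Cot n X} (U V : TangentSpace (IC n) p) :
    compatMetric g w p U V = compatMetric g w p V U := by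
  rw [compatMetric_eq, compatMetric_eq, flat_comm g p.1 (hor U)]
  congr 2
  rw [← flat_sharp g p.1 (ver g U), ← flat_sharp g p.1 (ver g V)]
  simp only [LinearEquiv.symm_apply_apply]
  rw [flat_comm]

theorem compatMetric_add (w : Cot n X → ℝ) {p : Cot n X} (U V V' : TangentSpace (IC n) p) :
    compatMetric g w p U (V + V') = compatMetric g w p U V + compatMetric g w p U V' := by
  simp only [compatMetric_eq, ver_add, hor_add, map_add]
  ring

theorem compatMetric_smul (w : Cot n X → ℝ) {p : Cot n X} (U : TangentSpace (IC n) p) (c : ℝ)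
    (V : TangentSpace (IC n) p) :
    compatMetric g w p U (c • V) = c * compatMetric g w p U V := by
  simp only [compatMetric_eq, ver_smul, hor_smul, map_smul, smul_eq_mul]
  ring

theorem compatMetric_pos {w : Cot n X → ℝ} (hw : ∀ p, 0 < w p) {p : Cot n X}
    {V : TangentSpace (IC n) p} (hV : V ≠ 0) : 0 < compatMetric g w p V V := by
  rw [compatMetric_eq]
  have h1 : ∀ a, 0 ≤ flat g p.1 a a := by
    intro a
    rcases eq_or_ne a 0 with rfl | h
    · simp
    · exact (flat_pos g p.1 h).le
  have e : ver g V ((flat g p.1).symm (ver g V))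
      = flat g p.1 ((flat g p.1).symm (ver g V)) ((flat g p.1).symm (ver g V)) := by
    rw [flat_sharp]
  rw [e]
  have hwp := hw p
  by_cases h : hor V = 0
  · have h2 : (flat g p.1).symm (ver g V) ≠ 0 := by
      intro h0
      apply hV
      refine ext_hor_ver g h ?_
      rw [LinearEquiv.map_eq_zero_iff] at h0
      rw [h0]
      exact ((verL g p).map_zero).symm
    have := flat_pos g p.1 h2
    have := h1 (hor V)
    positivity
  · have := flat_pos g p.1 h
    have := h1 ((flat g p.1).symm (ver g V))
    positivity

/-- A family of subspaces of the tangent spaces of `T^*X`, with the metric of `T^*X`. -/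
theorem isRiemannian_compatMetric (w : C(Cot n X, ℝ)) (hw : ∀ p, 0 < w p) (φ : B → Cot n X)
    (fib : ∀ b, Submodule ℝ (TangentSpace (IC n) (φ b))) :
    EuclFamily.IsRiemannian (⟨φ, fib, fun b => compatMetric g w (φ b)⟩ :
      EuclFamily (IC n) (Cot n X) B) where
  symm b u v := compatMetric_comm g w u v
  add b u v v' := compatMetric_add g w u v v'
  smul b u c v := compatMetric_smul g w u c v
  cont S u v hu hv b hb :=
    continuousWithinAt_compatMetric g w.continuous (fun p => (hw p).ne') (hu b hb) (hv b hb)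

theorem isRiemannian_tangentX : (tangentX g).IsRiemannian where
  symm b u v := g.symm b u v
  add b u v v' := (g.inner b u).map_add v v'
  smul b u c v := (g.inner b u).map_smul c v
  cont S u v hu hv b hb := by
    obtain ⟨hx, h1⟩ := vec_iff.1 (hu b hb)
    obtain ⟨-, h2⟩ := vec_iff.1 (hv b hb)
    exact (h1.flat g hx).pair hx h2

end Sections

/-! ### Orthonormal frames by polar decomposition -/

section Polar

variable {E H M : Type*} [NormedAddCommGroup E] [NormedSpace ℝ E] [TopologicalSpace H]
  {I : ModelWithCorners ℝ E H} [TopologicalSpace M] [ChartedSpace H M]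
  {B : Type*} [TopologicalSpace B] {n : ℕ} [IsManifold I 1 M]

/-- The tuple `e A`, with `j`-th member `∑ i, A i j e i`. -/
def combine {V : Type*} [AddCommGroup V] [Module ℝ V] (e : Fin n → V)
    (A : Matrix (Fin n) (Fin n) ℝ) : Fin n → V := fun j => ∑ i, A i j • e i

theorem combine_combine {V : Type*} [AddCommGroup V] [Module ℝ V] (e : Fin n → V)
    (A C : Matrix (Fin n) (Fin n) ℝ) : combine (combine e A) C = combine e (A * C) := by
  funext j
  simp only [combine, Finset.smul_sum, Matrix.mul_apply, Finset.sum_smul, smul_smul]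
  rw [Finset.sum_comm]
  exact Finset.sum_congr rfl fun i _ => Finset.sum_congr rfl fun k _ => by rw [mul_comm]

theorem combine_one {V : Type*} [AddCommGroup V] [Module ℝ V] (e : Fin n → V) :
    combine e 1 = e := by
  funext j
  simp [combine, Matrix.one_apply]

theorem map_combine {V W : Type*} [AddCommGroup V] [Module ℝ V] [AddCommGroup W] [Module ℝ W]
    (f : V →ₗ[ℝ] W) (e : Fin n → V) (A : Matrix (Fin n) (Fin n) ℝ) :
    (fun j => f (combine e A j)) = combine (fun i => f (e i)) A := by
  funext j
  simp [combine]

theorem combine_mem {V : Type*} [AddCommGroup V] [Module ℝ V] (e : Fin n → V)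
    (A : Matrix (Fin n) (Fin n) ℝ) (j : Fin n) :
    combine e A j ∈ Submodule.span ℝ (range e) :=
  Submodule.sum_mem _ fun i _ => Submodule.smul_mem _ _ (Submodule.subset_span ⟨i, rfl⟩)

theorem continuousWithinAt_combine {φ : B → M} {S : Set B} {b₀ : B}
    (hφ : ContinuousWithinAt φ S b₀) {e : Fin n → ∀ b, TangentSpace I (φ b)}
    (he : ∀ i, ContinuousWithinAt (fun b => (⟨φ b, e i b⟩ : TangentBundle I M)) S b₀)
    {A : B → Matrix (Fin n) (Fin n) ℝ} (hA : ContinuousWithinAt A S b₀) (j : Fin n) :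
    ContinuousWithinAt
      (fun b => (⟨φ b, combine (fun i => e i b) (A b) j⟩ : TangentBundle I M)) S b₀ := by
  have key : ∀ v : ∀ b, TangentSpace I (φ b),
      ContinuousWithinAt (fun b => (⟨φ b, v b⟩ : TangentBundle I M)) S b₀ ↔
        ContinuousWithinAt φ S b₀ ∧ ContinuousWithinAt
          (fun b => (tangentCoordChange I (φ b) (φ b₀) (φ b) (v b) : E)) S b₀ := fun v =>
    FiberBundle.continuousWithinAt_totalSpace ..
  rw [key]
  refine ⟨hφ, ?_⟩
  have e1 : ∀ b, (tangentCoordChange I (φ b) (φ b₀) (φ b)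
      (combine (fun i => e i b) (A b) j : TangentSpace I (φ b)) : E)
      = ∑ i, A b i j • tangentCoordChange I (φ b) (φ b₀) (φ b) (e i b) := by
    intro b
    exact (map_sum (tangentCoordChange I (φ b) (φ b₀) (φ b)) _ _).trans
      (Finset.sum_congr rfl fun i _ => map_smul _ _ _)
  simp only [e1]
  have hAij : ∀ i, ContinuousWithinAt (fun b => A b i j) S b₀ := fun i =>
    (continuousWithinAt_pi.1 ((continuousWithinAt_pi.1 hA) i)) j
  have := tendsto_finsetSum (Finset.univ) fun i _ => (hAij i).smul ((key (e i)).1 (he i)).2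
  exact this

namespace EuclFamily

variable {F : EuclFamily I M B} {b : B} {e e' : Fin n → TangentSpace I (F.map b)}

theorem IsRiemannian.change_combine (hF : F.IsRiemannian) (A C : Matrix (Fin n) (Fin n) ℝ) :
    F.change b (combine e A) (combine e' C) = A.transpose * F.change b e e' * C := by
  have h1 : ∀ (e : Fin n → TangentSpace I (F.map b)) (u) (C : Matrix (Fin n) (Fin n) ℝ) (j : Fin n),
      F.form b u (combine e C j) = ∑ k, F.form b u (e k) * C k j := by
    intro e u C j
    rw [combine, hF.sum_right]
    exact Finset.sum_congr rfl fun _ _ => mul_comm _ _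
  ext i j
  simp only [change, Matrix.mul_apply, Matrix.of_apply, Matrix.transpose_apply]
  rw [h1]
  refine Finset.sum_congr rfl fun k _ => ?_
  rw [hF.symm, h1]
  congr 1
  exact Finset.sum_congr rfl fun l _ => by rw [hF.symm, mul_comm]

theorem IsRiemannian.posDef_change (hF : F.IsRiemannian) (hpos : ∀ v ∈ F.fib b, v ≠ 0 → 0 < F.form b v v)
    (hmem : ∀ i, e i ∈ F.fib b) (he : LinearIndependent ℝ e) : (F.change b e e).PosDef := by
  refine Matrix.PosDef.of_dotProduct_mulVec_pos ?_ fun c hc => ?_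
  · ext i j
    simp [change, hF.symm b (e j)]
  · have h1 : F.form b (∑ i, c i • e i) (∑ i, c i • e i)
        = star c ⬝ᵥ (F.change b e e).mulVec c := by
      rw [hF.sum_right]
      simp only [dotProduct, Matrix.mulVec, star_trivial, change, Matrix.of_apply]
      refine Finset.sum_congr rfl fun i _ => ?_
      rw [hF.symm, hF.sum_right]
      congr 1
      exact Finset.sum_congr rfl fun j _ => mul_comm _ _
    rw [← h1]
    refine hpos _ (Submodule.sum_mem _ fun i _ => Submodule.smul_mem _ _ (hmem i)) fun h0 => hc ?_
    funext i
    exact Fintype.linearIndependent_iff.1 he c h0 i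

/-- The orthonormal basis obtained from the basis `e` by polar decomposition. -/
def polar (F : EuclFamily I M B) (b : B) (e : Fin n → TangentSpace I (F.map b)) :
    Fin n → TangentSpace I (F.map b) :=
  combine e (invSqrt (F.change b e e))

theorem IsRiemannian.isBasisAt_polar (hF : F.IsRiemannian) (hp : (F.change b e e).PosDef)
    (hspan : Submodule.span ℝ (range e) = F.fib b) : F.IsBasisAt b (F.polar b e) := by
  constructor
  · rw [← hspan]
    refine le_antisymm (Submodule.span_le.2 ?_) (Submodule.span_le.2 ?_)
    · rintro _ ⟨j, rfl⟩
      exact combine_mem e _ j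
    · rintro _ ⟨j, rfl⟩
      have h : e = combine (F.polar b e) (F.change b e e * invSqrt (F.change b e e)) := by
        rw [polar, combine_combine, ← mul_assoc, invSqrt_mul_mul_invSqrt hp, combine_one]
      have h2 := combine_mem (F.polar b e) (F.change b e e * invSqrt (F.change b e e)) j
      rw [← h] at h2
      exact h2
  · intro i j
    have h : F.change b (F.polar b e) (F.polar b e) = 1 := by
      rw [polar, hF.change_combine, transpose_invSqrt, invSqrt_mul_mul_invSqrt hp]
    have := congrFun (congrFun h i) j
    simpa [change, Matrix.one_apply] using this

/-- The polar decomposition is equivariant under orthogonal matrices. -/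
theorem IsRiemannian.polar_combine (hF : F.IsRiemannian) (hp : (F.change b e e).PosDef)
    {r : Matrix (Fin n) (Fin n) ℝ} (hr : r.transpose * r = 1) :
    F.polar b (combine e r) = combine (F.polar b e) r := by
  rw [polar, polar, hF.change_combine, invSqrt_conj hp hr, combine_combine, combine_combine,
    ← mul_assoc, ← mul_assoc, mul_eq_one_comm.1 hr, one_mul]

/-- Orthonormalization does not disturb an orthogonal change of basis. Elements of Pin⁺(n) over r
therefore remain valid lifts for the orthonormalized frames. -/
theorem IsRiemannian.change_polar_combine (hF : F.IsRiemannian) (hp : (F.change b e e).PosDef)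
    {r : Matrix (Fin n) (Fin n) ℝ} (hr : r.transpose * r = 1) :
    F.change b (F.polar b e) (F.polar b (combine e r)) = r := by
  rw [hF.polar_combine hp hr]
  nth_rewrite 1 [← combine_one (F.polar b e)]
  rw [hF.change_combine, polar, hF.change_combine, transpose_invSqrt, invSqrt_mul_mul_invSqrt hp]
  simp

theorem polar_of_orthonormal (h : F.change b e e = 1) : F.polar b e = e := by
  rw [polar, h, invSqrt_one, combine_one]

theorem IsRiemannian.isFrameOn_polar (hF : F.IsRiemannian) {S : Set B} (hmap : ContinuousOn F.map S)
    {e : Fin n → ∀ b, TangentSpace I (F.map b)}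
    (he : ∀ i, ContinuousOn (fun b => (⟨F.map b, e i b⟩ : TangentBundle I M)) S)
    (hp : ∀ b ∈ S, (F.change b (fun i => e i b) fun i => e i b).PosDef)
    (hspan : ∀ b ∈ S, Submodule.span ℝ (range fun i => e i b) = F.fib b) :
    F.IsFrameOn S fun j b => F.polar b (fun i => e i b) j := by
  have hc : ContinuousOn (fun b => F.change b (fun i => e i b) fun i => e i b) S :=
    continuousOn_pi.2 fun i => continuousOn_pi.2 fun j => hF.cont _ _ _ (he i) (he j)
  refine ⟨fun j b hb => ?_, fun b hb => hF.isBasisAt_polar (hp b hb) (hspan b hb)⟩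
  exact continuousWithinAt_combine (hmap b hb) (fun i => he i b hb)
    (continuousOn_invSqrt hc hp b hb) j

end EuclFamily

end Polar

/-! ### Orthonormal frames of TX -/

section FramesX

variable {n : ℕ} {X : Type*} [TopologicalSpace X] [ChartedSpace (Eu n) X]
  [IsManifold 𝓘(ℝ, Eu n) ∞ X] (g : Metric n X)

theorem continuousOn_tcc_section (x₀ : X) (a : Eu n) :
    ContinuousOn (fun y => (⟨y, tcc n x₀ y y a⟩ : TangentBundle 𝓘(ℝ, Eu n) X))
      (ech n x₀).source := by
  intro y₀ hy₀
  refine vec_iff.2 ⟨continuousWithinAt_id, ?_⟩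
  have h : ContinuousWithinAt (fun y => tcc n x₀ y₀ y a) (ech n x₀).source y₀ := by
    have := (continuousOn_tcc x₀ y₀).continuousAt
      (((isOpen_extChartAt_source (I := 𝓘(ℝ, Eu n)) x₀).inter
        (isOpen_extChartAt_source (I := 𝓘(ℝ, Eu n)) y₀)).mem_nhds ⟨hy₀, mem_ech_source y₀⟩)
    exact (this.clm_apply continuousAt_const).continuousWithinAt
  refine h.congr_of_eventuallyEq ?_ ?_
  · have h1 : ∀ᶠ y in 𝓝[(ech n x₀).source] y₀, y ∈ (ech n y₀).source :=
      mem_nhdsWithin_of_mem_nhds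
        ((isOpen_extChartAt_source (I := 𝓘(ℝ, Eu n)) y₀).mem_nhds (mem_ech_source y₀))
    filter_upwards [h1, self_mem_nhdsWithin] with y hy hy'
    exact tcc_comp hy' (mem_ech_source y) hy a
  · exact tcc_comp hy₀ (mem_ech_source _) (mem_ech_source _) a

/-- The coordinate frame of the chart at `x₀`. -/
def coordFrame (x₀ : X) (i : Fin n) (y : X) : Eu n :=
  tcc n x₀ y y (EuclideanSpace.basisFun (Fin n) ℝ i)

/-- The coordinate basis at `y` of the chart at `x₀`. -/
def coordBasis {x₀ y : X} (h : y ∈ (ech n x₀).source) : Module.Basis (Fin n) ℝ (Eu n) :=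
  (EuclideanSpace.basisFun (Fin n) ℝ).toBasis.map
    (LinearEquiv.ofLinearMap (tcc n x₀ y y).toLinearMap (tcc n y x₀ y).toLinearMap
      (LinearMap.ext fun a => tcc_tcc (mem_ech_source y) h a)
      (LinearMap.ext fun a => tcc_tcc h (mem_ech_source y) a))

theorem coordBasis_apply {x₀ y : X} (h : y ∈ (ech n x₀).source) (i : Fin n) :
    coordBasis h i = coordFrame x₀ i y := by
  simp [coordBasis, coordFrame]

theorem exists_frame_tangentX (x₀ : X) : ∃ U, IsOpen U ∧ x₀ ∈ U ∧
    ∃ e : Fin n → ∀ y, TangentSpace 𝓘(ℝ, Eu n) ((tangentX g).map y), (tangentX g).IsFrameOn U e := by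
  refine ⟨(ech n x₀).source, isOpen_extChartAt_source (I := 𝓘(ℝ, Eu n)) x₀, mem_ech_source x₀,
    _, (isRiemannian_tangentX g).isFrameOn_polar (e := fun i y => coordFrame x₀ i y)
      continuousOn_id (fun i => continuousOn_tcc_section x₀ _) (fun y hy => ?_) fun y hy => ?_⟩
  · have hli : LinearIndependent ℝ fun i => coordFrame (n := n) x₀ i y := by
      simp only [← coordBasis_apply hy]
      exact (coordBasis hy).linearIndependent
    exact (isRiemannian_tangentX g).posDef_change (fun v _ hv => g.pos y v hv)
      (fun i => (Submodule.mem_top : coordFrame x₀ i y ∈ (⊤ : Submodule ℝ (Eu n)))) hli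
  · have : (fun i => coordFrame (n := n) x₀ i y) = coordBasis hy :=
      funext fun i => (coordBasis_apply hy i).symm
    change Submodule.span (M := Eu n) ℝ (range fun i => coordFrame x₀ i y) = ⊤
    rw [this]
    exact (coordBasis hy).span_eq

theorem exists_pinCochain_tangentX [CompactSpace X] [T2Space X] :
    Nonempty (PinCochain n (tangentX g)) :=
  (isRiemannian_tangentX g).exists_pinCochain (exists_frame_tangentX g)

/-- A `g`-orthonormal basis of the tangent space at `x`. -/
theorem exists_orthonormal (x : X) : ∃ e : Fin n → Eu n,
    (∀ i j, flat g x (e i) (e j) = if i = j then 1 else 0) := by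
  obtain ⟨U, -, hx, e, he⟩ := exists_frame_tangentX g x
  exact ⟨fun i => e i x, (he.2 x hx).2⟩

end FramesX

/-! ### Complex coordinates and the fibre of the bicanonical bundle -/

section Bicanonical

set_option synthInstance.maxHeartbeats 200000

section LinearAlgebra

variable {n : ℕ} {T : Type*} [AddCommGroup T] [Module ℝ T] {J : T → T} (Φ : T ≃ₗ[ℝ] (Fin n → ℂ))
  (hJ : ∀ v, Φ (J v) = Complex.I • Φ v) (η : T [⋀^Fin n]→ₗ[ℝ] ℂ)
  (hη : ∀ v i, η (Function.update v i (J (v i))) = Complex.I * η v)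

theorem update_symm (c : Fin n → Fin n → ℂ) (i : Fin n) (a : Fin n → ℂ) :
    (fun j => Φ.symm (Function.update c i a j))
      = Function.update (fun j => Φ.symm (c j)) i (Φ.symm a) := by
  funext j
  by_cases hj : j = i
  · subst hj
    simp
  · simp [hj]

/-- The complex alternating form on `ℂⁿ` corresponding to a real alternating form which is complex
linear with respect to the complex structure `J`. -/
def complexForm : (Fin n → ℂ) [⋀^Fin n]→ₗ[ℂ] ℂ where
  toFun c := η fun i => Φ.symm (c i)
  map_update_add' := by
    intro inst c i a b
    obtain rfl : inst = instDecidableEqFin n := Subsingleton.elim _ _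
    rw [update_symm, update_symm, update_symm, map_add, η.map_update_add]
  map_update_smul' := by
    intro inst c i z a
    obtain rfl : inst = instDecidableEqFin n := Subsingleton.elim _ _
    have hI : Φ.symm (Complex.I • a) = J (Φ.symm a) := by
      rw [LinearEquiv.symm_apply_eq, hJ, LinearEquiv.apply_symm_apply]
    have hz : z • a = z.re • a + z.im • (Complex.I • a) := by
      funext k
      simp only [Pi.smul_apply, Pi.add_apply, smul_eq_mul, Complex.real_smul]
      conv_lhs => rw [← Complex.re_add_im z]
      ring
    have h3 := hη (Function.update (fun j => Φ.symm (c j)) i (Φ.symm a)) i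
    rw [Function.update_idem, Function.update_self] at h3
    rw [update_symm, update_symm, hz, map_add, map_smul, map_smul, hI, η.map_update_add,
      η.map_update_smul, η.map_update_smul, h3]
    simp only [Complex.real_smul, smul_eq_mul]
    conv_rhs => rw [← Complex.re_add_im z]
    ring
  map_eq_zero_of_eq' c i j hij hne := η.map_eq_zero_of_eq _ (by simp [hij]) hne

include hJ hη in
-- Complex alternating n-forms on ℂⁿ are multiples of the determinant, the factor being the value on
-- the standard basis.
theorem complexForm_eq (u : Fin n → T) : η u
    = η (fun i => Φ.symm (Pi.basisFun ℂ (Fin n) i)) * (Matrix.of fun i => Φ (u i)).det := by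
  have h := AlternatingMap.eq_smul_basis_det (Pi.basisFun ℂ (Fin n)) (complexForm Φ hJ η hη)
  have h1 : complexForm Φ hJ η hη (fun i => Φ (u i)) = η u := by
    change η (fun i => Φ.symm (Φ (u i))) = _
    simp
  rw [← h1, h, AlternatingMap.smul_apply, Module.Basis.det_apply, smul_eq_mul,
    ← Matrix.det_transpose (Matrix.of fun i => Φ (u i))]
  rfl

theorem tmul_eq_smul {K : Type*} [AddCommGroup K] [Module ℂ K] {η η' ζ : K} {a b : ℂ}
    (h : η = a • ζ) (h' : η' = b • ζ) : η ⊗ₜ[ℂ] η' = (a * b) • ζ ⊗ₜ[ℂ] ζ := by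
  rw [h, h', TensorProduct.smul_tmul_smul]

end LinearAlgebra

variable {n : ℕ} {X : Type*} [TopologicalSpace X] [ChartedSpace (Eu n) X]
  [IsManifold 𝓘(ℝ, Eu n) ∞ X] (g : Metric n X) (w : Cot n X → ℝ)

/-- `e` is an orthonormal basis of the tangent space at `x`. -/
def IsOrtho (x : X) (e : Fin n → Eu n) : Prop :=
  ∀ i j, flat g x (e i) (e j) = if i = j then 1 else 0

variable {g} in
theorem IsOrtho.linearIndependent {x : X} {e : Fin n → Eu n} (he : IsOrtho g x e) :
    LinearIndependent ℝ e := by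
  rw [Fintype.linearIndependent_iff]
  intro c hc i
  have h := congrArg (flat g x (e i)) hc
  simpa [he i] using h

/-- An orthonormal basis as a basis. -/
def IsOrtho.basis {g : Metric n X} {x : X} {e : Fin n → Eu n} (he : IsOrtho g x e) :
    Module.Basis (Fin n) ℝ (Eu n) :=
  basisOfLinearIndependentOfCardEqFinrank' e he.linearIndependent (by simp)

variable {g} in
theorem IsOrtho.coe_basis {x : X} {e : Fin n → Eu n} (he : IsOrtho g x e) : ⇑he.basis = e := by
  simp [IsOrtho.basis]

variable {g} in
theorem IsOrtho.expand {x : X} {e : Fin n → Eu n} (he : IsOrtho g x e) (a : Eu n) :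
    a = ∑ i, flat g x (e i) a • e i := by
  conv_lhs => rw [← he.basis.sum_repr a]
  refine Finset.sum_congr rfl fun i _ => ?_
  conv_rhs => rw [← he.basis.sum_repr a]
  simp [he.coe_basis, he i]

variable {g} in
theorem IsOrtho.form_expand {x : X} {e : Fin n → Eu n} (he : IsOrtho g x e) (η : Eu n →L[ℝ] ℝ)
    (a : Eu n) : η a = ∑ i, flat g x (e i) a * η (e i) := by
  conv_lhs => rw [he.expand a]
  simp

/-- The complex coordinates of `T_p(T^*X)` with respect to the complex structure `J_w` given by an
orthonormal basis `e` of the horizontal space. -/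
def cplx (e : Fin n → Eu n) (p : Cot n X) : TangentSpace (IC n) p →ₗ[ℝ] (Fin n → ℂ) where
  toFun V i := (flat g p.1 (e i) (hor V) : ℂ) - Complex.I * ((w p)⁻¹ * ver g V (e i) : ℝ)
  map_add' U V := by
    funext i
    simp only [hor_add, ver_add, map_add, add_apply, Pi.add_apply]
    push_cast
    ring
  map_smul' c V := by
    funext i
    simp only [hor_smul, ver_smul, map_smul, smul_apply, Pi.smul_apply, smul_eq_mul,
      RingHom.id_apply, Complex.real_smul]
    push_cast
    ring

theorem cplx_apply (e : Fin n → Eu n) {p : Cot n X} (V : TangentSpace (IC n) p) (i : Fin n) :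
    cplx g w e p V i = (flat g p.1 (e i) (hor V) : ℂ)
      - Complex.I * ((w p)⁻¹ * ver g V (e i) : ℝ) := rfl

/-- The coordinate is z = a - i w⁻¹ ♯η. Since J_w sends (a, η) to (w⁻¹ ♯η, -w ♭a), it becomes w⁻¹ ♯η
+ i a = i z. -/
theorem cplx_acs (hw : ∀ p, 0 < w p) (e : Fin n → Eu n) {p : Cot n X}
    (V : TangentSpace (IC n) p) : cplx g w e p (acs g w p V) = Complex.I • cplx g w e p V := by
  funext i
  have hne : ((w p : ℝ) : ℂ) ≠ 0 := Complex.ofReal_ne_zero.2 (hw p).ne'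
  rw [Pi.smul_apply, smul_eq_mul, cplx_apply, cplx_apply, hor_acs, ver_acs, map_smul,
    flat_comm g p.1 (e i) ((flat g p.1).symm _), flat_sharp, neg_apply, smul_apply,
    flat_comm g p.1 (hor V) (e i)]
  simp only [smul_eq_mul]
  push_cast
  field_simp
  linear_combination ((ver g V (e i) : ℝ) : ℂ) * Complex.I_sq

theorem cplx_injective (hw : ∀ p, 0 < w p) {e : Fin n → Eu n} {p : Cot n X}
    (he : IsOrtho g p.1 e) : Function.Injective (cplx g w e p) := by
  rw [injective_iff_map_eq_zero]
  intro V hV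
  have h1 : ∀ i, flat g p.1 (e i) (hor V) = 0 ∧ ver g V (e i) = 0 := by
    intro i
    have := congrFun hV i
    rw [cplx_apply, Pi.zero_apply, Complex.ext_iff] at this
    have hw' := (hw p).ne'
    simpa [hw'] using this
  refine ext_hor_ver g ?_ ?_
  · rw [he.expand (hor V)]
    simp only [h1, zero_smul, Finset.sum_const_zero]
    rfl
  · have h0 : ver g (0 : TangentSpace (IC n) p) = 0 := (verL g p).map_zero
    rw [h0]
    ext a
    rw [he.form_expand (ver g V) a]
    simp [h1]

theorem cplx_surjective (hw : ∀ p, 0 < w p) {e : Fin n → Eu n} {p : Cot n X}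
    (he : IsOrtho g p.1 e) : Function.Surjective (cplx g w e p) := by
  intro c
  refine ⟨ofHV g p (∑ i, (c i).re • e i) (-(w p) • ∑ i, (c i).im • flat g p.1 (e i)), ?_⟩
  funext i
  have hw' := (hw p).ne'
  rw [cplx_apply, hor_ofHV, ver_ofHV]
  have h1 : flat g p.1 (e i) (∑ i, (c i).re • e i) = (c i).re := by simp [he i]
  have h2 : (-(w p) • ∑ j, (c j).im • flat g p.1 (e j) : Eu n →L[ℝ] ℝ) (e i)
      = -(w p) * (c i).im := by
    rw [smul_apply, sum_apply]
    simp [he _ i]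
  rw [h1, h2]
  apply Complex.ext <;> simp [hw']

/-- The complex coordinates as an isomorphism. -/
def cplxEquiv (hw : ∀ p, 0 < w p) {e : Fin n → Eu n} {p : Cot n X} (he : IsOrtho g p.1 e) :
    TangentSpace (IC n) p ≃ₗ[ℝ] (Fin n → ℂ) :=
  LinearEquiv.ofBijective (cplx g w e p) ⟨cplx_injective g w hw he, cplx_surjective g w hw he⟩

/-- The horizontal lift of a vector. -/
def hlift (p : Cot n X) (a : Eu n) : TangentSpace (IC n) p := ofHV g p a 0

theorem cplx_hlift {e : Fin n → Eu n} {p : Cot n X} (he : IsOrtho g p.1 e) (i : Fin n) :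
    cplx g w e p (hlift g p (e i)) = Pi.basisFun ℂ (Fin n) i := by
  funext j
  rw [cplx_apply, hlift, hor_ofHV, ver_ofHV, he j i]
  by_cases h : j = i <;> simp [Pi.single_apply, h]

/-- The matrix of complex coordinates of a tuple. -/
def cplxMat (e : Fin n → Eu n) (p : Cot n X) (u : Fin n → TangentSpace (IC n) p) :
    Matrix (Fin n) (Fin n) ℂ := Matrix.of fun i => cplx g w e p (u i)

/-- The complex volume form of an orthonormal basis. -/
def volForm (e : Fin n → Eu n) (p : Cot n X) : (TangentSpace (IC n) p) [⋀^Fin n]→ₗ[ℝ] ℂ where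
  toFun u := (cplxMat g w e p u).det
  map_update_add' := by
    intro inst u i a b
    obtain rfl : inst = instDecidableEqFin n := Subsingleton.elim _ _
    have h : ∀ a, cplxMat g w e p (Function.update u i a)
        = (cplxMat g w e p u).updateRow i (cplx g w e p a) := by
      intro a
      ext j k
      by_cases hj : j = i
      · subst hj
        simp [cplxMat]
      · simp [cplxMat, hj]
    rw [h, h, h, map_add, Matrix.det_updateRow_add]
  map_update_smul' := by
    intro inst u i c a
    obtain rfl : inst = instDecidableEqFin n := Subsingleton.elim _ _
    have h : ∀ a, cplxMat g w e p (Function.update u i a)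
        = (cplxMat g w e p u).updateRow i (cplx g w e p a) := by
      intro a
      ext j k
      by_cases hj : j = i
      · subst hj
        simp [cplxMat]
      · simp [cplxMat, hj]
    rw [h, h, map_smul]
    have : c • cplx g w e p a = (c : ℂ) • cplx g w e p a := by
      funext k
      simp
    rw [this, Matrix.det_updateRow_smul]
    simp
  map_eq_zero_of_eq' u i j hij hne := by
    exact Matrix.det_zero_of_row_eq hne (congrArg (cplx g w e p) hij)

theorem volForm_apply (e : Fin n → Eu n) (p : Cot n X) (u : Fin n → TangentSpace (IC n) p) :
    volForm g w e p u = (cplxMat g w e p u).det := rfl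

theorem volForm_mem (hw : ∀ p, 0 < w p) (e : Fin n → Eu n) (p : Cot n X) :
    volForm g w e p ∈ canonicalFiber g w p := by
  intro v i
  have h : cplxMat g w e p (Function.update v i (acs g w p (v i)))
        = (cplxMat g w e p v).updateRow i (Complex.I • (cplxMat g w e p v) i) := by
    ext j k
    by_cases hj : j = i
    · subst hj
      simp [cplxMat, cplx_acs g w hw]
    · simp [cplxMat, hj]
  rw [volForm_apply, volForm_apply, h, Matrix.det_updateRow_smul, Matrix.updateRow_eq_self]

theorem volForm_hlift {e : Fin n → Eu n} {p : Cot n X} (he : IsOrtho g p.1 e) :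
    volForm g w e p (fun i => hlift g p (e i)) = 1 := by
  rw [volForm_apply]
  have : cplxMat g w e p (fun i => hlift g p (e i)) = 1 := by
    ext i j
    simp [cplxMat, cplx_hlift g w he, Matrix.one_apply, Pi.single_apply, eq_comm]
  rw [this, Matrix.det_one]

/-- Elements of `κ_p` are determined by their value on a horizontal orthonormal basis. -/
theorem canonical_eq (hw : ∀ p, 0 < w p) {e : Fin n → Eu n} {p : Cot n X} (he : IsOrtho g p.1 e)
    (η : canonicalFiber g w p) :
    η.1 = η.1 (fun i => hlift g p (e i)) • volForm g w e p := by
  ext u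
  have h := complexForm_eq (cplxEquiv g w hw he) (cplx_acs g w hw e) η.1 η.2 u
  have h2 : (fun i => (cplxEquiv g w hw he).symm (Pi.basisFun ℂ (Fin n) i))
      = fun i => hlift g p (e i) := by
    funext i
    rw [LinearEquiv.symm_apply_eq]
    exact (cplx_hlift g w he i).symm
  rw [h2] at h
  exact h

/-- The standard element of the fibre of the bicanonical bundle. -/
def stdBican (hw : ∀ p, 0 < w p) (e : Fin n → Eu n) (p : Cot n X) : BicanFiber g w p :=
  (⟨volForm g w e p, volForm_mem g w hw e p⟩ : canonicalFiber g w p) ⊗ₜ[ℂ]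
    (⟨volForm g w e p, volForm_mem g w hw e p⟩ : canonicalFiber g w p)

theorem bican_eq (hw : ∀ p, 0 < w p) {e : Fin n → Eu n} {p : Cot n X} (he : IsOrtho g p.1 e)
    (z : BicanFiber g w p) : z = evalBican g w p (fun i => hlift g p (e i))
      (fun i => hlift g p (e i)) z • stdBican g w hw e p := by
  induction z using TensorProduct.induction_on with
  | zero => simp
  | add a b ha hb =>
    conv_lhs => rw [ha, hb]
    rw [map_add, add_smul]
  | tmul η η' =>
    have h1 : η = η.1 (fun i => hlift g p (e i)) •
        (⟨volForm g w e p, volForm_mem g w hw e p⟩ : canonicalFiber g w p) :=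
      Subtype.ext (canonical_eq g w hw he η)
    have h2 : η' = η'.1 (fun i => hlift g p (e i)) •
        (⟨volForm g w e p, volForm_mem g w hw e p⟩ : canonicalFiber g w p) :=
      Subtype.ext (canonical_eq g w hw he η')
    exact tmul_eq_smul h1 h2

theorem evalBican_stdBican (hw : ∀ p, 0 < w p) (e : Fin n → Eu n) {p : Cot n X}
    (u v : Fin n → TangentSpace (IC n) p) : evalBican g w p u v (stdBican g w hw e p)
      = (cplxMat g w e p u).det * (cplxMat g w e p v).det := rfl

/-- The complex bilinear extension of the metric. -/
def cform (p : Cot n X) (U V : TangentSpace (IC n) p) : ℂ :=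
  ((flat g p.1 (hor U) (hor V) - (w p)⁻¹ * (w p)⁻¹ * ver g U ((flat g p.1).symm (ver g V)) : ℝ) : ℂ)
    - Complex.I * ((w p)⁻¹ * (ver g U (hor V) + ver g V (hor U)) : ℝ)

/-- Parseval for the orthonormal basis e. The right side no longer involves e, which is why the
square of the volume form is global although the form itself is defined only up to sign. -/
theorem cplx_dot {e : Fin n → Eu n} {p : Cot n X} (he : IsOrtho g p.1 e)
    (U V : TangentSpace (IC n) p) :
    ∑ k, cplx g w e p U k * cplx g w e p V k = cform g w p U V := by
  have h1 := he.form_expand (flat g p.1 (hor U)) (hor V)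
  have h2 := he.form_expand (ver g U) (hor V)
  have h3 := he.form_expand (ver g V) (hor U)
  have h4 : ver g U ((flat g p.1).symm (ver g V)) = ∑ k, ver g V (e k) * ver g U (e k) := by
    rw [he.form_expand (ver g U)]
    refine Finset.sum_congr rfl fun k _ => ?_
    rw [flat_comm, flat_sharp]
  rw [cform, h1, h2, h3, h4]
  simp only [cplx_apply]
  push_cast
  simp only [Finset.mul_sum, ← Finset.sum_sub_distrib, ← Finset.sum_add_distrib]
  refine Finset.sum_congr rfl fun k _ => ?_
  rw [flat_comm g p.1 (hor U) (e k)]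
  linear_combination (((w p : ℂ)⁻¹) ^ 2 * (ver g U (e k) : ℂ) * (ver g V (e k) : ℂ)) * Complex.I_sq

/-- The matrix of the complex bilinear form on two tuples. -/
def cformMat (p : Cot n X) (u v : Fin n → TangentSpace (IC n) p) : Matrix (Fin n) (Fin n) ℂ :=
  Matrix.of fun i j => cform g w p (u i) (v j)

/-- The product of the determinants of two coordinate matrices is the determinant of one times the
transpose of the other, whose entries do not depend on e. Continuity then needs no continuous choice
of orthonormal bases. -/
theorem evalBican_std (hw : ∀ p, 0 < w p) {e : Fin n → Eu n} {p : Cot n X} (he : IsOrtho g p.1 e)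
    (u v : Fin n → TangentSpace (IC n) p) :
    evalBican g w p u v (stdBican g w hw e p) = (cformMat g w p u v).det := by
  rw [evalBican_stdBican, ← Matrix.det_transpose (cplxMat g w e p v), ← Matrix.det_mul]
  congr 1
  ext i j
  simp only [Matrix.mul_apply, cplxMat, Matrix.of_apply, Matrix.transpose_apply, cformMat]
  exact cplx_dot g w he (u i) (v j)

end Bicanonical

/-! ### Bases of a subspace and their changes -/

section LinearAlgebra

variable {n : ℕ} {T : Type*} [AddCommGroup T] [Module ℝ T]

theorem span_coe_basis {V : Submodule ℝ T} (b : Module.Basis (Fin n) ℝ V) :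
    Submodule.span ℝ (range fun i => (b i : T)) = V := by
  have h : (range fun i => (b i : T)) = V.subtype '' range b := by
    rw [← range_comp]
    rfl
  rw [h, Submodule.span_image, b.span_eq, Submodule.map_top, Submodule.range_subtype]

theorem linearIndependent_coe_basis {V : Submodule ℝ T} (b : Module.Basis (Fin n) ℝ V) :
    LinearIndependent ℝ fun i => (b i : T) :=
  b.linearIndependent.map' V.subtype V.ker_subtype

theorem nonempty_basis_of_span {V : Submodule ℝ T} {u : Fin n → T} (hu : LinearIndependent ℝ u)
    (hspan : Submodule.span ℝ (range u) = V) : Nonempty (Module.Basis (Fin n) ℝ V) := by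
  rw [← hspan]
  exact ⟨Module.Basis.span hu⟩

/-- The matrix of the change between two bases of a subspace. -/
theorem exists_combine_eq {u v : Fin n → T} (hv : LinearIndependent ℝ v)
    (h : Submodule.span ℝ (range v) = Submodule.span ℝ (range u)) :
    ∃ A : Matrix (Fin n) (Fin n) ℝ, A.det ≠ 0 ∧ combine u A = v := by
  have key : ∀ {u v : Fin n → T}, Submodule.span ℝ (range v) = Submodule.span ℝ (range u) →
      ∃ A : Matrix (Fin n) (Fin n) ℝ, combine u A = v := by
    intro u v h
    have hmem : ∀ j, ∃ c : Fin n → ℝ, ∑ i, c i • u i = v j := by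
      intro j
      rw [← Submodule.mem_span_range_iff_exists_fun, ← h]
      exact Submodule.subset_span ⟨j, rfl⟩
    choose c hc using hmem
    exact ⟨Matrix.of fun i j => c j i, funext fun j => hc j⟩
  obtain ⟨A, hA⟩ := key h
  obtain ⟨C, hC⟩ := key h.symm
  refine ⟨A, ?_, hA⟩
  have h1 : combine v (C * A) = v := by rw [← combine_combine, hC, hA]
  have h2 : C * A = 1 := by
    ext i j
    have h3 : ∑ k, ((C * A) k j - (1 : Matrix (Fin n) (Fin n) ℝ) k j) • v k = 0 := by
      have h4 := congrFun (h1.trans (combine_one v).symm) j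
      simp only [combine] at h4
      simp only [sub_smul, Finset.sum_sub_distrib]
      rw [h4, sub_self]
    exact sub_eq_zero.1 (Fintype.linearIndependent_iff.1 hv _ h3 i)
  intro h0
  have := congrArg Matrix.det h2
  rw [Matrix.det_mul, h0, mul_zero, Matrix.det_one] at this
  exact zero_ne_one this

theorem div_norm_eq_of_eq_mul {a b : ℂ} {r : ℝ} (hr : 0 < r) (h : a = (r : ℂ) * b) :
    a / (‖a‖ : ℂ) = b / (‖b‖ : ℂ) := by
  rw [h, norm_mul, Complex.norm_real, Real.norm_of_nonneg hr.le]
  push_cast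
  rw [mul_div_mul_left]
  exact_mod_cast hr.ne'

end LinearAlgebra

/-! ### Canonical trivializations and the squared phase -/

section Trivialization

set_option synthInstance.maxHeartbeats 200000

variable {n : ℕ} {X : Type*} [TopologicalSpace X] [ChartedSpace (Eu n) X]
  [IsManifold 𝓘(ℝ, Eu n) ∞ X] (g : Metric n X) {w : C(Cot n X, ℝ)} (hw : ∀ p, 0 < w p)
  {B : Type*} [TopologicalSpace B]

/-- A chosen orthonormal basis at `x`. -/
def orthoAt (x : X) : Fin n → Eu n := (exists_orthonormal g x).choose

theorem isOrtho_orthoAt (x : X) : IsOrtho g x (orthoAt g x) := (exists_orthonormal g x).choose_spec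

/-- The standard section of the bicanonical bundle. -/
def stdSection (p : Cot n X) : BicanFiber g w p := stdBican g w hw (orthoAt g p.1) p

/-- The coefficient of an element of the bicanonical bundle with respect to the standard section. -/
def coef (p : Cot n X) (z : BicanFiber g w p) : ℂ :=
  evalBican g w p (fun i => hlift g p (orthoAt g p.1 i)) (fun i => hlift g p (orthoAt g p.1 i)) z

theorem eq_coef_smul (p : Cot n X) (z : BicanFiber g w p) : z = coef g p z • stdSection g hw p :=
  bican_eq g w hw (isOrtho_orthoAt g p.1) z

theorem evalBican_stdSection (p : Cot n X) (u v : Fin n → TangentSpace (IC n) p) :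
    evalBican g w p u v (stdSection g hw p) = (cformMat g w p u v).det :=
  evalBican_std g w hw (isOrtho_orthoAt g p.1) u v

include hw in
theorem evalBican_eq (p : Cot n X) (u v : Fin n → TangentSpace (IC n) p) (z : BicanFiber g w p) :
    evalBican g w p u v z = coef g p z * (cformMat g w p u v).det := by
  conv_lhs => rw [eq_coef_smul g hw p z]
  rw [map_smul, evalBican_stdSection, smul_eq_mul]

theorem coef_stdSection (p : Cot n X) : coef g p (stdSection g hw p) = 1 := by
  rw [coef, stdSection, evalBican_stdBican, ← volForm_apply,
    volForm_hlift g w (isOrtho_orthoAt g p.1), one_mul]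

theorem coef_smul (p : Cot n X) (c : ℂ) : coef g p (c • stdSection g hw p) = c := by
  have h : coef g p (c • stdSection g hw p) = c * coef g p (stdSection g hw p) := by
    simp [coef]
  rw [h, coef_stdSection, mul_one]

include hw in
theorem coef_ne_zero {p : Cot n X} {z : BicanFiber g w p} (hz : z ≠ 0) : coef g p z ≠ 0 := by
  intro h
  apply hz
  rw [eq_coef_smul g hw p z, h, zero_smul]

theorem smul_stdSection_ne_zero {p : Cot n X} {c : ℂ} (hc : c ≠ 0) : c • stdSection g hw p ≠ 0 := by
  intro h
  have := coef_smul g hw p c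
  rw [h] at this
  apply hc
  rw [← this]
  simp [coef]

include hw in
theorem continuousWithinAt_cform {φ : B → Cot n X} {U V : ∀ b, TangentSpace (IC n) (φ b)}
    {S : Set B} {b₀ : B}
    (hU : ContinuousWithinAt (fun b => (⟨φ b, U b⟩ : TangentBundle (IC n) (Cot n X))) S b₀)
    (hV : ContinuousWithinAt (fun b => (⟨φ b, V b⟩ : TangentBundle (IC n) (Cot n X))) S b₀) :
    ContinuousWithinAt (fun b => cform g w (φ b) (U b) (V b)) S b₀ := by
  obtain ⟨hφ, h1, h2⟩ := (tot_iff g).1 hU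
  obtain ⟨-, h3, h4⟩ := (tot_iff g).1 hV
  have hx := (cov_of_cot hφ).1
  have hw' : ContinuousWithinAt (fun b => (w (φ b))⁻¹) S b₀ :=
    (w.continuous.continuousAt.comp_continuousWithinAt hφ).inv₀ (hw _).ne'
  have r1 := ((h1.flat g hx).pair hx h3).sub ((hw'.mul hw').mul (h2.pair hx (h4.sharp g hx)))
  have r2 := hw'.mul ((h2.pair hx h3).add (h4.pair hx h1))
  exact (Complex.continuous_ofReal.continuousAt.comp_continuousWithinAt r1).sub
    (continuousWithinAt_const.mul
      (Complex.continuous_ofReal.continuousAt.comp_continuousWithinAt r2))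

include hw in
theorem continuousWithinAt_det_cformMat {φ : B → Cot n X}
    {U V : Fin n → ∀ b, TangentSpace (IC n) (φ b)} {S : Set B} {b₀ : B}
    (hU : ∀ i, ContinuousWithinAt
      (fun b => (⟨φ b, U i b⟩ : TangentBundle (IC n) (Cot n X))) S b₀)
    (hV : ∀ i, ContinuousWithinAt
      (fun b => (⟨φ b, V i b⟩ : TangentBundle (IC n) (Cot n X))) S b₀) :
    ContinuousWithinAt (fun b => (cformMat g w (φ b) (fun i => U i b) (fun i => V i b)).det)
      S b₀ := by
  have h : ContinuousWithinAt
      (fun b => cformMat g w (φ b) (fun i => U i b) (fun i => V i b)) S b₀ :=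
    continuousWithinAt_pi.2 fun i => continuousWithinAt_pi.2 fun j =>
      continuousWithinAt_cform g hw (hU i) (hV j)
  exact (Continuous.matrix_det continuous_id).continuousAt.comp_continuousWithinAt h

theorem continuousOn_symm_section (p₀ : Cot n X) (u : EuCot n) :
    ContinuousOn (fun p => (⟨p, (trivializationAt (EuCot n)
      (TangentSpace (IC n) : Cot n X → Type) p₀).symm p u⟩ : TangentBundle (IC n) (Cot n X)))
      (trivializationAt (EuCot n) (TangentSpace (IC n) : Cot n X → Type) p₀).baseSet := by
  refine (Trivialization.continuousOn_symm_prodMk_left (v := u)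
    (trivializationAt (EuCot n) (TangentSpace (IC n) : Cot n X → Type) p₀)).congr fun p hp => ?_
  exact Trivialization.mk_symm _ hp u

/-- A continuous multiple of the standard section is continuous. -/
theorem isContinuousSection_smul {φ : B → Cot n X} (hφ : Continuous φ) {c : B → ℂ}
    (hc : Continuous c) :
    IsContinuousSection g w φ fun b => c b • stdSection g hw (φ b) := by
  intro p₀ u v T b hb
  have h : ∀ a, ContinuousWithinAt
      (fun b => (⟨φ b, T.symm (φ b) a⟩ : TangentBundle (IC n) (Cot n X))) (φ ⁻¹' T.baseSet) b :=
    fun a => (continuousOn_symm_section p₀ a (φ b) hb).comp hφ.continuousWithinAt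
      (mapsTo_preimage _ _)
  simp only [map_smul, evalBican_stdSection, smul_eq_mul]
  exact hc.continuousWithinAt.mul (continuousWithinAt_det_cformMat g hw
    (U := fun i b => T.symm (φ b) (u i)) (V := fun i b => T.symm (φ b) (v i))
    (fun i => h (u i)) fun i => h (v i))

include hw in
/-- The coefficient of a continuous section is continuous. -/
theorem continuous_coef {s : ∀ p, BicanFiber g w p} (hs : IsContinuousSection g w id s) :
    Continuous fun p => coef g p (s p) := by
  rw [continuous_iff_continuousAt]
  intro p₀
  set T := trivializationAt (EuCot n) (TangentSpace (IC n) : Cot n X → Type) p₀ with hT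
  have hp₀ : p₀ ∈ T.baseSet := FiberBundle.mem_baseSet_trivializationAt' p₀
  -- Constant coordinate vectors which at p₀ give the horizontal orthonormal basis. The determinant
  -- for the standard section is 1 at p₀, hence nonzero nearby, so the coefficient can be recovered
  -- there as a quotient of continuous functions.
  let u : Fin n → EuCot n := fun i =>
    (T ⟨p₀, hlift g p₀ (orthoAt g p₀.1 i)⟩).2
  have hu : ∀ i, T.symm p₀ (u i) = hlift g p₀ (orthoAt g p₀.1 i) := fun i =>
    T.symm_apply_apply_mk hp₀ _
  have h1 := (hs p₀ u u).continuousAt (T.open_baseSet.mem_nhds hp₀)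
  have h2 : ContinuousAt (fun p => (cformMat g w p (fun i => T.symm p (u i))
      (fun i => T.symm p (u i))).det) p₀ := by
    rw [← continuousWithinAt_univ]
    have : ∀ i, ContinuousWithinAt (fun p => (⟨p, T.symm p (u i)⟩ :
        TangentBundle (IC n) (Cot n X))) univ p₀ := fun i =>
      ((continuousOn_symm_section p₀ (u i)).continuousAt
        (T.open_baseSet.mem_nhds hp₀)).continuousWithinAt
    exact continuousWithinAt_det_cformMat g hw (φ := fun p => p) (U := fun i p => T.symm p (u i))
      (V := fun i p => T.symm p (u i)) this this
  have h3 : (cformMat g w p₀ (fun i => T.symm p₀ (u i)) (fun i => T.symm p₀ (u i))).det = 1 := by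
    simp only [hu]
    rw [← evalBican_stdSection g hw]
    exact coef_stdSection g hw p₀
  refine (h1.div h2 (by rw [h3]; exact one_ne_zero)).congr_of_eventuallyEq ?_
  filter_upwards [h2.eventually_ne (by rw [h3]; exact one_ne_zero)] with p hp
  have := evalBican_eq g hw p (fun i => T.symm p (u i)) (fun i => T.symm p (u i)) (s p)
  exact (eq_div_iff hp).2 this.symm

theorem christoffel_zero (x : X) (a : Eu n) : christoffel g ⟨x, 0⟩ a = 0 := by
  rw [christoffel_eq]
  ext b
  have h : (flat g x).symm (toCov (0 : CotSpace n X x)) = 0 := (flat g x).symm.map_zero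
  rw [h, christoffelAt_apply]
  rw [(fderiv ℝ (chartMetric g x) (ech n x x)).map_zero, ContinuousLinearMap.map_zero,
    ContinuousLinearMap.map_zero, zero_apply, zero_apply, add_zero, sub_zero, mul_zero]

theorem hlift_zero (x : X) (a : Eu n) : hlift g ⟨x, 0⟩ a = ofModel ⟨x, 0⟩ (a, 0) := by
  rw [hlift, ofHV, christoffel_zero, add_zero]

theorem det_cformMat_ortho (hw0 : ∀ x : X, w ⟨x, 0⟩ = 1) {x : X} {e : Fin n → Eu n}
    (he : IsOrtho g x e) : (cformMat g w ⟨x, 0⟩ (fun i => ofModel ⟨x, 0⟩ (e i, 0))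
      (fun i => ofModel ⟨x, 0⟩ (e i, 0))).det = 1 := by
  have h : cformMat g w ⟨x, 0⟩ (fun i => ofModel ⟨x, 0⟩ (e i, 0))
      (fun i => ofModel ⟨x, 0⟩ (e i, 0)) = 1 := by
    ext i j
    simp only [cformMat, Matrix.of_apply, ← hlift_zero g, cform, hlift, hor_ofHV, ver_ofHV]
    rw [he i j, Matrix.one_apply]
    by_cases h : i = j <;> simp [h]
  rw [h, Matrix.det_one]

/-- A multiple of the standard section is normalized if and only if the coefficient is `1` over the
zero section. -/
theorem isNormalized_smul (hw0 : ∀ x : X, w ⟨x, 0⟩ = 1) {c : Cot n X → ℂ}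
    (hc : ∀ x, c ⟨x, 0⟩ = 1) : IsNormalized g w fun p => c p • stdSection g hw p := by
  intro x e he
  rw [map_smul, evalBican_stdSection, det_cformMat_ortho g hw0 he, hc]
  simp

theorem coef_of_isNormalized {s : ∀ p, BicanFiber g w p}
    (hs : IsNormalized g w s) (x : X) : coef g ⟨x, 0⟩ (s ⟨x, 0⟩) = 1 := by
  rw [coef]
  simp only [hlift_zero]
  exact hs x (orthoAt g x) (isOrtho_orthoAt g x)

include hw in
theorem nonempty_canonicalTrivialization (hw0 : ∀ x : X, w ⟨x, 0⟩ = 1) :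
    Nonempty (CanonicalTrivialization g w) :=
  ⟨{ toFun := fun p => (1 : ℂ) • stdSection g hw p
     continuous := isContinuousSection_smul g hw continuous_id (c := fun _ => 1) continuous_const
     ne_zero := fun p => smul_stdSection_ne_zero g hw one_ne_zero
     normalized := isNormalized_smul g hw hw0 (c := fun _ => 1) fun _ => rfl }⟩

/-- Fibrewise multiplication of `T^*X` by real numbers. -/
def cotScale (t : ℝ) (p : Cot n X) : Cot n X := ⟨p.1, t • p.2⟩

theorem continuous_cotScale {t : B → ℝ} (ht : Continuous t) {φ : B → Cot n X} (hφ : Continuous φ) :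
    Continuous fun b => cotScale (t b) (φ b) := by
  rw [continuous_iff_continuousAt]
  intro b
  rw [← continuousWithinAt_univ]
  obtain ⟨h1, h2⟩ := cov_of_cot (hφ.continuousWithinAt (s := univ) (x := b))
  exact cov_iff.2 ⟨h1, h2.smul ht.continuousWithinAt⟩

theorem cotScale_one (p : Cot n X) : cotScale 1 p = p := by
  simp [cotScale]

theorem cotScale_zero (p : Cot n X) : cotScale 0 p = ⟨p.1, 0⟩ := by
  simp [cotScale]

theorem cotScale_zeroSection (t : ℝ) (x : X) : cotScale t (⟨x, 0⟩ : Cot n X) = ⟨x, 0⟩ := by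
  simp [cotScale]

include hw in
/-- Any two canonical trivializations are homotopic. -/
theorem CanonicalTrivialization.homotopic (hw0 : ∀ x : X, w ⟨x, 0⟩ = 1)
    (s s' : CanonicalTrivialization g w) : s.Homotopic s' := by
  set c : Cot n X → ℂ := fun p => coef g p (s.toFun p) with hc
  set c' : Cot n X → ℂ := fun p => coef g p (s'.toFun p) with hc'
  have h1 : Continuous c := continuous_coef g hw s.continuous
  have h1' : Continuous c' := continuous_coef g hw s'.continuous
  have h2 : ∀ p, c p ≠ 0 := fun p => coef_ne_zero g hw (s.ne_zero p)
  have h2' : ∀ p, c' p ≠ 0 := fun p => coef_ne_zero g hw (s'.ne_zero p)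
  have h3 : ∀ x, c ⟨x, 0⟩ = 1 := coef_of_isNormalized g s.normalized
  have h3' : ∀ x, c' ⟨x, 0⟩ = 1 := coef_of_isNormalized g s'.normalized
  let m : unitInterval × Cot n X → Cot n X := fun q => cotScale (q.1 : ℝ) q.2
  have hm : Continuous m :=
    continuous_cotScale (continuous_subtype_val.comp continuous_fst) continuous_snd
  -- The quotient c'/c is taken at t p. At t = 0 this point is in the zero section, where the
  -- quotient is 1 and H = c; at t = 1 one gets H = c'. Points of the zero section do not move, so
  -- every stage is normalized.
  let H : unitInterval × Cot n X → ℂ := fun q => c q.2 * (c' (m q) / c (m q))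
  have hH : Continuous H := (h1.comp continuous_snd).mul
    ((h1'.comp hm).div (h1.comp hm) fun q => h2 _)
  refine ⟨fun q => H q • stdSection g hw q.2, isContinuousSection_smul g hw continuous_snd hH,
    fun q => smul_stdSection_ne_zero g hw (mul_ne_zero (h2 _) (div_ne_zero (h2' _) (h2 _))),
    fun t => isNormalized_smul g hw hw0 (c := fun p => H (t, p)) fun x => ?_, fun p => ?_,
    fun p => ?_⟩
  · simp only [H, m, cotScale_zeroSection, h3, h3']
    norm_num
  · have : H (0, p) = c p := by
      simp only [H, m]
      rw [Set.Icc.coe_zero, cotScale_zero, h3, h3']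
      norm_num
    exact (congrArg (· • stdSection g hw p) this).trans (eq_coef_smul g hw p _).symm
  · have : H (1, p) = c' p := by
      simp only [H, m]
      rw [Set.Icc.coe_one, cotScale_one, mul_div_cancel₀ _ (h2 p)]
    exact (congrArg (· • stdSection g hw p) this).trans (eq_coef_smul g hw p _).symm

/-! ### The squared phase of Lagrangian subspaces -/

/-- The symplectic form as a bilinear map. -/
def sympL (p : Cot n X) : TangentSpace (IC n) p →ₗ[ℝ] TangentSpace (IC n) p →ₗ[ℝ] ℝ :=
  LinearMap.mk₂ ℝ (symplectic p)
    (fun U V W => by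
      have h1 : toModel (U + V) = toModel U + toModel V := rfl
      simp only [symplectic, h1, Prod.fst_add, Prod.snd_add, add_apply, map_add]
      ring)
    (fun c U W => by
      have h1 : toModel (c • U) = c • toModel U := rfl
      simp only [symplectic, h1, Prod.smul_fst, Prod.smul_snd, smul_apply, map_smul, smul_eq_mul]
      ring)
    (fun U V W => by
      have h1 : toModel (V + W) = toModel V + toModel W := rfl
      simp only [symplectic, h1, Prod.fst_add, Prod.snd_add, add_apply, map_add]
      ring)
    (fun c U W => by
      have h1 : toModel (c • W) = c • toModel W := rfl
      simp only [symplectic, h1, Prod.smul_fst, Prod.smul_snd, smul_apply, map_smul, smul_eq_mul]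
      ring)

theorem sympL_apply (p : Cot n X) (U V : TangentSpace (IC n) p) :
    sympL p U V = symplectic p U V := rfl

include hw in
-- Lagrangian subspaces are totally real. A complex relation among the u_i gives a + J b = 0 with a
-- and b in their real span, so ω(b, J b) = -ω(b, a) = 0. Positivity forces b = 0, then a = 0, and
-- the relation is trivial.
theorem det_cplxMat_ne_zero {p : Cot n X} {e : Fin n → Eu n} (he : IsOrtho g p.1 e)
    {u : Fin n → TangentSpace (IC n) p} (hu : LinearIndependent ℝ u)
    (hlag : ∀ i j, symplectic p (u i) (u j) = 0) : (cplxMat g w e p u).det ≠ 0 := by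
  intro hdet
  obtain ⟨c, hc, h⟩ := Matrix.exists_vecMul_eq_zero_iff.2 hdet
  set a := ∑ i, (c i).re • u i with ha
  set b := ∑ i, (c i).im • u i with hb
  have h1 : cplx g w e p (a + acs g w p b) = 0 := by
    rw [map_add, cplx_acs g w hw, ha, hb, map_sum, map_sum]
    funext j
    have hj := congrFun h j
    simp only [Matrix.vecMul, dotProduct, cplxMat, Matrix.of_apply, Pi.zero_apply] at hj
    rw [Pi.zero_apply, ← hj]
    simp only [map_smul, Pi.add_apply, Finset.sum_apply, Pi.smul_apply, Complex.real_smul,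
      smul_eq_mul, Finset.mul_sum, ← Finset.sum_add_distrib]
    refine Finset.sum_congr rfl fun i _ => ?_
    conv_rhs => rw [← Complex.re_add_im (c i)]
    ring
  have h2 : a + acs g w p b = 0 := cplx_injective g w hw he (h1.trans (map_zero _).symm)
  have h3 : symplectic p b a = 0 := by
    rw [← sympL_apply, ha, hb]
    simp [sympL_apply, hlag]
  have hb0 : b = 0 := by
    by_contra hne
    have := compatMetric_pos g hw hne
    rw [compatMetric, eq_neg_of_add_eq_zero_right h2, ← sympL_apply, map_neg, sympL_apply, h3,
      neg_zero] at this
    exact lt_irrefl _ this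
  have ha0 : a = 0 := by
    refine cplx_injective g w hw he ?_
    rw [map_add, cplx_acs g w hw, hb0, map_zero, smul_zero, add_zero] at h1
    rw [h1, map_zero]
  apply hc
  funext i
  exact Complex.ext (Fintype.linearIndependent_iff.1 hu _ ha0 i)
    (Fintype.linearIndependent_iff.1 hu _ hb0 i)

theorem det_cplxMat_combine (p : Cot n X) (e : Fin n → Eu n) (u : Fin n → TangentSpace (IC n) p)
    (A : Matrix (Fin n) (Fin n) ℝ) :
    (cplxMat g w e p (combine u A)).det = (A.det : ℂ) * (cplxMat g w e p u).det := by
  have h : cplxMat g w e p (combine u A) = (A.map Complex.ofReal).transpose * cplxMat g w e p u := by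
    ext i j
    simp only [cplxMat, Matrix.of_apply, combine, map_sum, map_smul, Finset.sum_apply,
      Pi.smul_apply, Matrix.mul_apply, Matrix.transpose_apply, Matrix.map_apply, Complex.real_smul]
  rw [h, Matrix.det_mul, Matrix.det_transpose]
  congr 1
  exact (RingHom.map_det Complex.ofRealHom A).symm

include hw in
theorem evalBican_diag (p : Cot n X) (z : BicanFiber g w p) (v : Fin n → TangentSpace (IC n) p) :
    evalBican g w p v v z = coef g p z * (cplxMat g w (orthoAt g p.1) p v).det ^ 2 := by
  conv_lhs => rw [eq_coef_smul g hw p z]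
  rw [map_smul, stdSection, evalBican_stdBican, smul_eq_mul, sq]

include hw in
-- The square makes the factor positive for an invertible matrix: the normalized value depends
-- neither on the basis nor on an orientation.
theorem evalBican_combine (p : Cot n X) (z : BicanFiber g w p) (u : Fin n → TangentSpace (IC n) p)
    (A : Matrix (Fin n) (Fin n) ℝ) : evalBican g w p (combine u A) (combine u A) z
      = ((A.det ^ 2 : ℝ) : ℂ) * evalBican g w p u u z := by
  rw [evalBican_diag g hw, evalBican_diag g hw, det_cplxMat_combine]
  push_cast
  ring

include hw in
theorem evalBican_diag_ne_zero {p : Cot n X} {z : BicanFiber g w p} (hz : z ≠ 0)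
    {u : Fin n → TangentSpace (IC n) p} (hu : LinearIndependent ℝ u)
    (hlag : ∀ i j, symplectic p (u i) (u j) = 0) : evalBican g w p u u z ≠ 0 := by
  rw [evalBican_diag g hw]
  exact mul_ne_zero (coef_ne_zero g hw hz)
    (pow_ne_zero 2 (det_cplxMat_ne_zero g hw (isOrtho_orthoAt g p.1) hu hlag))

variable {g} in
theorem squaredPhase_of_basis (s : CanonicalTrivialization g w) {p : Cot n X}
    {V : Submodule ℝ (TangentSpace (IC n) p)} (hne : Nonempty (Module.Basis (Fin n) ℝ V)) :
    ∃ v : Fin n → TangentSpace (IC n) p, LinearIndependent ℝ v ∧ Submodule.span ℝ (range v) = V ∧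
      squaredPhase s p V
        = evalBican g w p v v (s.toFun p) / (‖evalBican g w p v v (s.toFun p)‖ : ℂ) :=
  ⟨fun i => (hne.some i : TangentSpace (IC n) p), linearIndependent_coe_basis hne.some,
    span_coe_basis hne.some, dif_pos hne⟩

include hw in
/-- The squared phase can be computed in any basis. -/
theorem squaredPhase_eq (s : CanonicalTrivialization g w) {p : Cot n X}
    {V : Submodule ℝ (TangentSpace (IC n) p)} {u : Fin n → TangentSpace (IC n) p}
    (hu : LinearIndependent ℝ u) (hspan : Submodule.span ℝ (range u) = V) :
    squaredPhase s p V
      = evalBican g w p u u (s.toFun p) / (‖evalBican g w p u u (s.toFun p)‖ : ℂ) := by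
  have hne : Nonempty (Module.Basis (Fin n) ℝ V) := nonempty_basis_of_span hu hspan
  obtain ⟨v, hv, hv', h⟩ := squaredPhase_of_basis s hne
  obtain ⟨A, hA0, hA⟩ := exists_combine_eq (u := u) hv (hv'.trans hspan.symm)
  have h1 := evalBican_combine g hw p (s.toFun p) u A
  rw [hA] at h1
  rw [h]
  exact div_norm_eq_of_eq_mul (sq_pos_of_ne_zero hA0) h1

end Trivialization

/-! ### Tangent spaces of subsets that are linear in a chart -/

section TangentOf

variable {E H M : Type*} [NormedAddCommGroup E] [NormedSpace ℝ E] [TopologicalSpace H]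
  {I : ModelWithCorners ℝ E H} [TopologicalSpace M] [ChartedSpace H M]
  {E' : Type*} [NormedAddCommGroup E'] [NormedSpace ℝ E']

theorem HasDerivAt.mem_of_eventually_mem {K : Submodule ℝ E'} (hK : IsClosed (K : Set E'))
    {c : ℝ → E'} {v : E'} {t : ℝ} (h : HasDerivAt c v t) (hc : ∀ᶠ s in 𝓝 t, c s ∈ K)
    : v ∈ K := by
  have h1 := hasDerivAt_iff_tendsto_slope.1 h
  refine hK.mem_of_tendsto h1 ?_
  filter_upwards [hc.filter_mono nhdsWithin_le_nhds] with s hs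
  rw [slope_def_module]
  exact K.smul_mem _ (K.sub_mem hs hc.self_of_nhds)

/-- The tangent space of a subset which is a linear subspace in a chart. -/
theorem tangentOf_eq_comap {S : Set M} {p : M} {κ : M → E'} {μ : E' → M} {K : Submodule ℝ E'}
    (hK : IsClosed (K : Set E')) {A : TangentSpace I p →L[ℝ] E'}
    (hκ : HasMFDerivAt I 𝓘(ℝ, E') κ p A) (hμ : MDifferentiableAt 𝓘(ℝ, E') I μ (κ p))
    (h1 : ∀ᶠ q in 𝓝 p, μ (κ q) = q) (h2 : ∀ᶠ v in 𝓝 (κ p), κ (μ v) = v)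
    (hS : ∀ᶠ q in 𝓝 p, q ∈ S ↔ κ q ∈ K) (hp : p ∈ S) :
    tangentOf I S p = K.comap (A : TangentSpace I p →ₗ[ℝ] E') := by
  have hp1 : μ (κ p) = p := h1.self_of_nhds
  apply le_antisymm
  · refine Submodule.span_le.2 ?_
    rintro v ⟨c, rfl, hcS, hc⟩
    have h3 : HasMFDerivAt 𝓘(ℝ, ℝ) 𝓘(ℝ, E') (κ ∘ c) 0 _ := hκ.comp 0 hc
    have h4 : HasDerivAt (κ ∘ c) (A v) 0 := by
      have h : HasMFDerivAt 𝓘(ℝ, ℝ) 𝓘(ℝ, E') (κ ∘ c) 0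
          (ContinuousLinearMap.toSpanSingleton ℝ (A v) : ℝ →L[ℝ] E') :=
        h3.congr_mfderiv (ContinuousLinearMap.ext fun t => A.map_smul (t : ℝ) v)
      exact hasDerivAt_iff_hasFDerivAt.2 h.hasFDerivAt
    have h5 : ∀ᶠ s in 𝓝 (0 : ℝ), (κ ∘ c) s ∈ K := by
      filter_upwards [hcS, hc.continuousAt.eventually hS] with s hs hs'
      exact hs'.1 hs
    exact HasDerivAt.mem_of_eventually_mem hK h4 h5
  · intro v hv
    change A v ∈ K at hv
    -- The straight line in the chart with direction A v stays in K; carried back by μ it is a curve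
    -- in S, with velocity v because μ ∘ κ is the identity near p.
    refine Submodule.subset_span ⟨fun t => μ (κ p + t • A v), by simp [hp1], ?_, ?_⟩
    · have hl : Tendsto (fun t : ℝ => κ p + t • A v) (𝓝 0) (𝓝 (κ p)) := by
        have : Continuous fun t : ℝ => κ p + t • A v := by fun_prop
        simpa using this.tendsto 0
      have hm := hμ.continuousAt.tendsto
      rw [hp1] at hm
      filter_upwards [hl.eventually h2, (hm.comp hl).eventually hS] with t ht ht'
      refine ht'.2 ?_
      simp only [Function.comp_apply]
      rw [ht]
      exact K.add_mem (hS.self_of_nhds.1 hp) (K.smul_mem _ hv)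
    · have hl : HasMFDerivAt 𝓘(ℝ, ℝ) 𝓘(ℝ, E') (fun t : ℝ => κ p + t • A v) 0
          (ContinuousLinearMap.toSpanSingleton ℝ (A v)) := by
        have := ((hasDerivAt_id (0 : ℝ)).smul_const (A v)).const_add (κ p)
        rw [one_smul] at this
        exact this.hasFDerivAt.hasMFDerivAt
      have e0 : κ p + (0 : ℝ) • A v = κ p := by simp
      have hμ' := hμ.hasMFDerivAt
      have hμ2 : HasMFDerivAt 𝓘(ℝ, E') I μ (κ p + (0 : ℝ) • A v) (mfderiv 𝓘(ℝ, E') I μ (κ p)) := by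
        rw [e0]
        exact hμ'
      have hc := HasMFDerivAt.comp (0 : ℝ) hμ2 hl
      have hid : HasMFDerivAt I I (μ ∘ κ) p _ := HasMFDerivAt.comp p hμ' hκ
      have hid' : HasMFDerivAt I I (μ ∘ κ) p (ContinuousLinearMap.id ℝ (TangentSpace I p)) :=
        (hasMFDerivAt_id p).congr_of_eventuallyEq h1
      have hu := hasMFDerivAt_unique hid hid'
      refine hc.congr_mfderiv (ContinuousLinearMap.ext fun (t : ℝ) => Eq.symm ?_)
      have h6 := DFunLike.congr_fun hu (t • v)
      change t • v = mfderiv 𝓘(ℝ, E') I μ (κ p) (t • A v)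
      refine h6.symm.trans ?_
      change mfderiv 𝓘(ℝ, E') I μ (κ p) (A (t • v)) = _
      rw [map_smul]

end TangentOf

/-! ### The lift of a local diffeomorphism to covectors -/

section CotangentLift

variable {E : Type*} [NormedAddCommGroup E] [NormedSpace ℝ E]

/-- The map induced on cotangent vectors by the local diffeomorphism `θ` with inverse `ψ`, after
subtraction of the differential of `F`. -/
def covLift (θ ψ : E → E) (F : E → ℝ) (v : E × (E →L[ℝ] ℝ)) : E × (E →L[ℝ] ℝ) :=
  (θ v.1, (v.2 - fderiv ℝ F v.1).comp (fderiv ℝ ψ (θ v.1)))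

/-- The inverse of `covLift`. -/
def covDrop (θ ψ : E → E) (F : E → ℝ) (v : E × (E →L[ℝ] ℝ)) : E × (E →L[ℝ] ℝ) :=
  (ψ v.1, v.2.comp (fderiv ℝ θ (ψ v.1)) + fderiv ℝ F (ψ v.1))

/-- `θ` and `ψ` are mutually inverse local diffeomorphisms of class `C²` near `u` and `θ u`. -/
structure IsLocalInv (θ ψ : E → E) (u : E) : Prop where
  left : ∀ᶠ v in 𝓝 u, ψ (θ v) = v
  right : ∀ᶠ v in 𝓝 (θ u), θ (ψ v) = v
  smooth : ContDiffAt ℝ 2 θ u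
  smooth_symm : ContDiffAt ℝ 2 ψ (θ u)

variable {θ ψ : E → E} {u : E} {F : E → ℝ} {c : E →L[ℝ] ℝ}

theorem ContDiffAt.hasFDerivAt_fderiv {E' : Type*} [NormedAddCommGroup E'] [NormedSpace ℝ E']
    {f : E → E'} (h : ContDiffAt ℝ 2 f u) :
    HasFDerivAt (fderiv ℝ f) (fderiv ℝ (fderiv ℝ f) u) u :=
  ((h.fderiv_right (m := 1) (by norm_num)).differentiableAt (by simp)).hasFDerivAt

theorem ContDiffAt.eventually_two {E' : Type*} [NormedAddCommGroup E'] [NormedSpace ℝ E']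
    {f : E → E'} (h : ContDiffAt ℝ 2 f u) : ∀ᶠ v in 𝓝 u, ContDiffAt ℝ 2 f v :=
  h.eventually (by simp)

theorem IsLocalInv.eventually (h : IsLocalInv θ ψ u) : ∀ᶠ v in 𝓝 u, IsLocalInv θ ψ v := by
  have hc := h.smooth.continuousAt
  filter_upwards [h.left.eventually_nhds, hc.eventually h.right.eventually_nhds,
    ContDiffAt.eventually_two h.smooth,
    hc.eventually (ContDiffAt.eventually_two h.smooth_symm)] with v h1 h2 h3 h4
  exact ⟨h1, h2, h3, h4⟩

theorem IsLocalInv.symm (h : IsLocalInv θ ψ u) : IsLocalInv ψ θ (θ u) := by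
  have e : ψ (θ u) = u := h.left.self_of_nhds
  refine ⟨h.right, ?_, h.smooth_symm, ?_⟩ <;> rw [e]
  exacts [h.left, h.smooth]

theorem IsLocalInv.fderiv_fderiv (h : IsLocalInv θ ψ u) (a : E) :
    fderiv ℝ ψ (θ u) (fderiv ℝ θ u a) = a := by
  have h1 := (h.smooth_symm.differentiableAt (by simp)).hasFDerivAt.comp u
    (h.smooth.differentiableAt (by simp)).hasFDerivAt
  have h2 : HasFDerivAt (ψ ∘ θ) (ContinuousLinearMap.id ℝ E) u :=
    (hasFDerivAt_id u).congr_of_eventuallyEq h.left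
  exact DFunLike.congr_fun (h1.unique h2) a

theorem IsLocalInv.fderiv_fderiv' (h : IsLocalInv θ ψ u) (a : E) :
    fderiv ℝ θ u (fderiv ℝ ψ (θ u) a) = a := by
  have := h.symm.fderiv_fderiv a
  rwa [h.left.self_of_nhds] at this

/-- The derivative of `covLift`. -/
def covLiftD (θ ψ : E → E) (F : E → ℝ) (v : E × (E →L[ℝ] ℝ)) :
    E × (E →L[ℝ] ℝ) →L[ℝ] E × (E →L[ℝ] ℝ) :=
  fderiv ℝ (covLift θ ψ F) v

/-- Chain and product rules. The covector component contains derivatives of ψ and of F, so its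
derivative contains their second derivatives; this is where class C² is needed. -/
theorem hasFDerivAt_covLift (h : IsLocalInv θ ψ u) (hF : ContDiffAt ℝ 2 F u) :
    HasFDerivAt (covLift θ ψ F) (covLiftD θ ψ F (u, c)) (u, c) ∧
    ∀ V, covLiftD θ ψ F (u, c) V = (fderiv ℝ θ u V.1,
      (V.2 - fderiv ℝ (fderiv ℝ F) u V.1).comp (fderiv ℝ ψ (θ u))
        + (c - fderiv ℝ F u).comp (fderiv ℝ (fderiv ℝ ψ) (θ u) (fderiv ℝ θ u V.1))) := by
  have h1 : HasFDerivAt (fun v : E × (E →L[ℝ] ℝ) => θ v.1)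
      ((fderiv ℝ θ u).comp (.fst ℝ _ _)) (u, c) :=
    HasFDerivAt.comp (f := Prod.fst) (x := (u, c))
      (h.smooth.differentiableAt (by simp)).hasFDerivAt hasFDerivAt_fst
  have h2 : HasFDerivAt (fun v : E × (E →L[ℝ] ℝ) => fderiv ℝ ψ (θ v.1)) _ (u, c) :=
    HasFDerivAt.comp (f := fun v : E × (E →L[ℝ] ℝ) => θ v.1) (x := (u, c))
      (ContDiffAt.hasFDerivAt_fderiv h.smooth_symm) h1
  have h3 : HasFDerivAt (fun v : E × (E →L[ℝ] ℝ) => fderiv ℝ F v.1) _ (u, c) :=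
    HasFDerivAt.comp (f := Prod.fst) (x := (u, c))
      (ContDiffAt.hasFDerivAt_fderiv hF) hasFDerivAt_fst
  have h4 := h1.prodMk (((hasFDerivAt_snd (𝕜 := ℝ) (E := E) (F := E →L[ℝ] ℝ)
    (p := (u, c))).sub h3).clm_comp h2)
  have h5 : HasFDerivAt (covLift θ ψ F) _ (u, c) := h4
  refine ⟨h5.differentiableAt.hasFDerivAt, fun V => ?_⟩
  rw [covLiftD, h5.fderiv]
  exact Prod.ext rfl (add_comm _ _)

theorem differentiableAt_covDrop (h : IsLocalInv θ ψ u) (hF : ContDiffAt ℝ 2 F u) :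
    DifferentiableAt ℝ (covDrop θ ψ F) (covLift θ ψ F (u, c)) := by
  have e : ψ (θ u) = u := h.left.self_of_nhds
  set γ := (covLift θ ψ F (u, c)).2
  have e1 : covLift θ ψ F (u, c) = (θ u, γ) := rfl
  rw [e1]
  have h1 : DifferentiableAt ℝ (fun v : E × (E →L[ℝ] ℝ) => ψ v.1) (θ u, γ) :=
    DifferentiableAt.comp (f := Prod.fst) (θ u, γ) (h.smooth_symm.differentiableAt (by simp))
      differentiableAt_fst
  have h2 : DifferentiableAt ℝ (fun v : E × (E →L[ℝ] ℝ) => fderiv ℝ θ (ψ v.1)) (θ u, γ) := by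
    refine DifferentiableAt.comp (f := fun v : E × (E →L[ℝ] ℝ) => ψ v.1) (θ u, γ) ?_ h1
    simp only [e]
    exact (ContDiffAt.hasFDerivAt_fderiv h.smooth).differentiableAt
  have h3 : DifferentiableAt ℝ (fun v : E × (E →L[ℝ] ℝ) => fderiv ℝ F (ψ v.1)) (θ u, γ) := by
    refine DifferentiableAt.comp (f := fun v : E × (E →L[ℝ] ℝ) => ψ v.1) (θ u, γ) ?_ h1
    simp only [e]
    exact (ContDiffAt.hasFDerivAt_fderiv hF).differentiableAt
  exact h1.prodMk ((differentiableAt_snd.clm_comp h2).add h3)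

theorem covDrop_covLift (h : IsLocalInv θ ψ u) : covDrop θ ψ F (covLift θ ψ F (u, c)) = (u, c) := by
  have e : ψ (θ u) = u := h.left.self_of_nhds
  refine Prod.ext e ?_
  ext a
  simp [covDrop, covLift, e, h.fderiv_fderiv]

theorem covLift_covDrop (h : IsLocalInv ψ θ u) : covLift θ ψ F (covDrop θ ψ F (u, c)) = (u, c) := by
  have e : θ (ψ u) = u := h.left.self_of_nhds
  refine Prod.ext e ?_
  ext a
  simp [covDrop, covLift, e, h.fderiv_fderiv]

theorem eventually_covDrop_covLift (h : IsLocalInv θ ψ u) :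
    ∀ᶠ v in 𝓝 (u, c), covDrop θ ψ F (covLift θ ψ F v) = v := by
  filter_upwards [(continuous_fst.tendsto (u, c)).eventually h.eventually] with v hv
  exact covDrop_covLift hv

theorem eventually_covLift_covDrop (h : IsLocalInv θ ψ u) {γ : E →L[ℝ] ℝ} :
    ∀ᶠ v in 𝓝 (θ u, γ), covLift θ ψ F (covDrop θ ψ F v) = v := by
  filter_upwards [(continuous_fst.tendsto (θ u, γ)).eventually h.symm.eventually] with v hv
  exact covLift_covDrop hv

end CotangentLift

/-! ### Pulling back a basis along an injective map -/

section LinearAlgebra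

/-- In the application L is the derivative of the straightening chart and ι parametrizes the model
subspace, so that a tangent frame is found by solving for preimages of model vectors. -/
theorem basis_of_map_basis {n : ℕ} {T F E : Type*} [AddCommGroup T] [Module ℝ T] [AddCommGroup F]
    [Module ℝ F] [AddCommGroup E] [Module ℝ E] {L : T →ₗ[ℝ] F} (hL : Function.Injective L)
    {ι : E →ₗ[ℝ] F} (hι : Function.Injective ι) (b : Module.Basis (Fin n) ℝ E) {e : Fin n → T}
    (he : ∀ i, L (e i) = ι (b i)) :
    LinearIndependent ℝ e ∧ Submodule.span ℝ (range e) = (LinearMap.range ι).comap L := by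
  have h0 : (fun i => L (e i)) = fun i => ι (b i) := funext he
  have h1 : ∀ v : E, ι v = L (∑ i, b.repr v i • e i) := by
    intro v
    have h2 : ι (∑ i, b.repr v i • b i) = L (∑ i, b.repr v i • e i) := by
      simp only [map_sum, map_smul, he]
    rwa [b.sum_repr] at h2
  refine ⟨?_, le_antisymm ?_ ?_⟩
  · refine LinearIndependent.of_comp L ?_
    change LinearIndependent ℝ (fun i => L (e i))
    rw [h0]
    exact b.linearIndependent.map' ι (LinearMap.ker_eq_bot.2 hι)
  · rw [Submodule.span_le]
    rintro _ ⟨i, rfl⟩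
    exact ⟨b i, (he i).symm⟩
  · rintro V ⟨v, hv⟩
    rw [h1 v] at hv
    rw [← hL hv]
    exact Submodule.sum_mem _ fun i _ => Submodule.smul_mem _ _ (Submodule.subset_span ⟨i, rfl⟩)

end LinearAlgebra

/-! ### The conormal bundle of a linear subspace -/

section ModelConormal

variable {E : Type*} [NormedAddCommGroup E] [InnerProductSpace ℝ E] [FiniteDimensional ℝ E]
  (W : Submodule ℝ E)

/-- The conormal bundle of a linear subspace, as a linear subspace of `E × E^*`. -/
def modelConormal : Submodule ℝ (E × (E →L[ℝ] ℝ)) where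
  carrier := {v | v.1 ∈ W ∧ ∀ w ∈ W, v.2 w = 0}
  add_mem' := by
    rintro a b ⟨h1, h2⟩ ⟨h3, h4⟩
    refine ⟨W.add_mem h1 h3, fun w hw => ?_⟩
    rw [Prod.snd_add, add_apply, h2 w hw, h4 w hw, add_zero]
  zero_mem' := ⟨W.zero_mem, fun w _ => rfl⟩
  smul_mem' := by
    rintro c a ⟨h1, h2⟩
    refine ⟨W.smul_mem c h1, fun w hw => ?_⟩
    rw [Prod.smul_snd, smul_apply, h2 w hw, smul_zero]

theorem isClosed_modelConormal : IsClosed (modelConormal W : Set (E × (E →L[ℝ] ℝ))) :=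
  Submodule.closed_of_finiteDimensional _

/-- The identification of `E` with `W × W^⊥`. -/
def modelParam : E →ₗ[ℝ] E × (E →L[ℝ] ℝ) where
  toFun v := (W.starProjection v, innerSL ℝ (v - W.starProjection v))
  map_add' v w := by
    refine Prod.ext (map_add _ _ _) ?_
    change innerSL ℝ _ = innerSL ℝ _ + innerSL ℝ _
    rw [← map_add, map_add]
    congr 1
    abel
  map_smul' c v := by
    refine Prod.ext (map_smul _ _ _) ?_
    change innerSL ℝ _ = c • innerSL ℝ _
    rw [map_smul, ← smul_sub]
    exact (innerSL ℝ).map_smul c _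

theorem modelParam_injective : Function.Injective (modelParam W) := by
  rw [← LinearMap.ker_eq_bot, LinearMap.ker_eq_bot']
  intro v hv
  have h1 : W.starProjection v = 0 := congrArg Prod.fst hv
  have h2 : innerSL ℝ (v - W.starProjection v) = 0 := congrArg Prod.snd hv
  rw [h1, sub_zero] at h2
  have h3 : inner ℝ v v = 0 := DFunLike.congr_fun h2 v
  exact inner_self_eq_zero.1 h3

theorem range_modelParam : LinearMap.range (modelParam W) = modelConormal W := by
  apply le_antisymm
  · rintro _ ⟨v, rfl⟩
    refine ⟨W.starProjection_apply_mem v, fun w hw => ?_⟩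
    change inner ℝ (v - W.starProjection v) w = 0
    rw [real_inner_comm]
    exact Submodule.inner_right_of_mem_orthogonal hw (W.sub_starProjection_mem_orthogonal v)
  · rintro ⟨a, γ⟩ ⟨h1, h2⟩
    obtain ⟨ν, rfl⟩ := (InnerProductSpace.toDual ℝ E).surjective γ
    have hν : ν ∈ Wᗮ := by
      rw [Submodule.mem_orthogonal]
      intro w hw
      rw [real_inner_comm]
      exact h2 w hw
    have hp : W.starProjection (a + ν) = a := by
      rw [map_add, Submodule.starProjection_eq_self_iff.2 h1,
        (Submodule.starProjection_apply_eq_zero_iff W).2 hν, add_zero]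
    refine ⟨a + ν, Prod.ext hp ?_⟩
    change innerSL ℝ (a + ν - W.starProjection (a + ν)) = _
    rw [hp, add_sub_cancel_left]
    rfl

variable {θ ψ : E → E} {u : E} {F : E → ℝ} {c : E →L[ℝ] ℝ}

/-- The vector with `covLiftD` equal to `modelParam W v`. -/
def modelVec (θ ψ : E → E) (F : E → ℝ) (u : E) (c : E →L[ℝ] ℝ) (v : E) : E × (E →L[ℝ] ℝ) :=
  (fderiv ℝ ψ (θ u) (W.starProjection v),
    (innerSL ℝ (v - W.starProjection v) - (c - fderiv ℝ F u).comp
      (fderiv ℝ (fderiv ℝ ψ) (θ u) (W.starProjection v))).comp (fderiv ℝ θ u)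
    + fderiv ℝ (fderiv ℝ F) u (fderiv ℝ ψ (θ u) (W.starProjection v)))

theorem covLiftD_modelVec (h : IsLocalInv θ ψ u) (hF : ContDiffAt ℝ 2 F u) (v : E) :
    covLiftD θ ψ F (u, c) (modelVec W θ ψ F u c v) = modelParam W v := by
  rw [(hasFDerivAt_covLift h hF).2]
  have e : fderiv ℝ θ u (modelVec W θ ψ F u c v).1 = W.starProjection v :=
    h.fderiv_fderiv' _
  rw [e]
  refine Prod.ext rfl ?_
  ext b
  simp only [modelVec, add_apply, ContinuousLinearMap.comp_apply, sub_apply, h.fderiv_fderiv',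
    modelParam, LinearMap.coe_mk, AddHom.coe_mk]
  ring

/-- The derivative is block triangular, and both diagonal blocks are invertible because θ is a local
diffeomorphism. -/
theorem covLiftD_injective (h : IsLocalInv θ ψ u) (hF : ContDiffAt ℝ 2 F u) :
    Function.Injective (covLiftD θ ψ F (u, c)) := by
  rw [injective_iff_map_eq_zero]
  rintro ⟨a, β⟩ hV
  rw [(hasFDerivAt_covLift h hF).2] at hV
  have h1 : fderiv ℝ θ u a = 0 := congrArg Prod.fst hV
  have h2 : a = 0 := by rw [← h.fderiv_fderiv a, h1, map_zero]
  subst h2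
  have h3 := congrArg Prod.snd hV
  simp only [map_zero, sub_zero, ContinuousLinearMap.comp_zero, add_zero, Prod.snd_zero] at h3
  refine Prod.ext rfl ?_
  ext b
  rw [← h.fderiv_fderiv b]
  exact DFunLike.congr_fun h3 _

/-- The inverse image of the model conormal bundle under the derivative of `covLift`. -/
theorem covLiftD_mem_iff (h : IsLocalInv θ ψ u) (hF : ContDiffAt ℝ 2 F u) (V : E × (E →L[ℝ] ℝ)) :
    covLiftD θ ψ F (u, c) V ∈ modelConormal W ↔ fderiv ℝ θ u V.1 ∈ W ∧
      ∀ b, fderiv ℝ θ u b ∈ W → V.2 b = fderiv ℝ (fderiv ℝ F) u V.1 b - (c - fderiv ℝ F u)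
        (fderiv ℝ (fderiv ℝ ψ) (θ u) (fderiv ℝ θ u V.1) (fderiv ℝ θ u b)) := by
  rw [(hasFDerivAt_covLift h hF).2]
  refine and_congr_right fun _ => ⟨fun H b hb => ?_, fun H w hw => ?_⟩
  · have := H _ hb
    simp only [add_apply, ContinuousLinearMap.comp_apply, sub_apply, h.fderiv_fderiv] at this
    rw [sub_apply]
    linarith
  · have := H (fderiv ℝ ψ (θ u) w) (by rwa [h.fderiv_fderiv'])
    rw [h.fderiv_fderiv', sub_apply] at this
    simp only [add_apply, ContinuousLinearMap.comp_apply, sub_apply]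
    rw [this]
    ring

theorem ContDiffAt.fderiv_fderiv_comm {E' : Type*} [NormedAddCommGroup E'] [NormedSpace ℝ E']
    {f : E → E'} (h : ContDiffAt ℝ 2 f u) (a b : E) :
    fderiv ℝ (fderiv ℝ f) u a b = fderiv ℝ (fderiv ℝ f) u b a :=
  (h.isSymmSndFDerivAt (by simp)).eq a b

/-- By `covLiftD_mem_iff` the covector component, tested on first components, is a bilinear form
built from second derivatives of F and ψ. Second derivatives are symmetric, so the
antisymmetrization is zero. -/
theorem covLiftD_isotropic (h : IsLocalInv θ ψ u) (hF : ContDiffAt ℝ 2 F u)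
    {V V' : E × (E →L[ℝ] ℝ)} (hV : covLiftD θ ψ F (u, c) V ∈ modelConormal W)
    (hV' : covLiftD θ ψ F (u, c) V' ∈ modelConormal W) : V.2 V'.1 - V'.2 V.1 = 0 := by
  obtain ⟨h1, h2⟩ := (covLiftD_mem_iff W h hF V).1 hV
  obtain ⟨h3, h4⟩ := (covLiftD_mem_iff W h hF V').1 hV'
  rw [h2 _ h3, h4 _ h1, ContDiffAt.fderiv_fderiv_comm hF,
    ContDiffAt.fderiv_fderiv_comm h.smooth_symm]
  ring

end ModelConormal

/-! ### C² charts adapted to Y -/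

section Adapted

set_option synthInstance.maxHeartbeats 200000

variable {n : ℕ} {X : Type*} [TopologicalSpace X] [ChartedSpace (Eu n) X]
  [IsManifold 𝓘(ℝ, Eu n) ∞ X]

/-- A `C²` chart in which `Y` is a linear subspace. -/
structure AdaptedChart (n : ℕ) {X : Type*} [TopologicalSpace X] [ChartedSpace (Eu n) X] (d : ℕ)
    (Y : Set X) where
  chart : OpenPartialHomeomorph X (Eu n)
  mem_atlas : chart ∈ IsManifold.maximalAtlas 𝓘(ℝ, Eu n) 2 X
  space : Submodule ℝ (Eu n)
  finrank_space : Module.finrank ℝ space = d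
  mem_iff : ∀ x ∈ chart.source, x ∈ Y ↔ chart x ∈ space

theorem IsSubmanifold.exists_adaptedChart {d : ℕ} {Y : Set X} (h : IsSubmanifold n 2 d Y) {y : X}
    (hy : y ∈ Y) : ∃ D : AdaptedChart n d Y, y ∈ D.chart.source := by
  obtain ⟨φ, hφ, hys, W, hW, hm⟩ := h y hy
  exact ⟨⟨φ, hφ, W, hW, hm⟩, hys⟩

variable {d : ℕ} {Y : Set X} (D : AdaptedChart n d Y)

/-- The adapted chart in the coordinates of the preferred chart at `x₀`. -/
def AdaptedChart.theta (x₀ : X) : Eu n → Eu n := D.chart ∘ (ech n x₀).symm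

/-- The inverse of `AdaptedChart.theta`. -/
def AdaptedChart.psi (x₀ : X) : Eu n → Eu n := ech n x₀ ∘ D.chart.symm

variable {x₀ x : X}

theorem ech_symm_ech (hx : x ∈ (ech n x₀).source) : (ech n x₀).symm (ech n x₀ x) = x :=
  (ech n x₀).left_inv hx

theorem AdaptedChart.theta_ech (hx : x ∈ (ech n x₀).source) :
    D.theta x₀ (ech n x₀ x) = D.chart x := by
  rw [theta, Function.comp_apply, ech_symm_ech hx]

theorem eventually_ech_symm (hx : x ∈ (ech n x₀).source) {p : X → Prop} (h : ∀ᶠ y in 𝓝 x, p y) :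
    ∀ᶠ u in 𝓝 (ech n x₀ x), u ∈ (ech n x₀).target ∧ p ((ech n x₀).symm u) := by
  have hc : ContinuousAt (ech n x₀).symm (ech n x₀ x) :=
    continuousAt_extChartAt_symm' (I := 𝓘(ℝ, Eu n)) hx
  have hx' : x ∈ (extChartAt 𝓘(ℝ, Eu n) x₀).source := hx
  rw [← ech_symm_ech hx] at h
  filter_upwards [(isOpen_extChartAt_target (I := 𝓘(ℝ, Eu n)) x₀).mem_nhds
    ((extChartAt 𝓘(ℝ, Eu n) x₀).map_source hx'), hc.eventually h] with u h1 h2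
  exact ⟨h1, h2⟩

theorem contMDiffAt_ech_symm (hx : x ∈ (ech n x₀).source) :
    ContMDiffAt 𝓘(ℝ, Eu n) 𝓘(ℝ, Eu n) 2 (ech n x₀).symm (ech n x₀ x) := by
  have hx' : x ∈ (extChartAt 𝓘(ℝ, Eu n) x₀).source := hx
  have h := contMDiffOn_extChartAt_symm (I := 𝓘(ℝ, Eu n)) (n := ∞) x₀
  exact (h.contMDiffAt ((isOpen_extChartAt_target (I := 𝓘(ℝ, Eu n)) x₀).mem_nhds
    ((extChartAt 𝓘(ℝ, Eu n) x₀).map_source hx'))).of_le (by norm_cast)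

theorem contMDiffAt_ech (hx : x ∈ (ech n x₀).source) :
    ContMDiffAt 𝓘(ℝ, Eu n) 𝓘(ℝ, Eu n) 2 (ech n x₀) x :=
  (contMDiffAt_extChartAt' (n := ∞) (mem_ech_source_iff.1 hx)).of_le (by norm_cast)

theorem contDiffAt_comp_ech_symm {E' : Type*} [NormedAddCommGroup E'] [NormedSpace ℝ E']
    {f : X → E'} (hx : x ∈ (ech n x₀).source)
    (hf : ContMDiffAt 𝓘(ℝ, Eu n) 𝓘(ℝ, E') 2 f x) :
    ContDiffAt ℝ 2 (f ∘ (ech n x₀).symm) (ech n x₀ x) := by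
  rw [← contMDiffAt_iff_contDiffAt]
  refine ContMDiffAt.comp (ech n x₀ x) ?_ (contMDiffAt_ech_symm hx)
  rwa [ech_symm_ech hx]

theorem AdaptedChart.isLocalInv (hx : x ∈ (ech n x₀).source) (hD : x ∈ D.chart.source) :
    IsLocalInv (D.theta x₀) (D.psi x₀) (ech n x₀ x) := by
  have : IsManifold 𝓘(ℝ, Eu n) 2 X := IsManifold.of_le (n := ∞) (by norm_cast)
  have hφ := contMDiffAt_of_mem_maximalAtlas D.mem_atlas hD
  have hφ' := contMDiffAt_symm_of_mem_maximalAtlas D.mem_atlas (D.chart.map_source hD)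
  refine ⟨?_, ?_, contDiffAt_comp_ech_symm hx hφ, ?_⟩
  · filter_upwards [eventually_ech_symm hx (D.chart.open_source.mem_nhds hD)] with u hu
    simp only [psi, theta, Function.comp_apply]
    rw [D.chart.left_inv hu.2, (ech n x₀).right_inv hu.1]
  · rw [D.theta_ech hx]
    have hc := D.chart.continuousAt_symm (D.chart.map_source hD)
    have hs : ∀ᶠ y in 𝓝 x, y ∈ (ech n x₀).source :=
      (isOpen_extChartAt_source (I := 𝓘(ℝ, Eu n)) x₀).mem_nhds hx
    rw [← D.chart.left_inv hD] at hs
    filter_upwards [hc.eventually hs, D.chart.open_target.mem_nhds (D.chart.map_source hD)]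
      with u hu hu'
    simp only [psi, theta, Function.comp_apply]
    rw [ech_symm_ech hu, D.chart.right_inv hu']
  · rw [D.theta_ech hx, ← contMDiffAt_iff_contDiffAt]
    refine ContMDiffAt.comp (D.chart x) ?_ hφ'
    rw [D.chart.left_inv hD]
    exact contMDiffAt_ech hx

theorem differential_eq {f : X → ℝ} (hx : x ∈ (ech n x₀).source)
    (hf : ContMDiffAt 𝓘(ℝ, Eu n) 𝓘(ℝ, ℝ) 2 f x) :
    toCov (differential (n := n) f x)
      = (fderiv ℝ (f ∘ (ech n x₀).symm) (ech n x₀ x)).comp (tcc n x x₀ x) := by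
  have h1 := (contDiffAt_comp_ech_symm hx hf).differentiableAt (by simp)
  have h2 : HasMFDerivAt 𝓘(ℝ, Eu n) 𝓘(ℝ, Eu n) (ech n x₀) x (tcc n x x₀ x) := by
    rw [← mfderiv_ech hx]
    exact ((contMDiffAt_ech hx).mdifferentiableAt (by simp)).hasMFDerivAt
  have h3 := HasMFDerivAt.comp x h1.hasFDerivAt.hasMFDerivAt h2
  have h4 : f =ᶠ[𝓝 x] (f ∘ (ech n x₀).symm) ∘ ech n x₀ := by
    filter_upwards [(isOpen_extChartAt_source (I := 𝓘(ℝ, Eu n)) x₀).mem_nhds hx] with y hy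
    simp only [Function.comp_apply]
    rw [ech_symm_ech hy]
  exact (h3.congr_of_eventuallyEq h4).mfderiv

/-- The tangent space of `Y`. -/
theorem AdaptedChart.mem_tangentOf (hx : x ∈ (ech n x₀).source) (hD : x ∈ D.chart.source)
    (hY : x ∈ Y) (v : Eu n) : v ∈ tangentOf 𝓘(ℝ, Eu n) Y x ↔
      fderiv ℝ (D.theta x₀) (ech n x₀ x) (tcc n x x₀ x v) ∈ D.space := by
  have : IsManifold 𝓘(ℝ, Eu n) 2 X := IsManifold.of_le (n := ∞) (by norm_cast)
  have hφ' := contMDiffAt_symm_of_mem_maximalAtlas D.mem_atlas (D.chart.map_source hD)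
  have h1 := ((D.isLocalInv hx hD).smooth.differentiableAt (by simp)).hasFDerivAt
  have h2 : HasMFDerivAt 𝓘(ℝ, Eu n) 𝓘(ℝ, Eu n) (ech n x₀) x (tcc n x x₀ x) := by
    rw [← mfderiv_ech hx]
    exact ((contMDiffAt_ech hx).mdifferentiableAt (by simp)).hasMFDerivAt
  have h3 := HasMFDerivAt.comp x h1.hasMFDerivAt h2
  have h4 : D.chart =ᶠ[𝓝 x] D.theta x₀ ∘ ech n x₀ := by
    filter_upwards [(isOpen_extChartAt_source (I := 𝓘(ℝ, Eu n)) x₀).mem_nhds hx] with y hy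
    exact (D.theta_ech hy).symm
  have h5 := tangentOf_eq_comap (S := Y) (Submodule.closed_of_finiteDimensional D.space)
    (h3.congr_of_eventuallyEq h4) (hφ'.mdifferentiableAt (by simp))
    (D.chart.eventually_left_inverse hD) (D.chart.eventually_right_inverse (D.chart.map_source hD))
    (Filter.eventually_of_mem (D.chart.open_source.mem_nhds hD) D.mem_iff) hY
  rw [h5]
  rfl

end Adapted

/-! ### Straightening the standard Lagrangian -/

section StandardLagrangian

set_option synthInstance.maxHeartbeats 200000

variable {n : ℕ} {X : Type*} [TopologicalSpace X] [ChartedSpace (Eu n) X]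
  [IsManifold 𝓘(ℝ, Eu n) ∞ X] {d : ℕ} {Y : Set X} (D : AdaptedChart n d Y) {f : X → ℝ}
  {p₀ p : Cot n X}

/-- The standard Lagrangian in the coordinates given by an adapted chart. -/
theorem AdaptedChart.mem_stdLag_iff (hx : p.1 ∈ (ech n p₀.1).source) (hD : p.1 ∈ D.chart.source)
    (hf : ContMDiffAt 𝓘(ℝ, Eu n) 𝓘(ℝ, ℝ) 2 f p.1) : p ∈ stdLag n Y f ↔
      covLift (D.theta p₀.1) (D.psi p₀.1) (f ∘ (ech n p₀.1).symm) (extChartAt (IC n) p₀ p)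
        ∈ modelConormal D.space := by
  have hL := D.isLocalInv hx hD
  have hs := mem_ech_source (n := n) p.1
  have e0 : (ech n p₀.1 p.1, (toCov p.2).comp (tcc n p₀.1 p.1 p.1)) = extChartAt (IC n) p₀ p :=
    (cotChart_apply hx).symm
  rw [← e0]
  have h1 : D.theta p₀.1 (ech n p₀.1 p.1) ∈ D.space ↔ p.1 ∈ Y := by
    rw [D.theta_ech hx, D.mem_iff _ hD]
  have h2 : ∀ v, toCov (p.2 - differential (n := n) f p.1) v = toCov p.2 v
      - fderiv ℝ (f ∘ (ech n p₀.1).symm) (ech n p₀.1 p.1) (tcc n p.1 p₀.1 p.1 v) := by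
    intro v
    rw [← ContinuousLinearMap.comp_apply, ← differential_eq hx hf]
    rfl
  have h3 : p ∈ stdLag n Y f ↔ p.1 ∈ Y ∧ ∀ v ∈ tangentOf 𝓘(ℝ, Eu n) Y p.1,
      toCov (p.2 - differential (n := n) f p.1) v = 0 := by
    refine and_congr_right fun _ => ⟨?_, fun h => ⟨p.2 - differential (n := n) f p.1, h, ?_⟩⟩
    · rintro ⟨ν, hν, he⟩ v hv
      rw [he, add_sub_cancel_right]
      exact hν v hv
    · rw [sub_add_cancel]
  rw [h3]
  have h4 : ∀ v, tcc n p₀.1 p.1 p.1 (tcc n p.1 p₀.1 p.1 v) = v := fun v => tcc_tcc hs hx v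
  have h5 : ∀ v, tcc n p.1 p₀.1 p.1 (tcc n p₀.1 p.1 p.1 v) = v := fun v => tcc_tcc hx hs v
  constructor
  · rintro ⟨hY, h⟩
    refine ⟨h1.2 hY, fun w hw => ?_⟩
    have := h (tcc n p₀.1 p.1 p.1 (fderiv ℝ (D.psi p₀.1) (D.theta p₀.1 (ech n p₀.1 p.1)) w))
      ((D.mem_tangentOf hx hD hY _).2 (by rwa [h5, hL.fderiv_fderiv']))
    rw [h2, h5] at this
    exact this
  · rintro ⟨hY, h⟩
    refine ⟨h1.1 hY, fun (v : Eu n) hv => ?_⟩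
    have := h _ ((D.mem_tangentOf hx hD (h1.1 hY) v).1 hv)
    simp only [covLift, ContinuousLinearMap.comp_apply, sub_apply, hL.fderiv_fderiv, h4] at this
    exact (h2 v).trans this

theorem isOpen_ech_source (x₀ : X) : IsOpen (ech n x₀).source :=
  isOpen_extChartAt_source (I := 𝓘(ℝ, Eu n)) x₀

/-- The derivative of the coordinates of an adapted chart on `T^*X`. -/
def AdaptedChart.deriv (f : X → ℝ) (p₀ p : Cot n X) : TangentSpace (IC n) p →L[ℝ] EuCot n :=
  (covLiftD (D.theta p₀.1) (D.psi p₀.1) (f ∘ (ech n p₀.1).symm) (extChartAt (IC n) p₀ p)).comp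
    (mfderiv (IC n) 𝓘(ℝ, EuCot n) (extChartAt (IC n) p₀) p)

/-- The cotangent chart followed by `covLift` has local inverse given by `covDrop`, and near p it
identifies the Lagrangian with the linear model; `tangentOf_eq_comap` then applies. -/
theorem AdaptedChart.tangentOf_stdLag (hx : p.1 ∈ (ech n p₀.1).source)
    (hD : p.1 ∈ D.chart.source) (hf : ContMDiffAt 𝓘(ℝ, Eu n) 𝓘(ℝ, ℝ) 2 f p.1)
    (hp : p ∈ stdLag n Y f) : tangentOf (IC n) (stdLag n Y f) p
      = (modelConormal D.space).comap (D.deriv f p₀ p : TangentSpace (IC n) p →ₗ[ℝ] EuCot n) := by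
  set θ := D.theta p₀.1
  set ψ := D.psi p₀.1
  set F := f ∘ (ech n p₀.1).symm
  set e := extChartAt (IC n) p₀ with he
  set u := ech n p₀.1 p.1
  have hL : IsLocalInv θ ψ u := D.isLocalInv hx hD
  have hF : ContDiffAt ℝ 2 F u := contDiffAt_comp_ech_symm hx hf
  have hps : p ∈ e.source := by
    rw [he, cotChart_source]
    exact hx
  have hpc : p ∈ (chartAt (ModelProd (Eu n) (Eu n →L[ℝ] ℝ)) p₀).source := by
    rwa [he, extChartAt_source] at hps
  have e0 : e p = (u, (toCov p.2).comp (tcc n p₀.1 p.1 p.1)) := cotChart_apply hx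
  have hr : range (IC n) = univ := by simp [ModelWithCorners.range_eq_univ]
  have h1 : HasMFDerivAt (IC n) 𝓘(ℝ, EuCot n) e p (mfderiv (IC n) 𝓘(ℝ, EuCot n) e p) :=
    (mdifferentiableAt_extChartAt hpc).hasMFDerivAt
  have h2 : HasFDerivAt (covLift θ ψ F) (covLiftD θ ψ F (e p)) (e p) := by
    rw [e0]
    exact (hasFDerivAt_covLift hL hF).1
  have h3 : HasMFDerivAt (IC n) 𝓘(ℝ, EuCot n) (covLift θ ψ F ∘ e) p (D.deriv f p₀ p) :=
    HasMFDerivAt.comp p h2.hasMFDerivAt h1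
  have h4 : covDrop θ ψ F (covLift θ ψ F (e p)) = e p := by
    rw [e0]
    exact covDrop_covLift hL
  have h5 : DifferentiableAt ℝ (covDrop θ ψ F) (covLift θ ψ F (e p)) := by
    rw [e0]
    exact differentiableAt_covDrop hL hF
  have ht : e p ∈ e.target := e.map_source hps
  have h6 : MDifferentiableAt 𝓘(ℝ, EuCot n) (IC n) (e.symm ∘ covDrop θ ψ F)
      ((covLift θ ψ F ∘ e) p) := by
    refine MDifferentiableAt.comp _ ?_ h5.mdifferentiableAt
    have := mdifferentiableWithinAt_extChartAt_symm (I := IC n) ht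
    rw [hr, mdifferentiableWithinAt_univ] at this
    simp only [Function.comp_apply]
    rwa [h4]
  have hce : ContinuousAt e p := continuousAt_extChartAt' hps
  have htn : ∀ᶠ v in 𝓝 (e p), v ∈ e.target := (isOpen_extChartAt_target p₀).mem_nhds ht
  have hsn : ∀ᶠ q in 𝓝 p, q ∈ e.source := (isOpen_extChartAt_source p₀).mem_nhds hps
  have h7 : ∀ᶠ v in 𝓝 (e p), covDrop θ ψ F (covLift θ ψ F v) = v := by
    rw [e0]
    exact eventually_covDrop_covLift hL
  have h8 : ∀ᶠ v in 𝓝 (covLift θ ψ F (e p)), covLift θ ψ F (covDrop θ ψ F v) = v := by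
    rw [e0]
    exact eventually_covLift_covDrop hL
  refine tangentOf_eq_comap (isClosed_modelConormal _) h3 h6 ?_ ?_ ?_ hp
  · filter_upwards [hce.eventually h7, hsn] with q hq hq'
    simp only [Function.comp_apply]
    rw [hq, e.left_inv hq']
  · have hc : ContinuousAt (covDrop θ ψ F) (covLift θ ψ F (e p)) := h5.continuousAt
    have htn' : ∀ᶠ v in 𝓝 (covDrop θ ψ F (covLift θ ψ F (e p))), v ∈ e.target := by rwa [h4]
    change ∀ᶠ v in 𝓝 (covLift θ ψ F (e p)), _
    filter_upwards [h8, hc.eventually htn'] with v hv hv'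
    simp only [Function.comp_apply]
    rw [e.right_inv hv', hv]
  · have hπ := (cotProj n X).continuous.continuousAt (x := p)
    filter_upwards [hπ.eventually ((isOpen_ech_source p₀.1).mem_nhds hx),
      hπ.eventually (D.chart.open_source.mem_nhds hD), hπ.eventually ((contMDiffAt_iff_contMDiffAt_nhds (by simp)).1 hf)]
      with q h9 h10 h11
    exact D.mem_stdLag_iff h9 h10 h11

end StandardLagrangian

/-! ### Continuity of the model frame in the point and in t -/

section ModelContinuity

variable {E : Type*} [NormedAddCommGroup E] [InnerProductSpace ℝ E] [FiniteDimensional ℝ E]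
  (W : Submodule ℝ E) {θ ψ : E → E} {F : E → ℝ}

theorem fderiv_const_mul_two {u : E} (hF : ContDiffAt ℝ 2 F u) (t : ℝ) :
    fderiv ℝ (fun v => t * F v) u = t • fderiv ℝ F u ∧
    fderiv ℝ (fderiv ℝ fun v => t * F v) u = t • fderiv ℝ (fderiv ℝ F) u := by
  refine ⟨fderiv_const_mul (hF.differentiableAt (by simp)) t, ?_⟩
  have h : (fderiv ℝ fun v => t * F v) =ᶠ[𝓝 u] fun v => t • fderiv ℝ F v := by
    filter_upwards [ContDiffAt.eventually_two hF] with v hv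
    exact fderiv_const_mul (hv.differentiableAt (by simp)) t
  rw [h.fderiv_eq]
  exact fderiv_fun_const_smul (ContDiffAt.hasFDerivAt_fderiv hF).differentiableAt t

/-- The vector involves at most second derivatives of ψ and F, which are continuous for class C²,
and replacing F by tF makes it affine in t. The continuity is therefore joint in t and the point. -/
theorem continuousAt_modelVec {B : Type*} [TopologicalSpace B] {b : B} {u : B → E}
    {c : B → E →L[ℝ] ℝ} {t : B → ℝ} (hu : ContinuousAt u b) (hc : ContinuousAt c b)
    (ht : ContinuousAt t b) (hL : IsLocalInv θ ψ (u b)) (hF : ContDiffAt ℝ 2 F (u b)) (v : E) :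
    ContinuousAt (fun b' => modelVec W θ ψ (fun v => t b' * F v) (u b') (c b') v) b := by
  have h1 : ContinuousAt (fun b' => θ (u b')) b :=
    ContinuousAt.comp (f := u) hL.smooth.continuousAt hu
  have h2 : ContinuousAt (fun b' => fderiv ℝ θ (u b')) b :=
    ContinuousAt.comp (f := u) (ContDiffAt.hasFDerivAt_fderiv hL.smooth).continuousAt hu
  have h3 : ContinuousAt (fun b' => fderiv ℝ ψ (θ (u b'))) b :=
    ContinuousAt.comp (f := fun b' => θ (u b'))
      (ContDiffAt.hasFDerivAt_fderiv hL.smooth_symm).continuousAt h1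
  have h4 : ContinuousAt (fderiv ℝ (fderiv ℝ ψ)) (θ (u b)) :=
    ((hL.smooth_symm.fderiv_right (m := 1) (by norm_num)).fderiv_right (m := 0)
      (by norm_num)).continuousAt
  have h5 : ContinuousAt (fun b' => fderiv ℝ (fderiv ℝ ψ) (θ (u b'))) b :=
    ContinuousAt.comp (f := fun b' => θ (u b')) h4 h1
  have h6 : ContinuousAt (fun b' => fderiv ℝ F (u b')) b :=
    ContinuousAt.comp (f := u) (ContDiffAt.hasFDerivAt_fderiv hF).continuousAt hu
  have h7 : ContinuousAt (fderiv ℝ (fderiv ℝ F)) (u b) :=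
    ((hF.fderiv_right (m := 1) (by norm_num)).fderiv_right (m := 0) (by norm_num)).continuousAt
  have h8 : ContinuousAt (fun b' => fderiv ℝ (fderiv ℝ F) (u b')) b :=
    ContinuousAt.comp (f := u) h7 hu
  set P := W.starProjection v
  have h9 := h3.clm_apply (continuousAt_const (y := P))
  have h10 := (((continuousAt_const (y := innerSL ℝ (v - P))).sub
    ((hc.sub (ht.smul h6)).clm_comp (h5.clm_apply (continuousAt_const (y := P))))).clm_comp h2).add
    ((ht.smul h8).clm_apply h9)
  refine (h9.prodMk h10).congr ?_
  filter_upwards [hu.eventually (ContDiffAt.eventually_two hF)] with b' hb'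
  obtain ⟨e1, e2⟩ := fderiv_const_mul_two hb' (t b')
  rw [modelVec, e1, e2]
  rfl

end ModelContinuity

/-! ### Frames and tangent spaces of standard Lagrangians -/

section StandardLagrangian

set_option synthInstance.maxHeartbeats 200000

variable {n : ℕ} {X : Type*} [TopologicalSpace X] [ChartedSpace (Eu n) X]
  [IsManifold 𝓘(ℝ, Eu n) ∞ X] {d : ℕ} {Y : Set X} (D : AdaptedChart n d Y) {f : X → ℝ}
  {p₀ p : Cot n X}

/-- The trivialization of the tangent bundle of `T^*X` given by the preferred chart at `p₀`. -/
abbrev cotTriv (p₀ : Cot n X) :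
    Trivialization (EuCot n) (π (EuCot n) (TangentSpace (IC n) : Cot n X → Type)) :=
  trivializationAt (EuCot n) (TangentSpace (IC n) : Cot n X → Type) p₀

theorem mem_cotTriv_baseSet (hx : p.1 ∈ (ech n p₀.1).source) : p ∈ (cotTriv p₀).baseSet := by
  have hps : p ∈ (extChartAt (IC n) p₀).source := by
    rw [cotChart_source]
    exact hx
  rwa [extChartAt_source] at hps

theorem cotTriv_eq (hx : p.1 ∈ (ech n p₀.1).source) :
    (cotTriv p₀).continuousLinearMapAt ℝ p
      = mfderiv (IC n) 𝓘(ℝ, EuCot n) (extChartAt (IC n) p₀) p :=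
  TangentBundle.continuousLinearMapAt_trivializationAt (mem_cotTriv_baseSet hx)

theorem mfderiv_cotChart_injective (hx : p.1 ∈ (ech n p₀.1).source) :
    Function.Injective (mfderiv (IC n) 𝓘(ℝ, EuCot n) (extChartAt (IC n) p₀) p) := by
  rw [← cotTriv_eq hx]
  exact Function.LeftInverse.injective
    ((cotTriv p₀).symmL_continuousLinearMapAt (mem_cotTriv_baseSet hx))

theorem continuousOn_cotTriv_symmL {B : Type*} [TopologicalSpace B] {φ : B → Cot n X}
    (hφ : Continuous φ) {c : B → EuCot n} {S : Set B} (hc : ContinuousOn c S)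
    (hS : ∀ b ∈ S, (φ b).1 ∈ (ech n p₀.1).source) :
    ContinuousOn (fun b => (⟨φ b, (cotTriv p₀).symmL ℝ (φ b) (c b)⟩ :
      TangentBundle (IC n) (Cot n X))) S := by
  have h := (cotTriv p₀).toOpenPartialHomeomorph.continuousOn_symm
  have hm : ∀ b ∈ S, φ b ∈ (cotTriv p₀).baseSet := fun b hb => mem_cotTriv_baseSet (hS b hb)
  have h2 : ContinuousOn (fun b => (cotTriv p₀).toOpenPartialHomeomorph.symm (φ b, c b)) S := by
    refine h.comp (hφ.continuousOn.prodMk hc) fun b hb => ?_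
    rw [(cotTriv p₀).target_eq]
    exact ⟨hm b hb, mem_univ _⟩
  refine h2.congr fun b hb => ?_
  rw [(cotTriv p₀).symmL_apply (hm b hb)]
  exact (cotTriv p₀).mk_symm (hm b hb) (c b)

/-- A local frame of the tangent bundle of the standard Lagrangian. -/
def AdaptedChart.frame (f : X → ℝ) (p₀ : Cot n X) (i : Fin n) (p : Cot n X) :
    TangentSpace (IC n) p :=
  (cotTriv p₀).symmL ℝ p (modelVec D.space (D.theta p₀.1) (D.psi p₀.1) (f ∘ (ech n p₀.1).symm)
    (ech n p₀.1 p.1) (extChartAt (IC n) p₀ p).2 (EuclideanSpace.basisFun (Fin n) ℝ i))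

/-- The derivative of the straightening chart takes the frame to the images of the standard basis
under `modelParam`, which form a basis of the model conormal space. -/
theorem AdaptedChart.frame_spec (hx : p.1 ∈ (ech n p₀.1).source) (hD : p.1 ∈ D.chart.source)
    (hf : ContMDiffAt 𝓘(ℝ, Eu n) 𝓘(ℝ, ℝ) 2 f p.1) (hp : p ∈ stdLag n Y f) :
    (LinearIndependent ℝ fun i => D.frame f p₀ i p) ∧
      Submodule.span ℝ (range fun i => D.frame f p₀ i p) = tangentOf (IC n) (stdLag n Y f) p := by
  have hL := D.isLocalInv hx hD
  have hF := contDiffAt_comp_ech_symm hx hf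
  have e0 : (ech n p₀.1 p.1, (extChartAt (IC n) p₀ p).2) = extChartAt (IC n) p₀ p := by
    rw [cotChart_apply hx]
  rw [D.tangentOf_stdLag hx hD hf hp, ← range_modelParam]
  refine basis_of_map_basis (L := (D.deriv f p₀ p : TangentSpace (IC n) p →ₗ[ℝ] EuCot n)) ?_
    (modelParam_injective D.space) (EuclideanSpace.basisFun (Fin n) ℝ).toBasis fun i => ?_
  · have h1 := covLiftD_injective (c := (extChartAt (IC n) p₀ p).2) hL hF
    rw [e0] at h1
    exact h1.comp (mfderiv_cotChart_injective hx)
  · have h1 := covLiftD_modelVec D.space (c := (extChartAt (IC n) p₀ p).2) hL hF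
      (EuclideanSpace.basisFun (Fin n) ℝ i)
    rw [e0] at h1
    have h2 := (cotTriv p₀).continuousLinearMapAt_symmL (R := ℝ) (mem_cotTriv_baseSet hx)
      (modelVec D.space (D.theta p₀.1) (D.psi p₀.1) (f ∘ (ech n p₀.1).symm)
        (ech n p₀.1 p.1) (extChartAt (IC n) p₀ p).2 (EuclideanSpace.basisFun (Fin n) ℝ i))
    rw [cotTriv_eq hx] at h2
    rw [OrthonormalBasis.coe_toBasis, ← h1, ← h2]
    rfl

theorem AdaptedChart.continuousOn_frame {B : Type*} [TopologicalSpace B] {φ : B → Cot n X}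
    (hφ : Continuous φ) {t : B → ℝ} (ht : Continuous t) {S : Set B} (hS : ∀ b ∈ S,
      (φ b).1 ∈ (ech n p₀.1).source ∧ (φ b).1 ∈ D.chart.source ∧
        ContMDiffAt 𝓘(ℝ, Eu n) 𝓘(ℝ, ℝ) 2 f (φ b).1) (i : Fin n) :
    ContinuousOn (fun b => (⟨φ b, D.frame (fun x => t b * f x) p₀ i (φ b)⟩ :
      TangentBundle (IC n) (Cot n X))) S := by
  refine continuousOn_cotTriv_symmL hφ (fun b hb => ?_) fun b hb => (hS b hb).1
  obtain ⟨hx, hD, hf⟩ := hS b hb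
  refine ContinuousAt.continuousWithinAt ?_
  have hx' : φ b ∈ (extChartAt (IC n) p₀).source := by
    rw [cotChart_source]
    exact hx
  have h1 : ContinuousAt (fun b => ech n p₀.1 (φ b).1) b :=
    ContinuousAt.comp (f := fun b => (φ b).1) (continuousAt_ech hx)
      ((cotProj n X).continuous.comp hφ).continuousAt
  have h2 : ContinuousAt (fun b => (extChartAt (IC n) p₀ (φ b)).2) b :=
    (ContinuousAt.comp (f := φ) (continuousAt_extChartAt' hx') hφ.continuousAt).snd
  exact continuousAt_modelVec (F := f ∘ (ech n p₀.1).symm) D.space h1 h2 ht.continuousAt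
    (D.isLocalInv hx hD) (contDiffAt_comp_ech_symm hx hf) _

/-! ### Tangent spaces of standard Lagrangians -/

theorem AdaptedChart.mem_tangentOf_stdLag (hD : p.1 ∈ D.chart.source)
    (hf : ContMDiffAt 𝓘(ℝ, Eu n) 𝓘(ℝ, ℝ) 2 f p.1) (hp : p ∈ stdLag n Y f)
    (V : TangentSpace (IC n) p) : V ∈ tangentOf (IC n) (stdLag n Y f) p ↔
      covLiftD (D.theta p.1) (D.psi p.1) (f ∘ (ech n p.1).symm) (ech n p.1 p.1, toCov p.2)
        (toModel V) ∈ modelConormal D.space := by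
  rw [D.tangentOf_stdLag (mem_ech_source p.1) hD hf hp, ← cotChart_self]
  have h : mfderiv (IC n) 𝓘(ℝ, EuCot n) (extChartAt (IC n) p) p
      = ContinuousLinearMap.id ℝ (EuCot n) := mfderiv_extChartAt_self
  rw [Submodule.mem_comap]
  have h2 : D.deriv f p p V = covLiftD (D.theta p.1) (D.psi p.1) (f ∘ (ech n p.1).symm)
      (extChartAt (IC n) p p) (mfderiv (IC n) 𝓘(ℝ, EuCot n) (extChartAt (IC n) p) p V) := rfl
  rw [h] at h2
  exact Eq.to_iff (congrArg (· ∈ modelConormal D.space) h2)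

theorem AdaptedChart.mem_tangentOf_self (hD : p.1 ∈ D.chart.source) (hY : p.1 ∈ Y) (v : Eu n) :
    v ∈ tangentOf 𝓘(ℝ, Eu n) Y p.1 ↔
      fderiv ℝ (D.theta p.1) (ech n p.1 p.1) v ∈ D.space := by
  have h := D.mem_tangentOf (mem_ech_source p.1) hD hY v
  rwa [tcc_self (mem_ech_source p.1)] at h

section Facts

variable (hY : IsSubmanifold n 2 d Y) (hf : ∀ x ∈ Y, ContMDiffAt 𝓘(ℝ, Eu n) 𝓘(ℝ, ℝ) 2 f x)
  (hp : p ∈ stdLag n Y f)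
include hY hf hp

theorem symplectic_tangentOf_stdLag {V V' : TangentSpace (IC n) p}
    (hV : V ∈ tangentOf (IC n) (stdLag n Y f) p) (hV' : V' ∈ tangentOf (IC n) (stdLag n Y f) p) :
    symplectic p V V' = 0 := by
  obtain ⟨D, hD⟩ := hY.exists_adaptedChart hp.1
  rw [D.mem_tangentOf_stdLag hD (hf _ hp.1) hp] at hV hV'
  exact covLiftD_isotropic D.space (D.isLocalInv (mem_ech_source _) hD)
    (contDiffAt_comp_ech_symm (mem_ech_source _) (hf _ hp.1)) hV hV'

theorem hor_mem_tangentOf {V : TangentSpace (IC n) p}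
    (hV : V ∈ tangentOf (IC n) (stdLag n Y f) p) : hor V ∈ tangentOf 𝓘(ℝ, Eu n) Y p.1 := by
  obtain ⟨D, hD⟩ := hY.exists_adaptedChart hp.1
  rw [D.mem_tangentOf_stdLag hD (hf _ hp.1) hp, covLiftD_mem_iff D.space
    (D.isLocalInv (mem_ech_source _) hD)
    (contDiffAt_comp_ech_symm (mem_ech_source _) (hf _ hp.1))] at hV
  exact (D.mem_tangentOf_self hD hp.1 _).2 hV.1

/-- With zero horizontal part the second derivative terms in the description of the tangent space
drop out, and only the conormal condition remains. -/
theorem ver_eq_zero_of_hor_eq_zero (g : Metric n X) {V : TangentSpace (IC n) p}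
    (hV : V ∈ tangentOf (IC n) (stdLag n Y f) p) (h0 : hor V = 0) {b : Eu n}
    (hb : b ∈ tangentOf 𝓘(ℝ, Eu n) Y p.1) : ver g V b = 0 := by
  obtain ⟨D, hD⟩ := hY.exists_adaptedChart hp.1
  rw [D.mem_tangentOf_stdLag hD (hf _ hp.1) hp, covLiftD_mem_iff D.space
    (D.isLocalInv (mem_ech_source _) hD)
    (contDiffAt_comp_ech_symm (mem_ech_source _) (hf _ hp.1))] at hV
  have h1 := hV.2 b ((D.mem_tangentOf_self hD hp.1 b).1 hb)
  have h2 : (toModel V).1 = 0 := h0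
  rw [h2] at h1
  have h3 := symplectic_eq g V (ofHV g p b 0)
  rw [hor_ofHV, ver_ofHV, h0] at h3
  simp only [symplectic, h2, map_zero, zero_apply, sub_zero] at h3 h1
  rw [← h3]
  exact h1

theorem finrank_tangentOf_stdLag :
    Module.finrank ℝ (tangentOf (IC n) (stdLag n Y f) p) = n := by
  obtain ⟨D, hD⟩ := hY.exists_adaptedChart hp.1
  obtain ⟨h1, h2⟩ := D.frame_spec (p₀ := p) (mem_ech_source p.1) hD (hf _ hp.1) hp
  rw [← h2, finrank_span_eq_card h1, Fintype.card_fin]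

end Facts

theorem finrank_tangentOf (hY : IsSubmanifold n 2 d Y) {x : X} (hx : x ∈ Y) :
    Module.finrank ℝ (tangentOf 𝓘(ℝ, Eu n) Y x) = d := by
  obtain ⟨D, hD⟩ := hY.exists_adaptedChart hx
  have hL := D.isLocalInv (mem_ech_source x) hD
  have e : ∀ v : Eu n, v ∈ tangentOf 𝓘(ℝ, Eu n) Y x ↔
      fderiv ℝ (D.theta x) (ech n x x) v ∈ D.space := fun v => by
    have h := D.mem_tangentOf (mem_ech_source x) hD hx v
    rwa [tcc_self (mem_ech_source x)] at h
  let A : Eu n ≃ₗ[ℝ] Eu n := LinearEquiv.ofBijective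
    (fderiv ℝ (D.theta x) (ech n x x) : Eu n →ₗ[ℝ] Eu n)
    ⟨Function.LeftInverse.injective hL.fderiv_fderiv,
      Function.RightInverse.surjective hL.fderiv_fderiv'⟩
  have h : (tangentOf 𝓘(ℝ, Eu n) Y x : Submodule ℝ (Eu n)) = D.space.comap (A : Eu n →ₗ[ℝ] Eu n) :=
    Submodule.ext e
  have h2 : (D.space.comap (A : Eu n →ₗ[ℝ] Eu n)) = D.space.map (A.symm : Eu n →ₗ[ℝ] Eu n) :=
    (Submodule.map_equiv_eq_comap_symm A.symm D.space).symm
  have h3 := LinearEquiv.finrank_map_eq A.symm D.space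
  rw [← h2, ← h, D.finrank_space] at h3
  exact h3

/-- The tangent space of the conormal bundle at a point of the zero section. -/
theorem mem_tangentOf_conormal (hY : IsSubmanifold n 2 d Y) (g : Metric n X) {x : X} (hx : x ∈ Y)
    (h0 : ∀ y, f y = 0) (V : TangentSpace (IC n) (⟨x, 0⟩ : Cot n X)) :
    V ∈ tangentOf (IC n) (stdLag n Y f) ⟨x, 0⟩ ↔ hor V ∈ tangentOf 𝓘(ℝ, Eu n) Y x ∧
      ∀ b ∈ tangentOf 𝓘(ℝ, Eu n) Y x, ver g V b = 0 := by
  obtain rfl : f = fun _ => 0 := funext h0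
  have hf : ContMDiffAt 𝓘(ℝ, Eu n) 𝓘(ℝ, ℝ) 2 (fun _ : X => (0 : ℝ)) x := contMDiffAt_const
  have hp : (⟨x, 0⟩ : Cot n X) ∈ stdLag n Y fun _ => 0 := by
    refine ⟨hx, 0, fun v _ => rfl, ?_⟩
    have : differential (n := n) (fun _ : X => (0 : ℝ)) x = 0 := mfderiv_const
    rw [this, add_zero]
  obtain ⟨D, hD⟩ := hY.exists_adaptedChart hx
  have hv : ver g V = (toModel V).2 := by
    rw [ver, christoffel_zero, sub_zero]
  have hF : ContDiffAt ℝ 2 ((fun _ : X => (0 : ℝ)) ∘ (ech n x).symm) (ech n x x) := contDiffAt_const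
  have hF0 : fderiv ℝ ((fun _ : X => (0 : ℝ)) ∘ (ech n x).symm) = 0 := fderiv_const _
  have hc : toCov (0 : CotSpace n X x) = 0 := rfl
  rw [D.mem_tangentOf_stdLag hD hf hp, covLiftD_mem_iff D.space
    (D.isLocalInv (mem_ech_source _) hD) hF, hv]
  refine and_congr (D.mem_tangentOf_self (p := ⟨x, 0⟩) hD hx _).symm
    (forall_congr' fun b => imp_congr (D.mem_tangentOf_self (p := ⟨x, 0⟩) hD hx _).symm ?_)
  have h1 : fderiv ℝ (fderiv ℝ ((fun _ : X => (0 : ℝ)) ∘ (ech n x).symm)) (ech n x x) = 0 := by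
    rw [hF0]
    exact fderiv_const_apply _
  have h2 : fderiv ℝ ((fun _ : X => (0 : ℝ)) ∘ (ech n x).symm) (ech n x x) = 0 := by
    rw [hF0]
    rfl
  rw [h1, h2, hc, sub_zero, zero_apply, zero_apply, zero_apply, sub_zero]

end StandardLagrangian

/-! ### Lifting phases to ℝ along a contraction -/

section Grading

variable {B Y : Type*} [TopologicalSpace B] [TopologicalSpace Y]

/-- Real lifts of a map to the circle are unique on a space which contracts onto `Y`, if they are
prescribed on `Y`. -/
theorem existsUnique_circle_lift (j : C(Y, B)) (ρ : C(B, Y)) (K : C(unitInterval × B, B))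
    (hK0 : ∀ b, K (0, b) = j (ρ b)) (hK1 : ∀ b, K (1, b) = b) (hKj : ∀ t y, K (t, j y) = j y)
    (P : C(B, Circle)) (a : ℝ) (hP : ∀ y, P (j y) = Circle.exp a) :
    ∃! A : C(B, ℝ), (∀ b, Circle.exp (A b) = P b) ∧ ∀ y, A (j y) = a := by
  have cov := Circle.isCoveringMap_exp
  -- The homotopy P ∘ K starts at values of P on Y, all equal to exp(ia). Lifted from the constant
  -- a, it ends at a lift of P.
  let H : C(unitInterval × B, Circle) := P.comp K
  have H0 : ∀ b, H (0, b) = Circle.exp (ContinuousMap.const B a b) := fun b => by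
    simp only [H, ContinuousMap.comp_apply, hK0, hP, ContinuousMap.const_apply]
  have hl := cov.liftHomotopy_lifts H (ContinuousMap.const B a) H0
  refine ⟨⟨fun b => cov.liftHomotopy H (ContinuousMap.const B a) H0 (1, b), by fun_prop⟩,
    ⟨fun b => ?_, fun y => ?_⟩, ?_⟩
  · refine (congrFun hl (1, b)).trans ?_
    simp only [H, ContinuousMap.comp_apply, hK1]
  · refine Eq.trans ?_ (cov.liftHomotopy_zero H (ContinuousMap.const B a) H0 (j y))
    -- The contraction fixes the points of Y, so above such a point the path being lifted is
    -- constant, and so is its lift.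
    refine cov.const_of_comp (g := fun t : unitInterval =>
      cov.liftHomotopy H (ContinuousMap.const B a) H0 (t, j y)) (by fun_prop) (fun t t' => ?_) 1 0
    refine (congrFun hl (t, j y)).trans (Eq.trans ?_ (congrFun hl (t', j y)).symm)
    simp only [H, ContinuousMap.comp_apply, hKj]
  · rintro A ⟨h1, h2⟩
    ext b
    -- For a competing lift A, the composite A ∘ K lifts the same homotopy with the same initial
    -- value, so the two agree.
    have h3 : A.comp K = cov.liftHomotopy H (ContinuousMap.const B a) H0 := by
      refine (cov.eq_liftHomotopy_iff' H0 _).2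
        ⟨funext fun q => h1 _, fun b => ?_⟩
      simp only [ContinuousMap.comp_apply, hK0, h2, ContinuousMap.const_apply]
    have h4 := DFunLike.congr_fun h3 (1, b)
    rw [ContinuousMap.comp_apply, hK1] at h4
    exact h4

theorem eventually_eq_of_int_mul {f : B → ℝ} {b : B} (hf : ContinuousAt f b)
    (h : ∀ b', ∃ k : ℤ, f b' = k * (2 * Real.pi)) : ∀ᶠ b' in 𝓝 b, f b' = f b := by
  have hpi : 0 < 2 * Real.pi := by positivity
  filter_upwards [Metric.continuousAt_iff'.1 hf _ hpi] with v hv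
  obtain ⟨k, hk⟩ := h v
  obtain ⟨l, hl⟩ := h b
  rw [Real.dist_eq, hk, hl, ← sub_mul, abs_mul, abs_of_pos hpi] at hv
  have h3 : |((k - l : ℤ) : ℝ)| < 1 := by
    push_cast
    by_contra hcon
    push Not at hcon
    nlinarith
  have h4 : k - l = 0 := Int.abs_lt_one_iff.1 (by exact_mod_cast h3)
  rw [hk, hl, sub_eq_zero.1 h4]

/-- The Maslov class is the obstruction to a grading. -/
theorem maslovClass_eq_zero (P : C(B, Circle)) (A : C(B, ℝ)) (h : ∀ b, Circle.exp (A b) = P b) :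
    maslovClass P = 0 := by
  refine Quotient.sound ?_
  -- Local angle minus global angle: both are arguments of P, so the difference is locally constant,
  -- and its coboundary is the pulled back angle cocycle.
  refine ⟨halfCircles.pullback P, fun _ => Subset.rfl, fun _ => subset_univ _,
    fun s b => angleBranch (P (s 0)) (P b) - A b, fun s b hb => ?_, fun s b _ => ?_⟩
  · refine eventually_eq_of_int_mul ?_ fun b' => ?_
    · refine ContinuousAt.sub ?_ A.continuous.continuousAt
      exact ContinuousAt.comp (f := P) (continuousAt_angleBranch (mem_iInter.1 hb 0))
        P.continuous.continuousAt
    · have h1 : Complex.exp ((angleBranch (P (s 0)) (P b') : ℝ) * Complex.I)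
          = Complex.exp ((A b' : ℝ) * Complex.I) := by
        rw [exp_angleBranch, ← h, Circle.coe_exp]
      obtain ⟨k, hk⟩ := Complex.exp_eq_exp_iff_exists_int.1 h1
      refine ⟨k, ?_⟩
      have h2 : ((angleBranch (P (s 0)) (P b') - A b' : ℝ) : ℂ) * Complex.I
          = ((k * (2 * Real.pi) : ℝ) : ℂ) * Complex.I := by
        push_cast
        linear_combination hk
      exact_mod_cast mul_right_cancel₀ Complex.I_ne_zero h2
  · simp [CechCocycle.pullback, dtCocycle, CechCocycle.zero, cechD, Fin.sum_univ_two]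

end Grading

/-! ### Orthogonal projection and the conormal identification -/

section Projection

set_option synthInstance.maxHeartbeats 200000

variable {n : ℕ} {X : Type*} [TopologicalSpace X] [ChartedSpace (Eu n) X]
  [IsManifold 𝓘(ℝ, Eu n) ∞ X] (g : Metric n X) (x : X) (K : Submodule ℝ (Eu n))

/-- An isometry of `ℝⁿ` with `T_x X`. -/
def orthoEquiv : Eu n ≃ₗ[ℝ] Eu n :=
  (EuclideanSpace.basisFun (Fin n) ℝ).toBasis.equiv (isOrtho_orthoAt g x).basis (Equiv.refl _)

theorem orthoEquiv_basisFun (i : Fin n) :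
    orthoEquiv g x (EuclideanSpace.basisFun (Fin n) ℝ i) = orthoAt g x i := by
  have := (EuclideanSpace.basisFun (Fin n) ℝ).toBasis.equiv_apply i
    (isOrtho_orthoAt g x).basis (Equiv.refl _)
  rw [OrthonormalBasis.coe_toBasis] at this
  rw [orthoEquiv, this, Equiv.refl_apply, IsOrtho.coe_basis]

theorem flat_orthoEquiv (a b : Eu n) :
    flat g x (orthoEquiv g x a) (orthoEquiv g x b) = inner ℝ a b := by
  have h : ∀ a : Eu n, orthoEquiv g x a = ∑ i, a i • orthoAt g x i := by
    intro a
    conv_lhs => rw [← (EuclideanSpace.basisFun (Fin n) ℝ).sum_repr a]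
    rw [map_sum]
    refine Finset.sum_congr rfl fun i _ => ?_
    rw [map_smul, orthoEquiv_basisFun]
    rfl
  have h2 : ∀ i j, flat g x (orthoAt g x i) (orthoAt g x j) = if i = j then 1 else 0 :=
    isOrtho_orthoAt g x
  rw [h a, h b]
  simp only [map_sum, map_smul, sum_apply, smul_apply, h2, smul_eq_mul, PiLp.inner_apply]
  simp [mul_comm]

/-- The orthogonal projection of `T_x X` onto a subspace. -/
def gProj : Eu n →ₗ[ℝ] Eu n :=
  (orthoEquiv g x : Eu n →ₗ[ℝ] Eu n) ∘ₗ
    ((K.comap (orthoEquiv g x : Eu n →ₗ[ℝ] Eu n)).starProjection : Eu n →ₗ[ℝ] Eu n) ∘ₗ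
    ((orthoEquiv g x).symm : Eu n →ₗ[ℝ] Eu n)

theorem gProj_orthoEquiv (a : Eu n) : gProj g x K (orthoEquiv g x a)
    = orthoEquiv g x ((K.comap (orthoEquiv g x : Eu n →ₗ[ℝ] Eu n)).starProjection a) := by
  simp [gProj]

variable {K}

theorem gProj_mem (v : Eu n) : gProj g x K v ∈ K :=
  (K.comap (orthoEquiv g x : Eu n →ₗ[ℝ] Eu n)).starProjection_apply_mem ((orthoEquiv g x).symm v)

theorem flat_sub_gProj (v : Eu n) {u : Eu n} (hu : u ∈ K) :
    flat g x (v - gProj g x K v) u = 0 := by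
  obtain ⟨a, rfl⟩ := (orthoEquiv g x).surjective v
  obtain ⟨b, rfl⟩ := (orthoEquiv g x).surjective u
  rw [gProj_orthoEquiv, ← map_sub, flat_orthoEquiv, real_inner_comm]
  exact Submodule.inner_right_of_mem_orthogonal hu
    ((K.comap (orthoEquiv g x : Eu n →ₗ[ℝ] Eu n)).sub_starProjection_mem_orthogonal a)

theorem gProj_of_mem {u : Eu n} (hu : u ∈ K) : gProj g x K u = u := by
  by_contra h
  have h1 : u - gProj g x K u ∈ K := K.sub_mem hu (gProj_mem g x u)
  have h2 := flat_pos g x (sub_ne_zero.2 (Ne.symm h))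
  rw [flat_sub_gProj g x u h1] at h2
  exact lt_irrefl _ h2

theorem gProj_of_orthogonal {v : Eu n} (hv : ∀ u ∈ K, flat g x u v = 0) : gProj g x K v = 0 := by
  by_contra h
  have h1 := flat_pos g x h
  have h2 := flat_sub_gProj g x v (gProj_mem g x v (K := K))
  have h3 := hv _ (gProj_mem g x v (K := K))
  rw [flat_comm] at h3
  rw [map_sub, sub_apply, h3] at h2
  linarith

variable (K)

/-- The identification of `T_x X` with the tangent space of the conormal bundle of a submanifold
with tangent space `K`. -/
def conormalId : Eu n →ₗ[ℝ] EuCot n :=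
  (gProj g x K).prod ((flat g x : Eu n →ₗ[ℝ] (Eu n →L[ℝ] ℝ)) ∘ₗ (LinearMap.id - gProj g x K))

theorem conormalId_apply (v : Eu n) :
    conormalId g x K v = (gProj g x K v, flat g x (v - gProj g x K v)) := rfl

theorem conormalId_injective : Function.Injective (conormalId g x K) := by
  rw [← LinearMap.ker_eq_bot, LinearMap.ker_eq_bot']
  intro v hv
  rw [conormalId_apply] at hv
  have h1 : gProj g x K v = 0 := congrArg Prod.fst hv
  have h2 : flat g x (v - gProj g x K v) = 0 := congrArg Prod.snd hv
  rw [h1, sub_zero] at h2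
  exact (flat g x).map_eq_zero_iff.1 h2

/-- With P the projection onto K, the entry is ⟨P e_i, P e_j⟩ - ⟨(1-P) e_i, (1-P) e_j⟩ = ⟨e_i, (2P -
1) e_j⟩. This is the matrix of the reflection in K, which is -1 on a complement of dimension n - d.
-/
theorem det_conormalId {d : ℕ} (hd : Module.finrank ℝ K = d) : (Matrix.of fun i j => flat g x (gProj g x K (orthoAt g x i))
      (gProj g x K (orthoAt g x j)) - flat g x (orthoAt g x i - gProj g x K (orthoAt g x i))
        (orthoAt g x j - gProj g x K (orthoAt g x j))).det = (-1 : ℝ) ^ (n - d) := by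
  subst hd
  set K' := K.comap (orthoEquiv g x : Eu n →ₗ[ℝ] Eu n) with hK'
  have h1 : Module.finrank ℝ K' = Module.finrank ℝ K := by
    have h2 := LinearEquiv.finrank_map_eq (orthoEquiv g x).symm K
    rwa [Submodule.map_equiv_eq_comap_symm] at h2
  have h2 : Module.finrank ℝ K'ᗮ = n - Module.finrank ℝ K := by
    have := K'.finrank_add_finrank_orthogonal
    rw [finrank_euclideanSpace, Fintype.card_fin, h1] at this
    omega
  rw [← h2, ← K'.det_reflection,
    ← LinearMap.det_toMatrix (EuclideanSpace.basisFun (Fin n) ℝ).toBasis]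
  congr 1
  ext i j
  have h3 : ∀ i, gProj g x K (orthoAt g x i)
      = orthoEquiv g x (K'.starProjection (EuclideanSpace.basisFun (Fin n) ℝ i)) := fun i => by
    rw [← orthoEquiv_basisFun, gProj_orthoEquiv]
  have h4 : ∀ i, orthoAt g x i - gProj g x K (orthoAt g x i)
      = orthoEquiv g x (EuclideanSpace.basisFun (Fin n) ℝ i
        - K'.starProjection (EuclideanSpace.basisFun (Fin n) ℝ i)) := fun i => by
    rw [h3, map_sub, orthoEquiv_basisFun]
  rw [Matrix.of_apply, h4 i, h4 j, h3 i, h3 j, flat_orthoEquiv, flat_orthoEquiv,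
    LinearMap.toMatrix_apply]
  set a := EuclideanSpace.basisFun (Fin n) ℝ i with ha
  set b := EuclideanSpace.basisFun (Fin n) ℝ j with hb
  have h5 : ((EuclideanSpace.basisFun (Fin n) ℝ).toBasis.repr
      (K'.reflection.toLinearMap ((EuclideanSpace.basisFun (Fin n) ℝ).toBasis j))) i
      = inner ℝ a (K'.reflection b) := by
    rw [OrthonormalBasis.coe_toBasis, ← OrthonormalBasis.repr_apply_apply]
    rfl
  rw [h5, Submodule.reflection_apply, two_smul]
  have h6 : inner ℝ (K'.starProjection a) (b - K'.starProjection b) = 0 :=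
    Submodule.inner_right_of_mem_orthogonal (K'.starProjection_apply_mem a)
      (K'.sub_starProjection_mem_orthogonal b)
  have h7 : inner ℝ (K'.starProjection b) (a - K'.starProjection a) = 0 :=
    Submodule.inner_right_of_mem_orthogonal (K'.starProjection_apply_mem b)
      (K'.sub_starProjection_mem_orthogonal a)
  simp only [inner_sub_left, inner_sub_right, inner_add_right] at h6 h7 ⊢
  rw [real_inner_comm a, real_inner_comm] at h7
  have e1 := real_inner_comm (K'.starProjection b) a
  have e2 := real_inner_comm (K'.starProjection b) (K'.starProjection a)
  have e3 := real_inner_comm a b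
  linarith

end Projection

/-! ### The family of Lagrangians, its contraction, and continuity of its phase -/

section Family

set_option synthInstance.maxHeartbeats 200000

variable {n : ℕ} {X : Type*} [TopologicalSpace X] [ChartedSpace (Eu n) X]
  [IsManifold 𝓘(ℝ, Eu n) ∞ X] {d : ℕ} {Y : Set X} {f : X → ℝ}

theorem contMDiffAt_const_mul {x : X} (hf : ContMDiffAt 𝓘(ℝ, Eu n) 𝓘(ℝ, ℝ) 2 f x) (t : ℝ) :
    ContMDiffAt 𝓘(ℝ, Eu n) 𝓘(ℝ, ℝ) 2 (fun x => t * f x) x :=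
  ((contDiffAt_id (𝕜 := ℝ) (x := f x)).const_smul t).contMDiffAt.comp x hf

theorem toCov_injective {x : X} {ξ ξ' : CotSpace n X x} (h : toCov ξ = toCov ξ') : ξ = ξ' := h

theorem differential_const_mul {x : X} (hf : ContMDiffAt 𝓘(ℝ, Eu n) 𝓘(ℝ, ℝ) 2 f x) (t : ℝ) :
    differential (n := n) (fun x => t * f x) x = t • differential (n := n) f x := by
  apply toCov_injective
  have h1 := differential_eq (mem_ech_source x) hf
  have h2 := differential_eq (mem_ech_source x) (contMDiffAt_const_mul hf t)
  have h3 := (contDiffAt_comp_ech_symm (mem_ech_source x) hf).differentiableAt (by simp)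
  have h4 : (fun x => t * f x) ∘ (ech n x).symm = fun u => t * (f ∘ (ech n x).symm) u := rfl
  rw [h2, h4, fderiv_const_mul h3]
  change t • fderiv ℝ _ _ ∘L _ = t • toCov (differential (n := n) f x)
  rw [h1]

/-- Scaling by τ takes the coset of the conormal space through t df to the one through τt df. The
value τ = 0 is allowed and lands in the zero section, so scaling contracts the family. -/
theorem cotScale_mem_stdLag (hf : ∀ x ∈ Y, ContMDiffAt 𝓘(ℝ, Eu n) 𝓘(ℝ, ℝ) 2 f x) {p : Cot n X}
    {t : ℝ} (hp : p ∈ stdLag n Y fun x => t * f x) (τ : ℝ) :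
    cotScale τ p ∈ stdLag n Y fun x => (τ * t) * f x := by
  obtain ⟨h1, ν, hν, he⟩ := hp
  refine ⟨h1, τ • ν, fun v hv => ?_, ?_⟩
  · have h2 : ν v = 0 := hν v hv
    change τ • ν v = 0
    rw [h2, smul_zero]
  · change τ • p.2 = τ • ν + differential (n := n) (fun x => (τ * t) * f x) p.1
    rw [he, differential_const_mul (hf _ h1), differential_const_mul (hf _ h1), smul_add, smul_smul]

/-- The contraction of the family of standard Lagrangians onto `Y`. -/
def dilation (hf : ∀ x ∈ Y, ContMDiffAt 𝓘(ℝ, Eu n) 𝓘(ℝ, ℝ) 2 f x) :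
    C(unitInterval × stdLagFamily n Y f, stdLagFamily n Y f) where
  toFun q := ⟨(q.1 * q.2.1.1, cotScale (q.1 : ℝ) q.2.1.2), by
    have h := cotScale_mem_stdLag hf q.2.2 q.1
    rwa [← Set.Icc.coe_mul] at h⟩
  continuous_toFun := by
    refine Continuous.subtype_mk (Continuous.prodMk (by fun_prop) ?_) _
    exact continuous_cotScale (by fun_prop) (by fun_prop)

/-- The projection of the family of standard Lagrangians to `Y`. -/
def famToY (n : ℕ) {X : Type*} [TopologicalSpace X] [ChartedSpace (Eu n) X]
    [IsManifold 𝓘(ℝ, Eu n) ∞ X] (Y : Set X) (f : X → ℝ) : C(stdLagFamily n Y f, Y) where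
  toFun q := ⟨q.1.2.1, q.2.1⟩
  continuous_toFun := ((cotProj n X).continuous.comp (famToCot Y f).continuous).subtype_mk _

variable (hf : ∀ x ∈ Y, ContMDiffAt 𝓘(ℝ, Eu n) 𝓘(ℝ, ℝ) 2 f x)

theorem dilation_zero (q : stdLagFamily n Y f) :
    dilation hf (0, q) = inclZero Y f (famToY n Y f q) := by
  refine Subtype.ext (Prod.ext (zero_mul _) ?_)
  exact cotScale_zero _

theorem dilation_one (q : stdLagFamily n Y f) : dilation hf (1, q) = q := by
  refine Subtype.ext (Prod.ext (one_mul _) ?_)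
  exact cotScale_one _

theorem dilation_inclZero (t : unitInterval) (y : Y) :
    dilation hf (t, inclZero Y f y) = inclZero Y f y := by
  refine Subtype.ext (Prod.ext (mul_zero _) ?_)
  exact cotScale_zeroSection _ _

include hf in
/-- Local frames of the tangent spaces of the members of the family. -/
theorem exists_local_frame (hY : IsSubmanifold n 2 d Y) (q₀ : stdLagFamily n Y f) :
    ∃ U : Set (stdLagFamily n Y f), IsOpen U ∧ q₀ ∈ U ∧
      ∃ e : Fin n → ∀ q : stdLagFamily n Y f, TangentSpace (IC n) q.1.2,
        (∀ i, ContinuousOn (fun q : stdLagFamily n Y f =>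
          (⟨q.1.2, e i q⟩ : TangentBundle (IC n) (Cot n X))) U) ∧
        ∀ q ∈ U, (LinearIndependent ℝ fun i => e i q) ∧ Submodule.span ℝ (range fun i => e i q)
          = tangentOf (IC n) (stdLag n Y (fun x => (q.1.1 : ℝ) * f x)) q.1.2 := by
  obtain ⟨D, hD⟩ := hY.exists_adaptedChart q₀.2.1
  refine ⟨{q | q.1.2.1 ∈ (ech n q₀.1.2.1).source ∩ D.chart.source},
    ((isOpen_ech_source _).inter D.chart.open_source).preimage
      ((cotProj n X).continuous.comp (famToCot Y f).continuous), ⟨mem_ech_source _, hD⟩,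
    fun i q => D.frame (fun x => (q.1.1 : ℝ) * f x) q₀.1.2 i q.1.2, fun i => ?_, fun q hq => ?_⟩
  · exact D.continuousOn_frame (φ := fun q : stdLagFamily n Y f => q.1.2)
      (t := fun q : stdLagFamily n Y f => (q.1.1 : ℝ)) (famToCot Y f).continuous
      (by fun_prop) (fun q hq => ⟨hq.1, hq.2, hf _ q.2.1⟩) i
  · exact D.frame_spec hq.1 hq.2 (contMDiffAt_const_mul (hf _ q.2.1) _) q.2

theorem fib_inclOne (g : Metric n X) (w : Cot n X → ℝ) (p : stdLag n Y f) :
    (tangentFam g w Y f).fib (inclOne Y f p) = tangentOf (IC n) (stdLag n Y f) p.1 := by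
  have h : (fun x => (((inclOne Y f p).1.1 : unitInterval) : ℝ) * f x) = f := by
    funext x
    exact one_mul _
  change tangentOf (IC n) (stdLag n Y fun x => (((inclOne Y f p).1.1 : unitInterval) : ℝ) * f x) _ = _
  rw [h]
  rfl

variable {g : Metric n X} {w : C(Cot n X, ℝ)} (hw : ∀ p, 0 < w p)
  (s : CanonicalTrivialization g w) (hY : IsSubmanifold n 2 d Y)
include hf hw hY

/-- Take z to be the value of η² on a local frame. It is continuous because the frame and η² are,
and nonzero because the tangent spaces are Lagrangian. -/
theorem exists_phase_eq (q₀ : stdLagFamily n Y f) :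
    ∃ z : stdLagFamily n Y f → ℂ, ContinuousAt z q₀ ∧ z q₀ ≠ 0 ∧
      ∀ᶠ q in 𝓝 q₀, squaredPhase s q.1.2 ((tangentFam g w Y f).fib q) = z q / (‖z q‖ : ℂ) := by
  obtain ⟨U, hU, hq₀, e, he, hb⟩ := exists_local_frame hf hY q₀
  refine ⟨fun q => evalBican g w q.1.2 (fun i => e i q) (fun i => e i q) (s.toFun q.1.2), ?_, ?_, ?_⟩
  · have hc : ∀ i, ContinuousWithinAt (fun q : stdLagFamily n Y f =>
        (⟨q.1.2, e i q⟩ : TangentBundle (IC n) (Cot n X))) univ q₀ := fun i =>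
      ((he i).continuousAt (hU.mem_nhds hq₀)).continuousWithinAt
    have h1 := continuousWithinAt_det_cformMat g hw
      (φ := fun q : stdLagFamily n Y f => q.1.2) hc hc
    rw [continuousWithinAt_univ] at h1
    have h2 : ContinuousAt (fun q : stdLagFamily n Y f => coef g q.1.2 (s.toFun q.1.2)) q₀ :=
      ((continuous_coef g hw s.continuous).comp (famToCot Y f).continuous).continuousAt
    refine (h2.mul h1).congr (Eventually.of_forall fun q => ?_)
    exact (evalBican_eq g hw q.1.2 (fun i => e i q) (fun i => e i q) (s.toFun q.1.2)).symm
  · refine evalBican_diag_ne_zero g hw (s.ne_zero _) (hb q₀ hq₀).1 fun i j => ?_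
    have hmem : ∀ i, e i q₀ ∈ tangentOf (IC n)
        (stdLag n Y (fun x => (q₀.1.1 : ℝ) * f x)) q₀.1.2 := fun i => by
      rw [← (hb q₀ hq₀).2]
      exact Submodule.subset_span ⟨i, rfl⟩
    exact symplectic_tangentOf_stdLag hY (fun x hx => contMDiffAt_const_mul (hf x hx) _) q₀.2
      (hmem i) (hmem j)
  · filter_upwards [hU.mem_nhds hq₀] with q hq
    exact squaredPhase_eq g hw s (hb q hq).1 (hb q hq).2

/-- The squared phase of the members of the family. -/
theorem exists_famPhase : ∃ P : C(stdLagFamily n Y f, Circle),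
    ∀ q, (P q : ℂ) = squaredPhase s q.1.2 ((tangentFam g w Y f).fib q) := by
  have h1 : Continuous fun q : stdLagFamily n Y f =>
      squaredPhase s q.1.2 ((tangentFam g w Y f).fib q) := by
    rw [continuous_iff_continuousAt]
    intro q₀
    obtain ⟨z, hz, hz0, he⟩ := exists_phase_eq hf hw s hY q₀
    refine (hz.div (Complex.continuous_ofReal.continuousAt.comp hz.norm) ?_).congr
      (he.mono fun q hq => hq.symm)
    exact Complex.ofReal_ne_zero.2 (norm_ne_zero_iff.2 hz0)
  have h2 : ∀ q : stdLagFamily n Y f,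
      squaredPhase s q.1.2 ((tangentFam g w Y f).fib q) ∈ Submonoid.unitSphere ℂ := by
    intro q
    obtain ⟨z, -, hz0, he⟩ := exists_phase_eq hf hw s hY q
    rw [he.self_of_nhds]
    refine mem_sphere_zero_iff_norm.2 ?_
    rw [norm_div, Complex.norm_real, norm_norm,
      div_self (norm_ne_zero_iff.2 hz0)]
  exact ⟨⟨fun q => ⟨_, h2 q⟩, h1.subtype_mk h2⟩, fun q => rfl⟩

end Family

/-! ### The phase along Y and the canonical grading -/

section Family

set_option synthInstance.maxHeartbeats 200000

variable {n : ℕ} {X : Type*} [TopologicalSpace X] [ChartedSpace (Eu n) X]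
  [IsManifold 𝓘(ℝ, Eu n) ∞ X] {d : ℕ} {Y : Set X} {f : X → ℝ}

/-- The tangent vector of `T^*X` at a point of the zero section given by `conormalId`. -/
def conormalVec (g : Metric n X) (Y : Set X) (x : X) (v : Eu n) :
    TangentSpace (IC n) (⟨x, 0⟩ : Cot n X) :=
  ofModel ⟨x, 0⟩ (conormalId g x (tangentOf 𝓘(ℝ, Eu n) Y x) v)

theorem hor_conormalVec (g : Metric n X) (Y : Set X) (x : X) (v : Eu n) :
    hor (conormalVec g Y x v) = gProj g x (tangentOf 𝓘(ℝ, Eu n) Y x) v := rfl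

theorem ver_conormalVec (g : Metric n X) (Y : Set X) (x : X) (v : Eu n) :
    ver g (conormalVec g Y x v)
      = flat g x (v - gProj g x (tangentOf 𝓘(ℝ, Eu n) Y x) v) := by
  rw [ver, christoffel_zero, sub_zero]
  rfl

theorem conormalVec_mem (g : Metric n X) (hY : IsSubmanifold n 2 d Y) {x : X} (hx : x ∈ Y)
    (h0 : ∀ y, f y = 0) (v : Eu n) :
    conormalVec g Y x v ∈ tangentOf (IC n) (stdLag n Y f) ⟨x, 0⟩ := by
  rw [mem_tangentOf_conormal hY g hx h0, hor_conormalVec, ver_conormalVec]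
  exact ⟨gProj_mem g x v, fun b hb => flat_sub_gProj g x v hb⟩

theorem mem_stdLag_zero {x : X} (hx : x ∈ Y) (h0 : ∀ y, f y = 0) :
    (⟨x, 0⟩ : Cot n X) ∈ stdLag n Y f := by
  obtain rfl : f = fun _ => 0 := funext h0
  refine ⟨hx, 0, fun v _ => rfl, ?_⟩
  have : differential (n := n) (fun _ : X => (0 : ℝ)) x = 0 := mfderiv_const
  rw [this, add_zero]

/-- The conormal identification is injective and takes values in the tangent space, which has
dimension n too. -/
theorem conormalVec_span (g : Metric n X) (hY : IsSubmanifold n 2 d Y) {x : X} (hx : x ∈ Y)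
    (h0 : ∀ y, f y = 0) {e : Fin n → Eu n} (he : LinearIndependent ℝ e) :
    (LinearIndependent ℝ fun i => conormalVec g Y x (e i)) ∧
      Submodule.span ℝ (range fun i => conormalVec g Y x (e i))
        = tangentOf (IC n) (stdLag n Y f) ⟨x, 0⟩ := by
  have h1 : LinearIndependent ℝ fun i => conormalVec g Y x (e i) :=
    he.map' (conormalId g x (tangentOf 𝓘(ℝ, Eu n) Y x))
      (LinearMap.ker_eq_bot.2 (conormalId_injective g x _))
  refine ⟨h1, ?_⟩
  have hf : ∀ x ∈ Y, ContMDiffAt 𝓘(ℝ, Eu n) 𝓘(ℝ, ℝ) 2 f x := by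
    obtain rfl : f = fun _ => 0 := funext h0
    exact fun x _ => contMDiffAt_const
  have h2 := finrank_tangentOf_stdLag hY hf (mem_stdLag_zero hx h0)
  have : FiniteDimensional ℝ (TangentSpace (IC n) (⟨x, 0⟩ : Cot n X)) :=
    inferInstanceAs (FiniteDimensional ℝ (EuCot n))
  refine Submodule.eq_of_le_of_finrank_eq (Submodule.span_le.2 ?_) ?_
  · rintro _ ⟨i, rfl⟩
    exact conormalVec_mem g hY hx h0 (e i)
  · rw [h2, finrank_span_eq_card h1, Fintype.card_fin]

theorem coe_inclZero_mul (y : Y) (x : X) : ((inclZero (n := n) Y f y).1.1 : ℝ) * f x = 0 := by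
  change ((0 : unitInterval) : ℝ) * f x = 0
  rw [Set.Icc.coe_zero, zero_mul]

variable {g : Metric n X} {w : C(Cot n X, ℝ)} (hw : ∀ p, 0 < w p) (hw0 : ∀ x : X, w ⟨x, 0⟩ = 1)
  (s : CanonicalTrivialization g w) (hY : IsSubmanifold n 2 d Y)
include hw hw0 hY

omit hw in
-- The imaginary parts vanish because tangential and normal components are orthogonal. Since w = 1
-- on the zero section, the real parts form the reflection matrix of `det_conormalId`.
theorem det_cformMat_conormalVec {x : X} (hx : x ∈ Y) :
    (cformMat g w ⟨x, 0⟩ (fun i => conormalVec g Y x (orthoAt g x i))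
      (fun i => conormalVec g Y x (orthoAt g x i))).det = (-1 : ℂ) ^ (n - d) := by
  have h1 := det_conormalId g x (tangentOf 𝓘(ℝ, Eu n) Y x) (finrank_tangentOf hY hx)
  have h2 := congrArg Complex.ofReal h1
  rw [← Complex.ofRealHom_eq_coe, RingHom.map_det] at h2
  refine Eq.trans (congrArg Matrix.det ?_) (h2.trans (by simp))
  ext i j
  have e1 : ∀ i j, ver g (conormalVec g Y x (orthoAt g x i))
      (hor (conormalVec g Y x (orthoAt g x j))) = 0 := fun i j => by
    rw [hor_conormalVec, ver_conormalVec]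
    exact flat_sub_gProj g x _ (gProj_mem g x _)
  simp only [cformMat, Matrix.of_apply, cform, e1, hw0]
  rw [hor_conormalVec, hor_conormalVec, ver_conormalVec, ver_conormalVec,
    LinearEquiv.symm_apply_apply]
  simp [RingHom.mapMatrix_apply]

/-- The phase (-1)^(n-d) has the argument -(n-d)π, so the value prescribed for the grading along Y
is a possible one. -/
theorem phase_inclZero (hf : ∀ x ∈ Y, ContMDiffAt 𝓘(ℝ, Eu n) 𝓘(ℝ, ℝ) 2 f x) (y : Y) :
    squaredPhase s (inclZero Y f y).1.2 ((tangentFam g w Y f).fib (inclZero Y f y))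
      = Complex.exp (((-((n : ℝ) - d) * Real.pi : ℝ) : ℂ) * Complex.I) := by
  obtain ⟨h1, h2⟩ := conormalVec_span (f := fun x => ((inclZero (n := n) Y f y).1.1 : ℝ) * f x)
    g hY y.2 (coe_inclZero_mul y) (isOrtho_orthoAt g y.1).linearIndependent
  have h3 := squaredPhase_eq g hw s h1 h2
  refine h3.trans ?_
  rw [evalBican_eq g hw, det_cformMat_conormalVec hw0 hY y.2, coef_of_isNormalized g s.normalized,
    one_mul, norm_pow, norm_neg, norm_one, one_pow, Complex.ofReal_one, div_one]
  -- The exponent n - d is a truncated difference of natural numbers, while the prescribed angle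
  -- uses the real difference.
  have hd : d ≤ n := by
    obtain ⟨D, -⟩ := hY.exists_adaptedChart y.2
    have h5 := Submodule.finrank_le D.space
    rwa [finrank_euclideanSpace, Fintype.card_fin, D.finrank_space] at h5
  have e : (((-((n : ℝ) - d) * Real.pi : ℝ) : ℂ) * Complex.I)
      = ((n - d : ℕ) : ℂ) * (-(Real.pi * Complex.I)) := by
    push_cast [Nat.cast_sub hd]
    ring
  rw [e, Complex.exp_nat_mul, Complex.exp_neg, Complex.exp_pi_mul_I]
  norm_num

/-- The canonical grading of the standard Lagrangian. -/
theorem existsUnique_canonicalGrading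
    (hf : ∀ x ∈ Y, ContMDiffAt 𝓘(ℝ, Eu n) 𝓘(ℝ, ℝ) 2 f x) :
    (∃ α : C(stdLag n Y f, Circle),
      (∀ p, (α p : ℂ) = squaredPhase s p.1 (tangentOf (IC n) (stdLag n Y f) p.1)) ∧
      maslovClass α = 0) ∧
    (∃! a : C(stdLag n Y f, ℝ), IsCanonicalGrading s d Y f a) ∧
    ∀ a : C(stdLag n Y f, ℝ), IsCanonicalGrading s d Y f a → ∀ p, Complex.exp (a p * Complex.I)
      = squaredPhase s p.1 (tangentOf (IC n) (stdLag n Y f) p.1) := by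
  obtain ⟨P, hP⟩ := exists_famPhase hf hw s hY
  obtain ⟨A, ⟨hA, hA0⟩, hu⟩ := existsUnique_circle_lift (inclZero Y f) (famToY n Y f)
    (dilation hf) (dilation_zero hf) (dilation_one hf) (dilation_inclZero hf) P
    (-((n : ℝ) - d) * Real.pi) (fun y => Circle.ext (by
      rw [hP, phase_inclZero hw hw0 s hY hf, Circle.coe_exp]))
  have hP1 : ∀ p : stdLag n Y f, squaredPhase s (inclOne Y f p).1.2
      ((tangentFam g w Y f).fib (inclOne Y f p))
      = squaredPhase s p.1 (tangentOf (IC n) (stdLag n Y f) p.1) := fun p => by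
    rw [fib_inclOne]
    rfl
  refine ⟨⟨P.comp (inclOne Y f), fun p => (hP _).trans (hP1 p),
    maslovClass_eq_zero _ (A.comp (inclOne Y f)) fun p => hA _⟩,
    ⟨A.comp (inclOne Y f), ⟨A, fun q => ?_, hA0, fun p => rfl⟩, ?_⟩, ?_⟩
  · rw [← hP, ← hA, Circle.coe_exp]
  · rintro a ⟨A', h1, h2, h3⟩
    have h4 : A' = A := hu A' ⟨fun q => Circle.ext (by rw [hP, ← h1, Circle.coe_exp]), h2⟩
    ext p
    rw [h3, h4]
    rfl
  · rintro a ⟨A', h1, h2, h3⟩ p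
    rw [h3, h1, hP1]

end Family

/-! ### Frames of the family and continuity of the projection to TY -/

section Conormal

set_option synthInstance.maxHeartbeats 200000

variable {n : ℕ} {X : Type*} [TopologicalSpace X] [ChartedSpace (Eu n) X]
  [IsManifold 𝓘(ℝ, Eu n) ∞ X] {d : ℕ} {Y : Set X} {f : X → ℝ}

theorem VecAt.sum {B : Type*} [TopologicalSpace B] {x : B → X} {S : Set B} {b₀ : B} {k : ℕ}
    {v : Fin k → B → Eu n} (h : ∀ i, VecAt x (v i) S b₀) :
    VecAt x (fun b => ∑ i, v i b) S b₀ := by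
  simp only [VecAt, map_sum]
  exact tendsto_finsetSum _ fun i _ => h i

theorem isRiemannian_tangentFam (g : Metric n X) {w : C(Cot n X, ℝ)} (hw : ∀ p, 0 < w p)
    (Y : Set X) (f : X → ℝ) : (tangentFam g w Y f).IsRiemannian :=
  isRiemannian_compatMetric g w hw (fun q : stdLagFamily n Y f => q.1.2) _

/-- Local orthonormal frames of the tangent spaces of the members of the family. -/
theorem exists_frame_tangentFam (g : Metric n X) {w : C(Cot n X, ℝ)} (hw : ∀ p, 0 < w p)
    (hY : IsSubmanifold n 2 d Y) (hf : ∀ x ∈ Y, ContMDiffAt 𝓘(ℝ, Eu n) 𝓘(ℝ, ℝ) 2 f x)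
    (q₀ : stdLagFamily n Y f) : ∃ U : Set (stdLagFamily n Y f), IsOpen U ∧ q₀ ∈ U ∧
      ∃ e : Fin n → ∀ q, TangentSpace (IC n) ((tangentFam g w Y f).map q),
        (tangentFam g w Y f).IsFrameOn U e := by
  obtain ⟨U, hU, hq, e, he, hb⟩ := exists_local_frame hf hY q₀
  refine ⟨U, hU, hq, _, (isRiemannian_tangentFam g hw Y f).isFrameOn_polar
    (famToCot Y f).continuous.continuousOn he (fun q hq => ?_) fun q hq => (hb q hq).2⟩
  refine (isRiemannian_tangentFam g hw Y f).posDef_change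
    (fun v _ hv => compatMetric_pos g hw hv) (fun i => ?_) (hb q hq).1
  have h := (hb q hq).2
  have h2 : e i q ∈ Submodule.span ℝ (range fun i => e i q) := Submodule.subset_span ⟨i, rfl⟩
  rw [h] at h2
  exact h2

theorem exists_isBasisAt_tangentFam (g : Metric n X) {w : C(Cot n X, ℝ)} (hw : ∀ p, 0 < w p)
    (hY : IsSubmanifold n 2 d Y) (hf : ∀ x ∈ Y, ContMDiffAt 𝓘(ℝ, Eu n) 𝓘(ℝ, ℝ) 2 f x)
    (q : stdLagFamily n Y f) :
    ∃ e : Fin n → TangentSpace (IC n) q.1.2, (tangentFam g w Y f).IsBasisAt q e := by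
  obtain ⟨U, -, hq, e, he⟩ := exists_frame_tangentFam g hw hY hf q
  exact ⟨fun i => e i q, he.2 q hq⟩

/-- The metric on `T^*X` at the zero section. -/
theorem compatMetric_conormalVec (g : Metric n X) {w : Cot n X → ℝ} (hw0 : ∀ x : X, w ⟨x, 0⟩ = 1)
    {x : X} (V : TangentSpace (IC n) (⟨x, 0⟩ : Cot n X)) (v : Eu n) :
    compatMetric g w ⟨x, 0⟩ V (conormalVec g Y x v)
      = ver g V (v - gProj g x (tangentOf 𝓘(ℝ, Eu n) Y x) v)
        + flat g x (hor V) (gProj g x (tangentOf 𝓘(ℝ, Eu n) Y x) v) := by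
  rw [compatMetric_eq, hw0, hor_conormalVec, ver_conormalVec, LinearEquiv.symm_apply_apply,
    inv_one, one_mul, one_mul]

/-- Frames of TY itself are not needed. The tangent space of the conormal bundle at the zero section
has continuous orthonormal frames; expanding the conormal vector of v in one of them and taking
horizontal parts expresses the projection of v by continuous quantities. -/
theorem VecAt.gProj (g : Metric n X) (hY : IsSubmanifold n 2 d Y) {B : Type*} [TopologicalSpace B]
    {x : B → Y} {S : Set B} {b₀ : B} (hx : ContinuousWithinAt x S b₀) {v : B → Eu n}
    (hv : VecAt (fun b => (x b : X)) v S b₀) :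
    VecAt (fun b => (x b : X))
      (fun b => CotBrane.gProj g (x b : X) (tangentOf 𝓘(ℝ, Eu n) Y (x b : X)) (v b)) S b₀ := by
  -- An auxiliary weight and function: only the conormal bundle, the case of zero f, is used, and
  -- any admissible weight would do.
  let w : C(Cot n X, ℝ) := 1
  have hw : ∀ p, 0 < w p := fun p => one_pos
  let f : X → ℝ := fun _ => 0
  let a : B → stdLagFamily n Y f := fun b => inclZero Y f (x b)
  have ha : ContinuousWithinAt a S b₀ :=
    (inclZero Y f).continuous.continuousAt.comp_continuousWithinAt hx
  obtain ⟨U, hU, hq, e, he⟩ := exists_frame_tangentFam (f := f) g hw hY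
    (fun _ _ => contMDiffAt_const) (a b₀)
  have hx' : ContinuousWithinAt (fun b => (x b : X)) S b₀ :=
    continuous_subtype_val.continuousAt.comp_continuousWithinAt hx
  have hE : ∀ i, ContinuousWithinAt (fun b => (⟨(a b).1.2, e i (a b)⟩ :
      TangentBundle (IC n) (Cot n X))) S b₀ := fun i =>
    ContinuousAt.comp_continuousWithinAt (f := a) (((he.1 i).continuousAt (hU.mem_nhds hq))) ha
  have hE' := fun i => ((tot_iff g).1 (hE i)).2
  have hsum : VecAt (fun b => (x b : X)) (fun b => ∑ i, (CotBrane.flat g (x b : X)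
      (hor (e i (a b))) (v b) + ver g (e i (a b)) (v b)) • hor (e i (a b))) S b₀ :=
    VecAt.sum fun i => VecAt.smul (ContinuousWithinAt.add
      (((hE' i).1.flat g hx').pair hx' hv) ((hE' i).2.pair hx' hv)) (hE' i).1
  have key : ∀ b, a b ∈ U → CotBrane.gProj g (x b : X) (tangentOf 𝓘(ℝ, Eu n) Y (x b : X)) (v b)
      = ∑ i, (CotBrane.flat g (x b : X)
      (hor (e i (a b))) (v b) + ver g (e i (a b)) (v b)) • hor (e i (a b)) := by
    intro b hb
    have hbas := he.2 (a b) hb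
    have h1 := (isRiemannian_tangentFam g hw Y f).expand (b := a b) hbas
      (conormalVec_mem g hY (x b).2 (f := fun y => (((a b).1.1 : unitInterval) : ℝ) * f y)
        (fun y => mul_zero _) (v b))
    have h2 := congrArg (horL (a b).1.2) h1
    refine Eq.trans h2 ((map_sum _ _ _).trans (Finset.sum_congr rfl fun i _ => ?_))
    refine (map_smul _ _ _).trans (congrArg₂ (· • ·) ?_ rfl)
    refine (compatMetric_conormalVec g (w := w) (fun _ => rfl) (e i (a b)) (v b)).trans ?_
    -- A frame vector has horizontal part tangent to Y and vertical part vanishing on TY. So its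
    -- product with the conormal vector of v does not change when both projected components of v are
    -- replaced by v itself, and the unknown projection disappears from the coefficients.
    have h3 := (mem_tangentOf_conormal (f := fun y => (((a b).1.1 : unitInterval) : ℝ) * f y)
      hY g (x b).2 (fun y => mul_zero _) (e i (a b))).1
        (EuclFamily.IsBasisAt.mem (F := tangentFam g w Y f) (b := a b) hbas i)
    have h4 := h3.2 _ (gProj_mem g (x b : X) (v b) (K := tangentOf 𝓘(ℝ, Eu n) Y (x b : X)))
    have h5 := flat_sub_gProj g (x b : X) (v b) h3.1
    rw [flat_comm, map_sub] at h5
    rw [map_sub, h4]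
    have h6 : ∀ p q r : ℝ, q - r = 0 → p - 0 + r = q + p := fun p q r h => by linarith
    exact h6 _ _ _ h5
  refine ContinuousWithinAt.congr_of_eventuallyEq hsum ?_ ?_
  · filter_upwards [ha.eventually (hU.mem_nhds hq)] with b hb
    rw [key b hb]
  · exact congrArg _ (key b₀ hq)

end Conormal

/-! ### The isomorphism of T_xX with the tangent spaces of the family -/

section Transport

set_option synthInstance.maxHeartbeats 200000

variable {n : ℕ} {X : Type*} [TopologicalSpace X] [ChartedSpace (Eu n) X]
  [IsManifold 𝓘(ℝ, Eu n) ∞ X] {d : ℕ} {Y : Set X} {f : X → ℝ} (g : Metric n X)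

/-- The pairing of tangent vectors of `T^*X` with those of `X` in which horizontal vectors pair with
the component tangent to `Y` and vertical vectors with the component normal to `Y`. -/
def conormalPairing (Y : Set X) (p : Cot n X) : TangentSpace (IC n) p →ₗ[ℝ] (Eu n →ₗ[ℝ] ℝ) where
  toFun V := (flat g p.1 (hor V) : Eu n →ₗ[ℝ] ℝ) ∘ₗ gProj g p.1 (tangentOf 𝓘(ℝ, Eu n) Y p.1)
    + (ver g V : Eu n →ₗ[ℝ] ℝ) ∘ₗ (LinearMap.id - gProj g p.1 (tangentOf 𝓘(ℝ, Eu n) Y p.1))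
  map_add' V V' := by
    rw [hor_add, ver_add, map_add, ContinuousLinearMap.toLinearMap_add,
      ContinuousLinearMap.toLinearMap_add, LinearMap.add_comp, LinearMap.add_comp]
    exact add_add_add_comm _ _ _ _
  map_smul' c V := by
    rw [hor_smul, ver_smul, map_smul, ContinuousLinearMap.toLinearMap_smul,
      ContinuousLinearMap.toLinearMap_smul, LinearMap.smul_comp, LinearMap.smul_comp]
    exact (smul_add _ _ _).symm

theorem conormalPairing_apply (p : Cot n X) (V : TangentSpace (IC n) p) (v : Eu n) :
    conormalPairing g Y p V v = flat g p.1 (hor V) (gProj g p.1 (tangentOf 𝓘(ℝ, Eu n) Y p.1) v)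
      + ver g V (v - gProj g p.1 (tangentOf 𝓘(ℝ, Eu n) Y p.1) v) := rfl

variable {g}

/-- Testing against v = hor V, which is tangent to Y, gives hor V = 0. Then the vertical part
vanishes on TY because V is tangent to the Lagrangian, and on the normal space because of the
pairing. -/
theorem eq_zero_of_conormalPairing (hY : IsSubmanifold n 2 d Y)
    (hf : ∀ x ∈ Y, ContMDiffAt 𝓘(ℝ, Eu n) 𝓘(ℝ, ℝ) 2 f x) {p : Cot n X} (hp : p ∈ stdLag n Y f)
    {V : TangentSpace (IC n) p} (hV : V ∈ tangentOf (IC n) (stdLag n Y f) p)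
    (h : conormalPairing g Y p V = 0) : V = 0 := by
  have h1 := hor_mem_tangentOf hY hf hp hV
  have h2 : ∀ v, flat g p.1 (hor V) (gProj g p.1 (tangentOf 𝓘(ℝ, Eu n) Y p.1) v)
      + ver g V (v - gProj g p.1 (tangentOf 𝓘(ℝ, Eu n) Y p.1) v) = 0 := fun v =>
    congrFun (congrArg DFunLike.coe h) v
  have h3 : hor V = 0 := by
    by_contra hne
    have h4 := h2 (hor V)
    rw [gProj_of_mem g p.1 h1, sub_self, map_zero, add_zero] at h4
    exact (flat_pos g p.1 hne).ne' h4
  refine ext_hor_ver g (h3.trans rfl) (Eq.trans ?_ (verL g p).map_zero.symm)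
  ext v
  have h5 := h2 v
  have h6 := ver_eq_zero_of_hor_eq_zero hY hf hp g hV h3
    (gProj_mem g p.1 v (K := tangentOf 𝓘(ℝ, Eu n) Y p.1))
  rw [h3, map_zero, zero_apply, zero_add, map_sub, h6, sub_zero] at h5
  exact h5

/-- The pairing restricted to the tangent space is injective, and both sides have dimension n. -/
theorem exists_conormalPairing_eq (hY : IsSubmanifold n 2 d Y)
    (hf : ∀ x ∈ Y, ContMDiffAt 𝓘(ℝ, Eu n) 𝓘(ℝ, ℝ) 2 f x) {p : Cot n X} (hp : p ∈ stdLag n Y f)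
    (l : Eu n →ₗ[ℝ] ℝ) :
    ∃ V ∈ tangentOf (IC n) (stdLag n Y f) p, conormalPairing g Y p V = l := by
  let A := (conormalPairing g Y p).comp (tangentOf (IC n) (stdLag n Y f) p).subtype
  have : FiniteDimensional ℝ (TangentSpace (IC n) p) :=
    inferInstanceAs (FiniteDimensional ℝ (EuCot n))
  have hinj : Function.Injective A := by
    rw [injective_iff_map_eq_zero]
    rintro ⟨V, hV⟩ h
    exact Subtype.ext (eq_zero_of_conormalPairing hY hf hp hV h)
  have hdim : Module.finrank ℝ (tangentOf (IC n) (stdLag n Y f) p)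
      = Module.finrank ℝ (Eu n →ₗ[ℝ] ℝ) := by
    rw [finrank_tangentOf_stdLag hY hf hp]
    refine Eq.trans ?_ Subspace.dual_finrank_eq.symm
    rw [finrank_euclideanSpace, Fintype.card_fin]
  obtain ⟨⟨V, hV⟩, h⟩ := (LinearMap.injective_iff_surjective_of_finrank_eq_finrank hdim).1 hinj l
  exact ⟨V, hV, h⟩

variable (g)

/-- The vector in the span of the orthonormal tuple `E` which represents the functional
`conormalPairing g Y p · v`. -/
def transport (Y : Set X) (p : Cot n X) (E : Fin n → TangentSpace (IC n) p) :
    Eu n →ₗ[ℝ] TangentSpace (IC n) p :=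
  ∑ i, (conormalPairing g Y p (E i)).smulRight (E i)

theorem transport_apply (p : Cot n X) (E : Fin n → TangentSpace (IC n) p) (v : Eu n) :
    transport g Y p E v = ∑ i, conormalPairing g Y p (E i) v • E i := by
  simp [transport, LinearMap.sum_apply]

variable {g} {w : C(Cot n X, ℝ)} (hw : ∀ p, 0 < w p)
  {q : stdLagFamily n Y f} {E E' : Fin n → TangentSpace (IC n) q.1.2}

theorem transport_mem (hE : (tangentFam g w Y f).IsBasisAt q E) (v : Eu n) :
    transport g Y q.1.2 E v ∈ (tangentFam g w Y f).fib q := by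
  rw [transport_apply]
  exact Submodule.sum_mem _ fun i _ => Submodule.smul_mem _ _
    (EuclFamily.IsBasisAt.mem (F := tangentFam g w Y f) hE i)

include hw in
-- This characterizes `transport` by the metric and the pairing alone; the orthonormal basis used to
-- write it down is immaterial.
theorem form_transport (hE : (tangentFam g w Y f).IsBasisAt q E) {V : TangentSpace (IC n) q.1.2}
    (hV : V ∈ (tangentFam g w Y f).fib q) (v : Eu n) :
    compatMetric g w q.1.2 V (transport g Y q.1.2 E v) = conormalPairing g Y q.1.2 V v := by
  have hF := isRiemannian_tangentFam g hw Y f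
  have h1 := hF.expand hE hV
  have h2 : conormalPairing g Y q.1.2 V v
      = ∑ i, compatMetric g w q.1.2 (E i) V * conormalPairing g Y q.1.2 (E i) v := by
    have h3 := congrArg (fun V => conormalPairing g Y q.1.2 V v) h1
    refine h3.trans ?_
    change conormalPairing g Y q.1.2 (∑ i, compatMetric g w q.1.2 (E i) V • E i) v = _
    rw [map_sum, LinearMap.sum_apply]
    exact Finset.sum_congr rfl fun i _ => by rw [map_smul]; rfl
  rw [h2, transport_apply]
  refine (hF.sum_right (b := q) _ V _ E).trans (Finset.sum_congr rfl fun i _ => ?_)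
  rw [mul_comm]
  exact congrArg₂ (· * ·) (hF.symm q _ _) rfl

include hw in
/-- `transport` does not depend on the orthonormal basis. -/
theorem transport_eq (hE : (tangentFam g w Y f).IsBasisAt q E)
    (hE' : (tangentFam g w Y f).IsBasisAt q E') :
    transport g Y q.1.2 E = transport g Y q.1.2 E' := by
  ext1 v
  have hF := isRiemannian_tangentFam g hw Y f
  refine (hF.expand hE' (transport_mem hE v)).trans ?_
  rw [transport_apply g q.1.2 E']
  exact Finset.sum_congr rfl fun i _ => congrArg₂ (· • ·) (form_transport hw hE
    (EuclFamily.IsBasisAt.mem (F := tangentFam g w Y f) hE' i) v) rfl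

variable (hY : IsSubmanifold n 2 d Y) (hf : ∀ x ∈ Y, ContMDiffAt 𝓘(ℝ, Eu n) 𝓘(ℝ, ℝ) 2 f x)
include hw hY hf

theorem transport_injective (hE : (tangentFam g w Y f).IsBasisAt q E) :
    Function.Injective (transport g Y q.1.2 E) := by
  rw [injective_iff_map_eq_zero]
  intro v hv
  by_contra hne
  -- A tangent vector V whose pairing is ♭v: then the product of V with the transported v is |v|² ≠
  -- 0.
  obtain ⟨V, hV, h⟩ := exists_conormalPairing_eq (g := g) hY
    (fun x hx => contMDiffAt_const_mul (hf x hx) q.1.1) q.2 (flat g q.1.2.1 v : Eu n →ₗ[ℝ] ℝ)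
  have h1 := form_transport hw hE hV v
  rw [hv, h] at h1
  have h2 : compatMetric g w q.1.2 V 0 = 0 := by
    have := compatMetric_smul g w V 0 0
    rwa [zero_smul, zero_mul] at this
  rw [h2] at h1
  exact (flat_pos g q.1.2.1 hne).ne h1

theorem transport_basis (hE : (tangentFam g w Y f).IsBasisAt q E) {e : Fin n → Eu n}
    (he : LinearIndependent ℝ e) :
    (LinearIndependent ℝ fun i => transport g Y q.1.2 E (e i)) ∧
      Submodule.span ℝ (range fun i => transport g Y q.1.2 E (e i)) = (tangentFam g w Y f).fib q := by
  have h1 : LinearIndependent ℝ fun i => transport g Y q.1.2 E (e i) :=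
    he.map' _ (LinearMap.ker_eq_bot.2 (transport_injective hw hY hf hE))
  refine ⟨h1, ?_⟩
  have h2 := finrank_tangentOf_stdLag hY (fun x hx => contMDiffAt_const_mul (hf x hx) q.1.1) q.2
  have : FiniteDimensional ℝ (TangentSpace (IC n) q.1.2) :=
    inferInstanceAs (FiniteDimensional ℝ (EuCot n))
  change _ = tangentOf (IC n) (stdLag n Y fun x => (q.1.1 : ℝ) * f x) q.1.2
  refine Submodule.eq_of_le_of_finrank_eq (Submodule.span_le.2 ?_) ?_
  · rintro _ ⟨i, rfl⟩
    exact transport_mem hE (e i)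
  · rw [finrank_span_eq_card h1, Fintype.card_fin]
    exact h2.symm

omit hf in
/-- `transport` on the zero section of the conormal bundle. -/
theorem transport_zero (hw0 : ∀ x : X, w ⟨x, 0⟩ = 1) {y : Y}
    {E : Fin n → TangentSpace (IC n) (inclZero Y f y).1.2}
    (hE : (tangentFam g w Y f).IsBasisAt (inclZero Y f y) E) (v : Eu n) :
    transport g Y (inclZero Y f y).1.2 E v = conormalVec g Y y.1 v := by
  have hF := isRiemannian_tangentFam g hw Y f
  have h1 := hF.expand hE (conormalVec_mem g hY y.2 (coe_inclZero_mul y) v)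
  refine Eq.trans ?_ h1.symm
  rw [transport_apply]
  refine Finset.sum_congr rfl fun i _ => congrArg₂ (· • ·) ?_ rfl
  rw [conormalPairing_apply, add_comm]
  exact (compatMetric_conormalVec g hw0 (E i) v).symm

end Transport

/-! ### Isomorphism and pullback of cochains -/

section General

variable {E H M : Type*} [NormedAddCommGroup E] [NormedSpace ℝ E] [TopologicalSpace H]
  {I : ModelWithCorners ℝ E H} [TopologicalSpace M] [ChartedSpace H M]
  {E' H' M' : Type*} [NormedAddCommGroup E'] [NormedSpace ℝ E'] [TopologicalSpace H']
  {I' : ModelWithCorners ℝ E' H'} [TopologicalSpace M'] [ChartedSpace H' M']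
  {B B' : Type*} [TopologicalSpace B] [TopologicalSpace B'] {n : ℕ}
  [IsManifold I 1 M] [IsManifold I' 1 M']

/-- Cochains with corresponding frames and equal lifts are isomorphic. -/
theorem PinIso.of_eq {F : EuclFamily I M B} {F' : EuclFamily I' M' B}
    {Ψ : ∀ b, TangentSpace I (F.map b) → TangentSpace I' (F'.map b)}
    {P : PinCochain n F} {Q : PinCochain n F'} (hc : P.cover ≤ Q.cover)
    (hl : ∀ x y b, P.lift x y b = Q.lift x y b)
    (hf : ∀ x, ∀ b ∈ P.cover.set x, ∀ i j,
      F'.form b (Ψ b (P.frame x i b)) (Q.frame x j b) = if i = j then 1 else 0) :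
    PinIso Ψ P Q := by
  refine ⟨P.cover, fun _ => Subset.rfl, hc, fun _ _ => 1, fun x => ClContinuousOn.const _,
    fun x b hb => ?_, fun x y b _ => by rw [hl, mul_one, one_mul]⟩
  have : (Matrix.of fun i j => F'.form b (Ψ b (P.frame x i b)) (Q.frame x j b)) = 1 := by
    ext i j
    rw [Matrix.of_apply, hf x b hb, Matrix.one_apply]
  rw [this]
  exact IsPinLift.one

theorem comp_vec_three {α β : Type*} (f : α → β) (x y z : α) :
    f ∘ ![x, y, z] = ![f x, f y, f z] := by
  funext i
  fin_cases i <;> rfl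

theorem PinCochain.IsRelativeTo.pullback {F : EuclFamily I M B} {P : PinCochain n F}
    {w : CechCocycle B (ZMod 2) 2} (h : P.IsRelativeTo w) (f : C(B', B)) :
    (P.pullback f).IsRelativeTo (w.pullback f) := by
  refine ⟨fun x => preimage_mono (h.1 (f x)), fun x y z b hb => ?_⟩
  have h1 := h.2 (f x) (f y) (f z) (f b) hb
  change P.lift _ _ _ * P.lift _ _ _ = (-1 : Cl n) ^ (w.val (f ∘ ![x, y, z]) (f b)).val * _
  rw [comp_vec_three]
  exact h1

end General

/-! ### The canonical pin structure on the family -/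

section Canonical

set_option synthInstance.maxHeartbeats 200000

variable {n : ℕ} {X : Type*} [TopologicalSpace X] [ChartedSpace (Eu n) X]
  [IsManifold 𝓘(ℝ, Eu n) ∞ X] {d : ℕ} {Y : Set X} {f : X → ℝ} {g : Metric n X}

theorem CovAt.sum {B : Type*} [TopologicalSpace B] {x : B → X} {S : Set B} {b₀ : B} {k : ℕ}
    {v : Fin k → B → Eu n →L[ℝ] ℝ} (h : ∀ i, CovAt x (v i) S b₀) :
    CovAt x (fun b => ∑ i, v i b) S b₀ := by
  simp only [CovAt, ContinuousLinearMap.finsetSum_comp]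
  exact tendsto_finsetSum _ fun i _ => h i

/-- The projection of the family to `X`. -/
def famToX (n : ℕ) {X : Type*} [TopologicalSpace X] [ChartedSpace (Eu n) X]
    [IsManifold 𝓘(ℝ, Eu n) ∞ X] (Y : Set X) (f : X → ℝ) : C(stdLagFamily n Y f, X) :=
  (cotProj n X).comp (famToCot Y f)

open Classical in
/-- The isomorphism from the tangent space of `X` to the fibres of `tangentFam`. -/
def famTransport (g : Metric n X) (w : Cot n X → ℝ) (Y : Set X) (f : X → ℝ)
    (q : stdLagFamily n Y f) : Eu n →ₗ[ℝ] TangentSpace (IC n) q.1.2 :=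
  -- For a submanifold Y and a C² function an orthonormal basis always exists, and the choice does
  -- not matter by `transport_eq`; the zero branch is only a default.
  if h : ∃ e : Fin n → TangentSpace (IC n) q.1.2, (tangentFam g w Y f).IsBasisAt q e then
    transport g Y q.1.2 h.choose
  else 0

variable {w : C(Cot n X, ℝ)} (hw : ∀ p, 0 < w p)

include hw in
theorem famTransport_eq {q : stdLagFamily n Y f} {e : Fin n → TangentSpace (IC n) q.1.2}
    (he : (tangentFam g w Y f).IsBasisAt q e) :
    famTransport g w Y f q = transport g Y q.1.2 e := by
  have h : ∃ e : Fin n → TangentSpace (IC n) q.1.2, (tangentFam g w Y f).IsBasisAt q e := ⟨e, he⟩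
  rw [famTransport, dif_pos h]
  exact transport_eq hw h.choose_spec he

variable (hY : IsSubmanifold n 2 d Y) (hf : ∀ x ∈ Y, ContMDiffAt 𝓘(ℝ, Eu n) 𝓘(ℝ, ℝ) 2 f x)
include hw hY hf

/-- In a local orthonormal frame the transported vector has as coefficients the pairings with the
frame, and these are continuous because the projection to TY is. -/
theorem continuousWithinAt_famTransport {S : Set (stdLagFamily n Y f)} {q₀ : stdLagFamily n Y f}
    {v : stdLagFamily n Y f → Eu n} (hv : VecAt (famToX n Y f) v S q₀) :
    ContinuousWithinAt (fun q : stdLagFamily n Y f =>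
      (⟨q.1.2, famTransport g w Y f q (v q)⟩ : TangentBundle (IC n) (Cot n X))) S q₀ := by
  obtain ⟨U, hU, hq, (e : Fin n → ∀ q : stdLagFamily n Y f, TangentSpace (IC n) q.1.2), he⟩ :=
    exists_frame_tangentFam g hw hY hf q₀
  have hφ : ContinuousWithinAt (fun q : stdLagFamily n Y f => q.1.2) S q₀ :=
    (famToCot Y f).continuous.continuousWithinAt
  have hx : ContinuousWithinAt (famToX n Y f) S q₀ := (famToX n Y f).continuous.continuousWithinAt
  have hE := fun i => ((tot_iff g).1
    ((((he.1 i).continuousAt (hU.mem_nhds hq))).continuousWithinAt (s := S))).2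
  have hπ : VecAt (famToX n Y f) (fun q => gProj g q.1.2.1
      (tangentOf 𝓘(ℝ, Eu n) Y q.1.2.1) (v q)) S q₀ :=
    VecAt.gProj g hY (x := famToY n Y f) (famToY n Y f).continuous.continuousWithinAt hv
  have hβ : ∀ i, ContinuousWithinAt (fun q => conormalPairing g Y q.1.2 (e i q) (v q)) S q₀ := by
    intro i
    have h1 : ∀ q, conormalPairing g Y q.1.2 (e i q) (v q)
        = flat g q.1.2.1 (hor (e i q)) (gProj g q.1.2.1 (tangentOf 𝓘(ℝ, Eu n) Y q.1.2.1) (v q))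
          + (ver g (e i q) (v q) - ver g (e i q)
            (gProj g q.1.2.1 (tangentOf 𝓘(ℝ, Eu n) Y q.1.2.1) (v q))) := fun q => by
      rw [conormalPairing_apply, map_sub]
    simp only [h1]
    exact (((hE i).1.flat g hx).pair hx hπ).add
      (((hE i).2.pair hx hv).sub ((hE i).2.pair hx hπ))
  have key : ∀ q ∈ U, famTransport g w Y f q (v q)
      = ∑ i, conormalPairing g Y q.1.2 (e i q) (v q) • e i q := fun q hq => by
    rw [famTransport_eq hw (e := fun i => e i q) (he.2 q hq), transport_apply]
  have hcont : ContinuousWithinAt (fun q : stdLagFamily n Y f =>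
      (⟨q.1.2, ∑ i, conormalPairing g Y q.1.2 (e i q) (v q) • e i q⟩ :
        TangentBundle (IC n) (Cot n X))) S q₀ := by
    refine (tot_iff g).2 ⟨hφ, ?_, ?_⟩
    · have h1 : ∀ q : stdLagFamily n Y f, hor (∑ i, conormalPairing g Y q.1.2 (e i q) (v q) • e i q)
          = ∑ i, conormalPairing g Y q.1.2 (e i q) (v q) • hor (e i q) := fun q =>
        (map_sum (horL q.1.2) _ _).trans (Finset.sum_congr rfl fun i _ => map_smul _ _ _)
      simp only [h1]
      exact VecAt.sum fun i => VecAt.smul (hβ i) (hE i).1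
    · have h1 : ∀ q : stdLagFamily n Y f,
          ver g (∑ i, conormalPairing g Y q.1.2 (e i q) (v q) • e i q)
          = ∑ i, conormalPairing g Y q.1.2 (e i q) (v q) • ver g (e i q) := fun q =>
        (map_sum (verL g q.1.2) _ _).trans (Finset.sum_congr rfl fun i _ => map_smul _ _ _)
      simp only [h1]
      exact CovAt.sum fun i => CovAt.smul (hβ i) (hE i).2
  refine hcont.congr_of_eventuallyEq ?_ ?_
  · filter_upwards [mem_nhdsWithin_of_mem_nhds (hU.mem_nhds hq)] with q hq
    rw [key q hq]
  · rw [key q₀ hq]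

theorem famTransport_basis (q : stdLagFamily n Y f) {e : Fin n → Eu n}
    (he : LinearIndependent ℝ e) :
    (LinearIndependent ℝ fun i => famTransport g w Y f q (e i)) ∧
      Submodule.span ℝ (range fun i => famTransport g w Y f q (e i))
        = (tangentFam g w Y f).fib q := by
  obtain ⟨E, hE⟩ := exists_isBasisAt_tangentFam g hw hY hf q
  rw [famTransport_eq hw hE]
  exact transport_basis hw hY hf hE he

theorem famTransport_inclZero (hw0 : ∀ x : X, w ⟨x, 0⟩ = 1) (y : Y) (v : Eu n) :
    famTransport g w Y f (inclZero Y f y) v = conormalVec g Y y.1 v := by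
  obtain ⟨E, hE⟩ := exists_isBasisAt_tangentFam g hw hY hf (inclZero Y f y)
  rw [famTransport_eq hw hE]
  exact transport_zero hw hY hw0 hE v

theorem posDef_famTransport (q : stdLagFamily n Y f) {e : Fin n → Eu n}
    (he : LinearIndependent ℝ e) : ((tangentFam g w Y f).change q
      (fun i => famTransport g w Y f q (e i)) fun i => famTransport g w Y f q (e i)).PosDef := by
  obtain ⟨h1, h2⟩ := famTransport_basis (g := g) hw hY hf q he
  refine (isRiemannian_tangentFam g hw Y f).posDef_change
    (fun v _ hv => compatMetric_pos g hw hv) (fun i => ?_) h1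
  have h3 : famTransport g w Y f q (e i)
      ∈ Submodule.span ℝ (range fun i => famTransport g w Y f q (e i)) :=
    Submodule.subset_span ⟨i, rfl⟩
  rw [h2] at h3
  exact h3

omit hw hY hf in
theorem frame_isOrtho (PX : PinCochain n (tangentX g)) {x y : X} (hy : y ∈ PX.cover.set x) :
    IsOrtho g y fun i => PX.frame x i y := (PX.isBasisAt hy).2

/-- The pin structure on the family which is transported from `X`. -/
def famPin (PX : PinCochain n (tangentX g)) : PinCochain n (tangentFam g w Y f) where
  cover := PX.cover.pullback (famToX n Y f)
  frame x i q := (tangentFam g w Y f).polar q (fun i =>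
    famTransport g w Y f q (PX.frame (famToX n Y f x) i (famToX n Y f q))) i
  isFrame x := by
    refine (isRiemannian_tangentFam g hw Y f).isFrameOn_polar
      (famToCot Y f).continuous.continuousOn (fun i q hq => ?_) (fun q hq => ?_) fun q hq => ?_
    · refine continuousWithinAt_famTransport hw hY hf ?_
      have h1 := ((PX.isFrame (famToX n Y f x)).1 i).comp (famToX n Y f).continuous.continuousOn
        (s := (PX.cover.pullback (famToX n Y f)).set x) fun _ hq => hq
      exact (vec_iff.1 (h1 q hq)).2
    · exact posDef_famTransport hw hY hf q (frame_isOrtho PX hq).linearIndependent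
    · exact (famTransport_basis hw hY hf q (frame_isOrtho PX hq).linearIndependent).2
  lift x y q := PX.lift (famToX n Y f x) (famToX n Y f y) (famToX n Y f q)
  -- Two frames of TX differ by an orthogonal matrix r. Their images under the linear transport
  -- differ by r, hence so do the polar frames; the transition matrix at q is the one of PX at the
  -- base point.
  isLift x y q hq := by
    have h1 := PX.isLift_change hq.1 hq.2
    have b1 := PX.isBasisAt hq.1
    have b2 := PX.isBasisAt hq.2
    have hr := (isRiemannian_tangentX g).change_orthogonal b1 b2
    have h2 : (fun i => PX.frame (famToX n Y f y) i (famToX n Y f q))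
        = combine (fun i => PX.frame (famToX n Y f x) i (famToX n Y f q))
          ((tangentX g).change (famToX n Y f q)
            (fun i => PX.frame (famToX n Y f x) i (famToX n Y f q))
            fun i => PX.frame (famToX n Y f y) i (famToX n Y f q)) :=
      funext fun j => (isRiemannian_tangentX g).expand b1 (b2.mem j)
    have h3 := map_combine (famTransport g w Y f q)
      (fun i => PX.frame (famToX n Y f x) i (famToX n Y f q))
      ((tangentX g).change (famToX n Y f q)
            (fun i => PX.frame (famToX n Y f x) i (famToX n Y f q))
            fun i => PX.frame (famToX n Y f y) i (famToX n Y f q))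
    have h4 : (fun j => famTransport g w Y f q (PX.frame (famToX n Y f y) j (famToX n Y f q)))
      = combine (fun i => famTransport g w Y f q (PX.frame (famToX n Y f x) i (famToX n Y f q)))
        ((tangentX g).change (famToX n Y f q)
            (fun i => PX.frame (famToX n Y f x) i (famToX n Y f q))
            fun i => PX.frame (famToX n Y f y) i (famToX n Y f q)) :=
      Eq.trans (congrArg (fun (e : Fin n → Eu n) => fun j => famTransport g w Y f q (e j)) h2) h3
    have h5 := (isRiemannian_tangentFam g hw Y f).change_polar_combine
      (posDef_famTransport hw hY hf q (frame_isOrtho PX hq.1).linearIndependent) hr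
    have h6 := (congrArg (fun e : Fin n → TangentSpace (IC n) q.1.2 =>
      (tangentFam g w Y f).change q ((tangentFam g w Y f).polar q fun i =>
        famTransport g w Y f q (PX.frame (famToX n Y f x) i (famToX n Y f q)))
        ((tangentFam g w Y f).polar q e)) h4).trans h5
    exact Eq.subst (motive := fun r => IsPinLift
      (PX.lift (famToX n Y f x) (famToX n Y f y) (famToX n Y f q)) r) h6.symm h1
  continuous x y := (PX.continuous (famToX n Y f x) (famToX n Y f y)).comp
    (famToX n Y f).continuous.continuousOn fun _ hb => hb

/-- The lifts are literally pulled back from X, hence so is their coboundary. -/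
theorem famPin_isRelativeTo {PX : PinCochain n (tangentX g)} {b : CechCocycle X (ZMod 2) 2}
    (h : PX.IsRelativeTo b) : (famPin (f := f) hw hY hf PX).IsRelativeTo
      ((b.pullback (cotProj n X)).pullback (famToCot Y f)) := by
  have h1 := h.pullback (famToX n Y f)
  exact ⟨h1.1, h1.2⟩

end Canonical

/-! ### Restriction to t = 1, uniqueness, and the canonical brane structure -/

section Brane

set_option synthInstance.maxHeartbeats 200000

variable {n : ℕ} {X : Type*} [TopologicalSpace X] [ChartedSpace (Eu n) X]
  [IsManifold 𝓘(ℝ, Eu n) ∞ X] {d : ℕ} {Y : Set X} {f : X → ℝ} {g : Metric n X}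
  {w : C(Cot n X, ℝ)}

/-- The restriction to `t = 1` of a cochain on the family. -/
def PinCochain.atOne (Q : PinCochain n (tangentFam g w Y f)) :
    PinCochain n (tangentL g w (stdLag n Y f)) where
  cover := Q.cover.pullback (inclOne Y f)
  frame x i p := Q.frame (inclOne Y f x) i (inclOne Y f p)
  isFrame x := by
    obtain ⟨h1, h2⟩ := (Q.pullback (inclOne Y f)).isFrame x
    exact ⟨h1, fun p hp => ⟨(h2 p hp).1.trans (fib_inclOne g w p), (h2 p hp).2⟩⟩
  lift := (Q.pullback (inclOne Y f)).lift
  isLift := (Q.pullback (inclOne Y f)).isLift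
  continuous := (Q.pullback (inclOne Y f)).continuous

theorem PinCochain.atOne_pinIso (Q : PinCochain n (tangentFam g w Y f)) :
    PinIso (F := (tangentFam g w Y f).pullback (inclOne Y f))
      (F' := tangentL g w (stdLag n Y f)) (fun _ v => v) (Q.pullback (inclOne Y f)) Q.atOne :=
  PinIso.of_eq (fun _ => Subset.rfl) (fun _ _ _ => rfl) fun x p hp =>
    ((Q.pullback (inclOne Y f)).isBasisAt hp).2

theorem PinCochain.IsRelativeTo.atOne {Q : PinCochain n (tangentFam g w Y f)}
    {b : CechCocycle (Cot n X) (ZMod 2) 2} (h : Q.IsRelativeTo (b.pullback (famToCot Y f))) :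
    Q.atOne.IsRelativeTo (b.pullback (incl (stdLag n Y f))) :=
  ⟨(h.pullback (inclOne Y f)).1, (h.pullback (inclOne Y f)).2⟩

theorem conormalId_of_mem (x : X) {K : Submodule ℝ (Eu n)} {u : Eu n} (hu : u ∈ K) :
    conormalId g x K u = (u, 0) := by
  rw [conormalId_apply, gProj_of_mem g x hu, sub_self, map_zero]

theorem conormalId_of_orthogonal (x : X) {K : Submodule ℝ (Eu n)} {v : Eu n}
    (hv : ∀ u ∈ K, flat g x v u = 0) : conormalId g x K v = (0, flat g x v) := by
  rw [conormalId_apply, gProj_of_orthogonal g x fun u hu => by rw [flat_comm]; exact hv u hu,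
    sub_zero]

/-- Every vector is the sum of its projection to K and an orthogonal vector, so the two conditions
determine a linear map. -/
theorem eq_conormalId {x : X} {K : Submodule ℝ (Eu n)} {Ψ : Eu n →ₗ[ℝ] EuCot n}
    (h : ∀ u ∈ K, Ψ u = (u, 0))
    (h' : ∀ v, (∀ u ∈ K, flat g x v u = 0) → Ψ v = (0, flat g x v)) : Ψ = conormalId g x K := by
  ext1 v
  have h3 : Ψ v = Ψ (gProj g x K v) + Ψ (v - gProj g x K v) := by
    rw [← map_add, add_sub_cancel]
  rw [h3, h _ (gProj_mem g x v), h' _ fun u hu => flat_sub_gProj g x v hu, conormalId_apply,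
    Prod.mk_add_mk, add_zero, zero_add]

theorem isConormalIdentification_conormalId (g : Metric n X) (Y : Set X) :
    IsConormalIdentification g Y fun y => conormalId g y.1 (tangentOf 𝓘(ℝ, Eu n) Y y.1) :=
  fun y => ⟨fun _ hu => conormalId_of_mem y.1 hu, fun _ hv => conormalId_of_orthogonal y.1 hv⟩

theorem IsConormalIdentification.eq {Ψ : Y → (Eu n →ₗ[ℝ] EuCot n)}
    (h : IsConormalIdentification g Y Ψ) :
    Ψ = fun y => conormalId g y.1 (tangentOf 𝓘(ℝ, Eu n) Y y.1) :=
  funext fun y => eq_conormalId (h y).1 (h y).2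

/-- Pythagoras for tangential and normal components, as w = 1 on the zero section. Hence along Y the
polar correction of the transport is the identity. -/
theorem compatMetric_conormalVec_self (hw0 : ∀ x : X, w ⟨x, 0⟩ = 1) (x : X) (u v : Eu n) :
    compatMetric g w ⟨x, 0⟩ (conormalVec g Y x u) (conormalVec g Y x v) = flat g x u v := by
  have h1 := flat_sub_gProj g x u (gProj_mem g x v (K := tangentOf 𝓘(ℝ, Eu n) Y x))
  have h2 := flat_sub_gProj g x v (gProj_mem g x u (K := tangentOf 𝓘(ℝ, Eu n) Y x))
  rw [compatMetric_conormalVec g hw0, hor_conormalVec, ver_conormalVec, map_sub, h1, sub_zero,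
    map_sub, sub_apply]
  rw [flat_comm, map_sub, sub_eq_zero] at h2
  rw [← h2]
  exact sub_add_cancel _ _

section

variable (hw : ∀ p, 0 < w p) (hw0 : ∀ x : X, w ⟨x, 0⟩ = 1) (hY : IsSubmanifold n 2 d Y)
  (hf : ∀ x ∈ Y, ContMDiffAt 𝓘(ℝ, Eu n) 𝓘(ℝ, ℝ) 2 f x)

include hw0 in
-- Along Y the transport is the conormal identification, already an isometry, so the frames
-- correspond exactly and the lifts are equal.
theorem famPin_inclZero (PX : PinCochain n (tangentX g)) :
    PinIso (F := (tangentX g).pullback (incl Y))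
      (F' := (tangentFam g w Y f).pullback (inclZero Y f))
      (fun y v => conormalId g y.1 (tangentOf 𝓘(ℝ, Eu n) Y y.1) v)
      (PX.pullback (incl Y)) ((famPin hw hY hf PX).pullback (inclZero Y f)) := by
  refine PinIso.of_eq (fun _ => Subset.rfl) (fun _ _ _ => rfl) fun x y hy i j => ?_
  have ho := frame_isOrtho PX hy
  have e1 : (fun i => famTransport g w Y f (inclZero Y f y) (PX.frame x.1 i y.1))
      = fun i => conormalVec g Y y.1 (PX.frame x.1 i y.1) :=
    funext fun i => famTransport_inclZero hw hY hf hw0 y _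
  have e2 : (tangentFam g w Y f).change (inclZero Y f y)
      (fun i => conormalVec g Y y.1 (PX.frame x.1 i y.1))
      (fun i => conormalVec g Y y.1 (PX.frame x.1 i y.1)) = 1 := by
    ext i j
    refine (compatMetric_conormalVec_self hw0 y.1 _ _).trans ((ho i j).trans ?_)
    rw [Matrix.one_apply]
  have e3 : (tangentFam g w Y f).polar (inclZero Y f y)
      (fun i => famTransport g w Y f (inclZero Y f y) (PX.frame x.1 i y.1))
      = fun i => conormalVec g Y y.1 (PX.frame x.1 i y.1) :=
    (congrArg (fun e : Fin n → TangentSpace (IC n) (inclZero Y f y).1.2 =>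
      (tangentFam g w Y f).polar (inclZero Y f y) e) e1).trans (EuclFamily.polar_of_orthonormal e2)
  have e4 := congrFun e3 j
  refine (congrArg (compatMetric g w ⟨y.1, 0⟩ (conormalVec g Y y.1 (PX.frame x.1 i y.1))) e4).trans ?_
  exact (compatMetric_conormalVec_self hw0 y.1 _ _).trans (ho i j)

include hw0 in
theorem isCanonicalPin_famPin {PX : PinCochain n (tangentX g)} {b : CechCocycle X (ZMod 2) 2}
    (h : PX.IsRelativeTo b) : IsCanonicalPin g w PX b Y f (famPin hw hY hf PX).atOne :=
  ⟨_, famPin_isRelativeTo hw hY hf h, ⟨_, isConormalIdentification_conormalId g Y,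
    famPin_inclZero hw hw0 hY hf PX⟩, PinCochain.atOne_pinIso _⟩

include hw hf in
-- Along Y both families are isomorphic to PX by the same identification, hence to each other. The
-- contraction spreads this isomorphism over the whole family, and its restriction to t = 1 compares
-- the two ends.
theorem IsCanonicalPin.pinIso {PX : PinCochain n (tangentX g)} {b : CechCocycle X (ZMod 2) 2}
    {P P' : PinCochain n (tangentL g w (stdLag n Y f))} (h : IsCanonicalPin g w PX b Y f P)
    (h' : IsCanonicalPin g w PX b Y f P') : PinIso (fun _ v => v) P P' := by
  obtain ⟨Q, hQ, ⟨Ψ, hΨ, hi⟩, hP⟩ := h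
  obtain ⟨Q', hQ', ⟨Ψ', hΨ', hi'⟩, hP'⟩ := h'
  obtain rfl : Ψ = Ψ' := hΨ.eq.trans hΨ'.eq.symm
  have hF := isRiemannian_tangentFam g hw Y f
  have hF0 : ((tangentFam g w Y f).pullback (inclZero Y f)).IsRiemannian :=
    isRiemannian_compatMetric g w hw (fun y : Y => (inclZero Y f y).1.2) _
  have hF1 : ((tangentFam g w Y f).pullback (inclOne Y f)).IsRiemannian :=
    isRiemannian_compatMetric g w hw (fun p : stdLag n Y f => (inclOne Y f p).1.2) _
  have hL : (tangentL g w (stdLag n Y f)).IsRiemannian :=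
    isRiemannian_compatMetric g w hw (fun p : stdLag n Y f => p.1) _
  have h0 := PinIso.of_common_source hF0 hi hi'
  have h1 := PinIso.of_contraction hF hQ hQ' (inclZero Y f) (famToY n Y f) (dilation hf)
    (dilation_zero hf) (dilation_one hf) h0
  have h2 := PinIso.trans hF1 hL (Ψ := fun _ => LinearMap.id) (h1.pullback (inclOne Y f)) hP'
  exact PinIso.of_common_source hL hP h2

include hw hY hf in
/-- The second Stiefel-Whitney class of the standard Lagrangian. -/
theorem isSW2_stdLag {PX : PinCochain n (tangentX g)} {b : CechCocycle X (ZMod 2) 2}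
    (h : PX.IsRelativeTo b) (c : CechH2 (stdLag n Y f) (ZMod 2)) :
    IsSW2 n (tangentL g w (stdLag n Y f)) c
      ↔ c = CechH.pullback (incl (stdLag n Y f)) (CechH.pullback (cotProj n X) b.toClass) := by
  have h1 : IsSW2 n (tangentL g w (stdLag n Y f))
      (CechH.pullback (incl (stdLag n Y f)) (CechH.pullback (cotProj n X) b.toClass)) :=
    ⟨(famPin hw hY hf PX).atOne, (b.pullback (cotProj n X)).pullback (incl (stdLag n Y f)),
      (famPin_isRelativeTo hw hY hf h).atOne, rfl⟩
  have hL : (tangentL g w (stdLag n Y f)).IsRiemannian :=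
    isRiemannian_compatMetric g w hw (fun p : stdLag n Y f => p.1) _
  exact ⟨fun hc => IsSW2.unique hL hc h1, fun hc => hc ▸ h1⟩

end

/-- A submanifold is locally closed. -/
theorem IsSubmanifold.frontier_compl_mem_nhds (hY : IsSubmanifold n 2 d Y) {x : X} (hx : x ∈ Y) :
    (closure Y \ Y)ᶜ ∈ 𝓝 x := by
  obtain ⟨D, hD⟩ := hY.exists_adaptedChart hx
  filter_upwards [D.chart.open_source.mem_nhds hD] with z hz hz'
  refine hz'.2 ((D.mem_iff z hz).2 ?_)
  have h1 : IsClosed (D.space : Set (Eu n)) := Submodule.closed_of_finiteDimensional _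
  -- In the adapted chart a limit of points of Y is a limit of points of a linear subspace, which is
  -- closed; so a limit point inside the chart is in Y.
  have h2 : D.chart z ∈ closure (D.chart '' (Y ∩ D.chart.source)) := by
    refine mem_closure_image (D.chart.continuousAt hz) ?_
    rw [inter_comm]
    exact D.chart.open_source.inter_closure ⟨hz, hz'.1⟩
  refine h1.closure_subset_iff.2 ?_ h2
  rintro _ ⟨a, ⟨ha, ha'⟩, rfl⟩
  exact (D.mem_iff a ha').1 ha

/-- Near a point of Y there are no points of the boundary, since Y is locally closed; there m is C²,
and it is nonzero at the point itself, where log is therefore smooth. -/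
theorem contMDiffAt_logFn (hY : IsSubmanifold n 2 d Y) {m : X → ℝ}
    (hm : ∀ x, m x = 0 ↔ x ∈ closure Y \ Y)
    (hc : ContMDiffOn 𝓘(ℝ, Eu n) 𝓘(ℝ, ℝ) 2 m (closure Y \ Y)ᶜ) :
    ∀ x ∈ Y, ContMDiffAt 𝓘(ℝ, Eu n) 𝓘(ℝ, ℝ) 2 (logFn m) x := by
  intro x hx
  have h1 := hc.contMDiffAt (hY.frontier_compl_mem_nhds hx)
  have h2 : m x ≠ 0 := fun h => ((hm x).1 h).2 hx
  exact (Real.contDiffAt_log.2 h2).contMDiffAt.comp x h1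

/-- The second Stiefel-Whitney class of `X`. -/
theorem isSW2_tangentX {PX : PinCochain n (tangentX g)} {b : CechCocycle X (ZMod 2) 2}
    (h : PX.IsRelativeTo b) (c : CechH2 X (ZMod 2)) :
    IsSW2 n (tangentX g) c ↔ c = b.toClass :=
  ⟨fun hc => IsSW2.unique (isRiemannian_tangentX g) hc ⟨PX, b, h, rfl⟩,
    fun hc => hc ▸ ⟨PX, b, h, rfl⟩⟩

/-- The canonical brane structure of the standard Lagrangian. -/
theorem exists_canonicalBrane (hw : ∀ p, 0 < w p) (hw0 : ∀ x : X, w ⟨x, 0⟩ = 1)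
    (hY : IsSubmanifold n 2 d Y) (hf : ∀ x ∈ Y, ContMDiffAt 𝓘(ℝ, Eu n) 𝓘(ℝ, ℝ) 2 f x)
    (s : CanonicalTrivialization g w) {PX : PinCochain n (tangentX g)}
    {b : CechCocycle X (ZMod 2) 2} (h : PX.IsRelativeTo b) :
    ∃ β : BraneStructure s (b.pullback (cotProj n X)) (stdLag n Y f),
      IsCanonicalGrading s d Y f β.grading ∧ IsCanonicalPin g w PX b Y f β.pin ∧
      ∀ β' : BraneStructure s (b.pullback (cotProj n X)) (stdLag n Y f),
        IsCanonicalGrading s d Y f β'.grading → IsCanonicalPin g w PX b Y f β'.pin →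
        β'.grading = β.grading ∧ PinIso (fun _ v => v) β.pin β'.pin := by
  obtain ⟨-, ⟨a, ha, hu⟩, hg⟩ := existsUnique_canonicalGrading hw hw0 s hY hf
  have hc := isCanonicalPin_famPin hw hw0 hY hf h
  exact ⟨⟨a, hg a ha, (famPin hw hY hf PX).atOne, (famPin_isRelativeTo hw hY hf h).atOne⟩,
    ha, hc, fun β' h1 h2 => ⟨hu _ h1, hc.pinIso hw hf h2⟩⟩

end Brane
end
end CotBrane

/-! ### The theorem -/

theorem mainTheorem9 (n : ℕ) {X : Type*} [TopologicalSpace X] [ChartedSpace (Eu n) X]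
    [IsManifold 𝓘(ℝ, Eu n) ∞ X] [CompactSpace X] [T2Space X] (g : CotBrane.Metric n X)
    (w : C(Cot n X, ℝ)) (hw : ∀ p, 0 < w p) (hw0 : ∀ x : X, w ⟨x, 0⟩ = 1) :
    Nonempty (CanonicalTrivialization g w) ∧
    (∀ s s' : CanonicalTrivialization g w, s.Homotopic s') ∧
    ∃ w₂X : CechH2 X (ZMod 2),
      (∀ c, IsSW2 n (tangentX g) c ↔ c = w₂X) ∧
      ∀ (d : ℕ) (Y : Set X) (m : X → ℝ), IsSubmanifold n 2 d Y → (∀ x, 0 ≤ m x) →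
        (∀ x, m x = 0 ↔ x ∈ closure Y \ Y) →
        ContMDiffOn 𝓘(ℝ, Eu n) 𝓘(ℝ, ℝ) 2 m (closure Y \ Y)ᶜ →
        let L : Set (Cot n X) := stdLag n Y (logFn m)
        (∀ c, IsSW2 n (tangentL g w L) c ↔
          c = CechH.pullback (incl L) (CechH.pullback (cotProj n X) w₂X)) ∧
        ∀ s : CanonicalTrivialization g w,
          (∃ α : C(L, Circle),
            (∀ p, (α p : ℂ) = squaredPhase s p.1 (tangentOf (IC n) L p.1)) ∧
            maslovClass α = 0) ∧
          (∃! a : C(L, ℝ), IsCanonicalGrading s d Y (logFn m) a) ∧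
          ∀ (PX : PinCochain n (tangentX g)) (b : CechCocycle X (ZMod 2) 2), PX.IsRelativeTo b →
            ∃ β : BraneStructure s (b.pullback (cotProj n X)) L,
              IsCanonicalGrading s d Y (logFn m) β.grading ∧ IsCanonicalPin g w PX b Y (logFn m) β.pin ∧
              ∀ β' : BraneStructure s (b.pullback (cotProj n X)) L,
                IsCanonicalGrading s d Y (logFn m) β'.grading → IsCanonicalPin g w PX b Y (logFn m) β'.pin →
                β'.grading = β.grading ∧ PinIso (fun _ v => v) β.pin β'.pin := by
  -- Some cochain of lifts exists because X is compact; it serves to define w₂(X) and to compute w₂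
  -- of the Lagrangians. The pin structures below are relative to an arbitrary PX.
  obtain ⟨PX₀⟩ := exists_pinCochain_tangentX g
  obtain ⟨b₀, h₀⟩ := PX₀.exists_isRelativeTo (isRiemannian_tangentX g)
  refine ⟨nonempty_canonicalTrivialization g hw hw0,
    fun s s' => CanonicalTrivialization.homotopic g hw hw0 s s', b₀.toClass, isSW2_tangentX h₀,
    fun d Y m hY _ hm hc => ?_⟩
  have hf := contMDiffAt_logFn hY hm hc
  refine ⟨isSW2_stdLag hw hY hf h₀, fun s => ?_⟩
  obtain ⟨hα, ha, -⟩ := existsUnique_canonicalGrading hw hw0 s hY hf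
  exact ⟨hα, ha, fun PX b h => exists_canonicalBrane hw hw0 hY hf s h⟩
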